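/- **Setting.** Let $(\mathcal P,\mathcal F^+,\mathcal F^-)$ be a bifoliated plane: $\mathcal P$ is a topological plane, $\mathcal F^\pm$ are (possibly singular) $1$-dimensional foliations whose leaves are properly embedded prongs, with the same prong singularities, and transverse elsewhere. Let $\mathcal F^+$ be oriented (so all singularities have an even number $2m\ge 4$ of prongs; half of the half-leaves at a singularity of $\mathcal F^+$ are positive, i.e. oriented away from it, half are negative). Write $\lambda_x$ for the leaf of $\mathcal F^+$ through $x$. Let a group $G$ act on $\mathcal P$ by homeomorphisms preserving $\mathcal F^+$, $\mathcal F^-$ and the orientation of $\mathcal F^+$. Assume that the action is *flowable*: - if $g\neq 1$ fixes a leaf of $\mathcal F^+$ or of $\mathcal F^-$, then $g$ has exactly one fixed point on this leaf, and of the two leaves of $\mathcal F^{\pm}$ through this point $g$ topologically expands one and contracts the other; - the stabilizer of a point fixed by some $g\ne1$ is infinite cyclic, and singular points have nontrivial stabilizer; - if $x\ne y$ are in one leaf of $\mathcal F^+$ or $\mathcal F^-$, there are neighborhoods $U\ni x$, $V\ni y$ such that no $g\neq 1$ has $g(x)\in U$ and $g(y)\in V$. For each singular leaf $\lambda$ of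 $\mathcal F^+$, with singularity $s$, let $h_\lambda:\lambda\to\mathbb R$ be a map with $h_\lambda(s)=0$ that maps every positive half-leaf onto $[0,\infty)$ and every negative half-leaf onto $(-\infty,0]$ by an orientation-preserving homeomorphism, such that each $x\in\lambda\setminus\{s\}$ has a neighborhood $V$ in $\lambda$ with $h_\lambda(V)\cap h_\lambda(\mathrm{Stab}_G(\lambda)\,x)=\{h_\lambda(x)\}$. For $u,v$ in a leaf $\lambda$ of $\mathcal F^+$ let $u\sim v$ mean $h_\lambda(u)=h_\lambda(v)$ if $\lambda$ is singular, and $u=v$ otherwise; assume that $\sim$ is $G$-invariant. For $x\in\mathcal P$ let $R_x$ be the positive side of $x$ in $\lambda_x$, except that if $x$ lies in a negative half-leaf $q$ of a singular leaf and is not its singularity $s$, then $R_x$ consists of the points of $q$ between $x$ and $s$, of $s$, and of the two positive half-leaves adjacent to $q$. Let $r_x=R_x/{\sim}$, let $N=\{(x,y): x\in\mathcal P,\ y\in r_x\}$ have the quotient topology of $N_2=\{(x,y)\in\mathcal P\times\mathcal P: y\in R_x\}$, and let $G$ act on $N$ by $g(x,y)=(gx,gy)$. Let $\widetilde\phi$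 be the flow on $N$ with flowlines $\{x\}\times r_x$. Let $\widetilde{\mathcal F^s}$ (resp. $\widetilde{\mathcal F^u}$) be the singular foliation of $N$ whose leaves are the unions of the flowlines over the leaves of $\mathcal F^+$ (resp. $\mathcal F^-$). Let $\widetilde{\mathcal F}$ be the foliation of $N$ given locally by the images of the surfaces $\{(x,y)\in N_2: y\in\mu\}$, $\mu$ a leaf of $\mathcal F^-$. Let $\phi,\mathcal F^s,\mathcal F^u,\mathcal F$ be the quotients of these by $G$ in $M=N/G$; transversality of foliations of $M$ is a local property and is read off in $N$. A flowline $\rho$ of $\widetilde\phi$ is *asymptotic* to a leaf $l$ of $\widetilde{\mathcal F}$ if $\rho\cap l=\emptyset$ and $\rho$ is the limit, in the orbit space of $\widetilde\phi$, of a sequence of flowlines that meet $l$. A leaf $l$ of $\widetilde{\mathcal F}$ is *asymptotic* to a non-singular leaf $l^u$ of $\widetilde{\mathcal F^u}$ if every flowline in $l^u$ is asymptotic to $l$; it is *asymptotic* to a singular leaf $l^u$ if $l\cap l^u=\emptyset$ and, for the component $J$ of $N\setminus l^u$ containing $l$, every flowline contained in $l^u\cap\overline J$ is asymptotic to $l$.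 **Proposition.** 1. $\phi$ is nowhere-regulating for $\mathcal F$: every flowline of $\widetilde\phi$ is asymptotic to some leaf of $\widetilde{\mathcal F}$. 2. The lifted foliations $\widetilde{\mathcal F^s},\widetilde{\mathcal F^u},\widetilde{\mathcal F}$ are $G$-invariant, and $\mathcal F^s$ and $\mathcal F^u$ are transverse to $\mathcal F$: every point of $N$ has a neighborhood $U\cong\mathbb C\times\mathbb R$ in which the plaques of $\widetilde{\mathcal F}$ are the planes $\mathbb C\times\{t\}$ and the plaques of $\widetilde{\mathcal F^s}$ (and, in another such neighborhood, those of $\widetilde{\mathcal F^u}$) are the products with $\mathbb R$ of the leaves of a standard $2m$-prong singular foliation of $\mathbb C$, $m\ge1$ (the regular foliation if $m=1$). 3. For every leaf $l^u$ of $\widetilde{\mathcal F^u}$ there is a leaf of $\widetilde{\mathcal F}$ asymptotic to $l^u$. If the projection of $l^u$ to $\mathcal P$ is a $2n$-prong with $n\ge2$, then exactly $n$ distinct leaves of $\widetilde{\mathcal F}$ are asymptotic to $l^u$. -/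

import Mathlib

open Set Filter Topology

/-- The standard `2m`-prong (`m ≥ 1`): the union of the `2m` rays `{z | z ^ m ∈ ℝ}` in the plane.
For `m = 1` it is the real line. -/
def prong (m : ℕ) : Set ℂ := {z | (z ^ m).im = 0}

/-- The orientation of the standard `2m`-prong by increasing `Re (z ^ m)`: the `m` rays with
`z ^ m < 0` are oriented towards the centre, the `m` rays with `z ^ m > 0` away from it.
`b` is on the positive side of `a` if a positively oriented arc of the prong goes from `a` to `b`. -/
def prongLt (m : ℕ) (a b : ℂ) : Prop :=
  (a ^ m).re < (b ^ m).re ∧ (SameRay ℝ a b ∨ ((a ^ m).re ≤ 0 ∧ 0 ≤ (b ^ m).re))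

/-- A subset of a space that is a properly embedded `2m`-prong. -/
def IsProng {P : Type*} [TopologicalSpace P] (m : ℕ) (s : Set P) : Prop :=
  ∃ γ : prong m → P, IsClosedEmbedding γ ∧ range γ = s

/-- The leaf through `x` of a decomposition of `X` into leaves. -/
def leafOf {X : Type*} (E : Setoid X) (x : X) : Set X := {y | E x y}

/-- The plaque through `y` in `U`: the component of (leaf of `y`) ∩ `U` that contains `y`. -/
def plaque {X : Type*} [TopologicalSpace X] (E : Setoid X) (U : Set X) (y : X) : Set X :=
  connectedComponentIn (leafOf E y ∩ U) y

/-- A bifoliated plane together with an orientation of `𝓕⁺`.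
Since `𝓕⁺` is oriented, all singularities have an even number of prongs. At every point `x` there
is a chart onto `ℂ`, centred at `x`, in which the leaves of `𝓕⁺` are the components of the level sets
of `Im (z ^ n)`, oriented by increasing `Re (z ^ n)`, and those of `𝓕⁻` the components of the level
sets of `Re (z ^ n)`, where `n = ord x`. So `ord x = 1` says that `𝓕⁺` and `𝓕⁻` are
regular and transverse at `x`, and `ord x = n ≥ 2` that `x` is a `2n`-prong singularity of both. -/
structure OrientedBifoliatedPlane (P : Type*) [TopologicalSpace P] where
  /-- being in the same leaf of `𝓕⁺` -/
  plus : Setoid P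
  /-- being in the same leaf of `𝓕⁻` -/
  minus : Setoid P
  /-- `lt x y`: `x`, `y` are in the same leaf of `𝓕⁺`, and `y` is on the positive side of `x` -/
  lt : P → P → Prop
  /-- half the number of prongs at a point -/
  ord : P → ℕ
  plane : Nonempty (P ≃ₜ ℂ)
  ord_pos : ∀ x, 1 ≤ ord x
  chart : ∀ x, ∃ (U : Set P) (φ : U ≃ₜ ℂ) (hx : x ∈ U), IsOpen U ∧ φ ⟨x, hx⟩ = 0 ∧
    (∀ y z : U, (z : P) ∈ plaque plus U y ↔
      φ z ∈ connectedComponentIn {w : ℂ | (w ^ ord x).im = (φ y ^ ord x).im} (φ y)) ∧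
    (∀ y z : U, (z : P) ∈ plaque minus U y ↔
      φ z ∈ connectedComponentIn {w : ℂ | (w ^ ord x).re = (φ y ^ ord x).re} (φ y)) ∧
    (∀ y z : U, (z : P) ∈ plaque plus U y → lt y z → (φ y ^ ord x).re < (φ z ^ ord x).re)
  lt_leaf : ∀ x y, lt x y → plus x y
  plus_prong : ∀ x, ∃ m : ℕ, 1 ≤ m ∧ ∃ γ : prong m → P, IsClosedEmbedding γ ∧
    range γ = leafOf plus x ∧ ∀ a b : prong m, lt (γ a) (γ b) ↔ prongLt m a b
  minus_prong : ∀ x, ∃ m : ℕ, 1 ≤ m ∧ IsProng m (leafOf minus x)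

namespace OrientedBifoliatedPlane

variable {P : Type*} [TopologicalSpace P] (B : OrientedBifoliatedPlane P)

/-- `x` lies in a singular leaf of `𝓕⁺`. -/
def SingLeaf (x : P) : Prop := ∃ s, B.plus x s ∧ 2 ≤ B.ord s

/-- `R_x`: the points `y` on the positive side of `x` in the leaf `λ` of `x` such that `x` and `y` lie
in the closure of one component of `P ∖ λ`.
The last condition only matters if `x` is in a negative half-leaf `q` of a singular leaf
and is not the singularity `s`. A component of `P ∖ λ` is then bounded by two adjacent half-leaves, so
`R_x` consists of the points between `x` and `s`, of `s`, and of the two positive half-leaves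
adjacent to `q`. In all other cases `R_x` is the whole positive side of `x`. -/
def R (x : P) : Set P :=
  {y | B.lt x y ∧ ∃ z ∉ leafOf B.plus x,
    x ∈ closure (connectedComponentIn (leafOf B.plus x)ᶜ z) ∧
    y ∈ closure (connectedComponentIn (leafOf B.plus x)ᶜ z)}

/-- The closed half-leaf containing `y` of the singular leaf with singularity `s`. -/
def halfLeaf (s y : P) : Set P := insert s (connectedComponentIn (leafOf B.plus s \ {s}) y)

/-- The relation `u ∼ v` on the leaves of `𝓕⁺`: on a singular leaf it says `h u = h v`, on the other
leaves it is equality. -/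
def sim (h : P → ℝ) (u v : P) : Prop := u = v ∨ (B.plus u v ∧ B.SingLeaf u ∧ h u = h v)

lemma sim_symm {h : P → ℝ} {u v : P} (H : B.sim h u v) : B.sim h v u := by
  rcases H with rfl | ⟨h1, ⟨s, hs, hn⟩, h3⟩
  · exact Or.inl rfl
  · exact Or.inr ⟨B.plus.symm h1, ⟨s, B.plus.trans (B.plus.symm h1) hs, hn⟩, h3.symm⟩

lemma sim_trans {h : P → ℝ} {u v w : P} (H : B.sim h u v) (H' : B.sim h v w) : B.sim h u w := by
  rcases H with rfl | ⟨h1, h2, h3⟩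
  · exact H'
  · rcases H' with rfl | ⟨k1, -, k3⟩
    · exact Or.inr ⟨h1, h2, h3⟩
    · exact Or.inr ⟨B.plus.trans h1 k1, h2, h3.trans k3⟩

/-- An action on the plane by homeomorphisms that maps leaves of `𝓕⁺`, `𝓕⁻` to leaves and
preserves the orientation of `𝓕⁺`. -/
structure IsOrientedAction (G : Type*) [Group G] [MulAction G P] : Prop where
  cont : ∀ g : G, Continuous (fun x : P => g • x)
  plus : ∀ (g : G) (x y : P), B.plus x y → B.plus (g • x) (g • y)
  minus : ∀ (g : G) (x y : P), B.minus x y → B.minus (g • x) (g • y)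
  lt : ∀ (g : G) (x y : P), B.lt x y → B.lt (g • x) (g • y)

/-- `g`, which fixes `x`, topologically contracts the leaf of `x`.
(It topologically expands the leaf if `g⁻¹` contracts it.) -/
def Contracts {G : Type*} [Group G] [MulAction G P] (E : Setoid P) (g : G) (x : P) : Prop :=
  ∀ y, E x y → Tendsto (fun k : ℕ => g ^ k • y) atTop (𝓝 x)

/-- A flowable action: the three properties traditionally labelled (A1), (A4), (A7). -/
structure IsFlowable (G : Type*) [Group G] [MulAction G P] : Prop where
  /-- a nontrivial element that fixes a leaf has exactly one fixed point in it, and it expands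
  one of the leaves through this point and contracts the other one -/
  fixed_leaf : ∀ E : Setoid P, E = B.plus ∨ E = B.minus → ∀ g : G, g ≠ 1 → ∀ x : P, E x (g • x) →
    (∃! y, E x y ∧ g • y = y) ∧
    ∀ y, E x y → g • y = y →
      (Contracts B.plus g y ∧ Contracts B.minus g⁻¹ y) ∨
      (Contracts B.plus g⁻¹ y ∧ Contracts B.minus g y)
  stab_cyclic : ∀ (x : P) (g : G), g ≠ 1 → g • x = x →
    IsCyclic (MulAction.stabilizer G x) ∧ Infinite (MulAction.stabilizer G x)
  stab_sing : ∀ x : P, 2 ≤ B.ord x → ∃ g : G, g ≠ 1 ∧ g • x = x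
  discrete : ∀ E : Setoid P, E = B.plus ∨ E = B.minus → ∀ x y : P, E x y → x ≠ y →
    ∃ U ∈ 𝓝 x, ∃ V ∈ 𝓝 y, ∀ g : G, g ≠ 1 → ¬ (g • x ∈ U ∧ g • y ∈ V)

/-- An admissible choice of the maps `h_λ : λ → ℝ`, for all singular leaves `λ` of `𝓕⁺`. They are
given by one function on the plane, whose values outside the singular leaves play no role. -/
structure IsHeight (G : Type*) [Group G] [MulAction G P] (h : P → ℝ) : Prop where
  zero : ∀ s, 2 ≤ B.ord s → h s = 0
  pos : ∀ s y, 2 ≤ B.ord s → B.lt s y →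
    (∃ e : B.halfLeaf s y ≃ₜ Ici (0 : ℝ), ∀ a, (e a : ℝ) = h a) ∧
    ∀ a ∈ B.halfLeaf s y, ∀ b ∈ B.halfLeaf s y, B.lt a b → h a < h b
  neg : ∀ s y, 2 ≤ B.ord s → B.lt y s →
    (∃ e : B.halfLeaf s y ≃ₜ Iic (0 : ℝ), ∀ a, (e a : ℝ) = h a) ∧
    ∀ a ∈ B.halfLeaf s y, ∀ b ∈ B.halfLeaf s y, B.lt a b → h a < h b
  /-- the relation `∼` is invariant under `G` -/
  equivariant : ∀ (g : G) (u v : P), B.sim h u v → B.sim h (g • u) (g • v)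
  /-- the values of `h` on the orbit of `x` under the stabilizer of its leaf do not accumulate
  at `h x` -/
  discrete : ∀ s x, 2 ≤ B.ord s → B.plus s x → x ≠ s →
    ∃ V ∈ 𝓝[leafOf B.plus s] x,
      h '' V ∩ h '' {y | ∃ g : G, B.plus s (g • s) ∧ y = g • x} = {h x}

/-- `N₂ = {(x, y) | y ∈ R_x}`, a subspace of `P × P`. -/
abbrev N₂ : Type _ := {p : P × P // p.2 ∈ B.R p.1}

/-- The identification `(x, y₁) ∼ (x, y₂)` if `y₁ ∼ y₂`. -/
def setoidN (h : P → ℝ) : Setoid B.N₂ where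
  r a b := a.1.1 = b.1.1 ∧ B.sim h a.1.2 b.1.2
  iseqv :=
    { refl := fun _ => ⟨rfl, Or.inl rfl⟩
      symm := fun H => ⟨H.1.symm, B.sim_symm H.2⟩
      trans := fun H H' => ⟨H.1.trans H'.1, B.sim_trans H.2 H'.2⟩ }

/-- The space `N = {(x, y) | y ∈ r_x}` with `r_x = R_x / ∼`, with the quotient topology of `N₂`. -/
abbrev N (h : P → ℝ) : Type _ := Quotient (B.setoidN h)

/-- The projection `(x, y) ↦ x` of `N` to the plane. Its fibres are the flowlines. -/
def proj (h : P → ℝ) : B.N h → P := Quotient.lift (fun a => a.1.1) (fun _ _ H => H.1)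

/-- The orbit space of the flow on `N`: the quotient space of `N` by collapsing
each flowline `{x} × r_x` to a point. -/
abbrev Orbits (h : P → ℝ) : Type _ := Quotient (Setoid.ker (B.proj h))

/-- A point of the orbit space as a subset of `N`. -/
def flowline {h : P → ℝ} (ρ : B.Orbits h) : Set (B.N h) :=
  {p | (Quotient.mk (Setoid.ker (B.proj h)) p) = ρ}

/-- The lifted stable foliation: its leaves are the unions of the flowlines over the leaves of `𝓕⁺`. -/
def stable (h : P → ℝ) : Setoid (B.N h) := B.plus.comap (B.proj h)

/-- The lifted unstable foliation: its leaves are the unions of the flowlines over the leaves of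
`𝓕⁻`. -/
def unstable (h : P → ℝ) : Setoid (B.N h) := B.minus.comap (B.proj h)

/-- The lifted foliation transverse to the flow. Its leaves are obtained by following, for the
leaves `μ` of `𝓕⁻`, the images in `N` of the surfaces `{(x, y) | y ∈ μ, y ∈ R_x}` (more precisely,
of their connected components), and passing from one to another where these images meet. -/
def folF (h : P → ℝ) : Setoid (B.N h) :=
  Relation.EqvGen.setoid fun p q => ∃ a b : B.N₂, Quotient.mk (B.setoidN h) a = p ∧
    Quotient.mk (B.setoidN h) b = q ∧
    b ∈ connectedComponentIn {c : B.N₂ | B.minus a.1.2 c.1.2} a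

/-- The flowline `ρ` is asymptotic to `l`: it does not meet `l`, but it is the limit, in the orbit
space, of a sequence of flowlines that meet `l`. -/
def Asymptotic {h : P → ℝ} (ρ : B.Orbits h) (l : Set (B.N h)) : Prop :=
  (∃ u : ℕ → B.Orbits h, Tendsto u atTop (𝓝 ρ) ∧ ∀ k, (B.flowline (u k) ∩ l).Nonempty) ∧
    B.flowline ρ ∩ l = ∅

/-- The flow is nowhere-regulating for the foliation: every lifted flowline is asymptotic to
some leaf of the lifted foliation. -/
def NowhereRegulating (h : P → ℝ) : Prop :=
  ∀ ρ : B.Orbits h, ∃ l ∈ (B.folF h).classes, B.Asymptotic ρ l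

/-- A leaf of the lifted unstable foliation that contains a singular flowline. -/
def IsSingularLeaf {h : P → ℝ} (lu : Set (B.N h)) : Prop := ∃ p ∈ lu, 2 ≤ B.ord (B.proj h p)

/-- The set `l` (a leaf of the lifted transverse foliation) is asymptotic to the leaf `lu` of the
lifted unstable foliation. -/
def AsymptoticToLeaf {h : P → ℝ} (l lu : Set (B.N h)) : Prop :=
  (¬ B.IsSingularLeaf lu → ∀ ρ : B.Orbits h, B.flowline ρ ⊆ lu → B.Asymptotic ρ l) ∧
  (B.IsSingularLeaf lu → l ∩ lu = ∅ ∧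
    ∃ p ∉ lu, l ⊆ connectedComponentIn luᶜ p ∧
      ∀ ρ : B.Orbits h, B.flowline ρ ⊆ lu ∩ closure (connectedComponentIn luᶜ p) →
        B.Asymptotic ρ l)

section action

variable {B} {G : Type*} [Group G] [MulAction G P]

lemma smul_mem_R (hG : B.IsOrientedAction G) (g : G) {x y : P} (H : y ∈ B.R x) :
    g • y ∈ B.R (g • x) := by
  obtain ⟨hlt, z, hz, hx, hy⟩ := H
  have hsub : MapsTo (fun w : P => g • w) (leafOf B.plus x)ᶜ (leafOf B.plus (g • x))ᶜ := by
    intro w hw hw'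
    apply hw
    have := hG.plus g⁻¹ _ _ hw'
    simpa [leafOf] using this
  have himg : MapsTo (fun w : P => g • w) (connectedComponentIn (leafOf B.plus x)ᶜ z)
      (connectedComponentIn (leafOf B.plus (g • x))ᶜ (g • z)) := by
    rw [mapsTo_iff_image_subset]
    apply IsPreconnected.subset_connectedComponentIn
    · exact isPreconnected_connectedComponentIn.image _ (hG.cont g).continuousOn
    · exact ⟨z, mem_connectedComponentIn hz, rfl⟩
    · rintro _ ⟨w, hw, rfl⟩
      exact hsub (connectedComponentIn_subset _ _ hw)
  exact ⟨hG.lt g _ _ hlt, g • z, hsub hz, himg.closure (hG.cont g) hx,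
    himg.closure (hG.cont g) hy⟩

/-- The action of `G` on `N`: `g (x, y) = (g x, g y)`. -/
def act (hG : B.IsOrientedAction G) {h : P → ℝ} (hh : B.IsHeight G h) (g : G) :
    B.N h → B.N h :=
  Quotient.map (fun a : B.N₂ => (⟨(g • a.1.1, g • a.1.2), smul_mem_R hG g a.2⟩ : B.N₂))
    (fun a b H => ⟨congrArg (g • ·) H.1, hh.equivariant g a.1.2 b.1.2 H.2⟩)

end action

end OrientedBifoliatedPlane

/-- Transversality, in a `3`-manifold, of a foliation `A` with possible singularities along lines
(locally `2n`-prong singularities times a line) and a regular foliation `B`, both by surfaces.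
Each point has a neighbourhood `U ≅ ℂ × ℝ` in which the plaques of `B` are the planes `t = const` and
the plaques of `A` are the products with `ℝ` of the components of the level sets of `Im (z ^ n)`.
For `n = 1` these are two families of coordinate planes; for `n ≥ 2` the point is singular. -/
def TransverseFoliations {X : Type*} [TopologicalSpace X] (A B : Setoid X) : Prop :=
  ∀ p : X, ∃ (n : ℕ) (U : Set X) (φ : U ≃ₜ ℂ × ℝ) (hp : p ∈ U), 1 ≤ n ∧ IsOpen U ∧
    φ ⟨p, hp⟩ = (0, 0) ∧
    (∀ y z : U, (z : X) ∈ plaque A U y ↔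
      (φ z).1 ∈ connectedComponentIn {w : ℂ | (w ^ n).im = ((φ y).1 ^ n).im} (φ y).1) ∧
    (∀ y z : U, (z : X) ∈ plaque B U y ↔ (φ z).2 = (φ y).2)

/-- Transversality of the foliations that `A` and `B` induce in the quotient of `X` by a group
of deck transformations `act g`: both are invariant, so that they descend to the quotient, and they
are transverse (a local property, which is read off in `X`). -/
def TransverseInQuotient {X G : Type*} [TopologicalSpace X] (act : G → X → X)
    (A B : Setoid X) : Prop :=
  (∀ g p q, A p q → A (act g p) (act g q)) ∧ (∀ g p q, B p q → B (act g p) (act g q)) ∧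
    TransverseFoliations A B

/-! The orientation of `𝓕⁺` forbids returns: a leaf of `𝓕⁻` meets a positively oriented arc of a
leaf of `𝓕⁺` at most once (`not_minus_of_lt`). A component of the complement of a leaf of `𝓕⁻` lies
on one side, positive or negative, of each of its boundary points, and on the same side of all of
them because its boundary is connected. An arc returning to the leaf would leave it on the positive
side and come back on the negative side of one and the same component.

A leaf of the transverse foliation changes the second coordinate of `(x, y)` only along leaves of
`𝓕⁻` and through identifications of positive half-leaves of a singularity. The relation generated by
these moves is `Linked`, and the central fact is `not_linked_of_lt`: `x` and `y` are never linked if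
`y` is on the positive side of `x`. A singularity together with its negative half-leaves separates
its positive half-leaves from each other (`mem_ray_of_mem_component`), so a shortest chain of moves
behaves like a path in a tree: each identification enters a region that the chain never leaves again
(`Chain.mem_component`). Consequently linked points of one `R x` are identified (`sim_of_linked`).

Transversality: leaves of `𝓕⁺` near `x₀` follow the arc from `x₀` to `y₀`, so the leaves of `𝓕⁻`
near `y₀` cut each `R x` in a point that is labelled by its height `t` on the leaf of `x₀`
(`exists_localSection`). Over the finitely many sectors at `x₀` these sections agree up to `∼` and
give a product chart of `N` (`exists_productChart`). By `sim_of_linked`, two points of this chart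
are in one transverse leaf exactly if they have the same height, while the stable and unstable
foliations are pulled back from the plane.

Asymptotics: the orbit space is the plane, so the question is where the projections of the
transverse leaves accumulate. Let `J` be a component of the complement of a leaf `μ` of `𝓕⁻` that
lies on the negative side of its boundary. All points `(x, y)` of `N` with `x ∈ J` and `y ∈ ∂J` lie
in one transverse leaf (`folF_entry`). It accumulates over every point of `∂J`, but has no point
`(b, b')` with `b ∈ μ`, because `b'` would be linked to `b`. So this leaf is asymptotic to all
flowlines over `∂J`, and every point of the plane is in such a boundary. At a `2n`-prong there are
`n` components `J` of this kind, one for each solution of `ω ^ n = -1`, and their leaves are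
distinct since they lie over disjoint sets. Conversely, let `(x, y)` be in an asymptotic leaf, with
`x` close to the singularity. The point `y` is not beyond the crossing of the row of `x` with `μ`,
since otherwise `x` could be slid onto `μ`. If `y` is this crossing, the leaf is the one attached to
`J`. If `y` were before it for all such `x`, a choice of `x` still closer to the singularity would
give two linked points on one oriented arc. -/

set_option linter.unusedSectionVars false

/-! ### Branches of the `n`-th root and contractions of the standard singular chart -/

/-- The `n`-th root of `a` in the branch determined by `w`, which is a root of `w ^ n`. -/
noncomputable def rootBranch (n : ℕ) (w a : ℂ) : ℂ := w * (a / w ^ n) ^ ((n : ℂ)⁻¹)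

lemma rootBranch_pow {n : ℕ} (hn : n ≠ 0) {w a : ℂ} (h : w ≠ 0 ∨ a = 0) :
    rootBranch n w a ^ n = a := by
  rcases eq_or_ne w 0 with rfl | hw
  · have : a = 0 := by tauto
    simp [rootBranch, this, hn]
  · rw [rootBranch, mul_pow, Complex.cpow_nat_inv_pow _ hn]
    field_simp

lemma rootBranch_self (n : ℕ) (w : ℂ) : rootBranch n w (w ^ n) = w := by
  rcases eq_or_ne w 0 with rfl | hw
  · simp [rootBranch]
  · rw [rootBranch, div_self (pow_ne_zero _ hw), Complex.one_cpow, mul_one]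

lemma rootBranch_zero {n : ℕ} (hn : n ≠ 0) (w : ℂ) : rootBranch n w 0 = 0 := by
  simp [rootBranch, hn]

/-- Off the slit the principal power of an inverse is the inverse of the principal power, so a
change of branch point can be undone. -/
lemma rootBranch_rootBranch_self {n : ℕ} (hn : n ≠ 0) {w a : ℂ} (h : a / w ^ n ∈ Complex.slitPlane) :
    rootBranch n (rootBranch n w a) (w ^ n) = w := by
  have hc : a / w ^ n ≠ 0 := Complex.slitPlane_ne_zero h
  have ha : a ≠ 0 := by rintro rfl; simp at hc
  have hw : w ≠ 0 := by rintro rfl; simp [hn] at hc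
  have hp : rootBranch n w a ^ n = a := rootBranch_pow hn (Or.inl hw)
  have h1 : w ^ n / a = (a / w ^ n)⁻¹ := by rw [inv_div]
  rw [rootBranch, hp, h1, Complex.inv_cpow _ _ (Complex.slitPlane_arg_ne_pi h), rootBranch, mul_assoc,
    mul_inv_cancel₀, mul_one]
  rw [Complex.cpow_ne_zero_iff]
  exact Or.inl hc

/-- Where `a` does not vanish this is continuity of the principal power off the slit. Where `a`
vanishes the branch is irrelevant: the norm of any root is `‖a‖ ^ (1 / n)`, which tends to `0`. -/
lemma continuousWithinAt_rootBranch {T : Type*} [TopologicalSpace T] {n : ℕ} (hn : n ≠ 0)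
    {f a : T → ℂ} {s : Set T} {x : T} (hf : ContinuousWithinAt f s x)
    (ha : ContinuousWithinAt a s x) (h : a x = 0 ∨ (a x / f x ^ n ∈ Complex.slitPlane))
    (h0 : ∀ t, f t = 0 → a t = 0) :
    ContinuousWithinAt (fun t => rootBranch n (f t) (a t)) s x := by
  by_cases hx : a x = 0
  · have hval : rootBranch n (f x) (a x) = 0 := by rw [hx, rootBranch_zero hn]
    rw [ContinuousWithinAt, hval, tendsto_zero_iff_norm_tendsto_zero]
    have hpow : ∀ t, ‖rootBranch n (f t) (a t)‖ = ‖a t‖ ^ ((n : ℝ)⁻¹) := by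
      intro t
      have h1 : rootBranch n (f t) (a t) ^ n = a t := by
        apply rootBranch_pow hn
        by_cases h2 : f t = 0
        · exact Or.inr (h0 t h2)
        · exact Or.inl h2
      rw [← Real.pow_rpow_inv_natCast (norm_nonneg _) hn, ← norm_pow, h1]
    simp only [hpow]
    have h2 : Tendsto (fun t => ‖a t‖) (𝓝[s] x) (𝓝 0) := by
      have := ha.norm
      rwa [ContinuousWithinAt, hx, norm_zero] at this
    have h3 := h2.rpow_const (p := (n : ℝ)⁻¹) (Or.inr (by positivity))
    rwa [Real.zero_rpow (by positivity)] at h3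
  · have hsl := h.resolve_left hx
    have hfx : f x ^ n ≠ 0 := by
      intro h1
      rw [h1, div_zero] at hsl
      simp at hsl
    exact hf.mul ((ha.div (hf.pow n) hfx).cpow continuousWithinAt_const hsl)

/-- An increasing homeomorphism of the line onto `(-δ, δ)`. -/
noncomputable def squeeze (δ t : ℝ) : ℝ := δ * t / (1 + |t|)

/-- The inverse of `squeeze`. -/
noncomputable def unsqueeze (δ t : ℝ) : ℝ := t / (δ - |t|)

lemma squeeze_eq {δ : ℝ} (t : ℝ) : squeeze δ t = t * (δ / (1 + |t|)) := by
  rw [squeeze]; ring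

lemma unsqueeze_eq {δ : ℝ} (t : ℝ) : unsqueeze δ t = t * (1 / (δ - |t|)) := by
  rw [unsqueeze]; ring

lemma abs_squeeze_lt {δ : ℝ} (hδ : 0 < δ) (t : ℝ) : |squeeze δ t| < δ := by
  have h1 : 0 < 1 + |t| := by positivity
  rw [squeeze, abs_div, abs_mul, abs_of_pos hδ, abs_of_pos h1, div_lt_iff₀ h1]
  nlinarith

lemma unsqueeze_squeeze {δ : ℝ} (hδ : 0 < δ) (t : ℝ) : unsqueeze δ (squeeze δ t) = t := by
  have h1 : 0 < 1 + |t| := by positivity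
  have h2 : |squeeze δ t| = δ * |t| / (1 + |t|) := by
    rw [squeeze, abs_div, abs_mul, abs_of_pos hδ, abs_of_pos h1]
  have h3 : δ - |squeeze δ t| = δ / (1 + |t|) := by
    rw [h2]; field_simp; ring
  rw [unsqueeze, h3, squeeze]
  field_simp

lemma squeeze_unsqueeze {δ : ℝ} {t : ℝ} (ht : |t| < δ) : squeeze δ (unsqueeze δ t) = t := by
  have h1 : 0 < δ - |t| := by linarith
  have hδ : 0 < δ := lt_of_le_of_lt (abs_nonneg _) ht
  have h2 : 1 + |unsqueeze δ t| = δ / (δ - |t|) := by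
    rw [unsqueeze, abs_div, abs_of_pos h1]; field_simp; ring
  rw [squeeze, h2, unsqueeze]
  field_simp

lemma continuous_squeeze (δ : ℝ) : Continuous (squeeze δ) := by
  unfold squeeze
  refine Continuous.div (by fun_prop) (by fun_prop) (fun t => by positivity)

lemma squeeze_injective {δ : ℝ} (hδ : 0 < δ) : Function.Injective (squeeze δ) :=
  Function.LeftInverse.injective (unsqueeze_squeeze hδ)

lemma squeeze_strictMono {δ : ℝ} (hδ : 0 < δ) : StrictMono (squeeze δ) := by
  apply ((continuous_squeeze δ).strictMono_of_inj (squeeze_injective hδ)).resolve_right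
  intro h
  have := h (show (0 : ℝ) < 1 by norm_num)
  simp only [squeeze] at this
  norm_num at this
  linarith

/-- `squeeze` applied to both coordinates. -/
noncomputable def squeezeC (δ : ℝ) (z : ℂ) : ℂ := ⟨squeeze δ z.re, squeeze δ z.im⟩

/-- The inverse of `squeezeC`. -/
noncomputable def unsqueezeC (δ : ℝ) (z : ℂ) : ℂ := ⟨unsqueeze δ z.re, unsqueeze δ z.im⟩

/-- Positive rescaling of the two coordinates turns `z` by less than a right angle: the real part of
the quotient is `(a x² + b y²) / |z|²`. -/
lemma div_mem_slitPlane_of_scale {z : ℂ} (hz : z ≠ 0) {a b : ℝ} (ha : 0 < a) (hb : 0 < b) :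
    (⟨z.re * a, z.im * b⟩ : ℂ) / z ∈ Complex.slitPlane := by
  rw [Complex.mem_slitPlane_iff]
  left
  rw [Complex.div_re]
  have h : 0 < Complex.normSq z := Complex.normSq_pos.2 hz
  rw [← add_div]
  apply div_pos _ h
  have h' : 0 < z.re * z.re + z.im * z.im := by rwa [Complex.normSq_apply] at h
  simp only
  have h1 : 0 ≤ z.re * z.re := mul_self_nonneg _
  have h2 : 0 ≤ z.im * z.im := mul_self_nonneg _
  rcases h1.eq_or_lt with h3 | h3
  · have : 0 < z.im * z.im := by linarith
    nlinarith
  · nlinarith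

lemma squeezeC_div_mem {δ : ℝ} (hδ : 0 < δ) {z : ℂ} (hz : z ≠ 0) :
    squeezeC δ z / z ∈ Complex.slitPlane := by
  rw [squeezeC, squeeze_eq, squeeze_eq]
  exact div_mem_slitPlane_of_scale hz (by positivity) (by positivity)

lemma unsqueezeC_div_mem {δ : ℝ} {z : ℂ} (hz : z ≠ 0) (h1 : |z.re| < δ) (h2 : |z.im| < δ) :
    unsqueezeC δ z / z ∈ Complex.slitPlane := by
  rw [unsqueezeC, unsqueeze_eq, unsqueeze_eq]
  exact div_mem_slitPlane_of_scale hz (one_div_pos.2 (by linarith)) (one_div_pos.2 (by linarith))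

lemma squeezeC_zero (δ : ℝ) : squeezeC δ 0 = 0 := by
  simp [squeezeC, squeeze, Complex.ext_iff]

lemma unsqueezeC_zero (δ : ℝ) : unsqueezeC δ 0 = 0 := by
  simp [unsqueezeC, unsqueeze, Complex.ext_iff]

lemma continuous_squeezeC (δ : ℝ) : Continuous (squeezeC δ) := by
  have h : Continuous fun z : ℂ => Complex.equivRealProdCLM.symm (squeeze δ z.re, squeeze δ z.im) := by
    have := continuous_squeeze δ
    fun_prop
  exact h.congr fun z => by simp [squeezeC, Complex.ext_iff]

lemma continuousAt_unsqueezeC {δ : ℝ} {z : ℂ} (h1 : |z.re| < δ) (h2 : |z.im| < δ) :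
    ContinuousAt (unsqueezeC δ) z := by
  have h : ContinuousAt (fun z : ℂ =>
      Complex.equivRealProdCLM.symm (unsqueeze δ z.re, unsqueeze δ z.im)) z := by
    apply Complex.equivRealProdCLM.symm.continuous.continuousAt.comp
    unfold unsqueeze
    apply ContinuousAt.prodMk
    · exact ContinuousAt.div (by fun_prop) (by fun_prop) (by linarith)
    · exact ContinuousAt.div (by fun_prop) (by fun_prop) (by linarith)
  exact h.congr (Eventually.of_forall fun z => by simp [unsqueezeC, Complex.ext_iff])

/-- A contraction of the plane onto a small neighbourhood of `0` that maps the level sets of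
`Re (w ^ n)` and `Im (w ^ n)` into such level sets. -/
noncomputable def shrink (n : ℕ) (δ : ℝ) (w : ℂ) : ℂ := rootBranch n w (squeezeC δ (w ^ n))

lemma shrink_pow {n : ℕ} (hn : n ≠ 0) (δ : ℝ) (w : ℂ) :
    shrink n δ w ^ n = squeezeC δ (w ^ n) := by
  apply rootBranch_pow hn
  by_cases hw : w = 0
  · right; simp [hw, hn, squeezeC_zero]
  · exact Or.inl hw

lemma shrink_zero {n : ℕ} (δ : ℝ) : shrink n δ 0 = 0 := by
  simp [shrink, rootBranch]

/-- The inverse is the same construction with `unsqueezeC`, defined where both coordinates of `w ^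
n` are smaller than `δ`. The branches match because `squeezeC` and `unsqueezeC` never move a point
by a right angle or more. -/
lemma isOpenEmbedding_shrink {n : ℕ} (hn : n ≠ 0) {δ : ℝ} (hδ : 0 < δ) :
    IsOpenEmbedding (shrink n δ) := by
  have hinv1 : ∀ w, rootBranch n (shrink n δ w) (unsqueezeC δ (shrink n δ w ^ n)) = w := by
    intro w
    by_cases hw : w = 0
    · subst hw; simp [shrink, rootBranch]
    · have h1 : unsqueezeC δ (shrink n δ w ^ n) = w ^ n := by
        rw [shrink_pow hn]
        simp [unsqueezeC, squeezeC, unsqueeze_squeeze hδ]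
      rw [h1]
      exact rootBranch_rootBranch_self hn (squeezeC_div_mem hδ (pow_ne_zero _ hw))
  have hinv2 : ∀ w : ℂ, |(w ^ n).re| < δ → |(w ^ n).im| < δ →
      shrink n δ (rootBranch n w (unsqueezeC δ (w ^ n))) = w := by
    intro w h1 h2
    by_cases hw : w = 0
    · subst hw; simp [shrink, rootBranch]
    · have h3 : rootBranch n w (unsqueezeC δ (w ^ n)) ^ n = unsqueezeC δ (w ^ n) :=
        rootBranch_pow hn (Or.inl hw)
      have h4 : squeezeC δ (unsqueezeC δ (w ^ n)) = w ^ n := by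
        simp [unsqueezeC, squeezeC, squeeze_unsqueeze h1, squeeze_unsqueeze h2]
      rw [shrink, h3, h4]
      exact rootBranch_rootBranch_self hn (unsqueezeC_div_mem (pow_ne_zero _ hw) h1 h2)
  let V : Set ℂ := {w | |(w ^ n).re| < δ ∧ |(w ^ n).im| < δ}
  have hV : IsOpen V := by
    apply IsOpen.inter
    · exact isOpen_lt (f := fun w : ℂ => |(w ^ n).re|) (by fun_prop) continuous_const
    · exact isOpen_lt (f := fun w : ℂ => |(w ^ n).im|) (by fun_prop) continuous_const
  have hmaps : ∀ w, shrink n δ w ∈ V := by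
    intro w
    simp only [V, mem_ofPred_eq, shrink_pow hn]
    exact ⟨abs_squeeze_lt hδ _, abs_squeeze_lt hδ _⟩
  let H : OpenPartialHomeomorph ℂ ℂ :=
    { toFun := shrink n δ
      invFun := fun w => rootBranch n w (unsqueezeC δ (w ^ n))
      source := univ
      target := V
      map_source' := fun w _ => hmaps w
      map_target' := fun _ _ => mem_univ _
      left_inv' := fun w _ => hinv1 w
      right_inv' := fun w hw => hinv2 w hw.1 hw.2
      open_source := isOpen_univ
      open_target := hV
      continuousOn_toFun := by
        intro w _
        apply continuousWithinAt_rootBranch hn continuousWithinAt_id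
        · exact ((continuous_squeezeC δ).comp (continuous_pow n)).continuousWithinAt
        · by_cases hw : w = 0
          · left; simp [hw, hn, squeezeC_zero]
          · right; exact squeezeC_div_mem hδ (pow_ne_zero _ hw)
        · rintro t rfl; simp [hn, squeezeC_zero]
      continuousOn_invFun := by
        intro w hw
        apply continuousWithinAt_rootBranch hn continuousWithinAt_id
        · exact (ContinuousAt.comp (f := fun w : ℂ => w ^ n) (continuousAt_unsqueezeC hw.1 hw.2)
            (continuous_pow n).continuousAt).continuousWithinAt
        · by_cases hw0 : w = 0
          · left; simp [hw0, hn, unsqueezeC_zero]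
          · right; exact unsqueezeC_div_mem (pow_ne_zero _ hw0) hw.1 hw.2
        · rintro t rfl; simp [hn, unsqueezeC_zero] }
  exact H.isOpenEmbedding rfl

lemma exists_shrink_subset {n : ℕ} (hn : n ≠ 0) {O : Set ℂ} (hO : O ∈ 𝓝 (0 : ℂ)) :
    ∃ δ : ℝ, 0 < δ ∧ range (shrink n δ) ⊆ O := by
  obtain ⟨r, hr, hrO⟩ := Metric.mem_nhds_iff.1 hO
  -- The norm of an `n`-th power in the range is less than `|Re| + |Im| < 2 δ`, and this has to be
  -- at most `r ^ n`.
  refine ⟨r ^ n / 2, by positivity, ?_⟩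
  rintro _ ⟨w, rfl⟩
  apply hrO
  rw [mem_ball_zero_iff]
  have h1 : ‖shrink n (r ^ n / 2) w‖ ^ n < r ^ n := by
    rw [← norm_pow, shrink_pow hn]
    refine lt_of_le_of_lt (Complex.norm_le_abs_re_add_abs_im _) ?_
    have := abs_squeeze_lt (show 0 < r ^ n / 2 by positivity) (w ^ n).re
    have := abs_squeeze_lt (show 0 < r ^ n / 2 by positivity) (w ^ n).im
    simp only [squeezeC]
    linarith
  exact lt_of_pow_lt_pow_left₀ n hr.le h1

/-! ### Sectors -/

/-- The directions of the sectors of the plane cut out by the lines `Im (w ^ n) = 0`. -/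
def sectorDirs (n : ℕ) : Set ℂ := {ζ | ζ ^ n = Complex.I ∨ ζ ^ n = -Complex.I}

/-- Coordinates on the closed sector with direction `ζ`. -/
noncomputable def halfBox (n : ℕ) (ζ : ℂ) (u v : ℝ) : ℂ := rootBranch n ζ (u + v * ζ ^ n)

/-- The open sector with direction `ζ`. -/
def sector (n : ℕ) (ζ : ℂ) : Set ℂ := {w | ∃ u v : ℝ, 0 < v ∧ halfBox n ζ u v = w}

section sectors

variable {n : ℕ} {ζ : ℂ}

lemma sectorDirs_ne_zero (hn : n ≠ 0) (hζ : ζ ∈ sectorDirs n) : ζ ≠ 0 := by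
  rintro rfl
  rcases hζ with h | h <;> simp [hn, Complex.ext_iff] at h

lemma sectorDirs_pow (hζ : ζ ∈ sectorDirs n) : ζ ^ n = (ζ ^ n).im * Complex.I := by
  rcases hζ with h | h <;> rw [h] <;> simp

lemma sectorDirs_im (hζ : ζ ∈ sectorDirs n) : (ζ ^ n).im = 1 ∨ (ζ ^ n).im = -1 := by
  rcases hζ with h | h <;> rw [h] <;> simp

lemma sectorDirs_re (hζ : ζ ∈ sectorDirs n) : (ζ ^ n).re = 0 := by
  rcases hζ with h | h <;> rw [h] <;> simp

lemma finite_setOf_pow_eq (hn : n ≠ 0) (a : ℂ) : {ζ : ℂ | ζ ^ n = a}.Finite := by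
  have : {ζ : ℂ | ζ ^ n = a} ⊆ (Polynomial.nthRoots n a).toFinset := by
    intro ζ hζ
    simpa [Polynomial.mem_nthRoots (Nat.pos_of_ne_zero hn)] using hζ
  exact (Finset.finite_toSet _).subset this

lemma finite_sectorDirs (hn : n ≠ 0) : (sectorDirs n).Finite :=
  (finite_setOf_pow_eq hn _).union (finite_setOf_pow_eq hn _)

lemma halfBox_pow (hn : n ≠ 0) (hζ : ζ ∈ sectorDirs n) (u v : ℝ) :
    halfBox n ζ u v ^ n = u + v * ζ ^ n :=
  rootBranch_pow hn (Or.inl (sectorDirs_ne_zero hn hζ))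

lemma halfBox_re (hn : n ≠ 0) (hζ : ζ ∈ sectorDirs n) (u v : ℝ) :
    (halfBox n ζ u v ^ n).re = u := by
  rw [halfBox_pow hn hζ]
  simp [sectorDirs_re hζ]

lemma halfBox_im (hn : n ≠ 0) (hζ : ζ ∈ sectorDirs n) (u v : ℝ) :
    (halfBox n ζ u v ^ n).im = v * (ζ ^ n).im := by
  rw [halfBox_pow hn hζ]
  simp

lemma halfBox_zero (hn : n ≠ 0) : halfBox n ζ 0 0 = 0 := by
  simp [halfBox, rootBranch_zero hn]

lemma halfBox_inj (hn : n ≠ 0) (hζ : ζ ∈ sectorDirs n) {u v u' v' : ℝ}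
    (h : halfBox n ζ u v = halfBox n ζ u' v') : u = u' ∧ v = v' := by
  constructor
  · rw [← halfBox_re hn hζ u v, h, halfBox_re hn hζ]
  · have h1 := halfBox_im hn hζ u v
    rw [h, halfBox_im hn hζ] at h1
    rcases sectorDirs_im hζ with h2 | h2 <;> rw [h2] at h1 <;> linarith

/-- Since `ζ ^ n = ± I`, the quotient is `v ∓ u I`. -/
lemma halfBox_ratio_mem (hn : n ≠ 0) (hζ : ζ ∈ sectorDirs n) {u v : ℝ} (h : 0 < v ∨ u ≠ 0) :
    (u + v * ζ ^ n) / ζ ^ n ∈ Complex.slitPlane := by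
  have h0 : ζ ^ n ≠ 0 := pow_ne_zero _ (sectorDirs_ne_zero hn hζ)
  rw [add_div, mul_div_assoc, div_self h0, mul_one, Complex.mem_slitPlane_iff]
  rcases hζ with h1 | h1 <;> rw [h1] <;> simpa [Complex.div_re, Complex.div_im] using h

lemma continuousOn_halfBox (hn : n ≠ 0) (hζ : ζ ∈ sectorDirs n) :
    ContinuousOn (fun p : ℝ × ℝ => halfBox n ζ p.1 p.2) {p | 0 ≤ p.2} := by
  intro p hp
  apply continuousWithinAt_rootBranch hn continuousWithinAt_const
  · apply Continuous.continuousWithinAt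
    fun_prop
  · by_cases h : p.1 = 0 ∧ p.2 = 0
    · left; simp [h.1, h.2]
    · right
      apply halfBox_ratio_mem hn hζ
      by_contra h1
      push Not at h1
      exact h ⟨h1.2, le_antisymm h1.1 hp⟩
  · intro t h
    exact absurd h (sectorDirs_ne_zero hn hζ)

lemma rootBranch_halfBox (hn : n ≠ 0) (hζ : ζ ∈ sectorDirs n) {u v : ℝ} (h : 0 < v ∨ u ≠ 0) :
    rootBranch n (halfBox n ζ u v) (ζ ^ n) = ζ :=
  rootBranch_rootBranch_self hn (halfBox_ratio_mem hn hζ h)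

/-- The sign of `Im (w ^ n)` determines which of `± I` is `ζ ^ n`, and `ζ` is then recovered as the
root of `ζ ^ n` in the branch at `w`. -/
lemma eq_of_halfBox_eq (hn : n ≠ 0) (hζ : ζ ∈ sectorDirs n) {ζ' : ℂ} (hζ' : ζ' ∈ sectorDirs n)
    {u v u' v' : ℝ} (hv : 0 < v) (hv' : 0 ≤ v') (h : halfBox n ζ u v = halfBox n ζ' u' v') :
    ζ = ζ' := by
  have h1 := halfBox_im hn hζ u v
  rw [h, halfBox_im hn hζ'] at h1
  have h2 : ζ ^ n = ζ' ^ n := by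
    rw [sectorDirs_pow hζ, sectorDirs_pow hζ']
    rcases sectorDirs_im hζ with h2 | h2 <;> rcases sectorDirs_im hζ' with h3 | h3 <;>
      rw [h2, h3] at h1 ⊢ <;> linarith
  have h3 : 0 < v' := by
    rcases hv'.eq_or_lt with h3 | h3
    · rw [← h3] at h1
      rcases sectorDirs_im hζ with h2 | h2 <;> rw [h2] at h1 <;> linarith
    · exact h3
  rw [← rootBranch_halfBox hn hζ (Or.inl hv), ← rootBranch_halfBox hn hζ' (Or.inl h3), h, h2]

/-- This finds the sector of a given `w`: its direction is the root of `ε I` in the branch at `w`.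
-/
lemma exists_halfBox_of_ratio (hn : n ≠ 0) {w : ℂ} {ε : ℝ} (hε : ε = 1 ∨ ε = -1)
    (hs : (ε * Complex.I) / w ^ n ∈ Complex.slitPlane) :
    rootBranch n w (ε * Complex.I) ∈ sectorDirs n ∧ rootBranch n w (ε * Complex.I) ^ n = ε * Complex.I ∧
    halfBox n (rootBranch n w (ε * Complex.I)) (w ^ n).re ((w ^ n).im * ε) = w := by
  have hw : w ≠ 0 := by
    rintro rfl
    simp [hn] at hs
  have h1 : rootBranch n w (ε * Complex.I) ^ n = ε * Complex.I := rootBranch_pow hn (Or.inl hw)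
  refine ⟨?_, h1, ?_⟩
  · rcases hε with rfl | rfl
    · left; simpa using h1
    · right; simpa using h1
  · rw [halfBox, h1]
    have h2 : (((w ^ n).re : ℂ) + ((w ^ n).im * ε : ℝ) * (ε * Complex.I)) = w ^ n := by
      have : (ε : ℂ) * ε = 1 := by rcases hε with rfl | rfl <;> simp
      push_cast
      rw [show ((w ^ n).im : ℂ) * ε * (ε * Complex.I) = (w ^ n).im * (ε * ε) * Complex.I by ring, this,
        mul_one, Complex.re_add_im]
    rw [h2]
    exact rootBranch_rootBranch_self hn hs

lemma ratio_mem_slitPlane {z : ℂ} {ε : ℝ} (hε : ε = 1 ∨ ε = -1) (h : 0 < z.im * ε ∨ (z.im = 0 ∧ z ≠ 0)) :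
    (ε * Complex.I) / z ∈ Complex.slitPlane := by
  have hz : z ≠ 0 := by
    rintro rfl
    simp at h
  have hN : 0 < Complex.normSq z := Complex.normSq_pos.2 hz
  rw [Complex.mem_slitPlane_iff, Complex.div_re, Complex.div_im]
  rcases h with h | ⟨h, -⟩
  · left
    simp only [Complex.mul_re, Complex.ofReal_re, Complex.I_re, Complex.ofReal_im, Complex.I_im,
      Complex.mul_im]
    have : 0 < ε * z.im / Complex.normSq z := div_pos (by linarith) hN
    simpa using this
  · right
    have hre : z.re ≠ 0 := by
      intro h'
      exact hz (Complex.ext h' h)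
    have hε0 : ε ≠ 0 := by rcases hε with rfl | rfl <;> norm_num
    simp [h, hε0, hre, hz]

lemma exists_sector (hn : n ≠ 0) {w : ℂ} (h : (w ^ n).im ≠ 0) : ∃ ζ ∈ sectorDirs n, w ∈ sector n ζ := by
  rcases lt_or_gt_of_ne h with h | h
  · have h0 : 0 < (w ^ n).im * (-1) := by linarith
    obtain ⟨h1, -, h2⟩ := exists_halfBox_of_ratio hn (Or.inr rfl) (ratio_mem_slitPlane (Or.inr rfl) (Or.inl h0))
    exact ⟨_, h1, _, _, h0, h2⟩
  · have h0 : 0 < (w ^ n).im * 1 := by linarith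
    obtain ⟨h1, -, h2⟩ := exists_halfBox_of_ratio hn (Or.inl rfl) (ratio_mem_slitPlane (Or.inl rfl) (Or.inl h0))
    exact ⟨_, h1, _, _, h0, h2⟩

/-- A point of an axis, except for `0`, lies in the boundaries of exactly two sectors, one on each side. -/
lemma exists_axis_halfBox (hn : n ≠ 0) {w : ℂ} (hw : w ≠ 0) (h : (w ^ n).im = 0) {ε : ℝ}
    (hε : ε = 1 ∨ ε = -1) : ∃ ζ ∈ sectorDirs n, ζ ^ n = ε * Complex.I ∧ halfBox n ζ (w ^ n).re 0 = w ∧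
      ∀ᶠ w' in 𝓝 w, 0 ≤ (w' ^ n).im * ε → halfBox n ζ (w' ^ n).re ((w' ^ n).im * ε) = w' := by
  have hs := ratio_mem_slitPlane (z := w ^ n) hε (Or.inr ⟨h, pow_ne_zero _ hw⟩)
  obtain ⟨h1, h2, h3⟩ := exists_halfBox_of_ratio hn hε hs
  refine ⟨_, h1, h2, ?_, ?_⟩
  · rwa [h, zero_mul] at h3
  -- The direction found from `w'` depends continuously on `w'` and lies in the finite set of roots
  -- of `ε I`. So it is constant near `w`.
  · have hc : ContinuousAt (fun w' : ℂ => rootBranch n w' (ε * Complex.I)) w := by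
      have hwn : w ^ n ≠ 0 := pow_ne_zero _ hw
      have hca : ContinuousAt (fun w' : ℂ => (ε * Complex.I) / w' ^ n) w :=
        continuousAt_const.div (by fun_prop) hwn
      exact continuousAt_id.mul (hca.cpow continuousAt_const hs)
    have hfin := (finite_setOf_pow_eq hn ((ε : ℂ) * Complex.I)).subset
      (sdiff_subset (t := {rootBranch n w (ε * Complex.I)}))
    have hopen : ({ζ : ℂ | ζ ^ n = ε * Complex.I} \ {rootBranch n w (ε * Complex.I)})ᶜ ∈
        𝓝 (rootBranch n w (ε * Complex.I)) :=
      hfin.isClosed.isOpen_compl.mem_nhds (by simp)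
    have hne : ∀ᶠ w' in 𝓝 w, w' ≠ 0 := isOpen_ne.mem_nhds hw
    filter_upwards [hc hopen, hne] with w' h4 h5 h6
    have h7 : rootBranch n w' (ε * Complex.I) ^ n = ε * Complex.I := rootBranch_pow hn (Or.inl h5)
    have h8 : rootBranch n w' (ε * Complex.I) = rootBranch n w (ε * Complex.I) := by
      by_contra h9
      exact h4 ⟨h7, h9⟩
    rw [← h8]
    apply (exists_halfBox_of_ratio hn hε (ratio_mem_slitPlane hε ?_)).2.2
    rcases h6.eq_or_lt with h9 | h9
    · right
      refine ⟨?_, pow_ne_zero _ h5⟩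
      rcases hε with rfl | rfl <;> linarith
    · exact Or.inl h9

lemma isPreconnected_sector (hn : n ≠ 0) (hζ : ζ ∈ sectorDirs n) : IsPreconnected (sector n ζ) := by
  have h : sector n ζ = (fun p : ℝ × ℝ => halfBox n ζ p.1 p.2) '' {p | 0 < p.2} := by
    ext w
    simp [sector]
  rw [h]
  apply IsPreconnected.image
  · have hc : Convex ℝ {p : ℝ × ℝ | 0 < p.2} := by
      exact (convex_Ioi (0 : ℝ)).linear_preimage (LinearMap.snd ℝ ℝ ℝ)
    exact hc.isPreconnected
  · exact (continuousOn_halfBox hn hζ).mono (fun p (hp : 0 < p.2) => hp.le)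

/-- The direction of the sector of `w'` is continuous in `w'` with values in a finite set, hence
locally constant. -/
lemma isOpen_sector (hn : n ≠ 0) (hζ : ζ ∈ sectorDirs n) : IsOpen (sector n ζ) := by
  rw [isOpen_iff_mem_nhds]
  rintro _ ⟨u, v, hv, rfl⟩
  set w := halfBox n ζ u v with hw
  have hε := sectorDirs_im hζ
  set ε := (ζ ^ n).im with hεd
  have hεε : ε * ε = 1 := by rcases hε with h | h <;> rw [h] <;> norm_num
  have him : (w ^ n).im * ε = v := by rw [hw, halfBox_im hn hζ, ← hεd, mul_assoc, hεε, mul_one]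
  have hs := ratio_mem_slitPlane (z := w ^ n) hε (Or.inl (by rw [him]; exact hv))
  have hw0 : w ≠ 0 := by
    rintro h
    rw [h] at him
    simp [hn] at him
    linarith
  have hroot : rootBranch n w (ε * Complex.I) = ζ := by
    rw [hεd, ← sectorDirs_pow hζ]
    exact rootBranch_halfBox hn hζ (Or.inl hv)
  have hc : ContinuousAt (fun w' : ℂ => rootBranch n w' (ε * Complex.I)) w := by
    have hwn : w ^ n ≠ 0 := pow_ne_zero _ hw0
    have hca : ContinuousAt (fun w' : ℂ => (ε * Complex.I) / w' ^ n) w :=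
      continuousAt_const.div (by fun_prop) hwn
    exact continuousAt_id.mul (hca.cpow continuousAt_const hs)
  have hfin := (finite_setOf_pow_eq hn ((ε : ℂ) * Complex.I)).subset (sdiff_subset (t := {ζ}))
  have hopen : ({ζ' : ℂ | ζ' ^ n = ε * Complex.I} \ {ζ})ᶜ ∈ 𝓝 (rootBranch n w (ε * Complex.I)) := by
    rw [hroot]
    exact hfin.isClosed.isOpen_compl.mem_nhds (by simp)
  have hne : ∀ᶠ w' in 𝓝 w, w' ≠ 0 := isOpen_ne.mem_nhds hw0
  have hpos : ∀ᶠ w' : ℂ in 𝓝 w, 0 < (w' ^ n).im * ε := by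
    have : Continuous fun w' : ℂ => (w' ^ n).im * ε := by fun_prop
    exact this.continuousAt.eventually_mem (Ioi_mem_nhds (by show 0 < (w ^ n).im * ε; linarith))
  filter_upwards [hc hopen, hne, hpos] with w' h4 h5 h6
  have h7 : rootBranch n w' (ε * Complex.I) ^ n = ε * Complex.I := rootBranch_pow hn (Or.inl h5)
  have h8 : rootBranch n w' (ε * Complex.I) = ζ := by
    by_contra h9
    exact h4 ⟨h7, h9⟩
  refine ⟨(w' ^ n).re, (w' ^ n).im * ε, h6, ?_⟩
  rw [← h8]
  exact (exists_halfBox_of_ratio hn hε (ratio_mem_slitPlane hε (Or.inl h6))).2.2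

lemma sector_disjoint (hn : n ≠ 0) (hζ : ζ ∈ sectorDirs n) {ζ' : ℂ} (hζ' : ζ' ∈ sectorDirs n) {w : ℂ}
    (h : w ∈ sector n ζ) (h' : w ∈ sector n ζ') : ζ = ζ' := by
  obtain ⟨u, v, hv, rfl⟩ := h
  obtain ⟨u', v', hv', h⟩ := h'
  exact eq_of_halfBox_eq hn hζ hζ' hv hv'.le h.symm

lemma sector_im (hn : n ≠ 0) (hζ : ζ ∈ sectorDirs n) {w : ℂ} (h : w ∈ sector n ζ) :
    0 < (w ^ n).im * (ζ ^ n).im := by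
  obtain ⟨u, v, hv, rfl⟩ := h
  rw [halfBox_im hn hζ]
  rcases sectorDirs_im hζ with h2 | h2 <;> rw [h2] <;> linarith

lemma sector_im_ne (hn : n ≠ 0) (hζ : ζ ∈ sectorDirs n) {w : ℂ} (h : w ∈ sector n ζ) :
    (w ^ n).im ≠ 0 := by
  intro h0
  have := sector_im hn hζ h
  rw [h0] at this
  simp at this

lemma exists_sectorDir (n : ℕ) (hn : n ≠ 0) : ∃ ζ : ℂ, ζ ^ n = Complex.I := by
  obtain ⟨z, hz⟩ := IsAlgClosed.exists_pow_nat_eq Complex.I (Nat.pos_of_ne_zero hn)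
  exact ⟨z, hz⟩

end sectors

/-! ### Gluing of locally defined functions with values in `ZMod 2` -/

/-- A transitive relation on the line that holds locally holds globally. -/
lemma interval_chain {r : ℝ → ℝ → Prop} (htr : ∀ a b c, a ≤ b → b ≤ c → r a b → r b c → r a c)
    (hloc : ∀ t, ∃ δ > 0, ∀ a b, t - δ < a → a ≤ b → b < t + δ → r a b) {a b : ℝ} (hab : a ≤ b) :
    r a b := by
  -- Continuous induction. The condition is imposed on all points up to `t`, so that the set is
  -- closed also under limits from above.
  have key : Icc a b ⊆ {t | ∀ u ∈ Icc a t, r a u} := by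
    apply IsClosed.Icc_subset_of_forall_exists_gt
    · apply isClosed_of_closure_subset
      intro t ht
      have ht2 : t ∈ Icc a b := closure_minimal inter_subset_right isClosed_Icc ht
      refine ⟨?_, ht2⟩
      intro u hu
      obtain ⟨δ, hδ, hr⟩ := hloc t
      obtain ⟨t', ht', h1, -⟩ := mem_closure_iff.1 ht (Ioo (t - δ) (t + δ)) isOpen_Ioo
        ⟨by linarith, by linarith⟩
      rcases le_or_gt u t' with h2 | h2
      · exact h1 u ⟨hu.1, h2⟩
      · rcases le_or_gt a t' with h3 | h3
        · exact htr a t' u h3 h2.le (h1 t' ⟨h3, le_rfl⟩)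
            (hr t' u ht'.1 h2.le (by linarith [hu.2]))
        · exact hr a u (by linarith [ht'.1]) hu.1 (by linarith [hu.2])
    · intro u hu
      obtain rfl : u = a := le_antisymm hu.2 hu.1
      obtain ⟨δ, hδ, hr⟩ := hloc u
      exact hr u u (by linarith) le_rfl (by linarith)
    · rintro t ⟨ht, ht1⟩ y hy
      obtain ⟨δ, hδ, hr⟩ := hloc t
      have hy' : t < y := hy
      refine ⟨min y (t + δ / 2), ?_, ?_, min_le_left _ _⟩
      · intro u hu
        have hu2 : u ≤ t + δ / 2 := hu.2.trans (min_le_right _ _)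
        rcases le_or_gt u t with h2 | h2
        · exact ht u ⟨hu.1, h2⟩
        · exact htr a t u ht1.1 h2.le (ht t ⟨ht1.1, le_rfl⟩) (hr t u (by linarith) h2.le (by linarith))
      · exact lt_min hy' (by linarith)
  exact key ⟨hab, le_rfl⟩ b ⟨hab, le_rfl⟩

/-- Near `x`, the functions `f` and `g` differ on `O` by a constant. -/
def EqUpToConst {X : Type*} [TopologicalSpace X] (O : Set X) (f g : X → ZMod 2) (x : X) : Prop :=
  ∃ c, ∀ᶠ y in 𝓝 x, y ∈ O → f y = g y + c

namespace EqUpToConst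

variable {X : Type*} [TopologicalSpace X] {O : Set X} {f g k : X → ZMod 2} {x : X}

lemma symm (h : EqUpToConst O f g x) : EqUpToConst O g f x := by
  obtain ⟨c, hc⟩ := h
  refine ⟨-c, ?_⟩
  filter_upwards [hc] with y hy hO
  rw [hy hO]; ring

lemma trans (h : EqUpToConst O f g x) (h' : EqUpToConst O g k x) : EqUpToConst O f k x := by
  obtain ⟨c, hc⟩ := h
  obtain ⟨c', hc'⟩ := h'
  refine ⟨c' + c, ?_⟩
  filter_upwards [hc, hc'] with y hy hy' hO
  rw [hy hO, hy' hO]; ring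

/-- Solutions of a local problem that is unique up to constants are glued along a connected set. -/
lemma glue (hO : Dense O) {m : X → X → ZMod 2} {R₁ R₂ : Set X} (h1 : IsOpen R₁) (h2 : IsOpen R₂)
    (hc : IsPreconnected (R₁ ∩ R₂)) (hf : ∀ x ∈ R₁, EqUpToConst O f (m x) x)
    (hg : ∀ x ∈ R₂, EqUpToConst O g (m x) x) :
    ∃ k : X → ZMod 2, (∀ x ∈ R₁ ∪ R₂, EqUpToConst O k (m x) x) ∧ ∀ x ∈ R₁, k x = f x := by
  classical
  have hfg : ∀ x ∈ R₁ ∩ R₂, EqUpToConst O f g x := fun x hx => (hf x hx.1).trans (hg x hx.2).symm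
  -- On the overlap `f - g` is locally constant on `O`, and density of `O` makes the constant at
  -- each point unique. Thus the sets `A c` are open and disjoint, and the connected overlap lies in
  -- one of them.
  obtain ⟨c, hcc⟩ : ∃ c, ∀ x ∈ R₁ ∩ R₂, ∀ᶠ y in 𝓝 x, y ∈ O → f y = g y + c := by
    rcases (R₁ ∩ R₂).eq_empty_or_nonempty with he | ⟨x₀, hx₀⟩
    · exact ⟨0, by simp [he]⟩
    · obtain ⟨c, hc0⟩ := hfg x₀ hx₀
      refine ⟨c, ?_⟩
      let A : ZMod 2 → Set X := fun c => {x | ∀ᶠ y in 𝓝 x, y ∈ O → f y = g y + c}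
      have hA : ∀ c, IsOpen (A c) := fun c => isOpen_setOfPred_eventually_nhds
      have hdis : ∀ a b, a ≠ b → Disjoint (A a) (A b) := by
        intro a b hab
        rw [Set.disjoint_left]
        intro x hx hx'
        have hx1 : ∀ᶠ y in 𝓝 x, y ∈ O → f y = g y + a := hx
        have hx2 : ∀ᶠ y in 𝓝 x, y ∈ O → f y = g y + b := hx'
        obtain ⟨y, hyO, hy⟩ := hO.inter_nhds_nonempty (hx1.and hx2)
        have := hy.1 hyO
        rw [hy.2 hyO] at this
        exact hab (add_left_cancel this).symm
      have := isPreconnected_iff_subset_of_disjoint.1 hc (A c) (⋃ b ∈ {b | b ≠ c}, A b) (hA c)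
        (isOpen_biUnion fun b _ => hA b)
        (by
          intro x hx
          obtain ⟨b, hb⟩ := hfg x hx
          by_cases hbc : b = c
          · exact Or.inl (hbc ▸ hb)
          · exact Or.inr (mem_biUnion hbc hb))
        (by
          rw [eq_empty_iff_forall_notMem]
          rintro x ⟨-, hx1, hx2⟩
          obtain ⟨b, hb, hb'⟩ := mem_iUnion₂.1 hx2
          exact Set.disjoint_left.1 (hdis b c hb) hb' hx1)
      rcases this with h | h
      · exact h
      · obtain ⟨b, hb, hb'⟩ := mem_iUnion₂.1 (h hx₀)
        exact (Set.disjoint_left.1 (hdis b c hb) hb' hc0).elim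
  refine ⟨fun x => if x ∈ R₁ then f x else g x + c, ?_, fun x hx => by simp [hx]⟩
  rintro x (hx | hx)
  · refine trans ⟨0, ?_⟩ (hf x hx)
    filter_upwards [h1.mem_nhds hx] with y hy _
    simp [hy]
  · refine trans ⟨c, ?_⟩ (hg x hx)
    filter_upwards [h2.mem_nhds hx] with y hy hyO
    by_cases hy1 : y ∈ R₁
    · simp only [hy1, if_true]
      exact (hcc y ⟨hy1, hy⟩).self_of_nhds hyO
    · simp [hy1]

/-- On a plane, a local problem that is unique up to constants has a global solution. -/
theorem exists_global (Ψ : X ≃ₜ ℝ × ℝ) (hO : Dense O) {m : X → X → ZMod 2}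
    (hm : ∀ p, ∀ᶠ x in 𝓝 p, EqUpToConst O (m p) (m x) x) :
    ∃ f : X → ZMod 2, ∀ x, EqUpToConst O f (m x) x := by
  classical
  let rect : ℝ → ℝ → ℝ → ℝ → Set X := fun a b c d => Ψ ⁻¹' (Ioo a b ×ˢ Ioo c d)
  have hopen : ∀ a b c d, IsOpen (rect a b c d) := fun a b c d =>
    (isOpen_Ioo.prod isOpen_Ioo).preimage Ψ.continuous
  have hconn : ∀ a b c d, IsPreconnected (rect a b c d) := by
    intro a b c d
    have : rect a b c d = Ψ.symm '' (Ioo a b ×ˢ Ioo c d) := by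
      rw [Homeomorph.image_symm]
    rw [this]
    exact (isPreconnected_Ioo.prod isPreconnected_Ioo).image _ Ψ.symm.continuous.continuousOn
  have hinter : ∀ a b c d a' b' c' d', rect a b c d ∩ rect a' b' c' d' =
      rect (max a a') (min b b') (max c c') (min d d') := by
    intro a b c d a' b' c' d'
    ext x
    simp only [rect, mem_inter_iff, mem_preimage, mem_prod, mem_Ioo, max_lt_iff, lt_min_iff]
    tauto
  let Good : Set X → Prop := fun R => ∃ f : X → ZMod 2, ∀ x ∈ R, EqUpToConst O f (m x) x
  have hmono : ∀ R R' : Set X, R ⊆ R' → Good R' → Good R := fun R R' h ⟨f, hf⟩ =>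
    ⟨f, fun x hx => hf x (h hx)⟩
  have hglue : ∀ a b c d a' b' c' d', Good (rect a b c d) → Good (rect a' b' c' d') →
      Good (rect a b c d ∪ rect a' b' c' d') := by
    rintro a b c d a' b' c' d' ⟨f, hf⟩ ⟨g, hg⟩
    obtain ⟨k, hk, -⟩ := glue hO (hopen _ _ _ _) (hopen _ _ _ _) (by rw [hinter]; exact hconn _ _ _ _) hf hg
    exact ⟨k, hk⟩
  -- Intersections of rectangles are rectangles, hence connected, so that solutions can be glued
  -- along a vertical segment. In `step2` the resulting strips are glued along a horizontal segment.
  have step1 : ∀ x : ℝ, ∀ c d, c ≤ d → ∃ ε > 0, Good (rect (x - ε) (x + ε) (c - ε) (d + ε)) := by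
    intro x c d hcd
    refine interval_chain (r := fun c d => ∃ ε > 0, Good (rect (x - ε) (x + ε) (c - ε) (d + ε))) ?_ ?_ hcd
    · rintro a b c hab hbc ⟨ε, hε, h⟩ ⟨ε', hε', h'⟩
      refine ⟨min ε ε', lt_min hε hε', hmono _ _ ?_ (hglue _ _ _ _ _ _ _ _ h h')⟩
      rintro y ⟨⟨h1, h2⟩, h3, h4⟩
      have h5 := min_le_left ε ε'
      have h6 := min_le_right ε ε'
      rcases lt_or_ge (Ψ y).2 (b + ε) with h7 | h7
      · left; exact ⟨⟨by linarith, by linarith⟩, by linarith, h7⟩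
      · right; exact ⟨⟨by linarith, by linarith⟩, by linarith, by linarith⟩
    · intro t
      have h1 := Ψ.symm.continuous.tendsto (x, t) |>.eventually (hm (Ψ.symm (x, t)))
      obtain ⟨ε, hε, h2⟩ := Metric.eventually_nhds_iff_ball.1 h1
      refine ⟨ε / 2, by positivity, fun a b ha hab hb => ⟨ε / 2, by positivity, m (Ψ.symm (x, t)), ?_⟩⟩
      rintro y ⟨⟨h3, h4⟩, h5, h6⟩
      have h7 := h2 (Ψ y) (by
        rw [← ball_prod_same]
        constructor
        · rw [Metric.mem_ball, Real.dist_eq, abs_lt]; constructor <;> linarith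
        · rw [Metric.mem_ball, Real.dist_eq, abs_lt]; constructor <;> linarith)
      simpa using h7
  have step2 : ∀ c d, c ≤ d → ∀ a b, a ≤ b → ∃ ε > 0, Good (rect (a - ε) (b + ε) c d) := by
    intro c d hcd a b hab
    refine interval_chain (r := fun a b => ∃ ε > 0, Good (rect (a - ε) (b + ε) c d)) ?_ ?_ hab
    · rintro a b e hab hbc ⟨ε, hε, h⟩ ⟨ε', hε', h'⟩
      refine ⟨min ε ε', lt_min hε hε', hmono _ _ ?_ (hglue _ _ _ _ _ _ _ _ h h')⟩
      rintro y ⟨⟨h1, h2⟩, h3, h4⟩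
      have h5 := min_le_left ε ε'
      have h6 := min_le_right ε ε'
      rcases lt_or_ge (Ψ y).1 (b + ε) with h7 | h7
      · left; exact ⟨⟨by linarith, by linarith⟩, h3, h4⟩
      · right; exact ⟨⟨by linarith, by linarith⟩, h3, h4⟩
    · intro t
      obtain ⟨ε, hε, h⟩ := step1 t c d hcd
      refine ⟨ε / 2, by positivity, fun a b ha hab hb => ⟨ε / 2, by positivity, hmono _ _ ?_ h⟩⟩
      rintro y ⟨⟨h1, h2⟩, h3, h4⟩
      exact ⟨⟨by linarith, by linarith⟩, by linarith, by linarith⟩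
  let S : ℕ → Set X := fun k => rect (-k) k (-k) k
  have hSmono : ∀ k l, k ≤ l → S k ⊆ S l := by
    rintro k l hkl y ⟨⟨h1, h2⟩, h3, h4⟩
    have : (k : ℝ) ≤ l := by exact_mod_cast hkl
    exact ⟨⟨by linarith, by linarith⟩, by linarith, by linarith⟩
  have hS : ∀ k, Good (S k) := by
    intro k
    have hk : (-k : ℝ) ≤ k := by
      have : (0 : ℝ) ≤ k := by positivity
      linarith
    obtain ⟨ε, hε, h⟩ := step2 (-k) k hk (-k) k hk
    refine hmono _ _ ?_ h
    rintro y ⟨⟨h1, h2⟩, h3, h4⟩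
    exact ⟨⟨by linarith, by linarith⟩, h3, h4⟩
  -- A solution on one square extends to the next one without being changed on the smaller square.
  -- The extensions therefore stabilize at every point.
  have hext : ∀ k : ℕ, ∀ g : {g : X → ZMod 2 // ∀ x ∈ S k, EqUpToConst O g (m x) x},
      ∃ g' : {g : X → ZMod 2 // ∀ x ∈ S (k + 1), EqUpToConst O g (m x) x}, ∀ x ∈ S k, g'.1 x = g.1 x := by
    rintro k ⟨g, hg⟩
    obtain ⟨g', hg'⟩ := hS (k + 1)
    obtain ⟨f, hf, hf'⟩ := glue hO (hopen _ _ _ _) (hopen _ _ _ _) (by rw [hinter]; exact hconn _ _ _ _) hg hg'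
    exact ⟨⟨f, fun x hx => hf x (Or.inr hx)⟩, hf'⟩
  choose next hnext using hext
  obtain ⟨g0, hg0⟩ := hS 0
  let G : ∀ k, {g : X → ZMod 2 // ∀ x ∈ S k, EqUpToConst O g (m x) x} :=
    fun k => Nat.rec ⟨g0, hg0⟩ (fun k g => next k g) k
  have hG : ∀ k l, k ≤ l → ∀ x ∈ S k, (G l).1 x = (G k).1 x := by
    intro k l hkl
    induction l, hkl using Nat.le_induction with
    | base => intro x _; rfl
    | succ l hl ih =>
      intro x hx
      rw [← ih x hx]
      exact hnext l (G l) x (hSmono k l hl hx)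
  have hex : ∀ x, ∃ k, x ∈ S k := by
    intro x
    obtain ⟨k, hk⟩ := exists_nat_gt (max |(Ψ x).1| |(Ψ x).2|)
    obtain ⟨h1, h2⟩ := max_lt_iff.1 hk
    exact ⟨k, abs_lt.1 h1, abs_lt.1 h2⟩
  refine ⟨fun x => (G (Nat.find (hex x))).1 x, fun x => ?_⟩
  obtain ⟨k, hk⟩ := hex x
  refine trans ⟨0, ?_⟩ ((G k).2 x hk)
  filter_upwards [(hopen _ _ _ _ : IsOpen (S k)).mem_nhds hk] with y hy _
  rw [add_zero]
  exact (hG _ k (Nat.find_min' (hex y) hy) y (Nat.find_spec (hex y))).symm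

end EqUpToConst

/-! ### The standard prong -/

/-- The unit directions of the rays of the standard prong. -/
def rayDirs (m : ℕ) : Set ℂ := {ω | ω ^ m = 1 ∨ ω ^ m = -1}

section prong

variable {m : ℕ}

lemma ncard_setOf_pow_eq (hm : m ≠ 0) {a : ℂ} (ha : a ≠ 0) : {ζ : ℂ | ζ ^ m = a}.ncard = m := by
  classical
  have h := Complex.isPrimitiveRoot_exp m hm
  have h1 : {ζ : ℂ | ζ ^ m = a} = ((Polynomial.nthRoots m a).toFinset : Set ℂ) := by
    ext ζ
    simp [Polynomial.mem_nthRoots (Nat.pos_of_ne_zero hm)]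
  rw [h1, Set.ncard_coe_finset, Multiset.toFinset_card_of_nodup (h.nthRoots_nodup ha),
    h.card_nthRoots, if_pos (IsAlgClosed.exists_pow_nat_eq a (Nat.pos_of_ne_zero hm))]

lemma ncard_rayDirs (hm : m ≠ 0) : (rayDirs m).ncard = 2 * m := by
  have h : rayDirs m = {ω | ω ^ m = 1} ∪ {ω | ω ^ m = -1} := rfl
  rw [h, ncard_union_eq _ (finite_setOf_pow_eq hm _) (finite_setOf_pow_eq hm _),
    ncard_setOf_pow_eq hm one_ne_zero, ncard_setOf_pow_eq hm (by norm_num), two_mul]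
  rw [Set.disjoint_left]
  intro ω (h1 : ω ^ m = 1) (h2 : ω ^ m = -1)
  rw [h1] at h2
  norm_num at h2

lemma rayDirs_ne_zero (hm : m ≠ 0) {ω : ℂ} (h : ω ∈ rayDirs m) : ω ≠ 0 := by
  rintro rfl
  rcases h with h | h <;> simp [hm] at h

lemma norm_rayDirs (hm : m ≠ 0) {ω : ℂ} (h : ω ∈ rayDirs m) : ‖ω‖ = 1 := by
  have h1 : ‖ω‖ ^ m = 1 := by
    rw [← norm_pow]
    rcases h with h | h <;> rw [h] <;> simp
  exact (pow_eq_one_iff_of_nonneg (norm_nonneg _) hm).1 h1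

lemma zero_mem_prong (hm : m ≠ 0) : (0 : ℂ) ∈ prong m := by simp [prong, hm]

lemma smul_mem_prong {c : ℂ} (h : c ∈ prong m) (r : ℝ) : r • c ∈ prong m := by
  have h' : (c ^ m).im = 0 := h
  show ((r • c) ^ m).im = 0
  rw [smul_pow, Complex.smul_im, h', smul_zero]

lemma rayDirs_subset_prong : rayDirs m ⊆ prong m := by
  rintro ω (h | h) <;> simp [prong, h]

lemma re_smul_pow (c : ℂ) (r : ℝ) : ((r • c) ^ m).re = r ^ m * (c ^ m).re := by
  rw [smul_pow, Complex.smul_re, smul_eq_mul]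

lemma prong_re_ne_zero {c : ℂ} (h : c ∈ prong m) (hc : c ≠ 0) : (c ^ m).re ≠ 0 := by
  intro h0
  exact pow_ne_zero m hc (Complex.ext h0 h)

lemma exists_rayDir {c : ℂ} (h : c ∈ prong m) (hc : c ≠ 0) : ∃ ω ∈ rayDirs m, ∃ r : ℝ, 0 < r ∧ c = r • ω := by
  have hn : 0 < ‖c‖ := norm_pos_iff.2 hc
  refine ⟨‖c‖⁻¹ • c, ?_, ‖c‖, hn, by rw [smul_inv_smul₀ hn.ne']⟩
  have h1 : (‖c‖⁻¹ • c) ^ m = (((‖c‖⁻¹ • c) ^ m).re : ℂ) := by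
    apply Complex.ext
    · simp
    · rw [Complex.ofReal_im]
      exact smul_mem_prong h _
  have h2 : ‖(‖c‖⁻¹ • c) ^ m‖ = 1 := by
    rw [norm_pow, norm_smul, norm_inv, norm_norm, inv_mul_cancel₀ hn.ne', one_pow]
  rw [h1, Complex.norm_real, Real.norm_eq_abs] at h2
  rcases (abs_eq (by norm_num)).1 h2 with h3 | h3
  · left; rw [h1, h3]; simp
  · right; rw [h1, h3]; simp

/-- The root of `c ^ m` in the branch at `c'` is continuous in `c'` and takes finitely many values,
so it equals `c` for `c'` near `c`. On the prong the quotient `c ^ m / c' ^ m` is a positive real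
number, which makes this root a positive multiple of `c'`. -/
lemma eventually_sameRay {c : ℂ} (h : c ∈ prong m) (hc : c ≠ 0) (hm : m ≠ 0) :
    ∀ᶠ c' in 𝓝 c, c' ∈ prong m → SameRay ℝ c c' := by
  have hcm : c ^ m ≠ 0 := pow_ne_zero _ hc
  have hca : ContinuousAt (fun c' : ℂ => c ^ m / c' ^ m) c :=
    continuousAt_const.div (by fun_prop) hcm
  have hroot : ContinuousAt (fun c' : ℂ => rootBranch m c' (c ^ m)) c := by
    refine continuousAt_id.mul (hca.cpow continuousAt_const ?_)
    rw [div_self hcm]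
    simp
  have hfin := (finite_setOf_pow_eq hm (c ^ m)).subset (sdiff_subset (t := {c}))
  have hopen : ({ζ : ℂ | ζ ^ m = c ^ m} \ {c})ᶜ ∈ 𝓝 (rootBranch m c (c ^ m)) := by
    rw [rootBranch_self]
    exact hfin.isClosed.isOpen_compl.mem_nhds (by simp)
  have hpos : ∀ᶠ c' : ℂ in 𝓝 c, 0 < (c ^ m / c' ^ m).re := by
    refine (Complex.continuous_re.continuousAt.comp hca).eventually_mem (Ioi_mem_nhds ?_)
    show 0 < (c ^ m / c ^ m).re
    rw [div_self hcm]
    simp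
  filter_upwards [hroot hopen, hpos, isOpen_ne.mem_nhds hc] with c' h1 h2 h3 h4
  have h5 : rootBranch m c' (c ^ m) = c := by
    by_contra h6
    exact h1 ⟨rootBranch_pow hm (Or.inl h3), h6⟩
  have h6 : c ^ m / c' ^ m = ((c ^ m / c' ^ m).re : ℂ) := by
    apply Complex.ext
    · simp
    · rw [Complex.div_im]
      have e1 : (c ^ m).im = 0 := h
      have e2 : (c' ^ m).im = 0 := h4
      simp [e1, e2]
  rw [rootBranch, h6, show ((m : ℂ)⁻¹) = (((m : ℝ)⁻¹ : ℝ) : ℂ) by simp, ← Complex.ofReal_cpow h2.le,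
    mul_comm, ← Complex.real_smul] at h5
  rw [← h5]
  exact SameRay.sameRay_nonneg_smul_left _ (by positivity)

/-- A connected part of a prong that avoids the centre lies in one ray. -/
lemma IsPreconnected.sameRay_of_prong (hm : m ≠ 0) {D : Set ℂ} (hD : IsPreconnected D)
    (h : D ⊆ prong m) (h0 : (0 : ℂ) ∉ D) {a b : ℂ} (ha : a ∈ D) (hb : b ∈ D) : SameRay ℝ a b := by
  refine hD.induction₂ (fun a b => SameRay ℝ a b) ?_ ?_ ?_ ha hb
  · intro x hx
    have := eventually_sameRay (h hx) (fun h' => h0 (h' ▸ hx)) hm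
    filter_upwards [mem_nhdsWithin_of_mem_nhds this, self_mem_nhdsWithin] with y h1 h2
    exact h1 (h h2)
  · intro x y z hx hy hz h1 h2
    exact h1.trans h2 (fun h' => absurd (h' ▸ hy) h0)
  · intro x y _ _ h1
    exact h1.symm

/-- Prongs are locally star-shaped. -/
lemma eventually_segment_prong {c : ℂ} (h : c ∈ prong m) (hm : m ≠ 0) :
    ∀ᶠ c' in 𝓝 c, c' ∈ prong m → ∀ t ∈ Icc (0 : ℝ) 1, c + t • (c' - c) ∈ prong m := by
  by_cases hc : c = 0
  · subst hc
    refine Eventually.of_forall fun c' h' t _ => ?_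
    simpa using smul_mem_prong h' t
  · filter_upwards [eventually_sameRay h hc hm, isOpen_ne.mem_nhds hc] with c' h1 h2 h3 t ht
    obtain ⟨r, hr, rfl⟩ := (h1 h3).exists_pos_left hc h2
    have : c + t • (r • c - c) = (1 + t * (r - 1)) • c := by
      rw [smul_sub, smul_smul, add_smul, one_smul, mul_sub, mul_one, sub_smul]
    rw [this]
    exact smul_mem_prong h _

/-- Two arcs in a half-line with the same starting point meet again. -/
lemma exists_eq_of_arcs {f g : ℝ → ℝ} {δ : ℝ} (hδ : 0 < δ) (hf : ContinuousOn f (Ico 0 δ))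
    (hg : ContinuousOn g (Ico 0 δ)) (hf0 : f 0 = 0) (hg0 : g 0 = 0)
    (hfp : ∀ t ∈ Ioo 0 δ, 0 < f t) (hgp : ∀ t ∈ Ioo 0 δ, 0 < g t) :
    ∃ s ∈ Ioo 0 δ, ∃ t ∈ Ioo 0 δ, f s = g t := by
  have h2 : δ / 2 ∈ Ioo 0 δ := ⟨by linarith, by linarith⟩
  have hsub : Icc 0 (δ / 2) ⊆ Ico 0 δ := fun t ht => ⟨ht.1, by linarith [ht.2]⟩
  have aux : ∀ f g : ℝ → ℝ, ContinuousOn g (Ico 0 δ) → g 0 = 0 → (∀ t ∈ Ioo 0 δ, 0 < f t) →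
      f (δ / 2) ≤ g (δ / 2) → ∃ t ∈ Ioo 0 δ, f (δ / 2) = g t := by
    intro f g hg hg0 hfp h
    obtain ⟨t, ht, h3⟩ := intermediate_value_Icc (by linarith) (hg.mono hsub)
      ⟨hg0.le.trans (hfp _ h2).le, h⟩
    refine ⟨t, ⟨lt_of_le_of_ne ht.1 ?_, by linarith [ht.2]⟩, h3.symm⟩
    rintro rfl
    rw [hg0] at h3
    exact (hfp _ h2).ne h3
  rcases le_total (f (δ / 2)) (g (δ / 2)) with h | h
  · obtain ⟨t, ht, h3⟩ := aux f g hg hg0 hfp h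
    exact ⟨_, h2, t, ht, h3⟩
  · obtain ⟨t, ht, h3⟩ := aux g f hf hf0 hgp h
    exact ⟨t, ht, _, h2, h3.symm⟩

/-- At most two arcs in a line starting at a point are disjoint. -/
lemma ncard_arcs_le {ι : Type*} {D : Set ι} {f : ι → ℝ → ℝ} {δ : ℝ} (hδ : 0 < δ)
    (hf : ∀ i ∈ D, ContinuousOn (f i) (Ico 0 δ)) (hf0 : ∀ i ∈ D, f i 0 = 0)
    (hne : ∀ i ∈ D, ∀ t ∈ Ioo 0 δ, f i t ≠ 0)
    (hdis : ∀ i ∈ D, ∀ j ∈ D, i ≠ j → ∀ s ∈ Ioo 0 δ, ∀ t ∈ Ioo 0 δ, f i s ≠ f j t) : D.ncard ≤ 2 := by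
  classical
  have h2 : δ / 2 ∈ Ioo 0 δ := ⟨by linarith, by linarith⟩
  have hsign : ∀ i ∈ D, ∀ σ : ℝ, (σ = 1 ∨ σ = -1) → 0 < σ * f i (δ / 2) →
      ∀ t ∈ Ioo 0 δ, 0 < σ * f i t := by
    intro i hi σ hσ hpos t ht
    by_contra hcon
    push Not at hcon
    have hcont : ContinuousOn (fun t => σ * f i t) (Ioo 0 δ) :=
      continuousOn_const.mul ((hf i hi).mono Ioo_subset_Ico_self)
    obtain ⟨s, hs, h3⟩ := isPreconnected_Ioo.intermediate_value ht h2 hcont ⟨hcon, hpos.le⟩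
    have h4 : σ * f i s = 0 := h3
    rcases mul_eq_zero.1 h4 with h5 | h5
    · rcases hσ with rfl | rfl <;> norm_num at h5
    · exact hne i hi s hs h5
  -- Each arc has constant sign after time `0`, and two arcs of the same sign meet. So an arc of the
  -- family is determined by its sign.
  have hinj : InjOn (fun i => decide (0 < f i (δ / 2))) D := by
    intro i hi j hj hij
    by_contra hne'
    have hij' : (0 < f i (δ / 2)) ↔ (0 < f j (δ / 2)) := by simpa using hij
    obtain ⟨σ, hσ, h3, h4⟩ : ∃ σ : ℝ, (σ = 1 ∨ σ = -1) ∧ 0 < σ * f i (δ / 2) ∧ 0 < σ * f j (δ / 2) := by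
      have hi0 := hne i hi _ h2
      have hj0 := hne j hj _ h2
      by_cases hp : 0 < f i (δ / 2)
      · exact ⟨1, Or.inl rfl, by linarith, by linarith [hij'.1 hp]⟩
      · refine ⟨-1, Or.inr rfl, ?_, ?_⟩
        · have := lt_of_le_of_ne (not_lt.1 hp) hi0
          linarith
        · have := lt_of_le_of_ne (not_lt.1 fun h => hp (hij'.2 h)) hj0
          linarith
    obtain ⟨s, hs, t, ht, h5⟩ := exists_eq_of_arcs hδ (continuousOn_const.mul (hf i hi))
      (continuousOn_const.mul (hf j hj)) (by simp [hf0 i hi]) (by simp [hf0 j hj])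
      (hsign i hi σ hσ h3) (hsign j hj σ hσ h4)
    refine hdis i hi j hj hne' s hs t ht (mul_left_cancel₀ ?_ h5)
    rcases hσ with rfl | rfl <;> norm_num
  calc D.ncard ≤ (univ : Set Bool).ncard := ncard_le_ncard_of_injOn _ (fun _ _ => mem_univ _) hinj
    _ = 2 := by simp

end prong

/-! ### Foliated charts -/

/-- `e` is a foliated chart: the plaques of `E` in its range correspond to the components of the
level sets of `q`. -/
structure FolChart {P : Type*} [TopologicalSpace P] (E : Setoid P) (q : ℂ → ℝ) (e : ℂ → P) : Prop where
  emb : IsOpenEmbedding e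
  same : ∀ C : Set ℂ, IsPreconnected C → (∀ w ∈ C, ∀ w' ∈ C, q w = q w') →
    ∀ w ∈ C, ∀ w' ∈ C, E (e w) (e w')
  level : ∀ C : Set ℂ, IsPreconnected C → (∀ w ∈ C, ∀ w' ∈ C, E (e w) (e w')) →
    ∀ w ∈ C, ∀ w' ∈ C, q w = q w'

lemma FolChart.comp {P : Type*} [TopologicalSpace P] {E : Setoid P} {q q' : ℂ → ℝ} {e : ℂ → P}
    (h : FolChart E q e) {G : ℂ → ℂ} (hG : IsOpenEmbedding G)
    (hq : ∀ w w', q' w = q' w' ↔ q (G w) = q (G w')) : FolChart E q' (e ∘ G) where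
  emb := h.emb.comp hG
  same C hC hw w hwC w' hwC' := by
    refine h.same (G '' C) (hC.image _ hG.continuous.continuousOn) ?_ _ ⟨w, hwC, rfl⟩ _ ⟨w', hwC', rfl⟩
    rintro _ ⟨a, ha, rfl⟩ _ ⟨b, hb, rfl⟩
    exact (hq _ _).1 (hw a ha b hb)
  level C hC hw w hwC w' hwC' := by
    refine (hq _ _).2 (h.level (G '' C) (hC.image _ hG.continuous.continuousOn) ?_ _ ⟨w, hwC, rfl⟩ _
      ⟨w', hwC', rfl⟩)
    rintro _ ⟨a, ha, rfl⟩ _ ⟨b, hb, rfl⟩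
    exact hw a ha b hb

/-- A foliation of a plane with prong singularities, whose leaves are properly embedded prongs. -/
structure PlaneFol {P : Type*} [TopologicalSpace P] (E : Setoid P) (ord : P → ℕ) : Prop where
  plane : Nonempty (P ≃ₜ ℂ)
  ord_ne : ∀ x, ord x ≠ 0
  chart : ∀ x, ∃ e : ℂ → P, FolChart E (fun w => (w ^ ord x).im) e ∧ e 0 = x
  leaf_prong : ∀ x, ∃ m : ℕ, m ≠ 0 ∧ IsProng m (leafOf E x)

/-- `γ` parametrizes the leaf of `x` by a standard prong. -/
structure LeafParam {P : Type*} [TopologicalSpace P] (E : Setoid P) (m : ℕ) (γ : prong m → P) (x : P) :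
    Prop where
  ne_zero : m ≠ 0
  emb : IsClosedEmbedding γ
  range_eq : range γ = leafOf E x

section leaf

variable {P : Type*} [TopologicalSpace P] {E : Setoid P} {m : ℕ} {γ : prong m → P} {x : P}

lemma leafOf_eq {y : P} (h : E x y) : leafOf E x = leafOf E y := by
  ext z
  exact ⟨fun h' => E.trans (E.symm h) h', fun h' => E.trans h h'⟩

lemma LeafParam.rel (h : LeafParam E m γ x) (a : prong m) : E x (γ a) := by
  have : γ a ∈ leafOf E x := h.range_eq ▸ mem_range_self a
  exact this

lemma LeafParam.rel' (h : LeafParam E m γ x) (a b : prong m) : E (γ a) (γ b) :=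
  E.trans (E.symm (h.rel a)) (h.rel b)

lemma LeafParam.exists_eq (h : LeafParam E m γ x) {y : P} (hy : E x y) : ∃ a, γ a = y := by
  have : y ∈ range γ := h.range_eq ▸ hy
  exact this

lemma LeafParam.congr (h : LeafParam E m γ x) {y : P} (hy : E x y) : LeafParam E m γ y :=
  ⟨h.ne_zero, h.emb, by rw [h.range_eq, leafOf_eq hy]⟩

/-- The segment in the prong from `c` to a nearby point is mapped into a chart. -/
lemma LeafParam.eventually_arc (h : LeafParam E m γ x) {e : ℂ → P} (he : IsOpenEmbedding e)
    {c : prong m} {w : ℂ} (hw : e w = γ c) {O : Set ℂ} (hO : O ∈ 𝓝 w) :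
    ∀ᶠ c' in 𝓝 c, ∃ D : Set ℂ, IsPreconnected D ∧ w ∈ D ∧ (∃ w' ∈ D, e w' = γ c') ∧ D ⊆ O ∧
      ∀ a ∈ D, ∃ b, γ b = e a := by
  have h1 : γ ⁻¹' (e '' O) ∈ 𝓝 c := h.emb.continuous.continuousAt (by
    rw [← hw]
    exact he.isOpenMap.image_mem_nhds hO)
  rw [nhds_subtype_eq_comap, mem_comap] at h1
  obtain ⟨t, ht, htO⟩ := h1
  obtain ⟨r, hr, hrt⟩ := Metric.mem_nhds_iff.1 ht
  rw [nhds_subtype_eq_comap, eventually_comap]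
  filter_upwards [eventually_segment_prong c.2 h.ne_zero, Metric.ball_mem_nhds _ hr] with b hb hbr c' hc'
  subst hc'
  have hseg := hb c'.2
  have hball : ∀ t ∈ Icc (0 : ℝ) 1, (c : ℂ) + t • ((c' : ℂ) - c) ∈ Metric.ball (c : ℂ) r := by
    intro t ht
    exact (convex_ball _ _).add_smul_sub_mem (Metric.mem_ball_self hr) hbr ht
  let k : Icc (0 : ℝ) 1 → prong m := fun t => ⟨(c : ℂ) + (t : ℝ) • ((c' : ℂ) - c), hseg t t.2⟩
  have hk : Continuous k := by
    apply Continuous.subtype_mk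
    fun_prop
  have hkO : ∀ t, γ (k t) ∈ e '' O := fun t => htO (hrt (hball t t.2))
  have hK : IsPreconnected (range (γ ∘ k)) := isPreconnected_range (h.emb.continuous.comp hk)
  have hsub : range (γ ∘ k) ⊆ range e := by
    rintro _ ⟨t, rfl⟩
    obtain ⟨a, -, ha⟩ := hkO t
    exact ⟨a, ha⟩
  have hk0 : k ⟨0, by simp⟩ = c := by
    apply Subtype.ext
    simp [k]
  have hk1 : k ⟨1, by simp⟩ = c' := by
    apply Subtype.ext
    simp [k]
  refine ⟨e ⁻¹' range (γ ∘ k), hK.preimage_of_isOpenMap he.injective he.isOpenMap hsub, ?_, ?_, ?_, ?_⟩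
  · exact ⟨⟨0, by simp⟩, by rw [Function.comp_apply, hk0, hw]⟩
  · obtain ⟨a, -, ha⟩ := hkO ⟨1, by simp⟩
    rw [hk1] at ha
    exact ⟨a, ⟨⟨1, by simp⟩, by rw [Function.comp_apply, hk1, ha]⟩, ha⟩
  · rintro a ⟨t, ht⟩
    obtain ⟨a', ha', h3⟩ := hkO t
    have : a' = a := he.injective (h3.trans ht)
    exact this ▸ ha'
  · rintro a ⟨t, ht⟩
    exact ⟨k t, ht⟩

/-- Near a point, a leaf is a level set in a foliated chart. -/
lemma FolChart.eventually_level {q : ℂ → ℝ} {e : ℂ → P} (he : FolChart E q e) {w : ℂ}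
    (hp : ∃ m : ℕ, m ≠ 0 ∧ IsProng m (leafOf E (e w))) :
    ∀ᶠ w' in 𝓝 w, E (e w) (e w') → q w' = q w := by
  obtain ⟨m, hm, γ, hγ, hr⟩ := hp
  have h : LeafParam E m γ (e w) := ⟨hm, hγ, hr⟩
  obtain ⟨c, hc⟩ := h.exists_eq (E.refl (e w))
  -- The leaf is an embedded prong, so its points near `e w` are joined to `e w` by small arcs
  -- inside the leaf and the chart. Along such an arc `q` is constant. Without the embedding, the
  -- leaf could return to every neighbourhood on other levels.
  have h1 := h.eventually_arc he.emb hc.symm univ_mem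
  have h2 : ∀ᶠ y in 𝓝 (e w), y ∈ range γ → ∃ w', e w' = y ∧ q w' = q w := by
    rw [← hc, hγ.isInducing.nhds_eq_comap, eventually_comap] at *
    filter_upwards [h1] with y hy
    rintro ⟨c', rfl⟩
    obtain ⟨D, hD, hwD, ⟨w', hw', he'⟩, -, hlev⟩ := hy c' rfl
    refine ⟨w', he', he.level D hD ?_ w' hw' w hwD⟩
    intro a ha b hb
    obtain ⟨a', ha'⟩ := hlev a ha
    obtain ⟨b', hb'⟩ := hlev b hb
    rw [← ha', ← hb']
    exact h.rel' _ _
  filter_upwards [he.emb.continuous.continuousAt.eventually h2] with w' hw' hE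
  obtain ⟨w'', h3, h4⟩ := hw' (hr ▸ hE)
  rwa [he.emb.injective h3] at h4

end leaf

section inverse

variable {P : Type*} [TopologicalSpace P] {e : ℂ → P}

lemma invFun_apply (he : IsOpenEmbedding e) (w : ℂ) : Function.invFun e (e w) = w :=
  Function.leftInverse_invFun he.injective w

lemma continuousAt_invFun (he : IsOpenEmbedding e) {y : P} (hy : y ∈ range e) :
    ContinuousAt (Function.invFun e) y := by
  obtain ⟨w, rfl⟩ := hy
  rw [← he.continuousAt_iff]
  have : Function.invFun e ∘ e = id := funext fun w => invFun_apply he w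
  rw [this]
  exact continuousAt_id

end inverse

section leaf

variable {P : Type*} [TopologicalSpace P] {E : Setoid P} {m : ℕ} {γ : prong m → P} {x : P}

lemma isPreconnected_smul_segment (w : ℂ) : IsPreconnected ((fun t : ℝ => t • w) '' Icc 0 1) :=
  isPreconnected_Icc.image _ (by fun_prop)

/-- The axes of a foliated chart are contained in the leaf of its centre. -/
lemma FolChart.rel_of_axis {n : ℕ} {e : ℂ → P} (he : FolChart E (fun w => (w ^ n).im) e) 
    {w : ℂ} (hw : (w ^ n).im = 0) : E (e 0) (e w) := by
  refine he.same _ (isPreconnected_smul_segment w) ?_ 0 ⟨0, by simp, by simp⟩ w ⟨1, by simp, by simp⟩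
  have : ∀ t : ℝ, ((t • w) ^ n).im = 0 := fun t => smul_mem_prong (show w ∈ prong n from hw) t
  rintro _ ⟨t, -, rfl⟩ _ ⟨s, -, rfl⟩
  simp only [this]

/-- Comparison of the standard prong in a foliated chart with the leaf of the centre of the chart. -/
lemma LeafParam.exists_lift (h : LeafParam E m γ x) {n : ℕ} {e : ℂ → P}
    (he : FolChart E (fun w => (w ^ n).im) e) (hx : E x (e 0)) :
    ∃ J : prong n → prong m, Continuous J ∧ Function.Injective J ∧ ∀ w, γ (J w) = e w := by
  have h1 : ∀ w : prong n, ∃ b, γ b = e w := fun w => h.exists_eq (E.trans hx (he.rel_of_axis w.2))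
  choose J hJ using h1
  refine ⟨J, ?_, ?_, hJ⟩
  · rw [h.emb.isInducing.continuous_iff]
    have : γ ∘ J = e ∘ Subtype.val := funext hJ
    rw [this]
    exact he.emb.continuous.comp continuous_subtype_val
  · intro a b hab
    have := hJ a
    rw [hab, hJ b] at this
    exact Subtype.ext (he.emb.injective this).symm

lemma smul_rayDir_inj {n : ℕ} (hn : n ≠ 0) {ω ω' : ℂ} (hω : ω ∈ rayDirs n) (hω' : ω' ∈ rayDirs n)
    {s t : ℝ} (hs : 0 < s) (ht : 0 < t) (h : s • ω = t • ω') : ω = ω' := by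
  have h1 : ‖s • ω‖ = ‖t • ω'‖ := by rw [h]
  rw [norm_smul, norm_smul, norm_rayDirs hn hω, norm_rayDirs hn hω', mul_one, mul_one, Real.norm_eq_abs,
    Real.norm_eq_abs, abs_of_pos hs, abs_of_pos ht] at h1
  rw [h1] at h
  exact smul_right_injective ℂ ht.ne' h

lemma eq_re_div_smul_of_sameRay {c c' : ℂ} (hc : c ≠ 0) (h : SameRay ℝ c c') : c' = (c' / c).re • c := by
  by_cases hc' : c' = 0
  · simp [hc']
  · obtain ⟨r, hr, rfl⟩ := h.exists_pos_left hc hc'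
    rw [Complex.real_smul, mul_div_assoc, div_self hc]
    simp

/-- The ray of a prong at a point: the path `t ↦ t • ω`. -/
noncomputable def rayPath {n : ℕ} {ω : ℂ} (hω : ω ∈ prong n) (t : ℝ) : prong n := ⟨t • ω, smul_mem_prong hω t⟩

lemma continuous_rayPath {n : ℕ} {ω : ℂ} (hω : ω ∈ prong n) : Continuous (rayPath hω) := by
  apply Continuous.subtype_mk
  fun_prop

namespace PlaneFol

variable {ord : P → ℕ} (F : PlaneFol E ord)
include F

/-- Points of a leaf other than the centre of the prong are regular. -/
lemma ord_of_ne (h : LeafParam E m γ x) {c : prong m} (hc : (c : ℂ) ≠ 0) : ord (γ c) = 1 := by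
  obtain ⟨e, he, he0⟩ := F.chart (γ c)
  set n := ord (γ c) with hn'
  have hn : n ≠ 0 := F.ord_ne _
  obtain ⟨J, hJc, hJi, hJ⟩ := h.exists_lift he (he0 ▸ h.rel c)
  have hJ0 : J ⟨0, zero_mem_prong hn⟩ = c := h.emb.injective (by rw [hJ, he0])
  have h1 : ∀ᶠ w in 𝓝 (⟨0, zero_mem_prong hn⟩ : prong n), SameRay ℝ (c : ℂ) (J w) := by
    have h2 := eventually_sameRay c.2 hc h.ne_zero
    have h3 : Tendsto (fun w => (J w : ℂ)) (𝓝 (⟨0, zero_mem_prong hn⟩ : prong n)) (𝓝 (c : ℂ)) := by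
      have := (continuous_subtype_val.comp hJc).tendsto (⟨0, zero_mem_prong hn⟩ : prong n)
      simpa only [Function.comp_def, hJ0] using this
    filter_upwards [h3.eventually h2] with w hw
    exact hw (J w).2
  rw [nhds_subtype_eq_comap, eventually_comap] at h1
  obtain ⟨δ, hδ, h2⟩ := Metric.eventually_nhds_iff_ball.1 h1
  have hball : ∀ ω (hω : ω ∈ rayDirs n), ∀ t ∈ Ico 0 δ,
      SameRay ℝ (c : ℂ) (J (rayPath (rayDirs_subset_prong hω) t)) := by
    intro ω hω t ht
    refine h2 (t • ω) ?_ _ rfl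
    rw [mem_ball_zero_iff, norm_smul, norm_rayDirs hn hω, Real.norm_eq_abs, abs_of_nonneg ht.1, mul_one]
    exact ht.2
  classical
  -- The coordinate, on the ray of the leaf through `c`, of the image of the ray `ω` of the chart,
  -- normalized to be `0` at `c`. The `2 n` rays become disjoint arcs in a line that start at one
  -- point, so there are at most two of them.
  let f : ℂ → ℝ → ℝ := fun ω t =>
    if hω : ω ∈ prong n then ((J (rayPath hω t) : ℂ) / c).re - 1 else 0
  have hinj : ∀ ω ∈ rayDirs n, ∀ ω' ∈ rayDirs n, ∀ s ∈ Ico 0 δ, ∀ t ∈ Ico 0 δ, f ω s = f ω' t →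
      s • ω = t • ω' := by
    intro ω hω ω' hω' s hs t ht hst
    simp only [f, rayDirs_subset_prong hω, rayDirs_subset_prong hω', dif_pos] at hst
    have h4 := eq_re_div_smul_of_sameRay hc (hball ω hω s hs)
    have h5 := eq_re_div_smul_of_sameRay hc (hball ω' hω' t ht)
    rw [sub_left_inj.1 hst, ← h5] at h4
    exact congrArg Subtype.val (hJi (Subtype.ext h4))
  have hz : ∀ ω ∈ rayDirs n, f ω 0 = 0 := by
    intro ω hω
    have : rayPath (rayDirs_subset_prong hω) 0 = ⟨0, zero_mem_prong hn⟩ := by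
      apply Subtype.ext; simp [rayPath]
    simp only [f, rayDirs_subset_prong hω, dif_pos, this, hJ0, div_self hc]
    simp
  have hle : (rayDirs n).ncard ≤ 2 := by
    refine ncard_arcs_le hδ (f := f) ?_ hz ?_ ?_
    · intro ω hω
      simp only [f, rayDirs_subset_prong hω, dif_pos]
      have := continuous_rayPath (rayDirs_subset_prong hω)
      exact Continuous.continuousOn (by fun_prop)
    · intro ω hω t ht h0
      have := hinj ω hω ω hω t ⟨ht.1.le, ht.2⟩ 0 ⟨le_rfl, hδ⟩ (by rw [h0, hz ω hω])
      rw [zero_smul, smul_eq_zero] at this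
      rcases this with h6 | h6
      · exact ht.1.ne' h6
      · exact rayDirs_ne_zero hn hω h6
    · intro ω hω ω' hω' hne s hs t ht hst
      exact hne (smul_rayDir_inj hn hω hω' hs.1 ht.1
        (hinj ω hω ω' hω' s ⟨hs.1.le, hs.2⟩ t ⟨ht.1.le, ht.2⟩ hst))
  rw [ncard_rayDirs hn] at hle
  omega

/-- The rays in a chart at the centre of a leaf lie in different rays of the leaf. -/
lemma ray_injective (h : LeafParam E m γ x) {n : ℕ} (hn : n ≠ 0) {J : prong n → prong m}
    (hJc : Continuous J) (hJi : Function.Injective J)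
    (hJ0 : (J ⟨0, zero_mem_prong hn⟩ : ℂ) = 0) {w w' : prong n} (hw : (w : ℂ) ≠ 0) (hw' : (w' : ℂ) ≠ 0)
    (hs : SameRay ℝ (J w : ℂ) (J w')) : SameRay ℝ (w : ℂ) w' := by
  have hne : ∀ w : prong n, (w : ℂ) ≠ 0 → (J w : ℂ) ≠ 0 := by
    intro w hw h0
    apply hw
    have : J w = J ⟨0, zero_mem_prong hn⟩ := Subtype.ext (h0.trans hJ0.symm)
    exact congrArg Subtype.val (hJi this)
  have hray : ∀ w : prong n, (w : ℂ) ≠ 0 → ∀ t : ℝ, 0 < t → SameRay ℝ (J w : ℂ) (J (rayPath w.2 t)) := by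
    intro w hw t ht
    have hpre : IsPreconnected ((fun t : ℝ => (J (rayPath w.2 t) : ℂ)) '' Ioi 0) := by
      refine isPreconnected_Ioi.image _ ?_
      have := continuous_rayPath w.2
      exact Continuous.continuousOn (by fun_prop)
    have h1 : rayPath w.2 1 = w := by apply Subtype.ext; simp [rayPath]
    refine hpre.sameRay_of_prong h.ne_zero ?_ ?_ ⟨1, by simp, by simp only [h1]⟩ ⟨t, ht, rfl⟩
    · rintro _ ⟨s, -, rfl⟩
      exact (J _).2
    · rintro ⟨s, hs, h2⟩
      have hs' : 0 < s := hs
      refine hne (rayPath w.2 s) ?_ h2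
      simp [rayPath, hs'.ne', hw]
  have hf : ∀ w : prong n, ContinuousOn (fun t => ‖(J (rayPath w.2 t) : ℂ)‖) (Ico 0 1) := by
    intro w
    have := continuous_rayPath w.2
    exact Continuous.continuousOn (by fun_prop)
  have hf0 : ∀ w : prong n, ‖(J (rayPath w.2 0) : ℂ)‖ = 0 := by
    intro w
    have : rayPath w.2 0 = ⟨0, zero_mem_prong hn⟩ := by apply Subtype.ext; simp [rayPath]
    rw [this, hJ0, norm_zero]
  have hpos : ∀ w : prong n, (w : ℂ) ≠ 0 → ∀ t ∈ Ioo (0 : ℝ) 1, 0 < ‖(J (rayPath w.2 t) : ℂ)‖ := by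
    intro w hw t ht
    rw [norm_pos_iff]
    apply hne
    simp [rayPath, ht.1.ne', hw]
  -- Two arcs that leave the centre in the same ray of the leaf reach a common distance from the
  -- centre, and so a common point. By injectivity of `J` the rays of `w` and `w'` then share a
  -- point.
  obtain ⟨s, hs1, t, ht1, hst⟩ := exists_eq_of_arcs one_pos (hf w) (hf w') (hf0 w) (hf0 w')
    (hpos w hw) (hpos w' hw')
  have h3 : SameRay ℝ (J (rayPath w.2 s) : ℂ) (J (rayPath w'.2 t)) := by
    refine ((hray w hw s hs1.1).symm.trans hs ?_).trans (hray w' hw' t ht1.1) ?_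
    · exact fun h0 => absurd h0 (hne w hw)
    · exact fun h0 => absurd h0 (hne w' hw')
  have h4 : (J (rayPath w.2 s) : ℂ) = J (rayPath w'.2 t) := by
    have h5 := h3.norm_smul_eq
    rw [hst] at h5
    have h6 := hpos w' hw' t ht1
    exact (smul_right_injective ℂ h6.ne' h5).symm
  have h5 : s • (w : ℂ) = t • (w' : ℂ) := congrArg Subtype.val (hJi (Subtype.ext h4))
  have h6 : (w' : ℂ) = (t⁻¹ * s) • (w : ℂ) := by
    rw [mul_smul, h5, smul_smul, inv_mul_cancel₀ ht1.1.ne', one_smul]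
  rw [h6]
  exact SameRay.sameRay_nonneg_smul_right _ (mul_nonneg (inv_nonneg.2 ht1.1.le) hs1.1.le)

/-- The order of the centre of a leaf is the number of its prongs. -/
lemma ord_center (h : LeafParam E m γ x) : ord (γ ⟨0, zero_mem_prong h.ne_zero⟩) = m := by
  obtain ⟨e, he, he0⟩ := F.chart (γ ⟨0, zero_mem_prong h.ne_zero⟩)
  set n := ord (γ ⟨0, zero_mem_prong h.ne_zero⟩) with hn'
  have hn : n ≠ 0 := F.ord_ne _
  obtain ⟨J, hJc, hJi, hJ⟩ := h.exists_lift he (he0 ▸ h.rel _)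
  have hJ0 : J ⟨0, zero_mem_prong hn⟩ = ⟨0, zero_mem_prong h.ne_zero⟩ := h.emb.injective (by rw [hJ, he0])
  have hne : ∀ w : prong n, (w : ℂ) ≠ 0 → (J w : ℂ) ≠ 0 := by
    intro w hw h0
    apply hw
    have : J w = J ⟨0, zero_mem_prong hn⟩ := by rw [hJ0]; exact Subtype.ext h0
    exact congrArg Subtype.val (hJi this)
  -- Each ray of the chart is sent to the ray of the leaf that contains its image. This is injective
  -- by `ray_injective`, and surjective because close to the centre every point of the leaf lies on
  -- an axis of the chart. Counting rays gives `2 n = 2 m`.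
  have hdir : ∀ ω : rayDirs n, ∃ ω' ∈ rayDirs m, SameRay ℝ (J ⟨ω, rayDirs_subset_prong ω.2⟩ : ℂ) ω' := by
    intro ω
    obtain ⟨ω', h1, r, hr, h2⟩ := exists_rayDir (J ⟨ω, rayDirs_subset_prong ω.2⟩).2
      (hne _ (rayDirs_ne_zero hn ω.2))
    refine ⟨ω', h1, ?_⟩
    rw [h2]
    exact SameRay.sameRay_nonneg_smul_left _ hr.le
  choose d hd hdr using hdir
  have hsr : ∀ {k : ℕ} (_ : k ≠ 0) {ω ω' : ℂ}, ω ∈ rayDirs k → ω' ∈ rayDirs k → SameRay ℝ ω ω' → ω = ω' := by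
    intro k hk ω ω' h1 h2 h3
    have := h3.norm_smul_eq
    rw [norm_rayDirs hk h1, norm_rayDirs hk h2, one_smul, one_smul] at this
    exact this.symm
  have hdi : Function.Injective d := by
    intro ω ω' hd'
    have h1 : SameRay ℝ (J ⟨ω, rayDirs_subset_prong ω.2⟩ : ℂ) (J ⟨ω', rayDirs_subset_prong ω'.2⟩) := by
      refine (hdr ω).trans (hd' ▸ (hdr ω').symm) ?_
      exact fun h0 => absurd h0 (rayDirs_ne_zero h.ne_zero (hd ω))
    have := F.ray_injective h hn hJc hJi (by rw [hJ0]) (rayDirs_ne_zero hn ω.2) (rayDirs_ne_zero hn ω'.2) h1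
    exact Subtype.ext (hsr hn ω.2 ω'.2 this)
  have hds : ∀ ω' ∈ rayDirs m, ∃ ω, d ω = ω' := by
    intro ω' hω'
    have h1 := h.eventually_arc he.emb (w := 0) (c := ⟨0, zero_mem_prong h.ne_zero⟩) he0 univ_mem
    have h2 : Tendsto (rayPath (rayDirs_subset_prong hω')) (𝓝[>] 0)
        (𝓝 ⟨0, zero_mem_prong h.ne_zero⟩) := by
      have := ((continuous_rayPath (rayDirs_subset_prong hω')).tendsto 0).mono_left
        (nhdsWithin_le_nhds (s := Ioi 0))
      convert this using 2
      apply Subtype.ext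
      simp [rayPath]
    obtain ⟨t, ⟨D, hD, h0D, ⟨w, hwD, hw⟩, -, hlev⟩, ht⟩ := ((h2.eventually h1).and self_mem_nhdsWithin).exists
    have ht' : 0 < t := ht
    have hwp : w ∈ prong n := by
      have := he.level D hD (fun a ha b hb => by
        obtain ⟨a', ha'⟩ := hlev a ha
        obtain ⟨b', hb'⟩ := hlev b hb
        rw [← ha', ← hb']
        exact h.rel' _ _) w hwD 0 h0D
      show (w ^ n).im = 0
      simpa [hn] using this
    have hJw : J ⟨w, hwp⟩ = rayPath (rayDirs_subset_prong hω') t := h.emb.injective (by rw [hJ, hw])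
    have hw0 : w ≠ 0 := by
      rintro rfl
      rw [hJ0] at hJw
      have := congrArg Subtype.val hJw
      simp [rayPath, ht'.ne', rayDirs_ne_zero h.ne_zero hω'] at this
    obtain ⟨ω, hω, r, hr, hwr⟩ := exists_rayDir hwp hw0
    refine ⟨⟨ω, hω⟩, hsr h.ne_zero (hd _) hω' ?_⟩
    have h5 : SameRay ℝ (J ⟨ω, rayDirs_subset_prong hω⟩ : ℂ) (J ⟨w, hwp⟩) := by
      have hpre : IsPreconnected ((fun t : ℝ => (J (rayPath (rayDirs_subset_prong hω) t) : ℂ)) '' Ioi 0) := by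
        refine isPreconnected_Ioi.image _ ?_
        have := continuous_rayPath (rayDirs_subset_prong hω)
        exact Continuous.continuousOn (by fun_prop)
      refine hpre.sameRay_of_prong h.ne_zero ?_ ?_ ⟨1, by simp, ?_⟩ ⟨r, hr, ?_⟩
      · rintro _ ⟨s, -, rfl⟩
        exact (J _).2
      · rintro ⟨s, hs, h2⟩
        have hs' : 0 < s := hs
        refine hne (rayPath (rayDirs_subset_prong hω) s) ?_ h2
        simp [rayPath, hs'.ne', rayDirs_ne_zero hn hω]
      · simp [rayPath]
      · simp [rayPath, hwr]
    refine ((hdr ⟨ω, hω⟩).symm.trans (h5.trans ?_ ?_) ?_)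
    · rw [hJw]
      exact SameRay.sameRay_nonneg_smul_left _ ht'.le
    · exact fun h0 => absurd h0 (hne _ hw0)
    · exact fun h0 => absurd h0 (hne _ (rayDirs_ne_zero hn hω))
  have hcard : Nat.card (rayDirs n) = Nat.card (rayDirs m) := by
    refine Nat.card_congr (Equiv.ofBijective (fun ω => (⟨d ω, hd ω⟩ : rayDirs m)) ⟨?_, ?_⟩)
    · intro a b hab
      exact hdi (congrArg Subtype.val hab)
    · rintro ⟨ω', hω'⟩
      obtain ⟨ω, hω⟩ := hds ω' hω'
      exact ⟨ω, Subtype.ext hω⟩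
  rw [Nat.card_coe_set_eq, Nat.card_coe_set_eq, ncard_rayDirs hn, ncard_rayDirs h.ne_zero] at hcard
  omega

lemma exists_leafParam (x : P) : ∃ (m : ℕ) (γ : prong m → P), LeafParam E m γ x := by
  obtain ⟨m, hm, γ, hγ, hr⟩ := F.leaf_prong x
  exact ⟨m, γ, hm, hγ, hr⟩

/-- In a foliated chart, only the centre can be singular. -/
lemma ord_chart {n : ℕ} (hn : n ≠ 0) {e : ℂ → P} (he : FolChart E (fun w => (w ^ n).im) e) {w : ℂ}
    (hw : w ≠ 0) : ord (e w) = 1 := by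
  obtain ⟨m, γ, h⟩ := F.exists_leafParam (e w)
  obtain ⟨c, hc⟩ := h.exists_eq (E.refl (e w))
  by_cases hc0 : (c : ℂ) = 0
  swap
  · rw [← hc]; exact F.ord_of_ne h hc0
  obtain rfl : c = ⟨0, zero_mem_prong h.ne_zero⟩ := Subtype.ext hc0
  have hm : ord (e w) = m := by rw [← hc]; exact F.ord_center h
  -- Away from `0` the power map is locally injective, so the level set of `Im (w ^ n)` is locally
  -- embedded in a line by `Re (w ^ n)`. The `2 m` rays of the leaf at its centre give disjoint arcs
  -- in this line, whence `m = 1`.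
  obtain ⟨O, hO, hOinj⟩ : ∃ O ∈ 𝓝 w, ∀ a ∈ O, ∀ b ∈ O, a ^ n = b ^ n → a = b := by
    have h1 := (hasStrictDerivAt_pow n w).eventually_left_inverse
      (mul_ne_zero (by exact_mod_cast hn) (pow_ne_zero _ hw))
    refine ⟨_, h1, fun a ha b hb hab => ?_⟩
    rw [← (show _ = a from ha), hab, (show _ = b from hb)]
  have h1 : ∀ᶠ c' in 𝓝 (⟨0, zero_mem_prong h.ne_zero⟩ : prong m),
      ∃ w' ∈ O, e w' = γ c' ∧ (w' ^ n).im = (w ^ n).im := by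
    filter_upwards [h.eventually_arc he.emb hc.symm hO] with c' ⟨D, hD, hwD, ⟨w', hw', he'⟩, hDO, hlev⟩
    refine ⟨w', hDO hw', he', he.level D hD ?_ w' hw' w hwD⟩
    intro a ha b hb
    obtain ⟨a', ha'⟩ := hlev a ha
    obtain ⟨b', hb'⟩ := hlev b hb
    rw [← ha', ← hb']
    exact h.rel' _ _
  rw [nhds_subtype_eq_comap, eventually_comap] at h1
  obtain ⟨δ, hδ, h2⟩ := Metric.eventually_nhds_iff_ball.1 h1
  have hball : ∀ ω (hω : ω ∈ rayDirs m), ∀ t ∈ Ico 0 δ,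
      ∃ w' ∈ O, e w' = γ (rayPath (rayDirs_subset_prong hω) t) ∧ (w' ^ n).im = (w ^ n).im := by
    intro ω hω t ht
    refine h2 (t • ω) ?_ _ rfl
    rw [mem_ball_zero_iff, norm_smul, norm_rayDirs h.ne_zero hω, Real.norm_eq_abs, abs_of_nonneg ht.1,
      mul_one]
    exact ht.2
  classical
  let f : ℂ → ℝ → ℝ := fun ω t =>
    if hω : ω ∈ prong m then (Function.invFun e (γ (rayPath hω t)) ^ n).re - (w ^ n).re else 0
  have hinj : ∀ ω ∈ rayDirs m, ∀ ω' ∈ rayDirs m, ∀ s ∈ Ico 0 δ, ∀ t ∈ Ico 0 δ, f ω s = f ω' t →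
      s • ω = t • ω' := by
    intro ω hω ω' hω' s hs t ht hst
    simp only [f, rayDirs_subset_prong hω, rayDirs_subset_prong hω', dif_pos] at hst
    obtain ⟨a, haO, ha, ha'⟩ := hball ω hω s hs
    obtain ⟨b, hbO, hb, hb'⟩ := hball ω' hω' t ht
    rw [← ha, ← hb, invFun_apply he.emb, invFun_apply he.emb, sub_left_inj] at hst
    have hab : a = b := hOinj a haO b hbO (Complex.ext hst (ha'.trans hb'.symm))
    rw [hab, hb] at ha
    exact congrArg Subtype.val (h.emb.injective ha).symm
  have hz : ∀ ω ∈ rayDirs m, f ω 0 = 0 := by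
    intro ω hω
    have : rayPath (rayDirs_subset_prong hω) 0 = ⟨0, zero_mem_prong h.ne_zero⟩ := by
      apply Subtype.ext; simp [rayPath]
    simp only [f, rayDirs_subset_prong hω, dif_pos, this, hc, invFun_apply he.emb, sub_self]
  have hle : (rayDirs m).ncard ≤ 2 := by
    refine ncard_arcs_le hδ (f := f) ?_ hz ?_ ?_
    · intro ω hω t ht
      simp only [f, rayDirs_subset_prong hω, dif_pos]
      obtain ⟨a, -, ha, -⟩ := hball ω hω t ht
      have h3 : ContinuousAt (Function.invFun e) (γ (rayPath (rayDirs_subset_prong hω) t)) :=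
        continuousAt_invFun he.emb ⟨a, ha⟩
      have h4 : ContinuousAt (fun t => Function.invFun e (γ (rayPath (rayDirs_subset_prong hω) t))) t :=
        ContinuousAt.comp (f := fun t => γ (rayPath (rayDirs_subset_prong hω) t)) h3
          (h.emb.continuous.comp (continuous_rayPath _)).continuousAt
      exact ((Complex.continuous_re.continuousAt.comp (h4.pow n)).sub continuousAt_const).continuousWithinAt
    · intro ω hω t ht h0
      have := hinj ω hω ω hω t ⟨ht.1.le, ht.2⟩ 0 ⟨le_rfl, hδ⟩ (by rw [h0, hz ω hω])
      rw [zero_smul, smul_eq_zero] at this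
      rcases this with h6 | h6
      · exact ht.1.ne' h6
      · exact rayDirs_ne_zero h.ne_zero hω h6
    · intro ω hω ω' hω' hne s hs t ht hst
      exact hne (smul_rayDir_inj h.ne_zero hω hω' hs.1 ht.1
        (hinj ω hω ω' hω' s ⟨hs.1.le, hs.2⟩ t ⟨ht.1.le, ht.2⟩ hst))
  rw [ncard_rayDirs h.ne_zero] at hle
  have := h.ne_zero
  omega

end PlaneFol

end leaf

/-! ### Separation of the plane by a leaf -/

lemma tendsto_halfBox {n : ℕ} {ζ : ℂ} (hn : n ≠ 0) (hζ : ζ ∈ sectorDirs n) (u : ℝ) :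
    Tendsto (fun v : ℝ => halfBox n ζ u v) (𝓝[>] 0) (𝓝 (halfBox n ζ u 0)) := by
  have h := continuousOn_halfBox hn hζ
  have h3 : ContinuousOn (fun v : ℝ => halfBox n ζ u v) (Ici 0) := by
    refine h.comp (f := fun v : ℝ => ((u, v) : ℝ × ℝ)) (by fun_prop) ?_
    intro v hv
    exact hv
  have h4 := (h3 0 self_mem_Ici).tendsto
  exact h4.mono_left (nhdsWithin_mono _ Ioi_subset_Ici_self)

lemma frequently_side {n : ℕ} (hn : n ≠ 0) {w : ℂ} (hw : w ≠ 0) (h : (w ^ n).im = 0) {ε : ℝ}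
    (hε : ε = 1 ∨ ε = -1) : ∃ᶠ w' in 𝓝 w, 0 < (w' ^ n).im * ε := by
  obtain ⟨ζ, hζ, hζε, hb, -⟩ := exists_axis_halfBox hn hw h hε
  have h1 := tendsto_halfBox hn hζ (w ^ n).re
  rw [hb] at h1
  refine h1.frequently (Eventually.frequently ?_)
  filter_upwards [self_mem_nhdsWithin] with v hv
  have hv' : 0 < v := hv
  rw [halfBox_im hn hζ, hζε]
  have : ε * ε = 1 := by rcases hε with rfl | rfl <;> norm_num
  simp only [Complex.mul_im, Complex.ofReal_re, Complex.I_im, Complex.ofReal_im, Complex.I_re]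
  nlinarith

lemma smul_halfBox {n : ℕ} {ζ : ℂ} (hn : n ≠ 0) (u : ℝ) {r : ℝ} (hr : 0 < r) :
    r • halfBox n ζ u 0 = halfBox n ζ (r ^ n * u) 0 := by
  simp only [halfBox, rootBranch, Complex.ofReal_zero, zero_mul, add_zero]
  by_cases hz : (u : ℂ) / ζ ^ n = 0
  · have : ((r ^ n * u : ℝ) : ℂ) / ζ ^ n = 0 := by
      rw [Complex.ofReal_mul, mul_div_assoc, hz, mul_zero]
    rw [this, hz]
    simp [hn]
  · have h1 : ((r ^ n * u : ℝ) : ℂ) / ζ ^ n = ((r ^ n : ℝ) : ℂ) * (u / ζ ^ n) := by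
      rw [Complex.ofReal_mul, mul_div_assoc]
    have hrn : 0 < r ^ n := by positivity
    have h2 : (((r ^ n : ℝ) : ℂ) * (u / ζ ^ n)) ^ ((n : ℂ)⁻¹) = r * (u / ζ ^ n) ^ ((n : ℂ)⁻¹) := by
      rw [Complex.cpow_def_of_ne_zero (mul_ne_zero (by exact_mod_cast hrn.ne') hz),
        Complex.log_ofReal_mul hrn hz, add_mul, Complex.exp_add, ← Complex.cpow_def_of_ne_zero hz]
      congr 1
      rw [Real.log_pow, Complex.ofReal_mul, Complex.ofReal_natCast, mul_comm (n : ℂ), mul_assoc,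
        mul_inv_cancel₀ (by exact_mod_cast hn), mul_one, ← Complex.ofReal_exp, Real.exp_log hr]
    rw [h1, h2, Complex.real_smul]
    ring

/-- A foliated chart at `x` that meets the leaf of `x` only in the axes. -/
structure NiceChart {P : Type*} [TopologicalSpace P] (E : Setoid P) (n : ℕ) (e : ℂ → P) (x : P) :
    Prop where
  ne_zero : n ≠ 0
  chart : FolChart E (fun w => (w ^ n).im) e
  zero : e 0 = x
  axis : ∀ w, E x (e w) → (w ^ n).im = 0

/-- The indicator function of a set. -/
noncomputable def ind {P : Type*} (S : Set P) (y : P) : ZMod 2 := by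
  classical exact if y ∈ S then 1 else 0

lemma ind_mem {P : Type*} {S : Set P} {y : P} (h : y ∈ S) : ind S y = 1 := by simp [ind, h]

lemma ind_notMem {P : Type*} {S : Set P} {y : P} (h : y ∉ S) : ind S y = 0 := by simp [ind, h]

section nice

variable {P : Type*} [TopologicalSpace P] {E : Setoid P} {n : ℕ} {e : ℂ → P} {x : P}

lemma FolChart.shrink_im (he : FolChart E (fun w => (w ^ n).im) e) (hn : n ≠ 0) {δ : ℝ} (hδ : 0 < δ) :
    FolChart E (fun w => (w ^ n).im) (e ∘ shrink n δ) := by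
  refine he.comp (isOpenEmbedding_shrink hn hδ) fun w w' => ?_
  rw [shrink_pow hn, shrink_pow hn]
  exact (squeeze_injective hδ).eq_iff.symm

lemma FolChart.shrink_re (he : FolChart E (fun w => (w ^ n).re) e) (hn : n ≠ 0) {δ : ℝ} (hδ : 0 < δ) :
    FolChart E (fun w => (w ^ n).re) (e ∘ shrink n δ) := by
  refine he.comp (isOpenEmbedding_shrink hn hδ) fun w w' => ?_
  rw [shrink_pow hn, shrink_pow hn]
  exact (squeeze_injective hδ).eq_iff.symm

lemma NiceChart.rel (h : NiceChart E n e x) {w : ℂ} (hw : (w ^ n).im = 0) : E x (e w) := by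
  rw [← h.zero]
  exact h.chart.rel_of_axis hw

lemma NiceChart.rel_iff (h : NiceChart E n e x) {w : ℂ} : E x (e w) ↔ (w ^ n).im = 0 :=
  ⟨h.axis w, h.rel⟩

lemma NiceChart.range_mem (h : NiceChart E n e x) : range e ∈ 𝓝 x :=
  h.chart.emb.isOpen_range.mem_nhds ⟨0, h.zero⟩

namespace PlaneFol

variable {ord : P → ℕ} (F : PlaneFol E ord)
include F

/-- Near `x` the leaf of `x` is a level set of the chart; once the chart is shrunk into that
neighbourhood, the level through `0` consists of the axes. All small shrinkings are allowed, so that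
further smallness conditions can be imposed. -/
lemma exists_nice_shrink (hn : n ≠ 0) (he : FolChart E (fun w => (w ^ n).im) e) (he0 : e 0 = x) :
    ∀ᶠ O in (𝓝 (0 : ℂ)).smallSets, ∀ δ > 0, range (shrink n δ) ⊆ O → NiceChart E n (e ∘ shrink n δ) x := by
  have h1 := he.eventually_level (w := 0) (F.leaf_prong _)
  rw [eventually_smallSets]
  refine ⟨_, h1, fun O hO δ hδ hr => ⟨hn, he.shrink_im hn hδ, by simp [shrink_zero, he0], ?_⟩⟩
  intro w hw
  have h2 := hO (hr ⟨w, rfl⟩) (he0 ▸ hw)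
  simp only [shrink_pow hn, ne_eq, hn, not_false_eq_true, zero_pow, Complex.zero_im, squeezeC] at h2
  exact squeeze_injective hδ (h2.trans (by simp [squeeze]))

lemma exists_nice (x : P) {O : Set P} (hO : O ∈ 𝓝 x) : ∃ e, NiceChart E (ord x) e x ∧ range e ⊆ O := by
  obtain ⟨e, he, he0⟩ := F.chart x
  have h1 := F.exists_nice_shrink (F.ord_ne x) he he0
  have h2 : e ⁻¹' O ∈ 𝓝 (0 : ℂ) := he.emb.continuous.continuousAt (by rwa [he0])
  obtain ⟨s, hs, hs'⟩ := eventually_smallSets.1 h1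
  obtain ⟨δ, hδ, hr⟩ := exists_shrink_subset (F.ord_ne x) (inter_mem hs h2)
  refine ⟨_, hs' s Subset.rfl δ hδ (hr.trans inter_subset_left), ?_⟩
  rintro _ ⟨w, rfl⟩
  exact (hr ⟨w, rfl⟩).2

lemma isClosed_leaf (x : P) : IsClosed (leafOf E x) := by
  obtain ⟨m, γ, h⟩ := F.exists_leafParam x
  rw [← h.range_eq]
  exact h.emb.isClosed_range

lemma t2Space : T2Space P := by
  obtain ⟨Ψ⟩ := F.plane
  exact Ψ.symm.t2Space

lemma locallyConnectedSpace : LocallyConnectedSpace P := by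
  obtain ⟨Ψ⟩ := F.plane
  exact Ψ.isOpenEmbedding.locallyConnectedSpace

lemma preconnectedSpace : PreconnectedSpace P := by
  obtain ⟨Ψ⟩ := F.plane
  refine ⟨?_⟩
  rw [← Ψ.symm.range_coe]
  exact isPreconnected_range Ψ.symm.continuous

lemma dense_compl_leaf (x : P) : Dense (leafOf E x)ᶜ := by
  intro y
  by_cases hy : y ∈ leafOf E x
  swap
  · exact subset_closure hy
  · obtain ⟨e, he, -⟩ := F.exists_nice y univ_mem
    have hn := he.ne_zero
    obtain ⟨ζ, hζ⟩ := exists_sectorDir (ord y) hn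
    have h1 := tendsto_halfBox hn (Or.inl hζ) 0
    rw [halfBox_zero hn] at h1
    have h2 := (he.chart.emb.continuous.tendsto 0).comp h1
    rw [he.zero] at h2
    refine mem_closure_of_tendsto h2 ?_
    filter_upwards [self_mem_nhdsWithin] with v hv hE
    have hv' : 0 < v := hv
    have h3 := he.axis _ (E.trans (E.symm hy) hE)
    rw [halfBox_im hn (Or.inl hζ), hζ] at h3
    simp at h3
    exact hv'.ne' h3

end PlaneFol

/-- The two sides of a leaf at a regular point are determined by any local separation of the
complement of the leaf. -/
lemma NiceChart.two_sides (he : NiceChart E 1 e x) {A B : Set P} (hA : IsOpen A) (hB : IsOpen B)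
    (hdis : Disjoint A B) (hAB : ∀ᶠ y in 𝓝 x, ¬ E x y → y ∈ A ∪ B) (hAf : ∃ᶠ y in 𝓝 x, y ∈ A)
    (hBf : ∃ᶠ y in 𝓝 x, y ∈ B) (hAE : ∀ y ∈ A, ¬ E x y) (hBE : ∀ y ∈ B, ¬ E x y) :
    EqUpToConst (leafOf E x)ᶜ (ind A) (ind (e '' {w | 0 < w.im})) x := by
  have h1 : ∀ᶠ w in 𝓝 (0 : ℂ), ¬ E x (e w) → e w ∈ A ∪ B := by
    have := he.chart.emb.continuous.tendsto 0
    rw [he.zero] at this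
    exact this.eventually hAB
  obtain ⟨r, hr, h2⟩ := Metric.eventually_nhds_iff_ball.1 h1
  have hrel : ∀ w, E x (e w) ↔ w.im = 0 := fun w => by simpa using he.rel_iff (w := w)
  -- Each open half-disc is connected and misses the leaf, so it lies in `A` or in `B`. Both cannot
  -- lie in the same set, because the other one accumulates at `x`. Hence near `x` the set `A` is
  -- one of the two half-discs, and its indicator is that of the upper one up to a constant.
  have hside : ∀ D : Set ℂ, Convex ℝ D → D ⊆ Metric.ball 0 r → (∀ w ∈ D, w.im ≠ 0) →
      e '' D ⊆ A ∨ e '' D ⊆ B := by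
    intro D hD hDr hD0
    refine (hD.isPreconnected.image _ he.chart.emb.continuous.continuousOn).subset_or_subset hA hB hdis ?_
    rintro _ ⟨w, hw, rfl⟩
    exact h2 w (hDr hw) (by rw [hrel]; exact hD0 w hw)
  have hUp := hside (Metric.ball 0 r ∩ {w | 0 < w.im}) ((convex_ball _ _).inter
    (convex_halfSpace_im_gt 0)) inter_subset_left (fun w hw => (show 0 < w.im from hw.2).ne')
  have hDn := hside (Metric.ball 0 r ∩ {w | w.im < 0}) ((convex_ball _ _).inter
    (convex_halfSpace_im_lt 0)) inter_subset_left (fun w hw => (show w.im < 0 from hw.2).ne)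
  have hnb : e '' Metric.ball 0 r ∈ 𝓝 x := by
    have := he.chart.emb.isOpenMap.image_mem_nhds (Metric.ball_mem_nhds (0 : ℂ) hr)
    rwa [he.zero] at this
  have hall : ∀ S T : Set P, Disjoint S T → (∀ y ∈ T, ¬ E x y) → (∃ᶠ y in 𝓝 x, y ∈ T) →
      e '' (Metric.ball 0 r ∩ {w | 0 < w.im}) ⊆ S → e '' (Metric.ball 0 r ∩ {w | w.im < 0}) ⊆ S → False := by
    intro S T hST hTE hTf hu hd
    obtain ⟨y, hyT, w, hw, rfl⟩ := (hTf.and_eventually hnb).exists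
    have him : w.im ≠ 0 := fun h0 => hTE _ hyT ((hrel w).2 h0)
    rcases lt_or_gt_of_ne him with h3 | h3
    · exact Set.disjoint_left.1 hST (hd ⟨w, ⟨hw, h3⟩, rfl⟩) hyT
    · exact Set.disjoint_left.1 hST (hu ⟨w, ⟨hw, h3⟩, rfl⟩) hyT
  have hcase : ∀ y ∈ e '' Metric.ball 0 r, y ∈ (leafOf E x)ᶜ →
      (y ∈ e '' {w | 0 < w.im} ∧ y ∈ e '' (Metric.ball 0 r ∩ {w | 0 < w.im})) ∨
      (y ∉ e '' {w | 0 < w.im} ∧ y ∈ e '' (Metric.ball 0 r ∩ {w | w.im < 0})) := by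
    rintro _ ⟨w, hw, rfl⟩ hy
    have him : w.im ≠ 0 := fun h0 => hy ((hrel w).2 h0)
    rcases lt_or_gt_of_ne him with h3 | h3
    · right
      refine ⟨?_, w, ⟨hw, h3⟩, rfl⟩
      rintro ⟨w', hw', h4⟩
      rw [he.chart.emb.injective h4] at hw'
      exact absurd (show 0 < w.im from hw') (not_lt.2 h3.le)
    · exact Or.inl ⟨⟨w, h3, rfl⟩, w, ⟨hw, h3⟩, rfl⟩
  have hone : (1 : ZMod 2) + 1 = 0 := by decide
  rcases hUp with hu | hu <;> rcases hDn with hd | hd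
  · exact (hall A B hdis hBE hBf hu hd).elim
  · refine ⟨0, ?_⟩
    filter_upwards [hnb] with y hy hyE
    rcases hcase y hy hyE with ⟨h3, h4⟩ | ⟨h3, h4⟩
    · rw [ind_mem (hu h4), ind_mem h3, add_zero]
    · rw [ind_notMem (fun h5 => Set.disjoint_left.1 hdis h5 (hd h4)), ind_notMem h3, add_zero]
  · refine ⟨1, ?_⟩
    filter_upwards [hnb] with y hy hyE
    rcases hcase y hy hyE with ⟨h3, h4⟩ | ⟨h3, h4⟩
    · rw [ind_notMem (fun h5 => Set.disjoint_left.1 hdis h5 (hu h4)), ind_mem h3, hone]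
    · rw [ind_mem (hd h4), ind_notMem h3, zero_add]
  · exact (hall B A hdis.symm hAE hAf hu hd).elim

/-- The sides of a leaf at a regular point, seen in a chart at another point of the leaf. -/
lemma NiceChart.side_eq {p : P} (he : NiceChart E n e p) {w : ℂ} (hw : w ≠ 0) (h : (w ^ n).im = 0)
    {ε : ℝ} (hε : ε = 1 ∨ ε = -1) {e' : ℂ → P} (he' : NiceChart E 1 e' (e w)) :
    EqUpToConst (leafOf E p)ᶜ (ind (e '' {w' | 0 < (w' ^ n).im * ε})) (ind (e' '' {w' | 0 < w'.im})) (e w) := by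
  have hEw := he.rel h
  rw [leafOf_eq hEw]
  have hopen : ∀ ε : ℝ, IsOpen (e '' {w' | 0 < (w' ^ n).im * ε}) := fun ε =>
    he.chart.emb.isOpenMap _ (isOpen_lt continuous_const (by fun_prop))
  have hfreq : ∀ ε : ℝ, ε = 1 ∨ ε = -1 → ∃ᶠ y in 𝓝 (e w), y ∈ e '' {w' | 0 < (w' ^ n).im * ε} := by
    intro ε hε
    exact (he.chart.emb.continuous.tendsto w).frequently
      ((frequently_side he.ne_zero hw h hε).mono fun w' hw' => ⟨w', hw', rfl⟩)
  have hE : ∀ ε : ℝ, ∀ y ∈ e '' {w' | 0 < (w' ^ n).im * ε}, ¬ E (e w) y := by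
    rintro ε _ ⟨w', hw', rfl⟩ hE
    have hw'' : 0 < (w' ^ n).im * ε := hw'
    rw [he.axis w' (E.trans hEw hE)] at hw''
    simp at hw''
  refine he'.two_sides (hopen ε) (hopen (-ε)) ?_ ?_ (hfreq ε hε) (hfreq (-ε) ?_) (hE ε) (hE (-ε))
  · rw [Set.disjoint_left]
    rintro _ ⟨a, ha, rfl⟩ ⟨b, hb, hab⟩
    rw [he.chart.emb.injective hab] at hb
    have ha' : 0 < (a ^ n).im * ε := ha
    have hb' : 0 < (a ^ n).im * -ε := hb
    linarith
  · filter_upwards [he.chart.emb.isOpen_range.mem_nhds ⟨w, rfl⟩] with y hy hyE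
    obtain ⟨a, rfl⟩ := hy
    have ha : (a ^ n).im ≠ 0 := fun h0 => hyE (E.trans (E.symm hEw) (he.rel h0))
    have hε0 : ε ≠ 0 := by rcases hε with rfl | rfl <;> norm_num
    rcases lt_or_gt_of_ne (mul_ne_zero ha hε0) with h3 | h3
    · exact Or.inr ⟨a, show 0 < (a ^ n).im * -ε by linarith, rfl⟩
    · exact Or.inl ⟨a, h3, rfl⟩
  · rcases hε with rfl | rfl <;> simp

end nice

section sides

variable {P : Type*} [TopologicalSpace P] {E : Setoid P} {n : ℕ} {e : ℂ → P} {x : P}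

/-- The rays of the leaf of `z` that bound the sector with direction `ζ` of a chart at `z`. -/
def boundaryRays (E : Setoid P) (n : ℕ) (e : ℂ → P) (z : P) (ζ : ℂ) : Set P :=
  {y | ∃ C : Set P, IsPreconnected C ∧ C ⊆ leafOf E z \ {z} ∧ y ∈ C ∧
    ∃ u : ℝ, u ≠ 0 ∧ e (halfBox n ζ u 0) ∈ C}

lemma eventually_const_ind (he : IsOpenEmbedding e) {A : Set ℂ} {w : ℂ}
    (h : (∀ᶠ w' in 𝓝 w, w' ∈ A) ∨ ∀ᶠ w' in 𝓝 w, w' ∉ A) : ∃ c, ∀ᶠ y in 𝓝 (e w), ind (e '' A) y = c := by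
  rcases h with h | h
  · refine ⟨1, ?_⟩
    rw [← he.map_nhds_eq, eventually_map]
    filter_upwards [h] with w' hw'
    exact ind_mem ⟨w', hw', rfl⟩
  · refine ⟨0, ?_⟩
    rw [← he.map_nhds_eq, eventually_map]
    filter_upwards [h] with w' hw'
    apply ind_notMem
    rintro ⟨a, ha, h1⟩
    rw [he.injective h1] at ha
    exact hw' ha

lemma eventually_sector (hn : n ≠ 0) {ζ w : ℂ} (hζ : ζ ∈ sectorDirs n) (hw : (w ^ n).im ≠ 0) :
    (∀ᶠ w' in 𝓝 w, w' ∈ sector n ζ) ∨ ∀ᶠ w' in 𝓝 w, w' ∉ sector n ζ := by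
  obtain ⟨ζ', hζ', hwζ'⟩ := exists_sector hn hw
  by_cases h : ζ' = ζ
  · subst h
    exact Or.inl ((isOpen_sector hn hζ).mem_nhds hwζ')
  · right
    filter_upwards [(isOpen_sector hn hζ').mem_nhds hwζ'] with w' h1 h2
    exact h (sector_disjoint hn hζ' hζ h1 h2)

lemma eventually_upper {w : ℂ} (hw : w.im ≠ 0) :
    (∀ᶠ w' in 𝓝 w, w' ∈ {w : ℂ | 0 < w.im}) ∨ ∀ᶠ w' in 𝓝 w, w' ∉ {w : ℂ | 0 < w.im} := by
  rcases lt_or_gt_of_ne hw with h | h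
  · right
    filter_upwards [(isOpen_lt Complex.continuous_im continuous_const).mem_nhds h] with w' h1 h2
    exact absurd (show 0 < w'.im from h2) (not_lt.2 (show w'.im < 0 from h1).le)
  · exact Or.inl ((isOpen_lt continuous_const Complex.continuous_im).mem_nhds h)

namespace PlaneFol

variable {ord : P → ℕ} (F : PlaneFol E ord)
include F

lemma ord_of_mem_leaf {z y : P} (hz : ∃ (m : ℕ) (γ : prong m → P) (h : LeafParam E m γ z),
    γ ⟨0, zero_mem_prong h.ne_zero⟩ = z) (hy : E z y) (hne : y ≠ z) : ord y = 1 := by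
  obtain ⟨m, γ, h, hz⟩ := hz
  obtain ⟨c, rfl⟩ := h.exists_eq hy
  refine F.ord_of_ne h fun h0 => hne ?_
  rw [← hz]
  congr 1
  exact Subtype.ext h0

/-- The rays of a chart at the centre of a leaf that are not in the boundary of a sector lie in other
rays of the leaf. -/
lemma halfBox_of_mem_boundaryRays {m : ℕ} {γ : prong m → P} (h : LeafParam E m γ x)
    (he : NiceChart E m e (γ ⟨0, zero_mem_prong h.ne_zero⟩)) {ζ : ℂ} (hζ : ζ ∈ sectorDirs m) {w : ℂ}
    (hw0 : w ≠ 0) (hw : (w ^ m).im = 0)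
    (hb : e w ∈ boundaryRays E m e (γ ⟨0, zero_mem_prong h.ne_zero⟩) ζ) :
    halfBox m ζ (w ^ m).re 0 = w := by
  have hm := h.ne_zero
  obtain ⟨C, hC, hCsub, hwC, u, hu, huC⟩ := hb
  set w₁ := halfBox m ζ u 0 with hw₁
  have hw₁p : w₁ ∈ prong m := by
    show (w₁ ^ m).im = 0
    rw [hw₁, halfBox_im hm hζ, zero_mul]
  have hw₁0 : w₁ ≠ 0 := by
    intro h0
    apply hu
    rw [← halfBox_re hm hζ u 0, ← hw₁, h0]
    simp [hm]
  obtain ⟨J, hJc, hJi, hJ⟩ := h.exists_lift he.chart (by rw [he.zero]; exact h.rel _)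
  have hJ0 : (J ⟨0, zero_mem_prong hm⟩ : ℂ) = 0 := by
    have : J ⟨0, zero_mem_prong hm⟩ = ⟨0, zero_mem_prong hm⟩ := h.emb.injective (by rw [hJ, he.zero])
    rw [this]
  have hsub : C ⊆ range γ := by
    intro y hy
    rw [h.range_eq]
    exact E.trans (h.rel _) (hCsub hy).1
  have hpre : IsPreconnected (Subtype.val '' (γ ⁻¹' C)) := by
    have h1 : IsPreconnected (γ ⁻¹' C) := by
      rw [← h.emb.isInducing.isPreconnected_image, image_preimage_eq_of_subset hsub]
      exact hC
    exact h1.image _ continuous_subtype_val.continuousOn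
  have hray : SameRay ℝ (J ⟨w₁, hw₁p⟩ : ℂ) (J ⟨w, hw⟩) := by
    refine hpre.sameRay_of_prong hm ?_ ?_ ⟨_, ?_, rfl⟩ ⟨_, ?_, rfl⟩
    · rintro _ ⟨c, -, rfl⟩
      exact c.2
    · rintro ⟨c, hc, hc0⟩
      apply (hCsub hc).2
      rw [mem_singleton_iff]
      congr 1
      exact Subtype.ext hc0
    · rw [mem_preimage, hJ]; exact huC
    · rw [mem_preimage, hJ]; exact hwC
  have h2 := F.ray_injective h hm hJc hJi hJ0 hw₁0 hw0 hray
  obtain ⟨r, hr, hrw⟩ := h2.exists_pos_left hw₁0 hw0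
  have hrw' : r • w₁ = w := hrw
  rw [hw₁, smul_halfBox hm u hr] at hrw'
  rw [← hrw', halfBox_re hm hζ]

/-- A function that jumps exactly across the two rays of a leaf that bound a given sector. -/
lemma exists_side_function {m : ℕ} {γ : prong m → P} (h : LeafParam E m γ x) {z : P}
    (hz : γ ⟨0, zero_mem_prong h.ne_zero⟩ = z)
    (he : NiceChart E m e z) {ζ : ℂ} (hζ : ζ ∈ sectorDirs m) :
    ∃ f : P → ZMod 2, (∀ y, ¬ E z y → ∃ c, ∀ᶠ y' in 𝓝 y, f y' = c) ∧
      EqUpToConst (leafOf E z)ᶜ f (ind (e '' sector m ζ)) z ∧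
      ∀ y ∈ boundaryRays E m e z ζ, ∀ e', NiceChart E 1 e' y →
        EqUpToConst (leafOf E z)ᶜ f (ind (e' '' {w | 0 < w.im})) y := by
  classical
  have hm := h.ne_zero
  have := F.t2Space
  have hcent : ∃ (m : ℕ) (γ : prong m → P) (h : LeafParam E m γ z),
      γ ⟨0, zero_mem_prong h.ne_zero⟩ = z := by
    refine ⟨m, γ, h.congr ?_, hz⟩
    rw [← hz]
    exact h.rel _
  have hch : ∀ p, ∃ e', NiceChart E (ord p) e' p ∧ (p ≠ z → z ∉ range e') := by
    intro p
    by_cases hp : p = z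
    · obtain ⟨e', he', -⟩ := F.exists_nice p univ_mem
      exact ⟨e', he', fun h => absurd hp h⟩
    · obtain ⟨e', he', hr⟩ := F.exists_nice p (isOpen_compl_singleton.mem_nhds (show p ∈ ({z} : Set P)ᶜ from hp))
      exact ⟨e', he', fun _ hz => hr hz rfl⟩
  choose ch hch hchz using hch
  let S := boundaryRays E m e z ζ
  have hSE : ∀ y ∈ S, E z y ∧ y ≠ z := by
    rintro y ⟨C, -, hCsub, hyC, -⟩
    exact hCsub hyC
  -- The local models: the indicator of the sector at `z`, the indicator of one side of the leaf on
  -- the two bounding rays, and `0` elsewhere. They are compatible up to constants, and on a plane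
  -- such data come from a global function.
  let M : P → P → ZMod 2 := fun p =>
    if p = z then ind (e '' sector m ζ) else if p ∈ S then ind (ch p '' {w | 0 < w.im}) else fun _ => 0
  have hMz : M z = ind (e '' sector m ζ) := by simp [M]
  have hMS : ∀ p ∈ S, M p = ind (ch p '' {w | 0 < w.im}) := by
    intro p hp
    simp [M, (hSE p hp).2, hp]
  have hM0 : ∀ p, p ≠ z → p ∉ S → M p = fun _ => 0 := by
    intro p hp hpS
    simp [M, hp, hpS]
  have hMoff : ∀ p, ¬ E z p → M p = fun _ => 0 := by
    intro p hp
    refine hM0 p ?_ fun hpS => hp (hSE p hpS).1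
    rintro rfl
    exact hp (E.refl _)
  have hord : ∀ p, E z p → p ≠ z → ord p = 1 := fun p hp hne => F.ord_of_mem_leaf hcent hp hne
  have hnice1 : ∀ p, E z p → p ≠ z → NiceChart E 1 (ch p) p := fun p hp hne => hord p hp hne ▸ hch p
  have hconst : ∀ {f : P → ZMod 2} {y : P}, (∃ c, ∀ᶠ y' in 𝓝 y, f y' = c) →
      EqUpToConst (leafOf E z)ᶜ f (fun _ => 0) y := by
    rintro f y ⟨c, hc⟩
    exact ⟨c, hc.mono fun y' h1 _ => by rw [h1, zero_add]⟩
  have hM : ∀ p, ∀ᶠ y in 𝓝 p, EqUpToConst (leafOf E z)ᶜ (M p) (M y) y := by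
    intro p
    by_cases hpE : E z p
    swap
    · filter_upwards [(F.isClosed_leaf z).isOpen_compl.mem_nhds hpE] with y hy
      rw [hMoff p hpE, hMoff y hy]
      exact hconst ⟨0, Eventually.of_forall fun _ => rfl⟩
    by_cases hpz : p = z
    · subst hpz
      filter_upwards [he.range_mem] with y hy
      obtain ⟨w, rfl⟩ := hy
      by_cases hw : (w ^ m).im = 0
      swap
      · rw [hMoff (e w) (fun h1 => hw (he.axis w h1)), hMz]
        exact hconst (eventually_const_ind he.chart.emb (eventually_sector hm hζ hw))
      by_cases hw0 : w = 0
      · subst hw0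
        rw [he.zero]
        exact ⟨0, Eventually.of_forall fun _ _ => by rw [add_zero]⟩
      have hε := sectorDirs_im hζ
      obtain ⟨ζ', hζ', hpow, hb, hnear⟩ := exists_axis_halfBox hm hw0 hw hε
      have hne : e w ≠ p := by
        intro h1
        rw [← he.zero] at h1
        exact hw0 (he.chart.emb.injective h1)
      have hζζ' : ∀ {w' : ℂ}, w' ∈ sector m ζ → halfBox m ζ' (w' ^ m).re ((w' ^ m).im * (ζ ^ m).im) = w' →
          ζ = ζ' := by
        intro w' h1 h2
        have h3 := sector_im hm hζ h1
        exact sector_disjoint hm hζ hζ' h1 ⟨_, _, h3, h2⟩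
      by_cases hζe : ζ = ζ'
      · subst hζe
        have hS : e w ∈ S := by
          refine ⟨{e w}, isPreconnected_singleton, ?_, rfl, (w ^ m).re, ?_, by rw [hb]; rfl⟩
          · rintro _ rfl
            exact ⟨he.rel hw, hne⟩
          · exact prong_re_ne_zero hw hw0
        rw [hMz, hMS _ hS]
        -- Near a point of an axis that bounds it, the sector is exactly the side of the axis
        -- selected by the sign of `Im (ζ ^ n)`.
        refine EqUpToConst.trans ⟨0, ?_⟩ (he.side_eq hw0 hw hε (hnice1 _ (he.rel hw) hne))
        rw [← he.chart.emb.map_nhds_eq, eventually_map]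
        filter_upwards [hnear] with w' hw' _
        rw [add_zero]
        by_cases h3 : 0 < (w' ^ m).im * (ζ ^ m).im
        · have h4 : w' ∈ sector m ζ := ⟨_, _, h3, hw' h3.le⟩
          rw [ind_mem (mem_image_of_mem e h4), ind_mem (mem_image_of_mem e (show w' ∈ {a | 0 < (a ^ m).im * (ζ ^ m).im} from h3))]
        · rw [ind_notMem, ind_notMem]
          · rintro ⟨a, ha, h4⟩
            rw [he.chart.emb.injective h4] at ha
            exact h3 ha
          · rintro ⟨a, ha, h4⟩
            rw [he.chart.emb.injective h4] at ha
            exact h3 (sector_im hm hζ ha)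
      -- A bounding ray of the leaf contains no other half-axis of the chart. Near this axis point
      -- the sector is empty, so both models are constant.
      · have hS : e w ∉ S := by
          intro hS
          have hz' : p = γ ⟨0, zero_mem_prong h.ne_zero⟩ := hz.symm
          have h1 := F.halfBox_of_mem_boundaryRays (e := e) h (hz' ▸ he) hζ hw0 hw (hz' ▸ hS)
          apply hζe
          have hu : (w ^ m).re ≠ 0 := prong_re_ne_zero hw hw0
          rw [← rootBranch_halfBox hm hζ (u := (w ^ m).re) (v := 0) (Or.inr hu),
            ← rootBranch_halfBox hm hζ' (u := (w ^ m).re) (v := 0) (Or.inr hu), h1, hb, hpow,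
            ← sectorDirs_pow hζ]
        rw [hMz, hM0 _ hne hS]
        refine hconst (eventually_const_ind he.chart.emb (Or.inr ?_))
        filter_upwards [hnear] with w' hw' h1
        exact hζe (hζζ' h1 (hw' (sector_im hm hζ h1).le))
    · have hp1 := hnice1 p hpE hpz
      filter_upwards [hp1.range_mem] with y hy
      have hyz : y ≠ z := by
        rintro rfl
        exact hchz p hpz hy
      obtain ⟨w, rfl⟩ := hy
      by_cases hw : w.im = 0
      swap
      · have hnE : ¬ E z (ch p w) := fun h1 => hw (by
          have := hp1.axis w (E.trans (E.symm hpE) h1)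
          simpa using this)
        rw [hMoff _ hnE]
        by_cases hpS : p ∈ S
        · rw [hMS p hpS]
          exact hconst (eventually_const_ind hp1.chart.emb (eventually_upper hw))
        · rw [hM0 p hpz hpS]
          exact hconst ⟨0, Eventually.of_forall fun _ => rfl⟩
      have hEw : E p (ch p w) := hp1.rel (by simpa using hw)
      have hSS : p ∈ S ↔ ch p w ∈ S := by
        have hD : IsPreconnected (ch p '' {w | w.im = 0}) := by
          refine IsPreconnected.image ?_ _ hp1.chart.emb.continuous.continuousOn
          have : Convex ℝ {w : ℂ | w.im = 0} := convex_hyperplane (r := 0) Complex.imLm.isLinear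
          exact this.isPreconnected
        have hDsub : ch p '' {w | w.im = 0} ⊆ leafOf E z \ {z} := by
          rintro _ ⟨a, ha, rfl⟩
          refine ⟨E.trans hpE (hp1.rel (by simpa using ha)), ?_⟩
          intro h1
          exact hchz p hpz ⟨a, h1⟩
        have hpD : p ∈ ch p '' {w | w.im = 0} := ⟨0, by simp, hp1.zero⟩
        have hwD : ch p w ∈ ch p '' {w | w.im = 0} := ⟨w, hw, rfl⟩
        constructor
        · rintro ⟨C, hC, hCs, hpC, u, hu, huC⟩
          exact ⟨C ∪ ch p '' {w | w.im = 0}, hC.union p hpC hpD hD, union_subset hCs hDsub, Or.inr hwD, u, hu,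
            Or.inl huC⟩
        · rintro ⟨C, hC, hCs, hpC, u, hu, huC⟩
          exact ⟨C ∪ ch p '' {w | w.im = 0}, hC.union _ hpC hwD hD, union_subset hCs hDsub, Or.inr hpD, u, hu,
            Or.inl huC⟩
      by_cases hpS : p ∈ S
      · rw [hMS p hpS, hMS _ (hSS.1 hpS)]
        by_cases hw0 : w = 0
        · subst hw0
          rw [hp1.zero]
          exact ⟨0, Eventually.of_forall fun _ _ => by rw [add_zero]⟩
        · have := hp1.side_eq hw0 (by simpa using hw) (Or.inl rfl) (hnice1 _ (E.trans hpE hEw) hyz)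
          rw [leafOf_eq hpE]
          simpa using this
      · rw [hM0 p hpz hpS, hM0 _ hyz (fun h1 => hpS (hSS.2 h1))]
        exact hconst ⟨0, Eventually.of_forall fun _ => rfl⟩
  obtain ⟨Ψ⟩ := F.plane
  obtain ⟨f, hf⟩ := EqUpToConst.exists_global (Ψ.trans Complex.equivRealProdCLM.toHomeomorph)
    (F.dense_compl_leaf z) hM
  refine ⟨f, ?_, ?_, ?_⟩
  · intro y hy
    obtain ⟨c, hc⟩ := hf y
    refine ⟨c, ?_⟩
    filter_upwards [hc, (F.isClosed_leaf z).isOpen_compl.mem_nhds hy] with y' h1 h2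
    rw [h1 h2, hMoff y hy, zero_add]
  · have := hf z
    rwa [hMz] at this
  · intro y hy e' he'
    have h1 := hf y
    rw [hMS y hy] at h1
    refine h1.trans ?_
    obtain ⟨hyE, hyz⟩ := hSE y hy
    have hn1 := hnice1 y hyE hyz
    rw [leafOf_eq hyE]
    have hopen : IsOpen (ch y '' {w | 0 < w.im}) :=
      hn1.chart.emb.isOpenMap _ (isOpen_lt continuous_const Complex.continuous_im)
    have hopen' : IsOpen (ch y '' {w | w.im < 0}) :=
      hn1.chart.emb.isOpenMap _ (isOpen_lt Complex.continuous_im continuous_const)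
    have hrel : ∀ w, E y (ch y w) ↔ w.im = 0 := fun w => by simpa using hn1.rel_iff (w := w)
    have hfreq : ∀ σ : ℝ, σ ≠ 0 → ∃ᶠ y' in 𝓝 y, ∃ t > 0, y' = ch y ((t * σ : ℝ) * Complex.I) := by
      intro σ hσ
      have : Tendsto (fun t : ℝ => ch y ((t * σ : ℝ) * Complex.I)) (𝓝[>] 0) (𝓝 y) := by
        have hc : Continuous fun t : ℝ => ch y ((t * σ : ℝ) * Complex.I) :=
          hn1.chart.emb.continuous.comp (by fun_prop)
        have := (hc.tendsto 0).mono_left (nhdsWithin_le_nhds (s := Ioi 0))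
        simpa [hn1.zero] using this
      refine this.frequently (Eventually.frequently ?_)
      filter_upwards [self_mem_nhdsWithin] with t ht
      exact ⟨t, ht, rfl⟩
    refine he'.two_sides hopen hopen' ?_ ?_ ?_ ?_ ?_ ?_
    · rw [Set.disjoint_left]
      rintro _ ⟨a, ha, rfl⟩ ⟨b, hb, hab⟩
      rw [hn1.chart.emb.injective hab] at hb
      exact absurd (show 0 < a.im from ha) (not_lt.2 (show a.im < 0 from hb).le)
    · filter_upwards [hn1.range_mem] with y' ⟨w, hw⟩ hE
      subst hw
      rcases lt_or_gt_of_ne (fun h0 => hE ((hrel w).2 h0)) with h3 | h3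
      · exact Or.inr ⟨w, h3, rfl⟩
      · exact Or.inl ⟨w, h3, rfl⟩
    · refine (hfreq 1 one_ne_zero).mono ?_
      rintro _ ⟨t, ht, rfl⟩
      exact ⟨_, by simpa using ht, rfl⟩
    · refine (hfreq (-1) (by norm_num)).mono ?_
      rintro _ ⟨t, ht, rfl⟩
      exact ⟨_, by simpa using ht, rfl⟩
    · rintro _ ⟨a, ha, rfl⟩ h3
      exact (show 0 < a.im from ha).ne' ((hrel a).1 h3)
    · rintro _ ⟨a, ha, rfl⟩ h3
      exact (show a.im < 0 from ha).ne ((hrel a).1 h3)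

end PlaneFol

end sides

/-! ### Components of the complement of a leaf and their boundaries -/

lemma locConst_on {P β : Type*} [TopologicalSpace P] {f : P → β} {C O : Set P}
    (hf : ∀ y ∈ O, ∃ c, ∀ᶠ y' in 𝓝 y, f y' = c) (hC : IsPreconnected C) (h : C ⊆ O) {a b : P}
    (ha : a ∈ C) (hb : b ∈ C) : f a = f b := by
  refine hC.induction₂ (fun a b => f a = f b) ?_ (fun _ _ _ _ _ _ h1 h2 => h1.trans h2)
    (fun _ _ _ _ h1 => h1.symm) ha hb
  intro x hx
  obtain ⟨c, hc⟩ := hf x (h hx)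
  refine mem_nhdsWithin_of_mem_nhds ?_
  filter_upwards [hc] with y hy
  rw [hy, hc.self_of_nhds]

lemma exists_eq_halfBox_of_mem_closure {n : ℕ} (hn : n ≠ 0) {ζ : ℂ} (hζ : ζ ∈ sectorDirs n) {w : ℂ}
    (hw : w ∈ closure (sector n ζ)) (h : (w ^ n).im = 0) : ∃ u, halfBox n ζ u 0 = w := by
  by_cases hw0 : w = 0
  · exact ⟨0, by rw [halfBox_zero hn, hw0]⟩
  · obtain ⟨ζ', hζ', hpow, hb, hnear⟩ := exists_axis_halfBox hn hw0 h (sectorDirs_im hζ)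
    obtain ⟨w', h1, h2⟩ := ((mem_closure_iff_frequently.1 hw).and_eventually hnear).exists
    have h3 := sector_im hn hζ h1
    have h4 : ζ' = ζ := sector_disjoint hn hζ' hζ ⟨_, _, h3, h2 h3.le⟩ h1
    exact ⟨_, h4 ▸ hb⟩

lemma halfBox_mem_closure_sector {n : ℕ} (hn : n ≠ 0) {ζ : ℂ} (hζ : ζ ∈ sectorDirs n) (u : ℝ) :
    halfBox n ζ u 0 ∈ closure (sector n ζ) := by
  refine mem_closure_of_tendsto (tendsto_halfBox hn hζ u) ?_
  filter_upwards [self_mem_nhdsWithin] with v hv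
  exact ⟨u, v, hv, rfl⟩

/-- A component of the complement of the leaf of `x`. -/
abbrev leafComp {P : Type*} [TopologicalSpace P] (E : Setoid P) (x z : P) : Set P :=
  connectedComponentIn (leafOf E x)ᶜ z

/-- The boundary of a component of the complement of the leaf of `x`. -/
def leafBd {P : Type*} [TopologicalSpace P] (E : Setoid P) (x z : P) : Set P :=
  closure (leafComp E x z) ∩ leafOf E x

section sides

variable {P : Type*} [TopologicalSpace P] {E : Setoid P} {n : ℕ} {e : ℂ → P} {x : P}

lemma NiceChart.image_sector_subset (he : NiceChart E n e x) {ζ : ℂ} (hζ : ζ ∈ sectorDirs n) :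
    e '' sector n ζ ⊆ (leafOf E x)ᶜ := by
  rintro _ ⟨w, hw, rfl⟩ hE
  exact sector_im_ne he.ne_zero hζ hw (he.axis w hE)

lemma NiceChart.isPreconnected_image_sector (he : NiceChart E n e x) {ζ : ℂ} (hζ : ζ ∈ sectorDirs n) :
    IsPreconnected (e '' sector n ζ) :=
  (isPreconnected_sector he.ne_zero hζ).image _ he.chart.emb.continuous.continuousOn

lemma NiceChart.frequently_sector (he : NiceChart E n e x) {ζ : ℂ} (hζ : ζ ∈ sectorDirs n) :
    ∃ᶠ y in 𝓝 x, y ∈ e '' sector n ζ := by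
  have h := mem_closure_iff_frequently.1 (halfBox_mem_closure_sector he.ne_zero hζ 0)
  rw [halfBox_zero he.ne_zero] at h
  rw [← he.zero]
  exact (he.chart.emb.continuous.tendsto 0).frequently (h.mono fun w hw => ⟨w, hw, rfl⟩)

/-- Near `x` the function is `1 + c` on the first sector and `c` on the second one. Off the leaf it
is locally constant, so these values persist on the whole sectors and would have to agree along `C`.
-/
lemma NiceChart.not_same_component (he : NiceChart E n e x) {f : P → ZMod 2}
    (hf : ∀ y, ¬ E x y → ∃ c, ∀ᶠ y' in 𝓝 y, f y' = c) {A : Set ℂ}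
    (hfA : EqUpToConst (leafOf E x)ᶜ f (ind (e '' A)) x) {ζ ζ' : ℂ} (hζ : ζ ∈ sectorDirs n)
    (hζ' : ζ' ∈ sectorDirs n) (h : sector n ζ ⊆ A) (h' : Disjoint (sector n ζ') A) {C : Set P}
    (hC : IsPreconnected C) (hCE : C ⊆ (leafOf E x)ᶜ) {w w' : ℂ} (hw : w ∈ sector n ζ) (hw' : w' ∈ sector n ζ')
    (hwC : e w ∈ C) (hwC' : e w' ∈ C) : False := by
  obtain ⟨c, hc⟩ := hfA
  obtain ⟨_, ⟨a, ha, rfl⟩, h1⟩ := ((he.frequently_sector hζ).and_eventually hc).exists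
  obtain ⟨_, ⟨b, hb, rfl⟩, h2⟩ := ((he.frequently_sector hζ').and_eventually hc).exists
  specialize h1 (he.image_sector_subset hζ ⟨a, ha, rfl⟩)
  specialize h2 (he.image_sector_subset hζ' ⟨b, hb, rfl⟩)
  rw [ind_mem (mem_image_of_mem e (h ha))] at h1
  rw [ind_notMem, zero_add] at h2
  swap
  · rintro ⟨b', hb', h3⟩
    rw [he.chart.emb.injective h3] at hb'
    exact Set.disjoint_left.1 h' hb hb'
  have e1 := locConst_on (O := (leafOf E x)ᶜ) hf (he.isPreconnected_image_sector hζ) (he.image_sector_subset hζ)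
    ⟨a, ha, rfl⟩ ⟨w, hw, rfl⟩
  have e2 := locConst_on (O := (leafOf E x)ᶜ) hf (he.isPreconnected_image_sector hζ') (he.image_sector_subset hζ')
    ⟨b, hb, rfl⟩ ⟨w', hw', rfl⟩
  have e3 := locConst_on (O := (leafOf E x)ᶜ) hf hC hCE hwC hwC'
  rw [h1, e3, ← e2, h2] at e1
  revert e1
  generalize c = c
  revert c
  decide

namespace PlaneFol

variable {ord : P → ℕ} (F : PlaneFol E ord)
include F

/-- Distinct sectors at a point lie in distinct components of the complement of the leaf. -/
lemma sector_unique (he : NiceChart E (ord x) e x) {ζ ζ' : ℂ} (hζ : ζ ∈ sectorDirs (ord x))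
    (hζ' : ζ' ∈ sectorDirs (ord x)) {C : Set P}
    (hC : IsPreconnected C) (hCE : C ⊆ (leafOf E x)ᶜ) {w w' : ℂ} (hw : w ∈ sector (ord x) ζ)
    (hw' : w' ∈ sector (ord x) ζ') (hwC : e w ∈ C) (hwC' : e w' ∈ C) : ζ = ζ' := by
  by_contra hne
  obtain ⟨m, γ, h⟩ := F.exists_leafParam x
  obtain ⟨c, hc⟩ := h.exists_eq (E.refl x)
  by_cases hc0 : (c : ℂ) = 0
  · have hz : γ ⟨0, zero_mem_prong h.ne_zero⟩ = x := by
      refine Eq.trans ?_ hc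
      congr 1; exact Subtype.ext hc0.symm
    have hm : ord x = m := by
      have := F.ord_center h
      rwa [hz] at this
    rw [hm] at he hζ hζ' hw hw'
    obtain ⟨f, hf, hfz, -⟩ := F.exists_side_function h hz he hζ
    refine he.not_same_component hf hfz hζ hζ' Subset.rfl ?_ hC hCE hw hw' hwC hwC'
    rw [Set.disjoint_left]
    intro a h1 h2
    exact hne (sector_disjoint h.ne_zero hζ hζ' h2 h1)
  · have hn : ord x = 1 := by rw [← hc]; exact F.ord_of_ne h hc0
    rw [hn] at he hζ hζ' hw hw'
    -- A regular point `x` other than the centre `z` lies on a ray that bounds some sector at `z`.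
    -- The side function of that sector jumps across the leaf at `x` and separates the two
    -- half-planes of the chart.
    set z := γ ⟨0, zero_mem_prong h.ne_zero⟩ with hz
    have hzm : ord z = m := F.ord_center h
    obtain ⟨e₀, he₀, -⟩ := F.exists_nice z univ_mem
    rw [hzm] at he₀
    have hxz : E z x := E.symm (h.rel _)
    have ht : Tendsto (fun t : ℝ => γ (rayPath c.2 t)) (𝓝[>] 0) (𝓝 z) := by
      have h1 : Continuous fun t : ℝ => γ (rayPath c.2 t) := h.emb.continuous.comp (continuous_rayPath c.2)
      have h2 := (h1.tendsto 0).mono_left (nhdsWithin_le_nhds (s := Ioi 0))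
      have h3 : rayPath c.2 0 = ⟨0, zero_mem_prong h.ne_zero⟩ := Subtype.ext (by simp [rayPath])
      rwa [h3] at h2
    have ht1 : ∀ᶠ t : ℝ in 𝓝[>] 0, t ∈ Ioo (0 : ℝ) 1 := Ioo_mem_nhdsGT one_pos
    obtain ⟨t, ht01, w₀, hw₀⟩ := (ht1.and (ht.eventually he₀.range_mem)).exists
    have hinj : ∀ {t : ℝ}, γ (rayPath c.2 t) = z → t = 0 := by
      intro t h1
      have h2 := congrArg Subtype.val (h.emb.injective h1)
      have h3 : t • (c : ℂ) = 0 := h2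
      exact (smul_eq_zero.1 h3).resolve_right hc0
    have hw₀0 : w₀ ≠ 0 := by
      rintro rfl
      rw [he₀.zero] at hw₀
      exact ht01.1.ne' (hinj hw₀.symm)
    have hw₀a : (w₀ ^ m).im = 0 := he₀.axis _ (by rw [hw₀]; exact h.rel' _ _)
    obtain ⟨ζ₀, hζ₀, -, hb, -⟩ := exists_axis_halfBox h.ne_zero hw₀0 hw₀a (Or.inl rfl)
    have hxb : x ∈ boundaryRays E m e₀ z ζ₀ := by
      refine ⟨(fun t => γ (rayPath c.2 t)) '' Ioc 0 1, isPreconnected_Ioc.image _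
        (h.emb.continuous.comp (continuous_rayPath c.2)).continuousOn, ?_, ⟨1, by simp, ?_⟩,
        (w₀ ^ m).re, prong_re_ne_zero hw₀a hw₀0, t, ⟨ht01.1, ht01.2.le⟩, by rw [hb]; exact hw₀.symm⟩
      · rintro _ ⟨s, hs, rfl⟩
        exact ⟨h.rel' _ _, fun h1 => hs.1.ne' (hinj h1)⟩
      · have h3 : rayPath c.2 1 = c := Subtype.ext (by simp [rayPath])
        simp only [h3, hc]
    obtain ⟨f, hf, -, hfb⟩ := F.exists_side_function h hz.symm he₀ hζ₀
    have hfx := hfb x hxb e he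
    have hf' : ∀ y, ¬ E x y → ∃ c, ∀ᶠ y' in 𝓝 y, f y' = c := fun y hy => hf y fun h1 => hy (E.trans (h.rel _) h1)
    rw [leafOf_eq hxz] at hfx
    have hup : ∀ ζ ∈ sectorDirs 1, ζ = Complex.I → sector 1 ζ ⊆ {w | 0 < w.im} := by
      rintro ζ hζ rfl w hw
      have := sector_im one_ne_zero hζ hw
      simpa using this
    have hdn : ∀ ζ ∈ sectorDirs 1, ζ = -Complex.I → Disjoint (sector 1 ζ) {w | 0 < w.im} := by
      rintro ζ hζ rfl
      rw [Set.disjoint_left]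
      intro w hw h2
      have := sector_im one_ne_zero hζ hw
      have h2' : 0 < w.im := h2
      simp at this
      linarith
    have hd : ∀ ζ ∈ sectorDirs 1, ζ = Complex.I ∨ ζ = -Complex.I := by
      intro ζ hζ
      simpa [sectorDirs] using hζ
    rcases hd ζ hζ with h1 | h1 <;> rcases hd ζ' hζ' with h2 | h2
    · exact hne (h1.trans h2.symm)
    · exact he.not_same_component hf' hfx hζ hζ' (hup _ hζ h1) (hdn _ hζ' h2) hC hCE hw hw' hwC hwC'
    · exact he.not_same_component hf' hfx hζ' hζ (hup _ hζ' h2) (hdn _ hζ h1) hC hCE hw' hw hwC' hwC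
    · exact hne (h1.trans h2.symm)

variable {z : P}

lemma isOpen_leafComp : IsOpen (leafComp E x z) := by
  have := F.locallyConnectedSpace
  exact (F.isClosed_leaf x).isOpen_compl.connectedComponentIn

/-- Otherwise the component would be open and closed in the connected plane. -/
lemma leafBd_nonempty (hz : ¬ E x z) : (leafBd E x z).Nonempty := by
  have h0 := F.preconnectedSpace
  have hne : leafComp E x z ≠ univ := by
    intro h
    exact connectedComponentIn_subset _ _ (h.symm ▸ mem_univ x : x ∈ leafComp E x z) (E.refl x)
  have hncl : ¬ IsClosed (leafComp E x z) := by
    intro hc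
    rcases isClopen_iff.1 ⟨hc, F.isOpen_leafComp⟩ with h | h
    · have h1 : z ∈ leafComp E x z := mem_connectedComponentIn hz
      rw [h] at h1
      exact h1
    · exact hne h
  have : ¬ closure (leafComp E x z) ⊆ leafComp E x z := fun h => hncl (isClosed_of_closure_subset h)
  obtain ⟨y, hy, hy'⟩ := not_subset.1 this
  refine ⟨y, hy, ?_⟩
  by_contra hyE
  apply hy'
  have h1 := (F.isOpen_leafComp (x := x) (z := y)).mem_nhds (mem_connectedComponentIn (show y ∈ (leafOf E x)ᶜ from hyE))
  obtain ⟨a, ha, ha'⟩ := mem_closure_iff_nhds.1 hy _ h1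
  have h2 := connectedComponentIn_eq ha
  have h3 := connectedComponentIn_eq ha'
  rw [leafComp, h3, ← h2]
  exact mem_connectedComponentIn hyE

/-- A component of the complement of a leaf, near a boundary point. -/
lemma exists_sector_leafComp {y : P} (hxy : E x y) (he : NiceChart E (ord y) e y) {w₁ : ℂ}
    (hy : e w₁ ∈ closure (leafComp E x z)) :
    ∃ ζ ∈ sectorDirs (ord y), (∀ w, e w ∈ leafComp E x z ↔ w ∈ sector (ord y) ζ) ∧
      ∀ w, e w ∈ leafBd E x z ↔ ∃ u, halfBox (ord y) ζ u 0 = w := by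
  have hle := leafOf_eq hxy
  obtain ⟨_, ⟨w₀, rfl⟩, ha⟩ := mem_closure_iff_nhds.1 hy _ (he.chart.emb.isOpen_range.mem_nhds ⟨w₁, rfl⟩)
  have hw₀ : (w₀ ^ ord y).im ≠ 0 := fun h0 => connectedComponentIn_subset _ _ ha (E.trans hxy (he.rel h0))
  obtain ⟨ζ, hζ, hwζ⟩ := exists_sector he.ne_zero hw₀
  have hsub : e '' sector (ord y) ζ ⊆ leafComp E x z := by
    rw [leafComp, connectedComponentIn_eq ha, hle]
    exact (he.isPreconnected_image_sector hζ).subset_connectedComponentIn ⟨w₀, hwζ, rfl⟩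
      (he.image_sector_subset hζ)
  -- Every other sector at `y` lies in a different component, by `sector_unique`.
  have hiff : ∀ w, e w ∈ leafComp E x z ↔ w ∈ sector (ord y) ζ := by
    refine fun w => ⟨fun hw => ?_, fun hw => hsub ⟨w, hw, rfl⟩⟩
    have hw0 : (w ^ ord y).im ≠ 0 := fun h0 => connectedComponentIn_subset _ _ hw (E.trans hxy (he.rel h0))
    obtain ⟨ζ', hζ', hwζ'⟩ := exists_sector he.ne_zero hw0
    rwa [F.sector_unique he hζ hζ' isPreconnected_connectedComponentIn
      (hle ▸ connectedComponentIn_subset _ _) hwζ hwζ' ha hw]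
  refine ⟨ζ, hζ, hiff, fun w => ⟨fun hw => ?_, ?_⟩⟩
  · refine exists_eq_halfBox_of_mem_closure he.ne_zero hζ ?_ (he.axis w (E.trans (E.symm hxy) hw.2))
    rw [mem_closure_iff_frequently]
    have h1 := mem_closure_iff_frequently.1 hw.1
    rw [← he.chart.emb.map_nhds_eq, frequently_map] at h1
    exact h1.mono fun a => (hiff a).1
  · rintro ⟨u, rfl⟩
    refine ⟨closure_mono hsub (image_closure_subset_closure_image he.chart.emb.continuous
      ⟨_, halfBox_mem_closure_sector he.ne_zero hζ u, rfl⟩), E.trans hxy (he.rel ?_)⟩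
    rw [halfBox_im he.ne_zero hζ, zero_mul]

lemma isClosed_leafBd : IsClosed (leafBd E x z) := isClosed_closure.inter (F.isClosed_leaf x)

/-- The boundary of a component is saturated with respect to regular arcs in the leaf. -/
lemma mem_leafBd_of_connected {C : Set P} (hC : IsPreconnected C) (hCx : C ⊆ leafOf E x)
    (h1 : ∀ p ∈ C, ord p = 1) {a b : P} (ha : a ∈ C) (hb : b ∈ C) (had : a ∈ leafBd E x z) :
    b ∈ leafBd E x z := by
  refine (hC.induction₂ (fun p q => p ∈ leafBd E x z ↔ q ∈ leafBd E x z) ?_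
    (fun _ _ _ _ _ _ => Iff.trans) (fun _ _ _ _ => Iff.symm) ha hb).1 had
  intro p hp
  obtain ⟨e, he, -⟩ := F.exists_nice p univ_mem
  have hxp : E x p := hCx hp
  -- At a regular point a component near the leaf is a half-plane of the chart, and its boundary is
  -- the whole axis. So one boundary point on the axis forces all of them.
  have key : ∀ w w₁, E x (e w) → e w₁ ∈ leafBd E x z → e w ∈ leafBd E x z := by
    intro w w₁ hw h2
    obtain ⟨ζ, hζ, -, h3⟩ := F.exists_sector_leafComp hxp he h2.1
    have h4 := he.axis w (E.trans (E.symm hxp) hw)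
    rw [h1 p hp] at h3 h4 hζ
    refine (h3 w).2 ⟨w.re, ?_⟩
    have h5 := halfBox_pow one_ne_zero hζ w.re 0
    simp only [pow_one, Complex.ofReal_zero, zero_mul, add_zero] at h5 h4
    rw [h5]
    exact Complex.ext (by simp) (by simp [h4])
  filter_upwards [self_mem_nhdsWithin, mem_nhdsWithin_of_mem_nhds he.range_mem] with q hq ⟨w, hw⟩
  subst hw
  constructor
  · intro h2
    exact key w 0 (hCx hq) (by rwa [he.zero])
  · intro h2
    rw [← he.zero]
    exact key 0 w (by rw [he.zero]; exact hxp) h2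

variable {m : ℕ} {γ : prong m → P}

lemma rayPath_mem_leafBd (h : LeafParam E m γ x) {c : prong m} (hc0 : (c : ℂ) ≠ 0)
    (hc : γ c ∈ leafBd E x z) {t : ℝ} (ht : 0 < t) : γ (rayPath c.2 t) ∈ leafBd E x z := by
  refine F.mem_leafBd_of_connected (C := (fun t => γ (rayPath c.2 t)) '' Ioi 0) (isPreconnected_Ioi.image _
    (h.emb.continuous.comp (continuous_rayPath c.2)).continuousOn) ?_ ?_ ⟨1, by simp, ?_⟩ ⟨t, ht, rfl⟩ hc
  · rintro _ ⟨s, -, rfl⟩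
    exact h.rel _
  · rintro _ ⟨s, hs, rfl⟩
    exact F.ord_of_ne h (smul_ne_zero (ne_of_gt hs) hc0)
  · have h3 : rayPath c.2 1 = c := Subtype.ext (by simp [rayPath])
    simp only [h3]

lemma tendsto_rayPath (h : LeafParam E m γ x) (c : prong m) :
    Tendsto (fun t : ℝ => γ (rayPath c.2 t)) (𝓝[>] 0) (𝓝 (γ ⟨0, zero_mem_prong h.ne_zero⟩)) := by
  have h1 : Continuous fun t : ℝ => γ (rayPath c.2 t) := h.emb.continuous.comp (continuous_rayPath c.2)
  have h2 := (h1.tendsto 0).mono_left (nhdsWithin_le_nhds (s := Ioi 0))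
  have h3 : rayPath c.2 0 = ⟨0, zero_mem_prong h.ne_zero⟩ := Subtype.ext (by simp [rayPath])
  rwa [h3] at h2

/-- The boundary is nonempty, contains the whole open ray of each of its points other than the
centre, and is closed; every ray ends at the centre. -/
lemma center_mem_leafBd (h : LeafParam E m γ x) (hz : ¬ E x z) :
    γ ⟨0, zero_mem_prong h.ne_zero⟩ ∈ leafBd E x z := by
  obtain ⟨y, hy⟩ := F.leafBd_nonempty hz
  obtain ⟨c, rfl⟩ := h.exists_eq hy.2
  by_cases hc0 : (c : ℂ) = 0
  · rwa [show c = ⟨0, zero_mem_prong h.ne_zero⟩ from Subtype.ext hc0] at hy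
  · refine F.isClosed_leafBd.mem_of_tendsto (F.tendsto_rayPath h c) ?_
    filter_upwards [self_mem_nhdsWithin] with t ht
    exact F.rayPath_mem_leafBd h hc0 hy ht

/-- The boundary of a component of the complement of a leaf consists of two rays. -/
lemma exists_rays (h : LeafParam E m γ x) (hz : ¬ E x z)
    (he : NiceChart E m e (γ ⟨0, zero_mem_prong h.ne_zero⟩)) :
    ∃ ζ ∈ sectorDirs m, (∀ w, e w ∈ leafComp E x z ↔ w ∈ sector m ζ) ∧
      (∀ w, e w ∈ leafBd E x z ↔ ∃ u, halfBox m ζ u 0 = w) ∧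
      ∃ a b : prong m, (a : ℂ) ≠ 0 ∧ (b : ℂ) ≠ 0 ∧ ¬ SameRay ℝ (a : ℂ) b ∧
        γ a = e (halfBox m ζ 1 0) ∧ γ b = e (halfBox m ζ (-1) 0) ∧
        ∀ y, y ∈ leafBd E x z ↔ ∃ t : ℝ, 0 ≤ t ∧ (y = γ (rayPath a.2 t) ∨ y = γ (rayPath b.2 t)) := by
  have hm := h.ne_zero
  set o : prong m := ⟨0, zero_mem_prong hm⟩ with ho
  have hom : ord (γ o) = m := F.ord_center h
  have hcen := F.center_mem_leafBd h hz
  have he' : NiceChart E (ord (γ o)) e (γ o) := by rw [hom]; exact he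
  obtain ⟨ζ, hζ, h1, h2⟩ := F.exists_sector_leafComp (h.rel o) he' (w₁ := 0) (by rw [he.zero]; exact hcen.1)
  rw [hom] at hζ h1 h2
  obtain ⟨J, hJc, hJi, hJ⟩ := h.exists_lift he.chart (by rw [he.zero]; exact h.rel _)
  have hJo : J o = o := h.emb.injective (by rw [hJ, he.zero])
  have hJ0 : ∀ w : prong m, (J w : ℂ) = 0 ↔ (w : ℂ) = 0 := by
    intro w
    constructor
    · intro h3
      have h4 : J w = J o := by rw [hJo]; exact Subtype.ext h3
      rw [hJi h4]
    · intro h3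
      rw [show w = o from Subtype.ext h3, hJo]
  have hJray : ∀ (w : prong m) (r : ℝ), (w : ℂ) ≠ 0 → 0 < r → SameRay ℝ (J w : ℂ) (J (rayPath w.2 r)) := by
    intro w r hw hr
    refine IsPreconnected.sameRay_of_prong (D := (fun s => (J (rayPath w.2 s) : ℂ)) '' Ioi 0) hm
      (isPreconnected_Ioi.image _ (continuous_subtype_val.comp
        (hJc.comp (continuous_rayPath w.2))).continuousOn) ?_ ?_ ⟨1, by simp, ?_⟩ ⟨r, hr, rfl⟩
    · rintro _ ⟨s, -, rfl⟩
      exact (J _).2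
    · rintro ⟨s, hs, h3⟩
      have h4 : s • (w : ℂ) = 0 := (hJ0 _).1 h3
      exact smul_ne_zero (ne_of_gt hs) hw h4
    · have h3 : rayPath w.2 1 = w := Subtype.ext (by simp [rayPath])
      simp only [h3]
  have hax : ∀ u, halfBox m ζ u 0 ∈ prong m := by
    intro u
    show (halfBox m ζ u 0 ^ m).im = 0
    rw [halfBox_im hm hζ, zero_mul]
  have hax0 : ∀ u, u ≠ 0 → halfBox m ζ u 0 ≠ 0 := by
    intro u hu h0
    apply hu
    rw [← halfBox_re hm hζ u 0, h0]
    simp [hm]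
  have ha0 : (J ⟨_, hax 1⟩ : ℂ) ≠ 0 := fun h0 => hax0 1 one_ne_zero ((hJ0 _).1 h0)
  have hb0 : (J ⟨_, hax (-1)⟩ : ℂ) ≠ 0 := fun h0 => hax0 (-1) (by norm_num) ((hJ0 _).1 h0)
  refine ⟨ζ, hζ, h1, h2, J ⟨_, hax 1⟩, J ⟨_, hax (-1)⟩, ha0, hb0, ?_, hJ _, hJ _, ?_⟩
  · intro hs
    have h3 := F.ray_injective h hm hJc hJi (by rw [← ho, hJo]) (hax0 1 one_ne_zero) (hax0 (-1) (by norm_num)) hs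
    obtain ⟨r, hr, h4⟩ := h3.exists_pos_left (hax0 1 one_ne_zero) (hax0 (-1) (by norm_num))
    have h5 : r • halfBox m ζ 1 0 = halfBox m ζ (-1) 0 := h4
    have h6 := re_smul_pow (m := m) (halfBox m ζ 1 0) r
    rw [h5, halfBox_re hm hζ, halfBox_re hm hζ] at h6
    have : 0 < r ^ m := by positivity
    linarith
  · intro y
    constructor
    · intro hy
      obtain ⟨c, rfl⟩ := h.exists_eq hy.2
      by_cases hc0 : (c : ℂ) = 0
      · refine ⟨0, le_rfl, Or.inl ?_⟩
        congr 1
        exact Subtype.ext (by simp [rayPath, hc0])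
      -- Close to the centre the ray of `c` is inside the chart, where the boundary consists of two
      -- half-axes. The sign of `u` tells which of the two rays it is, and the rescaling `r ^ m = u
      -- * σ` carries the base point of that half-axis to the point found.
      obtain ⟨t, ⟨w, hw⟩, ht⟩ := (((F.tendsto_rayPath h c).eventually he.range_mem).and
        self_mem_nhdsWithin).exists
      have ht' : 0 < t := ht
      have h3 := F.rayPath_mem_leafBd h hc0 hy ht'
      rw [← hw] at h3
      obtain ⟨u, rfl⟩ := (h2 w).1 h3
      have hJu : J ⟨_, hax u⟩ = rayPath c.2 t := h.emb.injective (by rw [hJ, ← hw])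
      have hu : u ≠ 0 := by
        rintro rfl
        have h4 : (J ⟨_, hax 0⟩ : ℂ) = 0 := (hJ0 _).2 (halfBox_zero hm)
        rw [hJu] at h4
        exact smul_ne_zero ht'.ne' hc0 h4
      have main : ∀ σ : ℝ, σ ≠ 0 → 0 < u * σ → |σ| = 1 → ∃ s : ℝ, 0 ≤ s ∧ γ c = γ (rayPath (J ⟨_, hax σ⟩).2 s) := by
        intro σ hσ0 hσ hσ1
        have hσσ : σ * σ = 1 := by rw [← abs_mul_abs_self, hσ1]; norm_num
        obtain ⟨r, hr, hru⟩ : ∃ r : ℝ, 0 < r ∧ r ^ m = u * σ :=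
          ⟨(u * σ) ^ ((m : ℝ)⁻¹), Real.rpow_pos_of_pos hσ _, Real.rpow_inv_natCast_pow hσ.le hm⟩
        have h4 := hJray ⟨_, hax σ⟩ r (hax0 σ hσ0) hr
        have h5 : rayPath (hax σ) r = ⟨_, hax u⟩ := by
          apply Subtype.ext
          show r • halfBox m ζ σ 0 = _
          rw [smul_halfBox hm σ hr, hru, mul_assoc, hσσ, mul_one]
        rw [h5, hJu] at h4
        have h6 : SameRay ℝ (J ⟨_, hax σ⟩ : ℂ) (c : ℂ) := by
          have h7 := h4.nonneg_smul_right (inv_nonneg.2 ht'.le)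
          have h8 : t⁻¹ • ((rayPath c.2 t : prong m) : ℂ) = c := by
            show t⁻¹ • t • (c : ℂ) = c
            rw [inv_smul_smul₀ ht'.ne']
          rwa [h8] at h7
        obtain ⟨s, hs, h7⟩ := h6.exists_pos_left (fun h0 => hax0 σ hσ0 ((hJ0 _).1 h0)) hc0
        exact ⟨s, hs.le, by congr 1; exact Subtype.ext h7.symm⟩
      rcases lt_or_gt_of_ne hu with h4 | h4
      · obtain ⟨s, hs, h5⟩ := main (-1) (by norm_num) (by linarith) (by norm_num)
        exact ⟨s, hs, Or.inr h5⟩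
      · obtain ⟨s, hs, h5⟩ := main 1 (by norm_num) (by linarith) (by norm_num)
        exact ⟨s, hs, Or.inl h5⟩
    · have main : ∀ σ : ℝ, σ ≠ 0 → ∀ t : ℝ, 0 ≤ t → γ (rayPath (J ⟨_, hax σ⟩).2 t) ∈ leafBd E x z := by
        intro σ hσ t ht
        rcases ht.eq_or_lt with rfl | ht
        · convert hcen using 2
          exact Subtype.ext (by simp [rayPath])
        · exact F.rayPath_mem_leafBd h (fun h0 => hax0 σ hσ ((hJ0 _).1 h0))
            (by rw [hJ]; exact (h2 _).2 ⟨σ, rfl⟩) ht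
      rintro ⟨t, ht, rfl | rfl⟩
      · exact main 1 one_ne_zero t ht
      · exact main (-1) (by norm_num) t ht

lemma isPreconnected_leafBd (hz : ¬ E x z) : IsPreconnected (leafBd E x z) := by
  obtain ⟨m, γ, h⟩ := F.exists_leafParam x
  obtain ⟨e, he, -⟩ := F.exists_nice (γ ⟨0, zero_mem_prong h.ne_zero⟩) univ_mem
  rw [F.ord_center h] at he
  obtain ⟨ζ, -, -, -, a, b, -, -, -, -, -, hab⟩ := F.exists_rays h hz he
  have h1 : leafBd E x z = (fun t => γ (rayPath a.2 t)) '' Ici 0 ∪ (fun t => γ (rayPath b.2 t)) '' Ici 0 := by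
    ext y
    rw [hab]
    constructor
    · rintro ⟨t, ht, rfl | rfl⟩
      exacts [Or.inl ⟨t, ht, rfl⟩, Or.inr ⟨t, ht, rfl⟩]
    · rintro (⟨t, ht, rfl⟩ | ⟨t, ht, rfl⟩)
      exacts [⟨t, ht, Or.inl rfl⟩, ⟨t, ht, Or.inr rfl⟩]
  rw [h1]
  refine IsPreconnected.union (γ ⟨0, zero_mem_prong h.ne_zero⟩) ⟨0, by simp, ?_⟩ ⟨0, by simp, ?_⟩
    (isPreconnected_Ici.image _ (h.emb.continuous.comp (continuous_rayPath a.2)).continuousOn)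
    (isPreconnected_Ici.image _ (h.emb.continuous.comp (continuous_rayPath b.2)).continuousOn)
  all_goals
    show γ _ = γ _
    congr 1
    exact Subtype.ext (by simp [rayPath])

/-- Every sector lies in a component that has its vertex in its boundary. -/
lemma mem_leafBd_sector {y : P} (he : NiceChart E (ord y) e y) {w : ℂ} {ζ : ℂ} (hζ : ζ ∈ sectorDirs (ord y))
    (hw : w ∈ sector (ord y) ζ) : y ∈ leafBd E y (e w) := by
  refine ⟨?_, E.refl y⟩
  have h1 : e '' sector (ord y) ζ ⊆ leafComp E y (e w) :=
    (he.isPreconnected_image_sector hζ).subset_connectedComponentIn ⟨w, hw, rfl⟩ (he.image_sector_subset hζ)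
  exact closure_mono h1 (mem_closure_iff_frequently.2 (he.frequently_sector hζ))

end PlaneFol

end sides

/-! ### The order on a prong -/

lemma prongLt_irrefl (m : ℕ) (a : ℂ) : ¬ prongLt m a a := fun h => lt_irrefl _ h.1

lemma prongLt_trans {m : ℕ} (hm : m ≠ 0) {a b c : ℂ} (h1 : prongLt m a b) (h2 : prongLt m b c) :
    prongLt m a c := by
  refine ⟨h1.1.trans h2.1, ?_⟩
  rcases h1.2 with h3 | ⟨h3, h3'⟩
  · rcases h2.2 with h4 | ⟨h4, h4'⟩
    -- `SameRay` fails to be transitive only through `0`. There `a` is on a negative and `c` on a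
    -- positive ray, which is the second alternative.
    · by_cases hb : b = 0
      · subst hb
        right
        have e1 := h1.1
        have e2 := h2.1
        simp only [ne_eq, hm, not_false_eq_true, zero_pow, Complex.zero_re] at e1 e2
        exact ⟨e1.le, e2.le⟩
      · exact Or.inl (h3.trans h4 fun h => absurd h hb)
    · exact Or.inr ⟨h1.1.le.trans h4, h4'⟩
  · exact Or.inr ⟨h3, h3'.trans h2.1.le⟩

lemma prongLt_of_sameRay {m : ℕ} (hm : m ≠ 0) {a b : ℂ} (ha : a ∈ prong m) (hb : b ∈ prong m)
    (h : SameRay ℝ a b) (hne : a ≠ b) : prongLt m a b ∨ prongLt m b a := by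
  rcases lt_trichotomy (a ^ m).re (b ^ m).re with h1 | h1 | h1
  · exact Or.inl ⟨h1, Or.inl h⟩
  · exfalso
    by_cases ha0 : a = 0
    · subst ha0
      simp only [ne_eq, hm, not_false_eq_true, zero_pow, Complex.zero_re] at h1
      exact prong_re_ne_zero hb (Ne.symm hne) h1.symm
    by_cases hb0 : b = 0
    · subst hb0
      simp only [ne_eq, hm, not_false_eq_true, zero_pow, Complex.zero_re] at h1
      exact prong_re_ne_zero ha ha0 h1
    obtain ⟨r, hr, rfl⟩ := h.exists_pos_left ha0 hb0
    rw [re_smul_pow] at h1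
    have h2 : r ^ m = 1 := by
      have := prong_re_ne_zero ha ha0
      field_simp at h1
      linarith
    have h3 := (pow_eq_one_iff_of_nonneg hr.le hm).1 h2
    rw [h3, one_smul] at hne
    exact hne rfl
  · exact Or.inr ⟨h1, Or.inl h.symm⟩

/-- Plaque-preserving charts are foliated charts. -/
lemma folChart_of_plaque {P : Type*} [TopologicalSpace P] {E : Setoid P} {q : ℂ → ℝ} {U : Set P}
    (hU : IsOpen U) (φ : U ≃ₜ ℂ)
    (h : ∀ y z : U, (z : P) ∈ plaque E U y ↔ φ z ∈ connectedComponentIn {w : ℂ | q w = q (φ y)} (φ y)) :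
    FolChart E q (Subtype.val ∘ φ.symm) where
  emb := hU.isOpenEmbedding_subtypeVal.comp φ.symm.isOpenEmbedding
  same C hC hq w hw w' hw' := by
    have h1 := (h (φ.symm w) (φ.symm w')).2 (by
      rw [φ.apply_symm_apply, φ.apply_symm_apply]
      exact hC.subset_connectedComponentIn hw (fun a ha => hq a ha w hw) hw')
    exact (connectedComponentIn_subset _ _ h1).1
  level C hC hE w hw w' hw' := by
    have h1 : ((φ.symm w' : U) : P) ∈ plaque E U (φ.symm w) := by
      refine (hC.image (Subtype.val ∘ φ.symm) (by fun_prop)).subset_connectedComponentIn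
        ⟨w, hw, rfl⟩ ?_ ⟨w', hw', rfl⟩
      rintro _ ⟨a, ha, rfl⟩
      exact ⟨hE w hw a ha, (φ.symm a).2⟩
    have h2 := (h _ _).1 h1
    rw [φ.apply_symm_apply, φ.apply_symm_apply] at h2
    have h3 : w' ∈ {a | q a = q w} := connectedComponentIn_subset _ _ h2
    exact Eq.symm h3

/-! ### Charts adapted to both foliations and to the orientation -/

namespace OrientedBifoliatedPlane

variable {P : Type*} [TopologicalSpace P] (B : OrientedBifoliatedPlane P)

lemma ord_ne (x : P) : B.ord x ≠ 0 := Nat.one_le_iff_ne_zero.1 (B.ord_pos x)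

/-- `e` is a foliated chart for both foliations that respects the orientation of horizontal arcs. -/
structure BiFol (n : ℕ) (e : ℂ → P) : Prop where
  ne_zero : n ≠ 0
  plus : FolChart B.plus (fun w => (w ^ n).im) e
  minus : FolChart B.minus (fun w => (w ^ n).re) e
  mono : ∀ C : Set ℂ, IsPreconnected C → (∀ w ∈ C, ∀ w' ∈ C, (w ^ n).im = (w' ^ n).im) →
    ∀ w ∈ C, ∀ w' ∈ C, B.lt (e w) (e w') → (w ^ n).re < (w' ^ n).re

lemma exists_biFol (x : P) : ∃ e, B.BiFol (B.ord x) e ∧ e 0 = x := by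
  obtain ⟨U, φ, hx, hU, h0, h1, h2, h3⟩ := B.chart x
  have hp := folChart_of_plaque (q := fun w => (w ^ B.ord x).im) hU φ h1
  refine ⟨Subtype.val ∘ φ.symm, ⟨B.ord_ne x, hp, folChart_of_plaque (q := fun w => (w ^ B.ord x).re) hU φ h2,
    ?_⟩, ?_⟩
  · intro C hC hq w hw w' hw' hlt
    have h4 := h3 (φ.symm w) (φ.symm w') ((h1 _ _).2 (by
      rw [φ.apply_symm_apply, φ.apply_symm_apply]
      exact hC.subset_connectedComponentIn hw (fun a ha => hq a ha w hw) hw')) hlt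
    rwa [φ.apply_symm_apply, φ.apply_symm_apply] at h4
  · have h4 : φ.symm 0 = ⟨x, hx⟩ := by rw [← h0, φ.symm_apply_apply]
    simp [h4]

variable {B}

lemma BiFol.shrink {n : ℕ} {e : ℂ → P} (he : B.BiFol n e) {δ : ℝ} (hδ : 0 < δ) :
    B.BiFol n (e ∘ shrink n δ) where
  ne_zero := he.ne_zero
  plus := he.plus.shrink_im he.ne_zero hδ
  minus := he.minus.shrink_re he.ne_zero hδ
  mono C hC hq w hw w' hw' hlt := by
    have h1 := he.mono (_root_.shrink n δ '' C)
      (hC.image _ (isOpenEmbedding_shrink he.ne_zero hδ).continuous.continuousOn) ?_ _ ⟨w, hw, rfl⟩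
      _ ⟨w', hw', rfl⟩ hlt
    · rw [shrink_pow he.ne_zero, shrink_pow he.ne_zero] at h1
      exact (squeeze_strictMono hδ).lt_iff_lt.1 h1
    · rintro _ ⟨a, ha, rfl⟩ _ ⟨b, hb, rfl⟩
      rw [shrink_pow he.ne_zero, shrink_pow he.ne_zero]
      simp only [squeezeC]
      rw [hq a ha b hb]

/-- Rotation of a chart that exchanges the two foliations. -/
lemma folChart_rotate {E : Setoid P} {n : ℕ} {e : ℂ → P} (he : FolChart E (fun w => (w ^ n).re) e) {κ : ℂ}
    (hκ : κ ^ n = Complex.I) (h0 : κ ≠ 0) : FolChart E (fun w => (w ^ n).im) (fun w => e (κ⁻¹ * w)) := by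
  refine he.comp (G := fun w => κ⁻¹ * w) (Homeomorph.mulLeft₀ κ⁻¹ (inv_ne_zero h0)).isOpenEmbedding ?_
  intro w w'
  simp [mul_pow, hκ]

lemma exists_rot (n : ℕ) (hn : n ≠ 0) : ∃ κ : ℂ, κ ^ n = Complex.I ∧ κ ≠ 0 := by
  obtain ⟨κ, hκ⟩ := exists_sectorDir n hn
  refine ⟨κ, hκ, ?_⟩
  rintro rfl
  simp [hn, Complex.ext_iff] at hκ

variable (B)

lemma plusFol : PlaneFol B.plus B.ord where
  plane := B.plane
  ord_ne := B.ord_ne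
  chart x := by
    obtain ⟨e, he, h0⟩ := B.exists_biFol x
    exact ⟨e, he.plus, h0⟩
  leaf_prong x := by
    obtain ⟨m, hm, γ, h1, h2, -⟩ := B.plus_prong x
    exact ⟨m, by omega, γ, h1, h2⟩

/-- Rotation by `κ` with `κ ^ n = I` turns the levels of `Re` into levels of `Im`, so that
everything proved for one singular foliation applies to `𝓕⁻` with the same orders. -/
lemma minusFol : PlaneFol B.minus B.ord where
  plane := B.plane
  ord_ne := B.ord_ne
  chart x := by
    obtain ⟨e, he, h0⟩ := B.exists_biFol x
    obtain ⟨κ, hκ, hκ0⟩ := exists_rot (B.ord x) (B.ord_ne x)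
    exact ⟨_, folChart_rotate he.minus hκ hκ0, by simp [h0]⟩
  leaf_prong x := by
    obtain ⟨m, hm, h⟩ := B.minus_prong x
    exact ⟨m, by omega, h⟩

/-- An oriented parametrization of a leaf of `𝓕⁺`. -/
structure PlusParam (m : ℕ) (γ : prong m → P) (x : P) : Prop extends LeafParam B.plus m γ x where
  lt_iff : ∀ a b, B.lt (γ a) (γ b) ↔ prongLt m a b

lemma exists_plusParam (x : P) : ∃ (m : ℕ) (γ : prong m → P), B.PlusParam m γ x := by
  obtain ⟨m, hm, γ, h1, h2, h3⟩ := B.plus_prong x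
  exact ⟨m, γ, ⟨by omega, h1, h2⟩, h3⟩

variable {B}

lemma lt_irrefl (x : P) : ¬ B.lt x x := by
  obtain ⟨m, γ, h⟩ := B.exists_plusParam x
  obtain ⟨a, rfl⟩ := h.exists_eq (B.plus.refl x)
  rw [h.lt_iff]
  exact prongLt_irrefl m a

lemma lt_trans {x y z : P} (h1 : B.lt x y) (h2 : B.lt y z) : B.lt x z := by
  obtain ⟨m, γ, h⟩ := B.exists_plusParam x
  obtain ⟨a, rfl⟩ := h.exists_eq (B.plus.refl x)
  obtain ⟨b, rfl⟩ := h.exists_eq (B.lt_leaf _ _ h1)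
  obtain ⟨c, rfl⟩ := h.exists_eq (B.plus.trans (h.rel' a b) (B.lt_leaf _ _ h2))
  rw [h.lt_iff] at *
  exact prongLt_trans h.ne_zero h1 h2

lemma lt_asymm {x y : P} (h1 : B.lt x y) (h2 : B.lt y x) : False := lt_irrefl x (lt_trans h1 h2)

lemma lt_ne {x y : P} (h1 : B.lt x y) : x ≠ y := fun h => lt_irrefl y (h ▸ h1)

/-- The points of a connected regular part of a leaf are comparable. -/
lemma lt_trichotomy_of_connected {C : Set P} (hC : IsPreconnected C) {x y : P} (hCx : C ⊆ leafOf B.plus x)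
    (h1 : ∀ p ∈ C, B.ord p = 1) (hx : x ∈ C) (hy : y ∈ C) : B.lt x y ∨ x = y ∨ B.lt y x := by
  obtain ⟨m, γ, h⟩ := B.exists_plusParam x
  have hm := h.ne_zero
  have hsub : C ⊆ range γ := by rw [h.range_eq]; exact hCx
  have hpre : IsPreconnected (γ ⁻¹' C) := by
    rw [← h.emb.isInducing.isPreconnected_image, image_preimage_eq_of_subset hsub]
    exact hC
  obtain ⟨a, rfl⟩ := hsub hx
  obtain ⟨b, rfl⟩ := hsub hy
  by_cases hab : a = b
  · exact Or.inr (Or.inl (by rw [hab]))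
  have hab' : (a : ℂ) ≠ b := fun h => hab (Subtype.ext h)
  rw [h.lt_iff, h.lt_iff]
  have hpre' : IsPreconnected (Subtype.val '' (γ ⁻¹' C)) := hpre.image _ continuous_subtype_val.continuousOn
  by_cases h0 : (0 : ℂ) ∈ Subtype.val '' (γ ⁻¹' C)
  · obtain ⟨o, ho, ho0⟩ := h0
    -- If the connected set contains the centre, then the centre is regular, so `m = 1` and the leaf
    -- is a line.
    have h2 := h1 _ ho
    rw [show o = ⟨0, zero_mem_prong hm⟩ from Subtype.ext ho0, B.plusFol.ord_center h.toLeafParam] at h2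
    subst h2
    have ea := a.2
    have eb := b.2
    simp only [prong, mem_ofPred_eq, pow_one] at ea eb
    have hre : (a : ℂ).re ≠ (b : ℂ).re := fun h => hab' (Complex.ext h (ea.trans eb.symm))
    have hray : ∀ z w : ℂ, z.im = 0 → w.im = 0 → z.re < w.re → prongLt 1 z w := by
      intro z w hz hw hzw
      refine ⟨by simpa using hzw, ?_⟩
      obtain ⟨z, rfl⟩ : ∃ r : ℝ, z = r := ⟨z.re, Complex.ext rfl hz⟩
      obtain ⟨w, rfl⟩ : ∃ r : ℝ, w = r := ⟨w.re, Complex.ext rfl hw⟩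
      simp only [Complex.ofReal_re] at hzw
      simp only [pow_one, Complex.ofReal_re]
      by_cases hz0 : z ≤ 0
      · by_cases hw0 : 0 ≤ w
        · exact Or.inr ⟨hz0, hw0⟩
        · push Not at hw0
          left
          refine Or.inr (Or.inr ⟨-w, -z, by linarith, by linarith, ?_⟩)
          simp; ring
      · push Not at hz0
        left
        refine Or.inr (Or.inr ⟨w, z, by linarith, by linarith, ?_⟩)
        simp; ring
    rcases lt_or_gt_of_ne hre with h3 | h3
    · exact Or.inl (hray _ _ ea eb h3)
    · exact Or.inr (Or.inr (hray _ _ eb ea h3))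
  · have := hpre'.sameRay_of_prong hm (by rintro _ ⟨c, -, rfl⟩; exact c.2) h0 ⟨a, hx, rfl⟩ ⟨b, hy, rfl⟩
    rcases prongLt_of_sameRay hm a.2 b.2 this hab' with h3 | h3
    · exact Or.inl h3
    · exact Or.inr (Or.inr h3)

/-- The centre of a leaf is comparable with all its points. -/
lemma lt_trichotomy_of_ord {s y : P} (hs : 2 ≤ B.ord s) (h : B.plus s y) : B.lt s y ∨ s = y ∨ B.lt y s := by
  obtain ⟨m, γ, hγ⟩ := B.exists_plusParam s
  have hm := hγ.ne_zero
  obtain ⟨a, rfl⟩ := hγ.exists_eq (B.plus.refl s)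
  obtain ⟨b, rfl⟩ := hγ.exists_eq h
  have ha : (a : ℂ) = 0 := by
    by_contra h0
    have := B.plusFol.ord_of_ne hγ.toLeafParam h0
    omega
  by_cases hb : (b : ℂ) = 0
  · right; left
    congr 1
    exact Subtype.ext (ha.trans hb.symm)
  · rw [hγ.lt_iff, hγ.lt_iff]
    rcases lt_or_gt_of_ne (prong_re_ne_zero b.2 hb) with h1 | h1
    · right; right
      simp [prongLt, ha, hm, h1, h1.le]
    · left
      simp [prongLt, ha, hm, h1, h1.le]

/-- A chart at `x` for both foliations that meets the leaves of `x` only in the axes. -/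
structure BiChart (B : OrientedBifoliatedPlane P) (n : ℕ) (e : ℂ → P) (x : P) : Prop extends B.BiFol n e where
  ord_eq : B.ord x = n
  zero : e 0 = x
  axis_plus : ∀ w, B.plus x (e w) → (w ^ n).im = 0
  axis_minus : ∀ w, B.minus x (e w) → (w ^ n).re = 0

variable (B) in
lemma exists_biChart (x : P) {O : Set P} (hO : O ∈ 𝓝 x) : ∃ e, B.BiChart (B.ord x) e x ∧ range e ⊆ O := by
  obtain ⟨e, he, he0⟩ := B.exists_biFol x
  have hn := B.ord_ne x
  have h1 := he.plus.eventually_level (w := 0) (B.plusFol.leaf_prong _)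
  have h2 := he.minus.eventually_level (w := 0) (B.minusFol.leaf_prong _)
  have h3 : e ⁻¹' O ∈ 𝓝 (0 : ℂ) := he.plus.emb.continuous.continuousAt (by rwa [he0])
  obtain ⟨δ, hδ, hr⟩ := exists_shrink_subset hn (inter_mem (inter_mem h1 h2) h3)
  refine ⟨e ∘ shrink _ δ, ⟨he.shrink hδ, rfl, by simp [shrink_zero, he0], ?_, ?_⟩, ?_⟩
  · intro w hw
    have h4 := (hr ⟨w, rfl⟩).1.1 (he0 ▸ hw)
    simp only [shrink_pow hn, ne_eq, hn, not_false_eq_true, zero_pow, Complex.zero_im, squeezeC] at h4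
    exact squeeze_injective hδ (h4.trans (by simp [squeeze]))
  · intro w hw
    have h4 := (hr ⟨w, rfl⟩).1.2 (he0 ▸ hw)
    simp only [shrink_pow hn, ne_eq, hn, not_false_eq_true, zero_pow, Complex.zero_re, squeezeC] at h4
    exact squeeze_injective hδ (h4.trans (by simp [squeeze]))
  · rintro _ ⟨w, rfl⟩
    exact (hr ⟨w, rfl⟩).2

section chart

variable {n : ℕ} {e : ℂ → P} {x : P}

lemma BiChart.nice (h : B.BiChart n e x) : NiceChart B.plus n e x := ⟨h.ne_zero, h.plus, h.zero, h.axis_plus⟩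

lemma BiChart.emb (h : B.BiChart n e x) : IsOpenEmbedding e := h.plus.emb

lemma BiChart.nice_minus (h : B.BiChart n e x) {κ : ℂ} (hκ : κ ^ n = Complex.I) (h0 : κ ≠ 0) :
    NiceChart B.minus n (fun w => e (κ⁻¹ * w)) x :=
  ⟨h.ne_zero, folChart_rotate h.minus hκ h0, by simp [h.zero], fun w hw => by
    have := h.axis_minus _ hw
    simpa [mul_pow, hκ] using this⟩

lemma BiChart.range_mem (h : B.BiChart n e x) : range e ∈ 𝓝 x := h.nice.range_mem

lemma isPreconnected_halfBox_row {ζ : ℂ} (hn : n ≠ 0) (hζ : ζ ∈ sectorDirs n) {v : ℝ} (hv : 0 ≤ v) {S : Set ℝ}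
    (hS : IsPreconnected S) : IsPreconnected ((fun u => halfBox n ζ u v) '' S) := by
  refine hS.image _ (ContinuousOn.mono ?_ (subset_univ _))
  exact (continuousOn_halfBox hn hζ).comp (f := fun u : ℝ => ((u, v) : ℝ × ℝ)) (by fun_prop) fun u _ => hv

lemma halfBox_ne_zero {ζ : ℂ} (hn : n ≠ 0) (hζ : ζ ∈ sectorDirs n) {u v : ℝ} (h : u ≠ 0 ∨ v ≠ 0) :
    halfBox n ζ u v ≠ 0 := by
  intro h0
  rw [← halfBox_zero (ζ := ζ) hn] at h0
  have := halfBox_inj hn hζ h0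
  tauto

/-- On the horizontals of a chart the order is the order of the first coordinate. -/
lemma BiChart.lt_iff (h : B.BiChart n e x) {ζ : ℂ} (hζ : ζ ∈ sectorDirs n) {u u' v : ℝ} (hv : 0 ≤ v) :
    B.lt (e (halfBox n ζ u v)) (e (halfBox n ζ u' v)) ↔ u < u' := by
  have hn := h.ne_zero
  have hrow : ∀ S : Set ℝ, ∀ w ∈ (fun u => halfBox n ζ u v) '' S, ∀ w' ∈ (fun u => halfBox n ζ u v) '' S,
      (w ^ n).im = (w' ^ n).im := by
    rintro S _ ⟨a, -, rfl⟩ _ ⟨b, -, rfl⟩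
    rw [halfBox_im hn hζ, halfBox_im hn hζ]
  have hone : ∀ u u', B.lt (e (halfBox n ζ u v)) (e (halfBox n ζ u' v)) → u < u' := by
    intro u u' hlt
    have := h.mono _ (isPreconnected_halfBox_row hn hζ hv isPreconnected_univ) (hrow univ) _ ⟨u, trivial, rfl⟩
      _ ⟨u', trivial, rfl⟩ hlt
    rwa [halfBox_re hn hζ, halfBox_re hn hζ] at this
  -- The chart gives only one implication. The converse holds on rows of regular points, where any
  -- two points are comparable and the wrong order is excluded by `hone`.
  have htri : ∀ u u', u < u' → (∀ t ∈ Icc u u', B.ord (e (halfBox n ζ t v)) = 1) →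
      B.lt (e (halfBox n ζ u v)) (e (halfBox n ζ u' v)) := by
    intro u u' huu h1
    have h2 := lt_trichotomy_of_connected (B := B) (C := e '' ((fun u => halfBox n ζ u v) '' Icc u u'))
      (x := e (halfBox n ζ u v)) (y := e (halfBox n ζ u' v))
      ((isPreconnected_halfBox_row hn hζ hv isPreconnected_Icc).image _ h.emb.continuous.continuousOn) ?_ ?_
      ⟨_, ⟨u, ⟨le_rfl, huu.le⟩, rfl⟩, rfl⟩ ⟨_, ⟨u', ⟨huu.le, le_rfl⟩, rfl⟩, rfl⟩
    · rcases h2 with h2 | h2 | h2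
      · exact h2
      · have := halfBox_inj hn hζ (h.emb.injective h2)
        exact absurd this.1 huu.ne
      · exact absurd (hone _ _ h2) huu.not_gt
    · rintro _ ⟨a, ha, rfl⟩
      exact h.plus.same _ (isPreconnected_halfBox_row hn hζ hv isPreconnected_Icc) (hrow (Icc u u')) _
        ⟨u, ⟨le_rfl, huu.le⟩, rfl⟩ _ ha
    · rintro _ ⟨_, ⟨t, ht, rfl⟩, rfl⟩
      exact h1 t ht
  refine ⟨hone u u', fun huu => ?_⟩
  have hord : ∀ t, t ≠ 0 ∨ v ≠ 0 ∨ n = 1 → B.ord (e (halfBox n ζ t v)) = 1 := by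
    intro t ht
    by_cases h0 : halfBox n ζ t v = 0
    · rcases ht with ht | ht | ht
      · exact absurd h0 (halfBox_ne_zero hn hζ (Or.inl ht))
      · exact absurd h0 (halfBox_ne_zero hn hζ (Or.inr ht))
      · rw [h0, h.zero, h.ord_eq, ht]
    · exact B.plusFol.ord_chart hn h.plus h0
  by_cases hc : v ≠ 0 ∨ n = 1
  · exact htri _ _ huu fun t _ => hord t (Or.inr hc)
  push Not at hc
  obtain ⟨rfl, hn1⟩ := hc
  -- On the row through a singularity, points on different sides are compared through the
  -- singularity, which is comparable with its whole leaf.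
  have hcen : ∀ t, t ≠ 0 → (0 < t ∧ B.lt x (e (halfBox n ζ t 0))) ∨ (t < 0 ∧ B.lt (e (halfBox n ζ t 0)) x) := by
    intro t ht
    have hx : e (halfBox n ζ 0 0) = x := by rw [halfBox_zero hn, h.zero]
    have h3 : B.plus x (e (halfBox n ζ t 0)) := h.nice.rel (by rw [halfBox_im hn hζ, zero_mul])
    rcases lt_trichotomy_of_ord (by rw [h.ord_eq]; omega) h3 with h4 | h4 | h4
    · left
      refine ⟨hone 0 t (by rwa [hx]), h4⟩
    · rw [← hx] at h4
      exact absurd (halfBox_inj hn hζ (h.emb.injective h4)).1.symm ht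
    · right
      refine ⟨hone t 0 (by rwa [hx]), h4⟩
  by_cases hs : u < 0 ∧ 0 < u'
  · rcases hcen u hs.1.ne with h5 | h5
    · linarith
    rcases hcen u' hs.2.ne' with h6 | h6
    · exact lt_trans h5.2 h6.2
    · linarith
  by_cases hu0 : u = 0
  · subst hu0
    rcases hcen u' huu.ne' with h6 | h6
    · rw [halfBox_zero hn, h.zero]; exact h6.2
    · linarith
  by_cases hu0' : u' = 0
  · subst hu0'
    rcases hcen u hu0 with h6 | h6
    · linarith
    · rw [halfBox_zero hn, h.zero]; exact h6.2
  refine htri _ _ huu fun t ht => hord t (Or.inl ?_)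
  rintro rfl
  exact hs ⟨lt_of_le_of_ne ht.1 hu0, lt_of_le_of_ne ht.2 (Ne.symm hu0')⟩

end chart

end OrientedBifoliatedPlane

namespace OrientedBifoliatedPlane

variable {P : Type*} [TopologicalSpace P] {B : OrientedBifoliatedPlane P}

/-! ### Oriented lines in the leaves of `𝓕⁺` -/

/-- A continuous line that is strictly increasing for the order of the leaves of `𝓕⁺`. -/
structure IsLine (B : OrientedBifoliatedPlane P) (g : ℝ → P) : Prop where
  cont : Continuous g
  lt_iff : ∀ s t, B.lt (g s) (g t) ↔ s < t

lemma IsLine.inj {g : ℝ → P} (hg : B.IsLine g) : Function.Injective g := by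
  intro s t h
  by_contra hne
  rcases lt_or_gt_of_ne hne with h1 | h1
  · exact lt_ne ((hg.lt_iff s t).2 h1) h
  · exact lt_ne ((hg.lt_iff t s).2 h1) h.symm

lemma IsLine.rel {g : ℝ → P} (hg : B.IsLine g) (s t : ℝ) : B.plus (g s) (g t) := by
  rcases lt_trichotomy s t with h | rfl | h
  · exact B.lt_leaf _ _ ((hg.lt_iff s t).2 h)
  · exact B.plus.refl _
  · exact B.plus.symm (B.lt_leaf _ _ ((hg.lt_iff t s).2 h))

/-- Two opposite rays of a leaf form a line. -/
lemma PlusParam.exists_line {m : ℕ} {γ : prong m → P} {x : P} (h : B.PlusParam m γ x) {a b : prong m}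
    (ha : 0 < ((a : ℂ) ^ m).re) (hb : ((b : ℂ) ^ m).re < 0) :
    ∃ g : ℝ → P, B.IsLine g ∧ (∀ t, 0 ≤ t → g t = γ (rayPath a.2 t)) ∧ ∀ t, t ≤ 0 → g t = γ (rayPath b.2 (-t)) := by
  have hm := h.ne_zero
  have h0 : ∀ c : prong m, rayPath c.2 0 = ⟨0, zero_mem_prong hm⟩ := fun c => Subtype.ext (by simp [rayPath])
  refine ⟨fun t => if 0 ≤ t then γ (rayPath a.2 t) else γ (rayPath b.2 (-t)), ⟨?_, ?_⟩, ?_, ?_⟩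
  · refine Continuous.if_le (h.emb.continuous.comp (continuous_rayPath a.2))
      (h.emb.continuous.comp ((continuous_rayPath b.2).comp continuous_neg)) continuous_const continuous_id ?_
    rintro t ht
    have ht : 0 = t := ht
    subst ht
    simp [h0]
  · have hmono : ∀ s t : ℝ, s < t → B.lt (if 0 ≤ s then γ (rayPath a.2 s) else γ (rayPath b.2 (-s)))
        (if 0 ≤ t then γ (rayPath a.2 t) else γ (rayPath b.2 (-t))) := by
      intro s t hst
      have e : ∀ (c : prong m) (r : ℝ), ((rayPath c.2 r : ℂ) ^ m).re = r ^ m * ((c : ℂ) ^ m).re :=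
        fun c r => re_smul_pow _ _
      split_ifs with h1 h2 h2
      · rw [h.lt_iff]
        refine ⟨?_, Or.inl ?_⟩
        · rw [e, e]
          exact mul_lt_mul_of_pos_right (pow_lt_pow_left₀ hst h1 hm) ha
        · exact ((SameRay.refl _).nonneg_smul_left h1).nonneg_smul_right h2
      · exact absurd (h1.trans hst.le) h2
      · push Not at h1
        have h3 : 0 < (-s) ^ m := pow_pos (by linarith) m
        have h4 : 0 ≤ t ^ m := pow_nonneg h2 m
        rw [h.lt_iff]
        refine ⟨?_, Or.inr ⟨?_, ?_⟩⟩
        · rw [e, e]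
          nlinarith [mul_nonneg h4 ha.le]
        · rw [e]; nlinarith
        · rw [e]; exact mul_nonneg h4 ha.le
      · push Not at h1 h2
        rw [h.lt_iff]
        refine ⟨?_, Or.inl ?_⟩
        · rw [e, e]
          exact mul_lt_mul_of_neg_right (pow_lt_pow_left₀ (by linarith) (by linarith) hm) hb
        · exact ((SameRay.refl _).nonneg_smul_left (by linarith)).nonneg_smul_right (by linarith)
    refine fun s t => ⟨fun hlt => ?_, hmono s t⟩
    by_contra hcon
    rcases (not_lt.1 hcon).eq_or_lt with rfl | h1
    · exact lt_irrefl _ hlt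
    · exact lt_asymm hlt (hmono _ _ h1)
  · intro t ht
    simp [ht]
  · intro t ht
    rcases ht.eq_or_lt with rfl | ht
    · simp [h0]
    · simp [ht.not_ge]

lemma exists_prong_pos {m : ℕ} : ∃ a : prong m, 0 < ((a : ℂ) ^ m).re :=
  ⟨⟨1, by simp [prong]⟩, by simp⟩

lemma exists_prong_neg {m : ℕ} (hm : m ≠ 0) : ∃ a : prong m, ((a : ℂ) ^ m).re < 0 := by
  obtain ⟨z, hz⟩ := IsAlgClosed.exists_pow_nat_eq (-1 : ℂ) (Nat.pos_of_ne_zero hm)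
  exact ⟨⟨z, by simp [prong, hz]⟩, by simp [hz]⟩

/-- An oriented arc uses at most one negative and one positive ray of the prong. A ray that it does
not use is chosen arbitrarily. -/
lemma exists_line_of_lt {x y : P} (hxy : B.lt x y) : ∃ g, B.IsLine g ∧ ∃ s t, s < t ∧ g s = x ∧ g t = y := by
  obtain ⟨m, γ, h⟩ := B.exists_plusParam x
  have hm := h.ne_zero
  obtain ⟨c, rfl⟩ := h.exists_eq (B.plus.refl x)
  obtain ⟨d, rfl⟩ := h.exists_eq (B.lt_leaf _ _ hxy)
  have hcd := (h.lt_iff c d).1 hxy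
  suffices ∃ a b : prong m, 0 < ((a : ℂ) ^ m).re ∧ ((b : ℂ) ^ m).re < 0 ∧
      (∃ r : ℝ, 0 ≤ r ∧ (r • (a : ℂ) = c ∨ r • (b : ℂ) = c)) ∧
      (∃ r : ℝ, 0 ≤ r ∧ (r • (a : ℂ) = d ∨ r • (b : ℂ) = d)) by
    obtain ⟨a, b, ha, hb, hc, hd⟩ := this
    obtain ⟨g, hg, h1, h2⟩ := h.exists_line ha hb
    have key : ∀ c : prong m, (∃ r : ℝ, 0 ≤ r ∧ (r • (a : ℂ) = c ∨ r • (b : ℂ) = c)) → ∃ s, g s = γ c := by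
      rintro c ⟨r, hr, hc | hc⟩
      · exact ⟨r, by rw [h1 r hr]; congr 1; exact Subtype.ext hc⟩
      · exact ⟨-r, by rw [h2 _ (by linarith), neg_neg]; congr 1; exact Subtype.ext hc⟩
    obtain ⟨s, hs⟩ := key c hc
    obtain ⟨t, ht⟩ := key d hd
    exact ⟨g, hg, s, t, (hg.lt_iff s t).1 (by rw [hs, ht]; exact hxy), hs, ht⟩
  obtain ⟨a₀, ha₀⟩ := exists_prong_pos (m := m)
  obtain ⟨b₀, hb₀⟩ := exists_prong_neg hm
  have hz : ∀ z : prong m, ((z : ℂ) ^ m).re = 0 → (z : ℂ) = 0 := fun z h1 => by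
    by_contra h0
    exact prong_re_ne_zero z.2 h0 h1
  have hself : ∀ z : ℂ, ∃ r : ℝ, 0 ≤ r ∧ r • z = z := fun z => ⟨1, zero_le_one, one_smul _ _⟩
  have hray : ∀ z w : ℂ, z ≠ 0 → SameRay ℝ z w → ∃ r : ℝ, 0 ≤ r ∧ r • z = w := fun z w h1 h2 =>
    h2.exists_nonneg_left h1
  rcases lt_or_ge ((c : ℂ) ^ m).re 0 with h1 | h1
  · have hc0 : (c : ℂ) ≠ 0 := by
      intro h0
      simp [h0, hm] at h1
    rcases lt_or_ge 0 ((d : ℂ) ^ m).re with h2 | h2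
    · refine ⟨d, c, h2, h1, ?_, ?_⟩
      · obtain ⟨r, hr, h3⟩ := hself c
        exact ⟨r, hr, Or.inr h3⟩
      · obtain ⟨r, hr, h3⟩ := hself d
        exact ⟨r, hr, Or.inl h3⟩
    · refine ⟨a₀, c, ha₀, h1, ?_, ?_⟩
      · obtain ⟨r, hr, h3⟩ := hself c
        exact ⟨r, hr, Or.inr h3⟩
      · have h3 : SameRay ℝ (c : ℂ) d := by
          rcases hcd.2 with h3 | h3
          · exact h3
          · rw [hz d (le_antisymm h2 h3.2)]
            exact SameRay.zero_right _
        obtain ⟨r, hr, h4⟩ := hray _ _ hc0 h3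
        exact ⟨r, hr, Or.inr h4⟩
  · have h2 : 0 < ((d : ℂ) ^ m).re := h1.trans_lt hcd.1
    have hd0 : (d : ℂ) ≠ 0 := by
      intro h0
      simp [h0, hm] at h2
    refine ⟨d, b₀, h2, hb₀, ?_, ?_⟩
    · have h3 : SameRay ℝ (d : ℂ) c := by
        rcases hcd.2 with h3 | h3
        · exact h3.symm
        · rw [hz c (le_antisymm h3.1 h1)]
          exact SameRay.zero_right _
      obtain ⟨r, hr, h4⟩ := hray _ _ hd0 h3
      exact ⟨r, hr, Or.inl h4⟩
    · obtain ⟨r, hr, h3⟩ := hself d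
      exact ⟨r, hr, Or.inl h3⟩

/-- The boundary of a component of the complement of a leaf of `𝓕⁺` is a line. -/
lemma exists_line_leafBd {x z : P} (hz : ¬ B.plus x z) :
    ∃ g, B.IsLine g ∧ range g = leafBd B.plus x z := by
  obtain ⟨m, γ, h⟩ := B.exists_plusParam x
  have hm := h.ne_zero
  obtain ⟨e, he, -⟩ := B.exists_biChart (γ ⟨0, zero_mem_prong hm⟩) univ_mem
  rw [B.plusFol.ord_center h.toLeafParam] at he
  obtain ⟨ζ, hζ, -, -, a, b, -, -, -, ha, hb, hab⟩ := B.plusFol.exists_rays h.toLeafParam hz he.nice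
  have h0 : γ ⟨0, zero_mem_prong hm⟩ = e (halfBox m ζ 0 0) := by rw [halfBox_zero hm, he.zero]
  have ha' : 0 < ((a : ℂ) ^ m).re := by
    have h1 : B.lt (γ ⟨0, zero_mem_prong hm⟩) (γ a) := by
      rw [h0, ha, he.lt_iff hζ le_rfl]
      exact one_pos
    have h2 := ((h.lt_iff _ _).1 h1).1
    simpa [hm] using h2
  have hb' : ((b : ℂ) ^ m).re < 0 := by
    have h1 : B.lt (γ b) (γ ⟨0, zero_mem_prong hm⟩) := by
      rw [h0, hb, he.lt_iff hζ le_rfl]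
      norm_num
    have h2 := ((h.lt_iff _ _).1 h1).1
    simpa [hm] using h2
  obtain ⟨g, hg, h1, h2⟩ := h.exists_line ha' hb'
  refine ⟨g, hg, ?_⟩
  ext y
  rw [hab]
  constructor
  · rintro ⟨t, rfl⟩
    rcases le_total 0 t with ht | ht
    · exact ⟨t, ht, Or.inl (h1 t ht)⟩
    · exact ⟨-t, by linarith, Or.inr (h2 t ht)⟩
  · rintro ⟨t, ht, rfl | rfl⟩
    · exact ⟨t, h1 t ht⟩
    · exact ⟨-t, by rw [h2 _ (by linarith), neg_neg]⟩

lemma lt_trichotomy_leafBd {x z p q : P} (hz : ¬ B.plus x z) (hp : p ∈ leafBd B.plus x z)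
    (hq : q ∈ leafBd B.plus x z) : B.lt p q ∨ p = q ∨ B.lt q p := by
  obtain ⟨g, hg, hr⟩ := exists_line_leafBd hz
  rw [← hr] at hp hq
  obtain ⟨s, rfl⟩ := hp
  obtain ⟨t, rfl⟩ := hq
  rw [hg.lt_iff, hg.lt_iff]
  rcases lt_trichotomy s t with h | h | h
  · exact Or.inl h
  · exact Or.inr (Or.inl (by rw [h]))
  · exact Or.inr (Or.inr h)

/-- A leaf contains at most one singularity. -/
lemma eq_of_ord {s p : P} (hs : 2 ≤ B.ord s) (hp : 2 ≤ B.ord p) (h : B.plus s p) : s = p := by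
  obtain ⟨m, γ, hγ⟩ := B.exists_plusParam s
  have key : ∀ q, B.plus s q → 2 ≤ B.ord q → q = γ ⟨0, zero_mem_prong hγ.ne_zero⟩ := by
    intro q hq h2
    obtain ⟨a, rfl⟩ := hγ.exists_eq hq
    congr 1
    refine Subtype.ext ?_
    by_contra h0
    have := B.plusFol.ord_of_ne hγ.toLeafParam h0
    omega
  rw [key s (B.plus.refl s) hs, ← key p h hp]

section chart

variable {n : ℕ} {e : ℂ → P} {x : P}

lemma BiChart.lt_center (h : B.BiChart n e x) {w : ℂ} (hw : (w ^ n).im = 0) :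
    (B.lt x (e w) ↔ 0 < (w ^ n).re) ∧ (B.lt (e w) x ↔ (w ^ n).re < 0) := by
  have hn := h.ne_zero
  by_cases hw0 : w = 0
  · subst hw0
    rw [h.zero]
    simp [hn, lt_irrefl]
  · obtain ⟨ζ, hζ, -, hb, -⟩ := exists_axis_halfBox hn hw0 hw (Or.inl rfl)
    have hx : x = e (halfBox n ζ 0 0) := by rw [halfBox_zero hn, h.zero]
    have h1 := h.lt_iff hζ (u := 0) (u' := (w ^ n).re) le_rfl
    have h2 := h.lt_iff hζ (u' := 0) (u := (w ^ n).re) le_rfl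
    rw [← hx, hb] at h1 h2
    exact ⟨h1, h2⟩

/-- Near a point off the axes, a chart is a product chart. -/
lemma BiChart.eventually_lt_iff (h : B.BiChart n e x) {w : ℂ} (hw : (w ^ n).im ≠ 0) :
    ∀ᶠ w' in 𝓝 w, (B.lt (e w) (e w') → (w ^ n).re < (w' ^ n).re) ∧
      (B.lt (e w') (e w) → (w' ^ n).re < (w ^ n).re) := by
  have hn := h.ne_zero
  obtain ⟨ζ, hζ, hwζ⟩ := exists_sector hn hw
  have h1 := h.plus.eventually_level (w := w) (B.plusFol.leaf_prong _)
  filter_upwards [(isOpen_sector hn hζ).mem_nhds hwζ, h1] with w' h2 h3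
  obtain ⟨u, v, hv, rfl⟩ := hwζ
  obtain ⟨u', v', hv', rfl⟩ := h2
  have key : B.plus (e (halfBox n ζ u v)) (e (halfBox n ζ u' v')) → v' = v := by
    intro h4
    have h5 := h3 h4
    rw [halfBox_im hn hζ, halfBox_im hn hζ] at h5
    refine mul_right_cancel₀ ?_ h5
    rcases sectorDirs_im hζ with h6 | h6 <;> rw [h6] <;> norm_num
  rw [halfBox_re hn hζ, halfBox_re hn hζ]
  constructor
  · intro h4
    rw [key (B.lt_leaf _ _ h4)] at h4
    exact (h.lt_iff hζ hv.le).1 h4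
  · intro h4
    rw [key (B.plus.symm (B.lt_leaf _ _ h4))] at h4
    exact (h.lt_iff hζ hv.le).1 h4

end chart

/-! ### The components of the complement of a leaf of `𝓕⁻` -/

/-- There are points of `J` just after `y`. -/
def PosSide (B : OrientedBifoliatedPlane P) (J : Set P) (y : P) : Prop := ∃ᶠ z in 𝓝 y, z ∈ J ∧ B.lt y z

/-- There are points of `J` just before `y`. -/
def NegSide (B : OrientedBifoliatedPlane P) (J : Set P) (y : P) : Prop := ∃ᶠ z in 𝓝 y, z ∈ J ∧ B.lt z y

/-- A component of the complement of a leaf of `𝓕⁻`, near a boundary point. -/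
lemma exists_minus_sector {x z y : P} {n : ℕ} {e : ℂ → P} (he : B.BiChart n e y) (hxy : B.minus x y)
    {w₁ : ℂ} (hy : e w₁ ∈ closure (leafComp B.minus x z)) :
    ∃ ω ∈ rayDirs n, (∀ w, e w ∈ leafComp B.minus x z → 0 < (w ^ n).re * (ω ^ n).re) ∧
      (∀ t : ℝ, 0 < t → e (t • ω) ∈ leafComp B.minus x z) := by
  have hn := he.ne_zero
  obtain ⟨κ, hκ, hκ0⟩ := exists_rot n hn
  have hord := he.ord_eq
  subst hord
  have h1 := he.nice_minus hκ hκ0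
  obtain ⟨ζ, hζ, h2, -⟩ := B.minusFol.exists_sector_leafComp (z := z) hxy h1 (w₁ := κ * w₁)
    (by simpa [hκ0] using hy)
  set n := B.ord y
  have hωn : (κ⁻¹ * ζ) ^ n = (ζ ^ n).im := by
    rw [mul_pow, inv_pow, hκ, sectorDirs_pow hζ]
    simp [mul_comm, ← mul_assoc]
  -- The sector of the component in the rotated chart has direction `ζ`. Rotated back, its middle
  -- line is the half-leaf of `𝓕⁺` at `y` that points into the component.
  refine ⟨κ⁻¹ * ζ, ?_, ?_, ?_⟩
  · show _ = _ ∨ _ = _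
    rw [hωn]
    rcases sectorDirs_im hζ with h3 | h3 <;> rw [h3] <;> simp
  · intro w hw
    have h3 := (h2 (κ * w)).1 (by simpa [hκ0] using hw)
    have h4 := sector_im hn hζ h3
    rw [hωn, Complex.ofReal_re]
    rw [mul_pow, hκ] at h4
    simpa using h4
  · intro t ht
    have h3 := (h2 (t • ζ)).2 ⟨0, t ^ n, by positivity, ?_⟩
    · have h4 : κ⁻¹ * t • ζ = t • (κ⁻¹ * ζ) := mul_smul_comm _ _ _
      rw [← h4]
      exact h3
    · have hζ0 := sectorDirs_ne_zero hn hζ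
      simp only [halfBox, rootBranch, Complex.ofReal_zero, zero_add]
      rw [mul_div_assoc, div_self (pow_ne_zero _ hζ0), mul_one,
        show ((n : ℂ)⁻¹) = (((n : ℝ)⁻¹ : ℝ) : ℂ) by simp, ← Complex.ofReal_cpow (by positivity),
        Real.pow_rpow_inv_natCast ht.le hn, mul_comm, Complex.real_smul]

lemma frequently_ray {n : ℕ} {e : ℂ → P} {y : P} (he : B.BiChart n e y) (ω : ℂ) {J : Set P}
    (h : ∀ t : ℝ, 0 < t → e (t • ω) ∈ J) : ∃ᶠ z in 𝓝 y, z ∈ J ∧ ∃ t : ℝ, 0 < t ∧ z = e (t • ω) := by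
  have h1 : Continuous fun t : ℝ => e (t • ω) := he.emb.continuous.comp (by fun_prop)
  have h2 := (h1.tendsto 0).mono_left (nhdsWithin_le_nhds (s := Ioi 0))
  simp only [zero_smul, he.zero] at h2
  refine h2.frequently (Eventually.frequently ?_)
  filter_upwards [self_mem_nhdsWithin] with t ht
  exact ⟨h t ht, t, ht, rfl⟩

lemma im_smul_rayDir {n : ℕ} {ω : ℂ} (hω : ω ∈ rayDirs n) (t : ℝ) : ((t • ω) ^ n).im = 0 :=
  smul_mem_prong (rayDirs_subset_prong hω) t

/-- A component of the complement of a leaf of `𝓕⁻` lies on one side of each of its boundary points. -/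
lemma side_dichotomy {x z y : P} (hy : y ∈ leafBd B.minus x z) :
    (PosSide B (leafComp B.minus x z) y ∧ ¬ NegSide B (leafComp B.minus x z) y ∧
      ∀ᶠ y' in 𝓝 y, y' ∈ leafBd B.minus x z → ¬ NegSide B (leafComp B.minus x z) y') ∨
    (NegSide B (leafComp B.minus x z) y ∧ ¬ PosSide B (leafComp B.minus x z) y ∧
      ∀ᶠ y' in 𝓝 y, y' ∈ leafBd B.minus x z → ¬ PosSide B (leafComp B.minus x z) y') := by
  obtain ⟨e, he, -⟩ := B.exists_biChart y univ_mem
  set n := B.ord y with hn'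
  have hn := he.ne_zero
  obtain ⟨ω, hω, h1, h2⟩ := exists_minus_sector he hy.2 (w₁ := 0) (by rw [he.zero]; exact hy.1)
  set J := leafComp B.minus x z
  have hfr := frequently_ray he ω h2
  have hre : ∀ t : ℝ, 0 < t → 0 < ((t • ω) ^ n).re * (ω ^ n).re := fun t ht => h1 _ (h2 t ht)
  have hmin : ∀ w, B.minus x (e w) → (w ^ n).re = 0 := fun w hw =>
    he.axis_minus w (B.minus.trans (B.minus.symm hy.2) hw)
  -- In the chart `Re (w ^ n)` has the sign of `Re (ω ^ n)` on all of `J` and vanishes on the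
  -- boundary leaf. For a point of `J` comparable with a nearby boundary point, the order is
  -- therefore decided by this one sign.
  have hnear : ∀ w, B.minus x (e w) → ∀ᶠ z in 𝓝 (e w), z ∈ J → ∃ w', 0 < (w' ^ n).re * (ω ^ n).re ∧
      z = e w' ∧ (B.lt (e w) z → 0 < (w' ^ n).re) ∧ (B.lt z (e w) → (w' ^ n).re < 0) := by
    intro w hw
    rw [← he.emb.map_nhds_eq, eventually_map]
    by_cases hw0 : w = 0
    · subst hw0
      rw [he.zero]
      refine Eventually.of_forall fun w' hw' => ⟨w', h1 w' hw', rfl, ?_, ?_⟩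
      · intro h3
        exact (he.lt_center (he.axis_plus _ (B.lt_leaf _ _ h3))).1.1 h3
      · intro h3
        exact (he.lt_center (he.axis_plus _ (B.plus.symm (B.lt_leaf _ _ h3)))).2.1 h3
    · have him : (w ^ n).im ≠ 0 := fun h0 => pow_ne_zero n hw0 (Complex.ext (hmin w hw) h0)
      filter_upwards [he.eventually_lt_iff him] with w' h3 hw'
      rw [hmin w hw] at h3
      exact ⟨w', h1 w' hw', rfl, h3.1, h3.2⟩
  have hneg : 0 < (ω ^ n).re → ∀ w, B.minus x (e w) → ¬ NegSide B J (e w) := by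
    intro h3 w hw h4
    obtain ⟨z, ⟨hz, hlt⟩, h5⟩ := (h4.and_eventually (hnear w hw)).exists
    obtain ⟨w', h6, rfl, -, h7⟩ := h5 hz
    nlinarith [h7 hlt]
  have hpos : (ω ^ n).re < 0 → ∀ w, B.minus x (e w) → ¬ PosSide B J (e w) := by
    intro h3 w hw h4
    obtain ⟨z, ⟨hz, hlt⟩, h5⟩ := (h4.and_eventually (hnear w hw)).exists
    obtain ⟨w', h6, rfl, h7, -⟩ := h5 hz
    nlinarith [h7 hlt]
  have h0 : (ω ^ n).re ≠ 0 := by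
    rcases hω with h | h <;> rw [h] <;> simp
  rcases lt_or_gt_of_ne h0 with h3 | h3
  · right
    refine ⟨hfr.mono ?_, ?_, ?_⟩
    · rintro z ⟨hz, t, ht, rfl⟩
      refine ⟨hz, (he.lt_center (im_smul_rayDir hω t)).2.2 ?_⟩
      nlinarith [hre t ht]
    · have := hpos h3 0 (by rw [he.zero]; exact hy.2)
      rwa [he.zero] at this
    · filter_upwards [he.range_mem] with y' ⟨w, hw⟩ hy'
      subst hw
      exact hpos h3 w hy'.2
  · left
    refine ⟨hfr.mono ?_, ?_, ?_⟩
    · rintro z ⟨hz, t, ht, rfl⟩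
      refine ⟨hz, (he.lt_center (im_smul_rayDir hω t)).1.2 ?_⟩
      nlinarith [hre t ht]
    · have := hneg h3 0 (by rw [he.zero]; exact hy.2)
      rwa [he.zero] at this
    · filter_upwards [he.range_mem] with y' ⟨w, hw⟩ hy'
      subst hw
      exact hneg h3 w hy'.2

lemma not_posSide_and_negSide {x z y : P} (hy : y ∈ leafBd B.minus x z) :
    (PosSide B (leafComp B.minus x z) y ↔ ¬ NegSide B (leafComp B.minus x z) y) := by
  have := side_dichotomy hy
  tauto

/-- The side of a component of the complement of a leaf of `𝓕⁻` is the same at all boundary points. -/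
lemma posSide_iff {x z y y' : P} (hz : ¬ B.minus x z) (hy : y ∈ leafBd B.minus x z)
    (hy' : y' ∈ leafBd B.minus x z) :
    PosSide B (leafComp B.minus x z) y ↔ PosSide B (leafComp B.minus x z) y' := by
  refine (B.minusFol.isPreconnected_leafBd hz).induction₂
    (fun a b => PosSide B (leafComp B.minus x z) a ↔ PosSide B (leafComp B.minus x z) b)
    ?_ (fun _ _ _ _ _ _ => Iff.trans) (fun _ _ _ _ => Iff.symm) hy hy'
  intro a ha
  rcases side_dichotomy ha with ⟨h1, h2, h3⟩ | ⟨h1, h2, h3⟩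
  · filter_upwards [mem_nhdsWithin_of_mem_nhds h3, self_mem_nhdsWithin] with b hb hb'
    have := not_posSide_and_negSide hb'
    have := hb hb'
    tauto
  · filter_upwards [mem_nhdsWithin_of_mem_nhds h3, self_mem_nhdsWithin] with b hb hb'
    have := hb hb'
    tauto

/-- A line crosses a leaf of `𝓕⁻` only at isolated points. -/
lemma IsLine.eventually_not_minus {g : ℝ → P} (hg : B.IsLine g) (s : ℝ) :
    ∀ᶠ t in 𝓝[≠] s, ¬ B.minus (g s) (g t) := by
  obtain ⟨e, he, -⟩ := B.exists_biChart (g s) univ_mem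
  filter_upwards [mem_nhdsWithin_of_mem_nhds (hg.cont.continuousAt he.range_mem), self_mem_nhdsWithin] with t ht hts hm
  obtain ⟨w, hw⟩ := ht
  have h1 := he.axis_plus w (by rw [hw]; exact hg.rel s t)
  have h2 := he.axis_minus w (by rwa [hw])
  have h3 := he.lt_center h1
  rw [hw, hg.lt_iff, hg.lt_iff, h2] at h3
  rcases lt_or_gt_of_ne (show t ≠ s from hts) with h4 | h4
  · exact _root_.lt_irrefl _ (h3.2.1 h4)
  · exact _root_.lt_irrefl _ (h3.1.1 h4)

/-- A leaf of `𝓕⁻` meets an oriented arc in a leaf of `𝓕⁺` at most once. -/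
theorem not_minus_of_lt {a b : P} (hab : B.lt a b) : ¬ B.minus a b := by
  intro hm
  obtain ⟨g, hg, s, t₀, hst, rfl, rfl⟩ := exists_line_of_lt hab
  obtain ⟨δ, hδ, h1⟩ : ∃ δ > s, ∀ t ∈ Ioo s δ, ¬ B.minus (g s) (g t) := by
    have h1 := (hg.eventually_not_minus s).filter_mono (nhdsWithin_mono s (fun t (ht : s < t) => ht.ne'))
    obtain ⟨δ, hδ, h2⟩ := mem_nhdsGT_iff_exists_Ioo_subset.1 h1
    exact ⟨δ, hδ, fun t ht => h2 ht⟩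
  have hδt : δ ≤ t₀ := by
    by_contra hcon
    exact h1 t₀ ⟨hst, not_le.1 hcon⟩ hm
  have hcl : IsClosed (Icc δ t₀ ∩ g ⁻¹' leafOf B.minus (g s)) :=
    isClosed_Icc.inter ((B.minusFol.isClosed_leaf _).preimage hg.cont)
  have hcpt : IsCompact (Icc δ t₀ ∩ g ⁻¹' leafOf B.minus (g s)) :=
    isCompact_Icc.of_isClosed_subset hcl inter_subset_left
  -- The first return of the arc to the leaf; it exists because crossings are isolated and the leaf
  -- is closed.
  obtain ⟨t₁, ⟨ht₁, hm₁⟩, hmin⟩ := hcpt.exists_isLeast ⟨t₀, ⟨hδt, le_rfl⟩, hm⟩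
  have hm₁ : B.minus (g s) (g t₁) := hm₁
  have hst₁ : s < t₁ := lt_of_lt_of_le hδ ht₁.1
  have hoff : ∀ t ∈ Ioo s t₁, ¬ B.minus (g s) (g t) := by
    intro t ht hmt
    by_cases htδ : t < δ
    · exact h1 t ⟨ht.1, htδ⟩ hmt
    · exact absurd (hmin ⟨⟨not_lt.1 htδ, ht.2.le.trans ht₁.2⟩, hmt⟩) (not_le.2 ht.2)
  obtain ⟨r, hr⟩ := exists_between hst₁
  -- Between the two crossings the arc stays in one component. This lies on the positive side of `g
  -- s` and on the negative side of `g t₁`, although its side is the same at all boundary points.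
  have hsub : g '' Ioo s t₁ ⊆ leafComp B.minus (g s) (g r) := by
    refine (isPreconnected_Ioo.image _ hg.cont.continuousOn).subset_connectedComponentIn ⟨r, hr, rfl⟩ ?_
    rintro _ ⟨t, ht, rfl⟩
    exact hoff t ht
  have hpos : ∃ᶠ z in 𝓝 (g s), z ∈ leafComp B.minus (g s) (g r) ∧ B.lt (g s) z := by
    refine (hg.cont.tendsto s).frequently ?_
    refine Frequently.filter_mono (Eventually.frequently ?_) (nhdsWithin_le_nhds (s := Ioi s))
    filter_upwards [Ioo_mem_nhdsGT hst₁] with t ht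
    exact ⟨hsub ⟨t, ht, rfl⟩, (hg.lt_iff _ _).2 ht.1⟩
  have hneg : ∃ᶠ z in 𝓝 (g t₁), z ∈ leafComp B.minus (g s) (g r) ∧ B.lt z (g t₁) := by
    refine (hg.cont.tendsto t₁).frequently ?_
    refine Frequently.filter_mono (Eventually.frequently ?_) (nhdsWithin_le_nhds (s := Iio t₁))
    filter_upwards [Ioo_mem_nhdsLT hst₁] with t ht
    exact ⟨hsub ⟨t, ht, rfl⟩, (hg.lt_iff _ _).2 ht.2⟩
  have hs_bd : g s ∈ leafBd B.minus (g s) (g r) :=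
    ⟨mem_closure_iff_frequently.2 (hpos.mono fun _ h => h.1), B.minus.refl _⟩
  have ht_bd : g t₁ ∈ leafBd B.minus (g s) (g r) :=
    ⟨mem_closure_iff_frequently.2 (hneg.mono fun _ h => h.1), hm₁⟩
  exact (not_posSide_and_negSide ht_bd).1 ((posSide_iff (hoff r hr) hs_bd ht_bd).1 hpos) hneg

end OrientedBifoliatedPlane

namespace OrientedBifoliatedPlane

variable {P : Type*} [TopologicalSpace P] {B : OrientedBifoliatedPlane P}

lemma isPreconnected_prong {m : ℕ} : IsPreconnected (prong m) := by
  refine isPreconnected_of_forall 0 fun y hy => ⟨(fun t : ℝ => t • y) '' Icc 0 1, ?_, ⟨0, by simp, by simp⟩,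
    ⟨1, by simp, by simp⟩, isPreconnected_smul_segment y⟩
  rintro _ ⟨t, -, rfl⟩
  exact smul_mem_prong hy t

/-! ### Separation by the negative half-leaves of a singularity -/

lemma ord_eq_one {s y : P} (hs : 2 ≤ B.ord s) (h : B.plus s y) (hne : y ≠ s) : B.ord y = 1 := by
  by_contra h1
  exact hne (eq_of_ord hs (by have := B.ord_pos y; omega) h).symm

/-- A connected part of a leaf that avoids the singularity lies in one half-leaf. -/
lemma lt_iff_of_connected {s : P} (hs : 2 ≤ B.ord s) {C : Set P} (hC : IsPreconnected C)
    (hsub : C ⊆ leafOf B.plus s \ {s}) {p q : P} (hp : p ∈ C) (hq : q ∈ C) (h : B.lt s p) : B.lt s q := by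
  obtain ⟨m, γ, hγ⟩ := B.exists_plusParam s
  have hm := hγ.ne_zero
  have hs0 : s = γ ⟨0, zero_mem_prong hm⟩ := by
    refine eq_of_ord hs ?_ (hγ.rel _)
    obtain ⟨o, rfl⟩ := hγ.exists_eq (B.plus.refl s)
    have ho : (o : ℂ) = 0 := by
      by_contra h0
      have := B.plusFol.ord_of_ne hγ.toLeafParam h0
      omega
    rwa [show o = ⟨0, zero_mem_prong hm⟩ from Subtype.ext ho] at hs
  have hCr : C ⊆ range γ := by
    rw [hγ.range_eq]
    exact fun c hc => (hsub hc).1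
  have hpre : IsPreconnected (Subtype.val '' (γ ⁻¹' C)) := by
    have h1 : IsPreconnected (γ ⁻¹' C) := by
      rw [← hγ.emb.isInducing.isPreconnected_image, image_preimage_eq_of_subset hCr]
      exact hC
    exact h1.image _ continuous_subtype_val.continuousOn
  have h0 : (0 : ℂ) ∉ Subtype.val '' (γ ⁻¹' C) := by
    rintro ⟨c, hc, hc0⟩
    apply (hsub hc).2
    rw [mem_singleton_iff, hs0]
    congr 1
    exact Subtype.ext hc0
  obtain ⟨a, rfl⟩ := hCr hp
  obtain ⟨b, rfl⟩ := hCr hq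
  have hray := hpre.sameRay_of_prong hm (by rintro _ ⟨c, -, rfl⟩; exact c.2) h0 ⟨a, hp, rfl⟩ ⟨b, hq, rfl⟩
  obtain ⟨r, hr, hrb⟩ := hray.exists_pos_left (fun h => h0 ⟨a, hp, h⟩) (fun h => h0 ⟨b, hq, h⟩)
  rw [hs0, hγ.lt_iff] at h ⊢
  have h1 := h.1
  simp only [ne_eq, hm, not_false_eq_true, zero_pow, Complex.zero_re] at h1
  have h2 : 0 < ((b : ℂ) ^ m).re := by
    rw [← hrb, re_smul_pow]
    positivity
  exact ⟨by simpa [hm] using h2, Or.inl (SameRay.zero_left _)⟩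

/-- The open half-leaf of `y` of the singular leaf with singularity `s`. -/
abbrev ray (B : OrientedBifoliatedPlane P) (s y : P) : Set P := connectedComponentIn (leafOf B.plus s \ {s}) y

lemma mem_diff_of_lt {s y : P} (h : B.lt s y) : y ∈ leafOf B.plus s \ {s} :=
  ⟨B.lt_leaf _ _ h, fun h1 => lt_ne h h1.symm⟩

lemma mem_ray_of_lt {s p q : P} (hs : B.lt s p) (h : B.lt p q) : q ∈ ray B s p := by
  obtain ⟨g, hg, a, b, hab, rfl, rfl⟩ := exists_line_of_lt h
  refine (isPreconnected_Icc.image g hg.cont.continuousOn).subset_connectedComponentIn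
    ⟨a, ⟨le_rfl, hab.le⟩, rfl⟩ ?_ ⟨b, ⟨hab.le, le_rfl⟩, rfl⟩
  rintro _ ⟨t, ht, rfl⟩
  refine mem_diff_of_lt ?_
  rcases ht.1.eq_or_lt with rfl | h1
  · exact hs
  · exact lt_trans hs ((hg.lt_iff _ _).2 h1)

lemma ray_symm {s p q : P} (hp : p ∈ leafOf B.plus s \ {s}) (h : q ∈ ray B s p) : p ∈ ray B s q := by
  rw [ray, ← connectedComponentIn_eq h]
  exact mem_connectedComponentIn hp

lemma lt_trichotomy_of_mem_ray {s p q : P} (hs : 2 ≤ B.ord s) (hp : p ∈ leafOf B.plus s \ {s}) (h : q ∈ ray B s p) :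
    B.lt p q ∨ p = q ∨ B.lt q p := by
  refine lt_trichotomy_of_connected (C := ray B s p) isPreconnected_connectedComponentIn ?_ ?_
    (mem_connectedComponentIn hp) h
  · intro c hc
    exact B.plus.trans (B.plus.symm hp.1) (connectedComponentIn_subset _ _ hc).1
  · intro c hc
    have := connectedComponentIn_subset _ _ hc
    exact ord_eq_one hs this.1 this.2

lemma lt_of_mem_ray {s p q : P} (hs : 2 ≤ B.ord s) (hp : B.lt s p) (h : q ∈ ray B s p) : B.lt s q :=
  lt_iff_of_connected hs isPreconnected_connectedComponentIn (connectedComponentIn_subset _ _)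
    (mem_connectedComponentIn (mem_diff_of_lt hp)) h hp

/-- The closed negative side of `s`. -/
def lowerSet (B : OrientedBifoliatedPlane P) (s : P) : Set P := {z | z = s ∨ B.lt z s}

/-- Different positive half-leaves of a singularity are separated by the negative half-leaves. -/
lemma mem_ray_of_mem_component {s y y' : P} (hs : 2 ≤ B.ord s) (hy : B.lt s y) (hy' : B.lt s y')
    (h : y' ∈ connectedComponentIn (lowerSet B s)ᶜ y) : y' ∈ ray B s y := by
  -- `H z` holds for `z` on the half-leaf of `y` or in a component of the complement of the leaf
  -- that has `y` in its boundary. It is locally constant off the negative half-leaves, and on the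
  -- positive half-leaves it singles out the one of `y`.
  let H : P → Prop := fun z => (¬ B.plus s z ∧ y ∈ closure (leafComp B.plus s z)) ∨ z ∈ ray B s y
  have hray_leaf : ∀ z ∈ ray B s y, B.plus s z := fun z hz => (connectedComponentIn_subset _ _ hz).1
  have hloc : ∀ z ∈ (lowerSet B s)ᶜ, ∃ c, ∀ᶠ z' in 𝓝 z, H z' = c := by
    intro z hz
    by_cases hsz : B.plus s z
    swap
    · refine ⟨H z, ?_⟩
      have h1 : leafComp B.plus s z ∈ 𝓝 z := B.plusFol.isOpen_leafComp.mem_nhds (mem_connectedComponentIn hsz)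
      filter_upwards [h1] with z' hz'
      have h2 : ¬ B.plus s z' := connectedComponentIn_subset _ _ hz'
      have h3 : leafComp B.plus s z' = leafComp B.plus s z := (connectedComponentIn_eq hz').symm
      have h4 : z ∉ ray B s y := fun h => hsz (hray_leaf _ h)
      have h5 : z' ∉ ray B s y := fun h => h2 (hray_leaf _ h)
      simp only [H, h2, h3, h4, h5, hsz]
    have hlt : B.lt s z := by
      rcases lt_trichotomy_of_ord hs hsz with h1 | h1 | h1
      · exact h1
      · exact absurd (Or.inl h1.symm) hz
      · exact absurd (Or.inr h1) hz
    have := B.plusFol.t2Space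
    obtain ⟨e, he, hr⟩ := B.exists_biChart z
      (isOpen_compl_singleton.mem_nhds (show z ∈ ({s} : Set P)ᶜ from fun h => lt_ne hlt h.symm))
    have hnz := he.ord_eq
    have hz1 : B.ord z = 1 := ord_eq_one hs hsz (lt_ne hlt).symm
    have hD : IsPreconnected (e '' {w | w.im = 0}) := by
      refine IsPreconnected.image ?_ _ he.emb.continuous.continuousOn
      have : Convex ℝ {w : ℂ | w.im = 0} := convex_hyperplane (r := 0) Complex.imLm.isLinear
      exact this.isPreconnected
    have hDsub : e '' {w | w.im = 0} ⊆ leafOf B.plus s \ {s} := by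
      rintro _ ⟨w, hw, rfl⟩
      refine ⟨B.plus.trans hsz (he.nice.rel ?_), fun h1 => hr ⟨w, h1⟩ rfl⟩
      rw [hz1, pow_one]
      exact hw
    have hzD : z ∈ e '' {w | w.im = 0} := ⟨0, by simp, he.zero⟩
    refine ⟨z ∈ ray B s y, ?_⟩
    filter_upwards [he.range_mem] with z' ⟨w, hw⟩
    subst hw
    by_cases hw0 : w.im = 0
    · have hwD : e w ∈ e '' {w | w.im = 0} := ⟨w, hw0, rfl⟩
      have h1 : B.plus s (e w) := (hDsub hwD).1
      have h2 : e w ∈ ray B s z := hD.subset_connectedComponentIn hzD hDsub hwD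
      have h3 : ray B s (e w) = ray B s z := (connectedComponentIn_eq h2).symm
      apply propext
      simp only [H, h1, not_true_eq_false, false_and, false_or]
      constructor
      · intro h4
        have h5 : ray B s y = ray B s (e w) := connectedComponentIn_eq h4
        rw [h5, h3]
        exact mem_connectedComponentIn (mem_diff_of_lt hlt)
      · intro h4
        have h5 : ray B s y = ray B s z := connectedComponentIn_eq h4
        rw [h5]
        exact h2
    · have hnp : ¬ B.plus s (e w) := by
        intro h1
        have := he.axis_plus w (B.plus.trans (B.plus.symm hsz) h1)
        rw [hz1, pow_one] at this
        exact hw0 this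
      have h1 : e w ∉ ray B s y := fun h => hnp (hray_leaf _ h)
      have hwi : (w ^ B.ord z).im ≠ 0 := by rw [hz1, pow_one]; exact hw0
      obtain ⟨ζ, hζ, hwζ⟩ := exists_sector he.ne_zero hwi
      -- Both components next to `z` have `z` in their boundary. Such a boundary is a line, so it
      -- contains `y` only if `y` and `z` are comparable, that is, on the same half-leaf; and it
      -- contains the whole regular half-leaf of each of its regular points.
      have h2 : z ∈ leafBd B.plus s (e w) := by
        have := B.plusFol.mem_leafBd_sector he.nice hζ hwζ
        rw [leafBd, leafComp] at this ⊢
        rwa [← leafOf_eq hsz] at this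
      apply propext
      simp only [H, hnp, not_false_eq_true, true_and, h1, or_false]
      constructor
      · intro h3
        have h4 : y ∈ leafBd B.plus s (e w) := ⟨h3, B.lt_leaf _ _ hy⟩
        rcases lt_trichotomy_leafBd hnp h4 h2 with h5 | h5 | h5
        · exact mem_ray_of_lt hy h5
        · rw [← h5]
          exact mem_connectedComponentIn (mem_diff_of_lt hy)
        · exact ray_symm (mem_diff_of_lt hlt) (mem_ray_of_lt hlt h5)
      · intro h3
        refine (B.plusFol.mem_leafBd_of_connected (C := ray B s y) isPreconnected_connectedComponentIn
          (fun c hc => hray_leaf c hc) ?_ h3 (mem_connectedComponentIn (mem_diff_of_lt hy)) h2).1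
        intro c hc
        have := connectedComponentIn_subset _ _ hc
        exact ord_eq_one hs this.1 this.2
  have hyQ : y ∈ (lowerSet B s)ᶜ := by
    rintro (h1 | h1)
    · exact lt_ne hy h1.symm
    · exact lt_asymm hy h1
  have h1 := locConst_on hloc isPreconnected_connectedComponentIn (connectedComponentIn_subset _ _)
    (mem_connectedComponentIn hyQ) h
  have h2 : H y := Or.inr (mem_connectedComponentIn (mem_diff_of_lt hy))
  rw [h1] at h2
  exact h2.resolve_left fun h3 => h3.1 (B.lt_leaf _ _ hy')

/-- Incomparable points on the positive side of a point lie on different half-leaves of a singularity. -/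
lemma exists_ord_of_not_comparable {x y y' : P} (hy : B.lt x y) (hy' : B.lt x y') :
    (B.lt y y' ∨ y = y' ∨ B.lt y' y) ∨ ∃ s, 2 ≤ B.ord s ∧ B.lt s y ∧ B.lt s y' := by
  obtain ⟨m, γ, hγ⟩ := B.exists_plusParam x
  have hm := hγ.ne_zero
  obtain ⟨a, rfl⟩ := hγ.exists_eq (B.plus.refl x)
  obtain ⟨b, rfl⟩ := hγ.exists_eq (B.lt_leaf _ _ hy)
  obtain ⟨c, rfl⟩ := hγ.exists_eq (B.lt_leaf _ _ hy')
  rw [hγ.lt_iff] at hy hy'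
  have hz : ∀ z : prong m, ((z : ℂ) ^ m).re = 0 → (z : ℂ) = 0 := fun z h1 => by
    by_contra h0
    exact prong_re_ne_zero z.2 h0 h1
  -- If `b` is not beyond the centre, then `a` is on a negative ray, and `b` is on that ray or at
  -- the centre. Everything on the positive side of `a` is then comparable with `b`.
  have main : ∀ b c : prong m, prongLt m a b → prongLt m a c → ((b : ℂ) ^ m).re ≤ 0 →
      (B.lt (γ b) (γ c) ∨ γ b = γ c ∨ B.lt (γ c) (γ b)) := by
    intro b c hb hc hb0
    have ha0 : ((a : ℂ) ^ m).re < 0 := hb.1.trans_le hb0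
    have ha : (a : ℂ) ≠ 0 := by
      intro h0
      simp [h0, hm] at ha0
    have hab : SameRay ℝ (a : ℂ) b := by
      rcases hb.2 with h1 | h1
      · exact h1
      · rw [hz b (le_antisymm hb0 h1.2)]
        exact SameRay.zero_right _
    by_cases hbc : b = c
    · exact Or.inr (Or.inl (by rw [hbc]))
    have hbc' : (b : ℂ) ≠ c := fun h => hbc (Subtype.ext h)
    rw [hγ.lt_iff, hγ.lt_iff]
    have hfin : SameRay ℝ (b : ℂ) c → prongLt m (b : ℂ) c ∨ γ b = γ c ∨ prongLt m (c : ℂ) b := by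
      intro h1
      rcases prongLt_of_sameRay hm b.2 c.2 h1 hbc' with h2 | h2
      · exact Or.inl h2
      · exact Or.inr (Or.inr h2)
    rcases hc.2 with h1 | h1
    · exact hfin (hab.symm.trans h1 fun h => absurd h ha)
    · rcases hb0.eq_or_lt with h2 | h2
      · rw [hz b h2] at hfin
        rw [hz b h2]
        exact hfin (SameRay.zero_left _)
      · exact Or.inl ⟨h2.trans_le h1.2, Or.inr ⟨hb0, h1.2⟩⟩
  by_cases hb0 : ((b : ℂ) ^ m).re ≤ 0
  · exact Or.inl (main b c hy hy' hb0)
  by_cases hc0 : ((c : ℂ) ^ m).re ≤ 0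
  · left
    have := main c b hy' hy hc0
    tauto
  push Not at hb0 hc0
  have hoc := B.plusFol.ord_center hγ.toLeafParam
  set o : prong m := ⟨0, zero_mem_prong hm⟩ with ho
  have hlt : ∀ b : prong m, 0 < ((b : ℂ) ^ m).re → B.lt (γ o) (γ b) := by
    intro b hb
    rw [hγ.lt_iff]
    exact ⟨by simpa [ho, hm] using hb, Or.inl (SameRay.zero_left _)⟩
  by_cases hm1 : m = 1
  · left
    refine lt_trichotomy_of_connected (C := leafOf B.plus (γ a)) ?_ ?_ ?_ (hγ.rel b) (hγ.rel c)
    · have h2 : IsPreconnected (prong m) := isPreconnected_prong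
      rw [← hγ.range_eq]
      have := isPreconnected_iff_preconnectedSpace.1 h2
      exact isPreconnected_range hγ.emb.continuous
    · rw [leafOf_eq (hγ.rel b)]
    · rw [← hγ.range_eq]
      rintro _ ⟨d, rfl⟩
      by_cases hd : (d : ℂ) = 0
      · rw [show d = o from Subtype.ext hd, hoc, hm1]
      · exact B.plusFol.ord_of_ne hγ.toLeafParam hd
  · exact Or.inr ⟨γ o, by omega, hlt b hb0, hlt c hc0⟩

/-! ### Heights -/

section height

variable {G : Type*} [Group G] [MulAction G P] {h : P → ℝ} (hh : B.IsHeight G h)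
include hh

lemma height_lt {s y y' : P} (hs : 2 ≤ B.ord s) (hy : B.lt s y) (hyy : B.lt y y') : h y < h y' :=
  (hh.pos s y hs hy).2 y (Or.inr (mem_connectedComponentIn (mem_diff_of_lt hy))) y'
    (Or.inr (mem_ray_of_lt hy hyy)) hyy

lemma height_pos {s y : P} (hs : 2 ≤ B.ord s) (hy : B.lt s y) : 0 < h y := by
  rw [← hh.zero s hs]
  exact (hh.pos s y hs hy).2 s (Or.inl rfl) y (Or.inr (mem_connectedComponentIn (mem_diff_of_lt hy))) hy

lemma height_eq_of_mem_ray {s y y' : P} (hs : 2 ≤ B.ord s) (hy : B.lt s y) (hr : y' ∈ ray B s y)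
    (he : h y = h y') : y = y' := by
  rcases lt_trichotomy_of_mem_ray hs (mem_diff_of_lt hy) hr with h1 | h1 | h1
  · exact absurd he (height_lt hh hs hy h1).ne
  · exact h1
  · exact absurd he (height_lt hh hs (lt_of_mem_ray hs hy hr) h1).ne'

lemma exists_height_eq {s y : P} (hs : 2 ≤ B.ord s) (hy : B.lt s y) {c : ℝ} (hc : 0 < c) :
    ∃ y' ∈ ray B s y, B.lt s y' ∧ h y' = c := by
  obtain ⟨⟨e, he⟩, -⟩ := hh.pos s y hs hy
  obtain ⟨⟨y', hy'⟩, h1⟩ := e.surjective ⟨c, hc.le⟩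
  have h2 : h y' = c := by rw [← he ⟨y', hy'⟩, h1]
  rcases hy' with rfl | hy'
  · rw [hh.zero _ hs] at h2
    exact absurd h2 hc.ne
  · exact ⟨y', hy', lt_of_mem_ray hs hy hy', h2⟩

omit hh

/-- The identifications of points on the positive half-leaves of the singular leaves. -/
def Edge (B : OrientedBifoliatedPlane P) (h : P → ℝ) (y y' : P) : Prop :=
  ∃ s, 2 ≤ B.ord s ∧ B.lt s y ∧ B.lt s y' ∧ h y = h y'

/-- The relation generated by the leaves of `𝓕⁻` and the identifications. -/
def Linked (B : OrientedBifoliatedPlane P) (h : P → ℝ) : P → P → Prop :=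
  Relation.ReflTransGen fun y y' => B.minus y y' ∨ Edge B h y y'

/-- `y'` can be reached from `y` by following leaves of `𝓕⁻` and `k` identifications. -/
def Chain (B : OrientedBifoliatedPlane P) (h : P → ℝ) : ℕ → P → P → Prop
  | 0, p, y => B.minus p y
  | k + 1, p, y => ∃ q s p', B.minus p q ∧ 2 ≤ B.ord s ∧ B.lt s q ∧ B.lt s p' ∧ h q = h p' ∧ Chain B h k p' y

lemma Chain.cons {k : ℕ} {p p' y : P} (hp : B.minus p p') (hc : Chain B h k p' y) : Chain B h k p y := by
  cases k with
  | zero => exact B.minus.trans hp hc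
  | succ k =>
    obtain ⟨q, s, r, h1, h2⟩ := hc
    exact ⟨q, s, r, B.minus.trans hp h1, h2⟩

lemma Linked.exists_chain {x y : P} (hl : Linked B h x y) : ∃ k, Chain B h k x y := by
  induction hl using Relation.ReflTransGen.head_induction_on with
  | refl => exact ⟨0, B.minus.refl _⟩
  | head h1 _ ih =>
    obtain ⟨k, hk⟩ := ih
    rcases h1 with h1 | ⟨s, h2, h3, h4, h5⟩
    · exact ⟨k, hk.cons h1⟩
    · exact ⟨k + 1, _, s, _, B.minus.refl _, h2, h3, h4, h5, hk⟩

lemma Linked.symm {x y : P} (hl : Linked B h x y) : Linked B h y x := by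
  induction hl with
  | refl => exact Relation.ReflTransGen.refl
  | tail _ h1 ih =>
    refine Relation.ReflTransGen.head ?_ ih
    rcases h1 with h1 | ⟨s, h2, h3, h4, h5⟩
    · exact Or.inl (B.minus.symm h1)
    · exact Or.inr ⟨s, h2, h4, h3, h5.symm⟩

lemma Linked.trans {x y z : P} (h1 : Linked B h x y) (h2 : Linked B h y z) : Linked B h x z :=
  Relation.ReflTransGen.trans h1 h2

lemma Linked.of_minus {x y : P} (h1 : B.minus x y) : Linked B h x y := Relation.ReflTransGen.single (Or.inl h1)

lemma Linked.of_edge {x y : P} (h1 : Edge B h x y) : Linked B h x y := Relation.ReflTransGen.single (Or.inr h1)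

lemma isPreconnected_leaf_minus (x : P) : IsPreconnected (leafOf B.minus x) := by
  obtain ⟨m, γ, hγ⟩ := B.minusFol.exists_leafParam x
  have hstar : IsPreconnected (prong m) := isPreconnected_prong
  rw [← hγ.range_eq]
  have := isPreconnected_iff_preconnectedSpace.1 hstar
  exact isPreconnected_range hγ.emb.continuous

/-- A common point of the leaf of `𝓕⁻` and `lowerSet B s` would be a second point of this leaf on an
oriented arc that passes through `s` and ends at `q`. -/
lemma minus_subset_component {s q : P} (hq : B.lt s q) :
    leafOf B.minus q ⊆ connectedComponentIn (lowerSet B s)ᶜ q := by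
  refine (isPreconnected_leaf_minus q).subset_connectedComponentIn (B.minus.refl q) ?_
  rintro c hc (rfl | h1)
  · exact not_minus_of_lt hq (B.minus.symm hc)
  · exact not_minus_of_lt (lt_trans h1 hq) (B.minus.symm hc)

/-- The closed arc of a leaf of `𝓕⁺` between two comparable points is connected. -/
lemma exists_arc {a b : P} (hab : B.lt a b) : ∃ C : Set P, IsPreconnected C ∧ a ∈ C ∧ b ∈ C ∧
    ∀ c ∈ C, (c = a ∨ B.lt a c) ∧ (c = b ∨ B.lt c b) := by
  obtain ⟨g, hg, s, t, hst, rfl, rfl⟩ := exists_line_of_lt hab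
  refine ⟨g '' Icc s t, isPreconnected_Icc.image g hg.cont.continuousOn, ⟨s, ⟨le_rfl, hst.le⟩, rfl⟩,
    ⟨t, ⟨hst.le, le_rfl⟩, rfl⟩, ?_⟩
  rintro _ ⟨r, hr, rfl⟩
  rw [hg.lt_iff, hg.lt_iff]
  constructor
  · rcases hr.1.eq_or_lt with rfl | h1
    · exact Or.inl rfl
    · exact Or.inr h1
  · rcases hr.2.eq_or_lt with rfl | h1
    · exact Or.inl rfl
    · exact Or.inr h1

lemma isPreconnected_lowerSet (s : P) : IsPreconnected (lowerSet B s) := by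
  refine isPreconnected_of_forall s ?_
  rintro y (rfl | hy)
  · exact ⟨{y}, by rintro _ rfl; exact Or.inl rfl, rfl, rfl, isPreconnected_singleton⟩
  · obtain ⟨C, hC, h1, h2, h3⟩ := exists_arc hy
    exact ⟨C, fun c hc => (h3 c hc).2, h2, h1, hC⟩

include hh

/-- The reason is tree-like: the chain enters the region of `p'` through the singularity `s` and
cannot leave it. By induction the end `y` lies in the region `D` beyond the next singularity `s₂`.
The connected set `lowerSet B s` hangs on the chain before `s₂`, hence outside `D`. So `D` and the
path from `p'` through `s₂` to `D` avoid `lowerSet B s`. Minimality of the chain enters twice: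
consecutive identifications are at different singularities, and each of them changes the region. -/
lemma Chain.mem_component : ∀ (k : ℕ) {p q s p' y : P}, B.minus p q → 2 ≤ B.ord s → B.lt s q → B.lt s p' →
    h q = h p' → Chain B h k p' y → (∀ j < k + 1, ¬ Chain B h j p y) →
    y ∈ connectedComponentIn (lowerSet B s)ᶜ p' := by
  intro k
  induction k with
  | zero =>
    intro p q s p' y _ _ _ hp' _ hc _
    exact minus_subset_component hp' hc
  | succ k ih =>
    intro p q s p' y hpq hs hq hp' hqp hc hmin
    obtain ⟨q₁, s₂, p₂, h1, hs₂, hq₁, hp₂, he, hc₂⟩ := hc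
    have hmin₂ : ∀ j < k + 1, ¬ Chain B h j p' y := fun j hj hcj =>
      hmin (j + 1) (by omega) ⟨q, s, p', hpq, hs, hq, hp', hqp, hcj⟩
    have hy := ih h1 hs₂ hq₁ hp₂ he hc₂ hmin₂
    set D := connectedComponentIn (lowerSet B s₂)ᶜ p₂ with hD
    have hnot : ∀ {s x : P}, B.lt s x → x ∈ (lowerSet B s)ᶜ := by
      rintro s x hx (h2 | h2)
      · exact lt_ne hx h2.symm
      · exact lt_asymm hx h2
    -- At one and the same singularity, `p'` and `q₁` would be on one half-leaf and one leaf of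
    -- `𝓕⁻`, hence equal. The two identifications would then merge into one, giving a shorter chain.
    have hne : s₂ ≠ s := by
      rintro rfl
      have h2 : q₁ ∈ ray B s₂ p' := mem_ray_of_mem_component hs₂ hp' hq₁ (minus_subset_component hp' h1)
      have h3 : p' = q₁ := by
        rcases lt_trichotomy_of_mem_ray hs₂ (mem_diff_of_lt hp') h2 with h3 | h3 | h3
        · exact absurd h1 (not_minus_of_lt h3)
        · exact h3
        · exact absurd (B.minus.symm h1) (not_minus_of_lt h3)
      exact hmin (k + 1) (by omega) ⟨q, s₂, p₂, hpq, hs, hq, hp₂, by rw [hqp, h3, he], hc₂⟩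
    have hleaf : ¬ B.plus s s₂ := fun h2 => hne (eq_of_ord hs hs₂ h2).symm
    have hlow : ∀ {s : P}, ∀ z ∈ lowerSet B s, B.plus s z := by
      rintro s z (rfl | h2)
      · exact B.plus.refl _
      · exact B.plus.symm (B.lt_leaf _ _ h2)
    -- Otherwise `q₁` and `p₂` are on the same half-leaf at the same height, hence equal, and the
    -- identification can be dropped.
    have hq₁D : q₁ ∉ D := by
      intro h2
      have h3 := height_eq_of_mem_ray hh hs₂ hp₂ (mem_ray_of_mem_component hs₂ hp₂ hq₁ h2) he.symm
      exact hmin₂ k (by omega) (Chain.cons (h3 ▸ h1) hc₂)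
    obtain ⟨A, hA, hsA, hpA, hA'⟩ := exists_arc hp'
    have hAleaf : ∀ a ∈ A, B.plus s a := by
      intro a ha
      rcases (hA' a ha).1 with rfl | h2
      · exact B.plus.refl _
      · exact B.lt_leaf _ _ h2
    -- the lower set of `s` lies on the other side
    have hout : lowerSet B s ⊆ connectedComponentIn (lowerSet B s₂)ᶜ q₁ := by
      have h2 : IsPreconnected ((lowerSet B s ∪ A) ∪ leafOf B.minus p') :=
        ((isPreconnected_lowerSet s).union s (Or.inl rfl) hsA hA).union p' (Or.inr hpA) (B.minus.refl _)
          (isPreconnected_leaf_minus p')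
      refine fun z hz => h2.subset_connectedComponentIn (Or.inr h1) ?_ (Or.inl (Or.inl hz))
      rintro z ((hz | hz) | hz) hz2
      · exact hleaf (B.plus.trans (hlow z hz) (B.plus.symm (hlow z hz2)))
      · exact hleaf (B.plus.trans (hAleaf z hz) (B.plus.symm (hlow z hz2)))
      · have h3 := minus_subset_component hq₁ (show B.minus q₁ z from B.minus.trans (B.minus.symm h1) hz)
        exact connectedComponentIn_subset _ _ h3 hz2
    have hdis : ∀ z ∈ D, z ∉ lowerSet B s := by
      intro z hz hzs
      have h2 := hout hzs
      apply hq₁D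
      rw [hD, connectedComponentIn_eq hz, ← connectedComponentIn_eq h2]
      exact mem_connectedComponentIn (hnot hq₁)
    obtain ⟨A₁, hA₁, hsA₁, hqA₁, hA₁'⟩ := exists_arc hq₁
    obtain ⟨A₂, hA₂, hsA₂, hpA₂, hA₂'⟩ := exists_arc hp₂
    -- The path from `p'` along its leaf of `𝓕⁻` to `q₁`, through `s₂` to `p₂`, and the region `D`
    -- reached there.
    have hconn : IsPreconnected (((leafOf B.minus p' ∪ A₁) ∪ A₂) ∪ D) :=
      (((isPreconnected_leaf_minus p').union q₁ h1 hqA₁ hA₁).union s₂ (Or.inr hsA₁) hsA₂ hA₂).union p₂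
        (Or.inr hpA₂) (mem_connectedComponentIn (hnot hp₂)) isPreconnected_connectedComponentIn
    refine hconn.subset_connectedComponentIn (Or.inl (Or.inl (Or.inl (B.minus.refl _)))) ?_ (Or.inr hy)
    rintro z (((hz | hz) | hz) | hz) hzs
    · exact connectedComponentIn_subset _ _ (minus_subset_component hp' hz) hzs
    · rcases (hA₁' z hz).1 with rfl | h2
      · exact hleaf (hlow z hzs)
      · exact hleaf (B.plus.trans (hlow z hzs) (B.plus.symm (B.lt_leaf _ _ h2)))
    · rcases (hA₂' z hz).1 with rfl | h2
      · exact hleaf (hlow z hzs)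
      · exact hleaf (B.plus.trans (hlow z hzs) (B.plus.symm (B.lt_leaf _ _ h2)))
    · exact hdis z hz hzs

/-- Following leaves of `𝓕⁻` and identifications one never returns to the positive side of a point. -/
theorem not_linked_of_lt {x y : P} (hxy : B.lt x y) : ¬ Linked B h x y := by
  classical
  intro hl
  have hex := hl.exists_chain
  have hk := Nat.find_spec hex
  have hmin : ∀ j < Nat.find hex, ¬ Chain B h j x y := fun j hj => Nat.find_min hex hj
  generalize Nat.find hex = k at hk hmin
  cases k with
  | zero => exact not_minus_of_lt hxy hk
  | succ k =>
    obtain ⟨q, s, p', h1, hs, hq, hp', he, hc⟩ := hk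
    have hy := Chain.mem_component hh k h1 hs hq hp' he hc hmin
    have hx : x ∈ connectedComponentIn (lowerSet B s)ᶜ q := minus_subset_component hq (B.minus.symm h1)
    obtain ⟨C, hC, hxC, hyC, hC'⟩ := exists_arc hxy
    have hxs : x ∉ lowerSet B s := connectedComponentIn_subset _ _ hx
    have h2 : y ∈ connectedComponentIn (lowerSet B s)ᶜ x := by
      refine hC.subset_connectedComponentIn hxC ?_ hyC
      rintro c hc (rfl | hcs)
      · rcases (hC' c hc).1 with rfl | h3
        · exact hxs (Or.inl rfl)
        · exact hxs (Or.inr h3)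
      · rcases (hC' c hc).1 with rfl | h3
        · exact hxs (Or.inr hcs)
        · exact hxs (Or.inr (lt_trans h3 hcs))
    rw [← connectedComponentIn_eq hx] at h2
    -- The arc from `x` to `y` cannot enter `lowerSet B s`, since `x` is not in it. So the end `y`
    -- of the chain is still in the region of `q`, although it is in the region of `p'`. The two
    -- regions coincide, `q = p'`, and the first identification was superfluous.
    have hp'q : p' ∈ connectedComponentIn (lowerSet B s)ᶜ q := by
      rw [connectedComponentIn_eq h2, ← connectedComponentIn_eq hy]
      refine mem_connectedComponentIn ?_
      rintro (h3 | h3)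
      · exact lt_ne hp' h3.symm
      · exact lt_asymm hp' h3
    have h3 := height_eq_of_mem_ray hh hs hq (mem_ray_of_mem_component hs hq hp' hp'q) he
    exact hmin k (by omega) (Chain.cons (h3 ▸ h1) hc)

/-- Linked points on the positive side of a point are identified. -/
theorem sim_of_linked {x y y' : P} (hy : B.lt x y) (hy' : B.lt x y') (hl : Linked B h y y') :
    B.sim h y y' := by
  have hcomp : ∀ {a b : P}, Linked B h a b → (B.lt a b ∨ a = b ∨ B.lt b a) → a = b := by
    rintro a b hl (h1 | h1 | h1)
    · exact absurd hl (not_linked_of_lt hh h1)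
    · exact h1
    · exact absurd hl.symm (not_linked_of_lt hh h1)
  rcases exists_ord_of_not_comparable hy hy' with h1 | ⟨s, hs, hsy, hsy'⟩
  · exact Or.inl (hcomp hl h1)
  · refine Or.inr ⟨B.plus.trans (B.plus.symm (B.lt_leaf _ _ hsy)) (B.lt_leaf _ _ hsy'),
      ⟨s, B.plus.symm (B.lt_leaf _ _ hsy), hs⟩, ?_⟩
    -- The partner of `y` on the half-leaf of `y'`. It is linked to `y'` and comparable with it, so
    -- it is `y'`, and the heights agree.
    obtain ⟨y'', hr, hsy'', he⟩ := exists_height_eq hh hs hsy' (height_pos hh hs hsy)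
    have h2 : Linked B h y' y'' := hl.symm.trans (Linked.of_edge ⟨s, hs, hsy, hsy'', he.symm⟩)
    rw [hcomp h2 (lt_trichotomy_of_mem_ray hs (mem_diff_of_lt hsy') hr), he]

end height

end OrientedBifoliatedPlane

/-- A horizontal shift in the coordinates of a sector. The absolute value keeps the second
coordinate nonnegative, so the map is continuous on the whole plane. -/
lemma continuous_slide {n : ℕ} (hn : n ≠ 0) {ζ : ℂ} (hζ : ζ ∈ sectorDirs n) (c : ℝ) :
    Continuous fun w : ℂ => halfBox n ζ ((w ^ n).re + c) |(w ^ n).im| :=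
  (continuousOn_halfBox hn hζ).comp_continuous (f := fun w : ℂ => (((w ^ n).re + c, |(w ^ n).im|) : ℝ × ℝ))
    (by fun_prop) fun w => abs_nonneg (w ^ n).im

lemma abs_halfBox_im {n : ℕ} (hn : n ≠ 0) {ζ : ℂ} (hζ : ζ ∈ sectorDirs n) (u : ℝ) {v : ℝ} (hv : 0 ≤ v) :
    |(halfBox n ζ u v ^ n).im| = v := by
  rw [halfBox_im hn hζ, abs_mul, abs_of_nonneg hv]
  rcases sectorDirs_im hζ with h | h <;> rw [h] <;> simp

namespace OrientedBifoliatedPlane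

variable {P : Type*} [TopologicalSpace P] {B : OrientedBifoliatedPlane P}

/-! ### Coordinates on the leaves -/

/-- The coordinate is `Re (a ^ m)` of the prong parameter `a`. It takes the same values on all
positive half-leaves, so it increases along the order without being injective. -/
lemma exists_coord (B : OrientedBifoliatedPlane P) (x : P) : ∃ ρ : P → ℝ, ContinuousOn ρ (leafOf B.plus x) ∧
    ∀ u v, B.plus x u → B.lt u v → ρ u < ρ v := by
  obtain ⟨m, γ, hγ⟩ := B.exists_plusParam x
  have : Nonempty (prong m) := ⟨⟨0, zero_mem_prong hγ.ne_zero⟩⟩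
  have hinv : ∀ a, Function.invFun γ (γ a) = a := Function.leftInverse_invFun hγ.emb.injective
  refine ⟨fun y => (((Function.invFun γ y : prong m) : ℂ) ^ m).re, ?_, ?_⟩
  · rw [← hγ.range_eq, continuousOn_iff_continuous_domRestrict]
    have h1 : Continuous fun y : range γ => (((hγ.emb.isEmbedding.toHomeomorph.symm y : prong m) : ℂ) ^ m).re := by
      fun_prop
    refine h1.congr ?_
    rintro ⟨_, a, rfl⟩
    have h2 : hγ.emb.isEmbedding.toHomeomorph.symm ⟨γ a, mem_range_self a⟩ = a := by
      rw [Homeomorph.symm_apply_eq]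
      rfl
    rw [h2, domRestrict_apply, hinv]
  · intro u v hu huv
    obtain ⟨a, rfl⟩ := hγ.exists_eq hu
    obtain ⟨b, rfl⟩ := hγ.exists_eq (B.plus.trans hu (B.lt_leaf _ _ huv))
    simp only [hinv]
    exact ((hγ.lt_iff a b).1 huv).1

/-- A connected part of a leaf whose points are comparable with `x` lies on one side of `x`. -/
lemma lt_of_connected {x : P} {C : Set P} (hC : IsPreconnected C) (hx : C ⊆ leafOf B.plus x)
    (h : ∀ c ∈ C, B.lt x c ∨ B.lt c x) {a b : P} (ha : a ∈ C) (hb : b ∈ C) (hxa : B.lt x a) : B.lt x b := by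
  refine (h b hb).resolve_right fun hbx => ?_
  obtain ⟨ρ, hρ, hmono⟩ := exists_coord B x
  obtain ⟨c, hc, hcx⟩ := hC.intermediate_value hb ha (hρ.mono hx)
    ⟨(hmono _ _ (hx hb) hbx).le, (hmono _ _ (B.plus.refl x) hxa).le⟩
  rcases h c hc with h1 | h1
  · exact absurd hcx (hmono _ _ (B.plus.refl x) h1).ne'
  · exact absurd hcx (hmono _ _ (hx hc) h1).ne

/-- A height function on the leaf of `x`, adapted to the identifications. -/
structure LeafHeight (B : OrientedBifoliatedPlane P) (h : P → ℝ) (x : P) (k : P → ℝ) : Prop where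
  mono : ∀ u v, B.plus x u → B.lt u v → k u < k v
  sim_iff : ∀ u v, B.plus x u → B.plus x v → (B.sim h u v ↔ k u = k v)
  cont : ∀ g, B.IsLine g → B.plus x (g 0) → Continuous (k ∘ g)

section height

variable {G : Type*} [Group G] [MulAction G P] {h : P → ℝ} (hh : B.IsHeight G h)
include hh

lemma height_neg {s y : P} (hs : 2 ≤ B.ord s) (hy : B.lt y s) : h y < 0 := by
  rw [← hh.zero s hs]
  refine (hh.neg s y hs hy).2 y (Or.inr (mem_connectedComponentIn ⟨B.plus.symm (B.lt_leaf _ _ hy), ?_⟩)) s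
    (Or.inl rfl) hy
  exact lt_ne hy

lemma height_lt_of_lt {s u v : P} (hs : 2 ≤ B.ord s) (hu : B.plus s u) (huv : B.lt u v) : h u < h v := by
  have hv : B.plus s v := B.plus.trans hu (B.lt_leaf _ _ huv)
  rcases lt_trichotomy_of_ord hs hu with h1 | rfl | h1
  · exact height_lt hh hs h1 huv
  · rw [hh.zero _ hs]
    exact height_pos hh hs huv
  · rcases lt_trichotomy_of_ord hs hv with h2 | rfl | h2
    · exact (height_neg hh hs h1).trans (height_pos hh hs h2)
    · rw [hh.zero _ hs]
      exact height_neg hh hs h1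
    · have hus : u ∈ leafOf B.plus s \ {s} := ⟨hu, lt_ne h1⟩
      refine (hh.neg s u hs h1).2 u (Or.inr (mem_connectedComponentIn hus)) v (Or.inr ?_) huv
      obtain ⟨C, hC, huC, hvC, hC'⟩ := exists_arc huv
      refine hC.subset_connectedComponentIn huC ?_ hvC
      intro c hc
      have h3 : B.lt c s := by
        rcases (hC' c hc).2 with rfl | h3
        · exact h2
        · exact lt_trans h3 h2
      exact ⟨B.plus.symm (B.lt_leaf _ _ h3), lt_ne h3⟩

lemma continuous_height_line {s : P} (hs : 2 ≤ B.ord s) {g : ℝ → P} (hg : B.IsLine g) (h0 : B.plus s (g 0)) :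
    Continuous (h ∘ g) := by
  have hrel : ∀ t, B.plus s (g t) := fun t => B.plus.trans h0 (hg.rel 0 t)
  have hcomp : ∀ (D : Set ℝ) (y : P), (B.lt s y ∨ B.lt y s) → (∀ t ∈ D, g t ∈ B.halfLeaf s y) →
      ContinuousOn (h ∘ g) D := by
    intro D y hy hD
    have h1 : ContinuousOn h (B.halfLeaf s y) := by
      rw [continuousOn_iff_continuous_domRestrict]
      rcases hy with hy | hy
      · obtain ⟨⟨e, he⟩, -⟩ := hh.pos s y hs hy
        exact (continuous_subtype_val.comp e.continuous).congr he
      · obtain ⟨⟨e, he⟩, -⟩ := hh.neg s y hs hy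
        exact (continuous_subtype_val.comp e.continuous).congr he
    exact h1.comp hg.cont.continuousOn hD
  have hside : ∀ (D : Set ℝ), IsPreconnected D → (∀ t ∈ D, g t ≠ s) → ∀ t₁ ∈ D, ∀ t ∈ D, g t ∈ B.halfLeaf s (g t₁) := by
    intro D hD hne t₁ ht₁ t ht
    refine Or.inr ((hD.image g hg.cont.continuousOn).subset_connectedComponentIn ⟨t₁, ht₁, rfl⟩ ?_ ⟨t, ht, rfl⟩)
    rintro _ ⟨r, hr, rfl⟩
    exact ⟨hrel r, hne r hr⟩
  by_cases hsg : ∃ a, g a = s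
  · obtain ⟨a, rfl⟩ := hsg
    have h1 : ContinuousOn (h ∘ g) (Ici a) := by
      refine hcomp _ (g (a + 1)) (Or.inl ((hg.lt_iff _ _).2 (by linarith))) ?_
      intro t ht
      rcases (show a ≤ t from ht).eq_or_lt with rfl | ht'
      · exact Or.inl rfl
      · exact hside (Ioi a) isPreconnected_Ioi (fun t ht h => (show a < t from ht).ne' (hg.inj h)) _ (by simp) _ ht'
    have h2 : ContinuousOn (h ∘ g) (Iic a) := by
      refine hcomp _ (g (a - 1)) (Or.inr ((hg.lt_iff _ _).2 (by linarith))) ?_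
      intro t ht
      rcases (show t ≤ a from ht).eq_or_lt with rfl | ht'
      · exact Or.inl rfl
      · exact hside (Iio a) isPreconnected_Iio (fun t ht h => (show t < a from ht).ne (hg.inj h)) _ (by simp) _ ht'
    rw [← continuousOn_univ, ← Iic_union_Ici (a := a)]
    exact h2.union_of_isClosed h1 isClosed_Iic isClosed_Ici
  · push Not at hsg
    rw [← continuousOn_univ]
    refine hcomp _ (g 0) ?_ fun t ht => hside univ isPreconnected_univ (fun t _ => hsg t) 0 trivial t ht
    rcases lt_trichotomy_of_ord hs h0 with h1 | h1 | h1
    · exact Or.inl h1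
    · exact absurd h1.symm (hsg 0)
    · exact Or.inr h1

/-- On a singular leaf `h` itself serves. On a regular leaf `∼` is equality and all points are
comparable, so any increasing coordinate will do. -/
lemma exists_leafHeight (x : P) : ∃ k, LeafHeight B h x k := by
  by_cases hx : B.SingLeaf x
  · obtain ⟨s, hxs, hs⟩ := hx
    refine ⟨h, ?_, ?_, ?_⟩
    · intro u v hu huv
      exact height_lt_of_lt hh hs (B.plus.trans (B.plus.symm hxs) hu) huv
    · intro u v hu hv
      constructor
      · rintro (rfl | h1)
        · rfl
        · exact h1.2.2
      · exact fun h1 => Or.inr ⟨B.plus.trans (B.plus.symm hu) hv, ⟨s, B.plus.trans (B.plus.symm hu) hxs, hs⟩, h1⟩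
    · intro g hg h0
      exact continuous_height_line hh hs hg (B.plus.trans (B.plus.symm hxs) h0)
  · obtain ⟨ρ, hρ, hmono⟩ := exists_coord B x
    have hord : ∀ p ∈ leafOf B.plus x, B.ord p = 1 := by
      intro p hp
      by_contra h1
      exact hx ⟨p, hp, by have := B.ord_pos p; omega⟩
    have hconn : IsPreconnected (leafOf B.plus x) := by
      obtain ⟨m, γ, hγ⟩ := B.exists_plusParam x
      rw [← hγ.range_eq]
      have := isPreconnected_iff_preconnectedSpace.1 (isPreconnected_prong (m := m))
      exact isPreconnected_range hγ.emb.continuous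
    refine ⟨ρ, hmono, ?_, ?_⟩
    · intro u v hu hv
      constructor
      · rintro (rfl | ⟨-, ⟨s, h1, h2⟩, -⟩)
        · rfl
        · exact absurd ⟨s, B.plus.trans hu h1, h2⟩ hx
      · intro h1
        rcases lt_trichotomy_of_connected (C := leafOf B.plus x) hconn (by rw [leafOf_eq hu]) hord hu hv with h2 | h2 | h2
        · exact absurd h1 (hmono _ _ hu h2).ne
        · exact Or.inl h2
        · exact absurd h1 (hmono _ _ hv h2).ne'
    · intro g hg h0
      exact hρ.comp_continuous hg.cont fun t => B.plus.trans h0 (hg.rel 0 t)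

/-- Comparable identified points are equal. -/
lemma eq_of_sim_of_comparable {u v : P} (hs : B.sim h u v) (hc : B.lt u v ∨ u = v ∨ B.lt v u) : u = v := by
  obtain ⟨k, hk⟩ := exists_leafHeight hh u
  rcases hc with h1 | h1 | h1
  · have h2 := B.lt_leaf _ _ h1
    exact absurd ((hk.sim_iff u v (B.plus.refl u) h2).1 hs) (hk.mono _ _ (B.plus.refl u) h1).ne
  · exact h1
  · have h2 := B.plus.symm (B.lt_leaf _ _ h1)
    exact absurd ((hk.sim_iff u v (B.plus.refl u) h2).1 hs) (hk.mono _ _ h2 h1).ne'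

/-- Every point of `R x` is identified with a point in the boundary of any given component that has `x` in its
boundary. -/
lemma exists_sim_mem_leafBd {x y x₀ z : P} (hz : ¬ B.plus x₀ z) (hx : x ∈ leafBd B.plus x₀ z) (hxy : B.lt x y) :
    ∃ y' ∈ leafBd B.plus x₀ z, B.sim h y y' := by
  have hx₀y : B.plus x₀ y := B.plus.trans hx.2 (B.lt_leaf _ _ hxy)
  by_cases hsing : B.SingLeaf x₀
  · obtain ⟨s, hxs, hs⟩ := hsing
    have hsbd : s ∈ leafBd B.plus x₀ z := by
      obtain ⟨m, γ, hγ⟩ := B.plusFol.exists_leafParam x₀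
      have h1 := B.plusFol.center_mem_leafBd hγ hz
      obtain ⟨o, rfl⟩ := hγ.exists_eq hxs
      have ho : (o : ℂ) = 0 := by
        by_contra h0
        have := B.plusFol.ord_of_ne hγ h0
        omega
      rwa [show o = ⟨0, zero_mem_prong hγ.ne_zero⟩ from Subtype.ext ho]
    have hsy : B.plus s y := B.plus.trans (B.plus.symm hxs) hx₀y
    rcases lt_trichotomy_of_ord hs hsy with h1 | rfl | h1
    -- If `y` is beyond the singularity, it may be on a half-leaf that does not bound the component.
    -- Its partner of the same height on the positive half-leaf that does is taken instead.
    · obtain ⟨g, hg, hr⟩ := exists_line_leafBd hz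
      obtain ⟨a, ha⟩ : s ∈ range g := hr ▸ hsbd
      have h2 : B.lt s (g (a + 1)) := by rw [← ha, hg.lt_iff]; linarith
      obtain ⟨y', hy', hsy', he⟩ := exists_height_eq hh hs h2 (height_pos hh hs h1)
      refine ⟨y', ?_, Or.inr ⟨B.plus.trans (B.plus.symm hsy) (B.lt_leaf _ _ hsy'),
        ⟨s, B.plus.symm hsy, hs⟩, he.symm⟩⟩
      refine B.plusFol.mem_leafBd_of_connected (C := ray B s (g (a + 1))) isPreconnected_connectedComponentIn ?_ ?_
        (mem_connectedComponentIn (mem_diff_of_lt h2)) hy' (hr ▸ mem_range_self _)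
      · intro c hc
        exact B.plus.trans hxs (connectedComponentIn_subset _ _ hc).1
      · intro c hc
        have := connectedComponentIn_subset _ _ hc
        exact ord_eq_one hs this.1 this.2
    · exact ⟨s, hsbd, Or.inl rfl⟩
    · refine ⟨y, ?_, Or.inl rfl⟩
      obtain ⟨C, hC, hxC, hyC, hC'⟩ := exists_arc hxy
      have hCs : ∀ c ∈ C, B.lt c s := by
        intro c hc
        rcases (hC' c hc).2 with rfl | h3
        · exact h1
        · exact lt_trans h3 h1
      refine B.plusFol.mem_leafBd_of_connected hC (fun c hc => ?_) (fun c hc => ?_) hxC hyC hx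
      · exact B.plus.trans hxs (B.plus.symm (B.lt_leaf _ _ (hCs c hc)))
      · exact ord_eq_one hs (B.plus.symm (B.lt_leaf _ _ (hCs c hc))) (lt_ne (hCs c hc))
  · refine ⟨y, ?_, Or.inl rfl⟩
    obtain ⟨C, hC, hxC, hyC, hC'⟩ := exists_arc hxy
    have hCl : ∀ c ∈ C, B.plus x₀ c := by
      intro c hc
      rcases (hC' c hc).1 with rfl | h3
      · exact hx.2
      · exact B.plus.trans hx.2 (B.lt_leaf _ _ h3)
    refine B.plusFol.mem_leafBd_of_connected hC hCl (fun c hc => ?_) hxC hyC hx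
    by_contra h1
    exact hsing ⟨c, hCl c hc, by have := B.ord_pos c; omega⟩

end height

/-! ### Transport along regular arcs -/

/-- `x` and `y` are joined in a leaf of `𝓕⁺` by a connected set of regular points. -/
def RegConn (B : OrientedBifoliatedPlane P) (x y : P) : Prop :=
  ∃ C : Set P, IsPreconnected C ∧ x ∈ C ∧ y ∈ C ∧ C ⊆ leafOf B.plus x ∧ ∀ c ∈ C, B.ord c = 1

lemma RegConn.rel {x y : P} (h : RegConn B x y) : B.plus x y := by
  obtain ⟨C, -, -, hy, hC, -⟩ := h
  exact hC hy

lemma RegConn.symm {x y : P} (h : RegConn B x y) : RegConn B y x := by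
  have h' := h.rel
  obtain ⟨C, h1, hx, hy, hC, h2⟩ := h
  exact ⟨C, h1, hy, hx, by rwa [← leafOf_eq h'], h2⟩

lemma RegConn.trans {x y z : P} (h : RegConn B x y) (h' : RegConn B y z) : RegConn B x z := by
  have hxy := h.rel
  obtain ⟨C, h1, hx, hy, hC, h2⟩ := h
  obtain ⟨C', h1', hy', hz, hC', h2'⟩ := h'
  refine ⟨C ∪ C', h1.union y hy hy' h1', Or.inl hx, Or.inr hz, union_subset hC ?_, ?_⟩
  · rwa [leafOf_eq hxy]
  · rintro c (hc | hc)
    exacts [h2 c hc, h2' c hc]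

lemma RegConn.comparable {x y : P} (h : RegConn B x y) : B.lt x y ∨ x = y ∨ B.lt y x := by
  obtain ⟨C, h1, hx, hy, hC, h2⟩ := h
  exact lt_trichotomy_of_connected h1 hC h2 hx hy

lemma RegConn.mem_leafBd {x y x₀ z : P} (h : RegConn B x y) (hx : x ∈ leafBd B.plus x₀ z) :
    y ∈ leafBd B.plus x₀ z := by
  obtain ⟨C, h1, hxC, hy, hC, h2⟩ := h
  exact B.plusFol.mem_leafBd_of_connected h1 (fun c hc => B.plus.trans hx.2 (hC hc)) h2 hxC hy hx

/-- Points on the positive side of `x` are comparable if one of them can be reached through regular points. -/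
lemma RegConn.comparable_of_lt {x y y' : P} (h : RegConn B x y') (hy' : B.lt x y') (hy : B.lt x y) :
    B.lt y y' ∨ y = y' ∨ B.lt y' y := by
  rcases exists_ord_of_not_comparable hy hy' with h1 | ⟨s, hs, hsy, hsy'⟩
  · exact h1
  · have hsx : B.plus s x := B.plus.trans (B.lt_leaf _ _ hsy) (B.plus.symm (B.lt_leaf _ _ hy))
    obtain ⟨C, h1, hxC, hyC, hC, h2⟩ := h
    have hCs : C ⊆ leafOf B.plus s \ {s} := by
      refine fun c hc => ⟨B.plus.trans hsx (hC hc), ?_⟩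
      rintro rfl
      have := h2 _ hc
      omega
    have h3 := lt_iff_of_connected hs h1 hCs hyC hxC hsy'
    have h4 := connectedComponentIn_eq (mem_ray_of_lt h3 hy)
    have h5 := mem_ray_of_lt h3 hy'
    refine lt_trichotomy_of_mem_ray hs (mem_diff_of_lt hsy) ?_
    rw [ray, ← h4]
    exact h5

section chart

variable {n : ℕ} {e : ℂ → P} {x : P}

/-- The horizontals of a sector. -/
lemma BiChart.regConn (h : B.BiChart n e x) {ζ : ℂ} (hζ : ζ ∈ sectorDirs n) (u u' : ℝ) {v : ℝ} (hv : 0 < v) :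
    RegConn B (e (halfBox n ζ u v)) (e (halfBox n ζ u' v)) := by
  have hn := h.ne_zero
  have hrow := isPreconnected_halfBox_row hn hζ hv.le isPreconnected_univ
  refine ⟨e '' ((fun u => halfBox n ζ u v) '' univ), hrow.image _ h.emb.continuous.continuousOn,
    ⟨_, ⟨u, trivial, rfl⟩, rfl⟩, ⟨_, ⟨u', trivial, rfl⟩, rfl⟩, ?_, ?_⟩
  · rintro _ ⟨a, ha, rfl⟩
    refine h.plus.same _ hrow ?_ _ ⟨u, trivial, rfl⟩ _ ha
    rintro _ ⟨a, -, rfl⟩ _ ⟨b, -, rfl⟩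
    rw [halfBox_im hn hζ, halfBox_im hn hζ]
  · rintro _ ⟨_, ⟨t, -, rfl⟩, rfl⟩
    exact B.plusFol.ord_chart hn h.plus (halfBox_ne_zero hn hζ (Or.inr hv.ne'))

lemma BiChart.regConn_one (h : B.BiChart 1 e x) {w w' : ℂ} (hw : w.im = w'.im) : RegConn B (e w) (e w') := by
  have hC : IsPreconnected {a : ℂ | a.im = w.im} := by
    have : Convex ℝ {a : ℂ | a.im = w.im} := convex_hyperplane (r := w.im) Complex.imLm.isLinear
    exact this.isPreconnected
  refine ⟨e '' {a : ℂ | a.im = w.im}, hC.image _ h.emb.continuous.continuousOn, ⟨w, rfl, rfl⟩, ⟨w', hw.symm, rfl⟩, ?_, ?_⟩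
  · rintro _ ⟨a, ha, rfl⟩
    refine h.plus.same _ hC ?_ _ rfl _ ha
    intro a ha b hb
    simp only [pow_one]
    exact (show a.im = w.im from ha).trans (show b.im = w.im from hb).symm
  · rintro _ ⟨a, -, rfl⟩
    by_cases ha : a = 0
    · rw [ha, h.zero, h.ord_eq]
    · exact B.plusFol.ord_chart one_ne_zero h.plus ha

end chart

/-- Nearby leaves follow a regular arc. -/
lemma RegConn.transport {x y : P} (h : RegConn B x y) {W : Set P} (hW : W ∈ 𝓝 y) :
    ∀ᶠ x' in 𝓝 x, ∃ y' ∈ W, RegConn B x' y' := by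
  -- Transport from `p` to `q` is transitive and holds in both directions within a regular chart, by
  -- horizontal translation. Connectedness of the arc spreads it.
  let T : P → P → Prop := fun p q => ∀ W ∈ 𝓝 q, ∀ᶠ x' in 𝓝 p, ∃ y' ∈ W, RegConn B x' y'
  have htr : ∀ p q r, T p q → T q r → T p r := by
    intro p q r h1 h2 W hW
    filter_upwards [h1 _ (h2 W hW)] with x' hx'
    obtain ⟨y', ⟨z', hz', h4⟩, h3⟩ := hx'
    exact ⟨z', hz', h3.trans h4⟩
  obtain ⟨C, h1, hxC, hyC, hC, h2⟩ := h
  refine (h1.induction₂ (fun p q => T p q ∧ T q p) ?_ (fun p q r _ _ _ h1 h2 => ⟨htr _ _ _ h1.1 h2.1, htr _ _ _ h2.2 h1.2⟩)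
    (fun _ _ _ _ h => ⟨h.2, h.1⟩) hxC hyC).1 W hW
  intro p hp
  obtain ⟨e, he, -⟩ := B.exists_biChart p univ_mem
  rw [h2 p hp] at he
  have key : ∀ w w', w.im = w'.im → T (e w) (e w') := by
    intro w w' hww W hW
    rw [← he.emb.map_nhds_eq, eventually_map]
    have hc : Continuous fun a : ℂ => e (a + (w' - w)) := he.emb.continuous.comp (by fun_prop)
    have h3 : ∀ᶠ a in 𝓝 w, e (a + (w' - w)) ∈ W := by
      refine hc.continuousAt.eventually_mem ?_
      rwa [add_sub_cancel]
    filter_upwards [h3] with a ha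
    exact ⟨_, ha, he.regConn_one (by simp [hww])⟩
  filter_upwards [mem_nhdsWithin_of_mem_nhds he.range_mem, self_mem_nhdsWithin] with q ⟨w, hw⟩ hq
  subst hw
  have h3 := he.axis_plus w (B.plus.trans (B.plus.symm (hC hp)) (hC hq))
  rw [pow_one] at h3
  rw [← he.zero]
  exact ⟨key 0 w (by simp [h3]), key w 0 (by simp [h3])⟩

/-- On one side, nearby leaves follow an arc in the boundary of a component. -/
lemma transport_leafBd {x₀ z x y : P} (hz : ¬ B.plus x₀ z) (hx : x ∈ leafBd B.plus x₀ z)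
    (hy : y ∈ leafBd B.plus x₀ z) (hxy : B.lt x y) {W : Set P} (hW : W ∈ 𝓝 y) :
    ∀ᶠ x' in 𝓝 x, x' ∈ leafComp B.plus x₀ z → ∃ y' ∈ W, RegConn B x' y' ∧ (y' = x' ∨ B.lt x' y') := by
  obtain ⟨g, hg, hr⟩ := exists_line_leafBd hz
  obtain ⟨a, rfl⟩ : x ∈ range g := hr ▸ hx
  obtain ⟨b, rfl⟩ : y ∈ range g := hr ▸ hy
  have hab := (hg.lt_iff a b).1 hxy
  have hbd : ∀ t, g t ∈ leafBd B.plus x₀ z := fun t => hr ▸ mem_range_self t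
  -- Locally the transport is a horizontal slide inside one sector. Singular points on the boundary
  -- line are harmless, because only leaves on one side of it are followed.
  refine interval_chain (r := fun a b => ∀ W ∈ 𝓝 (g b), ∀ᶠ x' in 𝓝 (g a), x' ∈ leafComp B.plus x₀ z →
    ∃ y' ∈ W, RegConn B x' y' ∧ (y' = x' ∨ B.lt x' y')) ?_ ?_ hab.le W hW
  · intro a b c _ _ h1 h2 W hW
    filter_upwards [h1 _ (h2 W hW)] with x' hx' hx'J
    obtain ⟨y', hy', h3, h4⟩ := hx' hx'J
    have hy'J : y' ∈ leafComp B.plus x₀ z := by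
      obtain ⟨C, hC, hxC, hyC, hCl, -⟩ := h3
      rw [leafComp, connectedComponentIn_eq hx'J]
      refine hC.subset_connectedComponentIn hxC ?_ hyC
      intro c hc hc'
      exact connectedComponentIn_subset _ _ hx'J (B.plus.trans hc' (B.plus.symm (hCl hc)))
    obtain ⟨z', hz', h5, h6⟩ := hy' hy'J
    refine ⟨z', hz', h3.trans h5, ?_⟩
    rcases h4 with rfl | h4
    · exact h6
    · rcases h6 with rfl | h6
      · exact Or.inr h4
      · exact Or.inr (lt_trans h4 h6)
  · intro t
    obtain ⟨e, he, -⟩ := B.exists_biChart (g t) univ_mem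
    set n := B.ord (g t) with hn'
    have hn := he.ne_zero
    obtain ⟨ζ, hζ, hJ, hJb⟩ := B.plusFol.exists_sector_leafComp (z := z) (hbd t).2 he.nice (w₁ := 0)
      (by rw [he.zero]; exact (hbd t).1)
    obtain ⟨δ, hδ, hball⟩ := Metric.mem_nhds_iff.1 (hg.cont.continuousAt he.range_mem)
    refine ⟨δ, hδ, fun a b ha hab hb W hW => ?_⟩
    have hmem : ∀ s, t - δ < s → s < t + δ → ∃ u, e (halfBox n ζ u 0) = g s := by
      intro s h1 h2
      obtain ⟨w, hw⟩ := hball (show s ∈ Metric.ball t δ by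
        rw [Metric.mem_ball, Real.dist_eq, abs_lt]; constructor <;> linarith)
      obtain ⟨u, rfl⟩ := (hJb w).1 (by rw [hw]; exact hbd s)
      exact ⟨u, hw⟩
    obtain ⟨ua, hua⟩ := hmem a ha (by linarith)
    obtain ⟨ub, hub⟩ := hmem b (by linarith) hb
    have huab : ua ≤ ub := by
      rcases hab.eq_or_lt with rfl | h1
      · exact (halfBox_inj hn hζ (he.emb.injective (hua.trans hub.symm))).1.le
      · rw [← hg.lt_iff, ← hua, ← hub, he.lt_iff hζ le_rfl] at h1
        exact h1.le
    rw [← hua, ← he.emb.map_nhds_eq, eventually_map]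
    have hc : Continuous fun w : ℂ => e (halfBox n ζ ((w ^ n).re + (ub - ua)) |(w ^ n).im|) :=
      he.emb.continuous.comp (continuous_slide hn hζ _)
    have h3 : ∀ᶠ w in 𝓝 (halfBox n ζ ua 0), e (halfBox n ζ ((w ^ n).re + (ub - ua)) |(w ^ n).im|) ∈ W := by
      refine hc.continuousAt.eventually_mem ?_
      rwa [halfBox_re hn hζ, abs_halfBox_im hn hζ _ le_rfl, add_sub_cancel, hub]
    filter_upwards [h3] with w hw hwJ
    obtain ⟨u, v, hv, rfl⟩ := (hJ w).1 hwJ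
    rw [halfBox_re hn hζ, abs_halfBox_im hn hζ _ hv.le] at hw
    refine ⟨_, hw, he.regConn hζ _ _ hv, ?_⟩
    rcases huab.eq_or_lt with h4 | h4
    · left
      rw [h4, sub_self, add_zero]
    · right
      rw [he.lt_iff hζ hv.le]
      linarith

end OrientedBifoliatedPlane

/-! ### Local sections of `N` obtained by following leaves of `𝓕⁻` -/

lemma Topology.IsEmbedding.continuousOn_invFun {X Y : Type*} [TopologicalSpace X] [TopologicalSpace Y] [Nonempty X]
    {f : X → Y} (hf : IsEmbedding f) : ContinuousOn (Function.invFun f) (range f) := by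
  rw [continuousOn_iff_continuous_domRestrict]
  refine hf.toHomeomorph.symm.continuous.congr ?_
  rintro ⟨_, a, rfl⟩
  rw [Homeomorph.symm_apply_eq, domRestrict_apply, Function.leftInverse_invFun hf.injective]
  rfl

lemma PlaneFol.mem_or_rel_of_mem_closure {P : Type*} [TopologicalSpace P] {E : Setoid P} {ord : P → ℕ}
    (F : PlaneFol E ord) {x y z : P} (hy : y ∈ closure (leafComp E x z)) : y ∈ leafComp E x z ∨ E x y := by
  by_cases hyE : E x y
  · exact Or.inr hyE
  · left
    have h1 := (F.isOpen_leafComp (x := x) (z := y)).mem_nhds (mem_connectedComponentIn (show y ∈ (leafOf E x)ᶜ from hyE))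
    obtain ⟨a, ha, ha'⟩ := mem_closure_iff_nhds.1 hy _ h1
    have h2 := connectedComponentIn_eq ha
    have h3 := connectedComponentIn_eq ha'
    rw [leafComp, h3, ← h2]
    exact mem_connectedComponentIn hyE

namespace OrientedBifoliatedPlane

variable {P : Type*} [TopologicalSpace P] {B : OrientedBifoliatedPlane P}

section chart

variable {n : ℕ} {e : ℂ → P} {x : P}

lemma BiChart.isLine_axis (h : B.BiChart n e x) {ζ : ℂ} (hζ : ζ ∈ sectorDirs n) :
    B.IsLine fun u => e (halfBox n ζ u 0) where
  cont := h.emb.continuous.comp ((continuousOn_halfBox h.ne_zero hζ).comp_continuous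
    (f := fun u : ℝ => ((u, 0) : ℝ × ℝ)) (by fun_prop) fun _ => le_refl (0 : ℝ))
  lt_iff _ _ := h.lt_iff hζ le_rfl

lemma BiChart.minus_vertical (h : B.BiChart n e x) {ζ : ℂ} (hζ : ζ ∈ sectorDirs n) (u : ℝ) {v v' : ℝ}
    (hv : 0 ≤ v) (hv' : 0 ≤ v') : B.minus (e (halfBox n ζ u v)) (e (halfBox n ζ u v')) := by
  have hn := h.ne_zero
  refine h.minus.same ((fun v => halfBox n ζ u v) '' Ici 0) ?_ ?_ _ ⟨v, hv, rfl⟩ _ ⟨v', hv', rfl⟩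
  · exact isPreconnected_Ici.image _ ((continuousOn_halfBox hn hζ).comp
      (f := fun v : ℝ => ((u, v) : ℝ × ℝ)) (by fun_prop) fun v hv => hv)
  · rintro _ ⟨a, -, rfl⟩ _ ⟨b, -, rfl⟩
    rw [halfBox_re hn hζ, halfBox_re hn hζ]

end chart

lemma eq_of_comparable_of_minus {p q : P} (h : B.lt p q ∨ p = q ∨ B.lt q p) (hm : B.minus p q) : p = q := by
  rcases h with h | h | h
  · exact absurd hm (not_minus_of_lt h)
  · exact h
  · exact absurd (B.minus.symm hm) (not_minus_of_lt h)

lemma mem_leafComp_of_rel {x₀ z x y : P} (hx : x ∈ leafComp B.plus x₀ z) (h : RegConn B x y) :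
    y ∈ leafComp B.plus x₀ z := by
  obtain ⟨C, hC, hxC, hyC, hCl, -⟩ := h
  rw [leafComp, connectedComponentIn_eq hx]
  refine hC.subset_connectedComponentIn hxC ?_ hyC
  intro c hc hc'
  exact connectedComponentIn_subset _ _ hx (B.plus.trans hc' (B.plus.symm (hCl hc)))

/-- Any sector at `x` lies in a component with `x` in its boundary, and boundaries are saturated
along regular arcs, so `y` is in the same boundary. -/
lemma RegConn.mem_R {x y : P} (h : RegConn B x y) (hxy : B.lt x y) : y ∈ B.R x := by
  obtain ⟨e, he, -⟩ := B.exists_biChart x univ_mem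
  obtain ⟨ζ, hζ⟩ := exists_sectorDir _ he.ne_zero
  have hζ' : ζ ∈ sectorDirs (B.ord x) := Or.inl hζ
  have hw : halfBox (B.ord x) ζ 0 1 ∈ sector (B.ord x) ζ := ⟨0, 1, one_pos, rfl⟩
  have h1 := B.plusFol.mem_leafBd_sector he.nice hζ' hw
  exact ⟨hxy, _, he.nice.image_sector_subset hζ' ⟨_, hw, rfl⟩, h1.1, (h.mem_leafBd h1).1⟩

/-- For `x` near `x₀` in the closure of a component of the complement of the leaf of `x₀`, `σ x t` is the point
on the positive side of `x` that lies on the same leaf of `𝓕⁻` as the point at height `t` of the leaf of `x₀`. -/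
structure LocalSection (B : OrientedBifoliatedPlane P) (h : P → ℝ) (x₀ z : P) (k : P → ℝ) (V : Set P) (I : Set ℝ)
    (σ : P → ℝ → P) : Prop where
  cont : ContinuousOn (fun p : P × ℝ => σ p.1 p.2) ((closure (leafComp B.plus x₀ z) ∩ V) ×ˢ I)
  mem_R : ∀ x ∈ closure (leafComp B.plus x₀ z), x ∈ V → ∀ t ∈ I, σ x t ∈ B.R x
  foot : ∀ x ∈ closure (leafComp B.plus x₀ z), x ∈ V → ∀ t ∈ I,
    ∃ y ∈ leafBd B.plus x₀ z, B.lt x₀ y ∧ k y = t ∧ B.minus (σ x t) y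
  leaf : ∀ x ∈ closure (leafComp B.plus x₀ z), x ∈ V → ∀ t ∈ I, B.plus x₀ x →
    σ x t ∈ leafBd B.plus x₀ z ∧ k (σ x t) = t
  nhds : ∀ x ∈ closure (leafComp B.plus x₀ z), x ∈ V → ∀ t ∈ I, ∀ T ∈ 𝓝 t, ∀ᶠ p : P × P in 𝓝 (x, σ x t),
    p.1 ∈ closure (leafComp B.plus x₀ z) → p.1 ∈ V → p.2 ∈ closure (leafComp B.plus x₀ z) → B.lt p.1 p.2 →
    ∃ t' ∈ T ∩ I, p.2 = σ p.1 t'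
  unique : ∀ x ∈ leafComp B.plus x₀ z, x ∈ V → ∀ t ∈ I, ∀ y, B.lt x y → B.sim h y (σ x t) → y = σ x t

lemma LocalSection.mono {h : P → ℝ} {x₀ z : P} {k : P → ℝ} {V V' : Set P} {I I' : Set ℝ} {σ : P → ℝ → P}
    (hσ : LocalSection B h x₀ z k V I σ) (hV : V' ⊆ V) (hI : I' ⊆ I) (hIo : IsOpen I') :
    LocalSection B h x₀ z k V' I' σ where
  cont := hσ.cont.mono (prod_mono (inter_subset_inter_right _ hV) hI)
  mem_R x hx hxV t ht := hσ.mem_R x hx (hV hxV) t (hI ht)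
  foot x hx hxV t ht := hσ.foot x hx (hV hxV) t (hI ht)
  leaf x hx hxV t ht := hσ.leaf x hx (hV hxV) t (hI ht)
  nhds x hx hxV t ht T hT := by
    filter_upwards [hσ.nhds x hx (hV hxV) t (hI ht) (T ∩ I') (inter_mem hT (hIo.mem_nhds ht))] with p hp h1 h2 h3 h4
    obtain ⟨t', ht', h5⟩ := hp h1 (hV h2) h3 h4
    exact ⟨t', ht'.1, h5⟩
  unique x hx hxV t ht := hσ.unique x hx (hV hxV) t (hI ht)

section height

variable {G : Type*} [Group G] [MulAction G P] {h : P → ℝ} (hh : B.IsHeight G h)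
include hh

/-- In a chart at `y₀`, the leaf of a point `x` of the component near `x₀` appears as a row of
height `v x`, because it follows the arc from `x₀` to `y₀`. The column `u t` is the leaf of `𝓕⁻`
through the boundary point of height `t`, and `σ x t` is the crossing of row and column. The row is
unique, since two rows would meet a column in two comparable points of one leaf of `𝓕⁻`; its
continuity in `x` is again the transport along arcs. -/
theorem exists_localSection {x₀ y₀ z : P} (hz : ¬ B.plus x₀ z) (hx₀ : x₀ ∈ leafBd B.plus x₀ z)
    (hy₀ : y₀ ∈ leafBd B.plus x₀ z) (hxy : B.lt x₀ y₀) {k : P → ℝ} (hk : LeafHeight B h x₀ k) :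
    ∃ V ∈ 𝓝 x₀, ∃ I ∈ 𝓝 (k y₀), ∃ σ, LocalSection B h x₀ z k V I σ := by
  classical
  have := B.plusFol.t2Space
  set J := leafComp B.plus x₀ z with hJdef
  -- Disjoint neighbourhoods keep `x` out of the chart at `y₀`. All points of its row are then
  -- different from `x`, and they stay on its positive side.
  obtain ⟨Od, Oy, hOd, hOy, hxOd, hyOy, hdisj⟩ := t2_separation (lt_ne hxy)
  obtain ⟨e, he, -⟩ := B.exists_biChart x₀ univ_mem
  set n := B.ord x₀ with hn'
  have hn := he.ne_zero
  obtain ⟨ζ, hζ, hJe, hJeb⟩ := B.plusFol.exists_sector_leafComp (z := z) (B.plus.refl x₀) he.nice (w₁ := 0)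
    (by rw [he.zero]; exact hx₀.1)
  obtain ⟨E, hE, hEr⟩ := B.exists_biChart y₀ (hOy.mem_nhds hyOy)
  set m := B.ord y₀ with hm'
  have hm := hE.ne_zero
  obtain ⟨η, hη, hJE, hJEb⟩ := B.plusFol.exists_sector_leafComp (z := z) hy₀.2 hE.nice (w₁ := 0)
    (by rw [hE.zero]; exact hy₀.1)
  rw [← hJdef] at hJe hJE
  have hline := hE.isLine_axis hη
  set f : ℝ → ℝ := k ∘ fun u => E (halfBox m η u 0) with hf
  have hEleaf : ∀ u, B.plus x₀ (E (halfBox m η u 0)) := fun u => ((hJEb _).2 ⟨u, rfl⟩).2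
  have hfc : Continuous f := hk.cont _ hline (hEleaf 0)
  have hfm : StrictMono f := fun u u' huu => hk.mono _ _ (hEleaf u) ((hline.lt_iff _ _).2 huu)
  have hf0 : f 0 = k y₀ := by simp [hf, halfBox_zero hm, hE.zero]
  have hfe : IsEmbedding f := by
    have : OrdConnected (range f) := (isPreconnected_range hfc).ordConnected
    exact hfm.isEmbedding_of_ordConnected this
  obtain ⟨a, hax, hay⟩ := exists_between (hk.mono _ _ (B.plus.refl x₀) hxy)
  -- The bounds `f (-1)` and `f 1` make every height in `I` the height of a column. The bound `a`
  -- keeps these heights above those of the boundary points near `x₀`.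
  set I := Ioo (max a (f (-1))) (f 1) with hI
  have hIr : I ⊆ range f := by
    intro t ht
    obtain ⟨u, -, hu⟩ := intermediate_value_Icc (by norm_num : (-1 : ℝ) ≤ 1) hfc.continuousOn
      ⟨(le_max_right _ _).trans ht.1.le, ht.2.le⟩
    exact ⟨u, hu⟩
  have hIy : I ∈ 𝓝 (k y₀) := by
    refine Ioo_mem_nhds (max_lt hay ?_) ?_
    · rw [← hf0]; exact hfm (by norm_num)
    · rw [← hf0]; exact hfm (by norm_num)
  set u : ℝ → ℝ := Function.invFun f with hu
  have hfu : ∀ t ∈ I, f (u t) = t := fun t ht => Function.invFun_eq (hIr ht)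
  have huf : ∀ s, u (f s) = s := Function.leftInverse_invFun hfm.injective
  have huc : ContinuousOn u I := hfe.continuousOn_invFun.mono hIr
  -- the neighbourhood of `x₀`
  have hlow : ∀ᶠ x in 𝓝 x₀, x ∈ closure J → B.plus x₀ x → k x < a := by
    have hl0 := he.isLine_axis hζ
    have hc := hk.cont _ hl0 (by rw [halfBox_zero hn, he.zero])
    have h1 : ∀ᶠ s in 𝓝 (0 : ℝ), k (e (halfBox n ζ s 0)) < a := by
      refine hc.continuousAt.eventually_lt continuousAt_const ?_
      simpa [halfBox_zero hn, he.zero] using hax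
    have h2 : Tendsto (fun w : ℂ => (w ^ n).re) (𝓝 0) (𝓝 0) := by
      have : Continuous fun w : ℂ => (w ^ n).re := by fun_prop
      simpa [hn] using this.tendsto 0
    rw [← he.zero, ← he.emb.map_nhds_eq, eventually_map]
    filter_upwards [h2.eventually h1] with w hw hwJ hwl
    obtain ⟨s, rfl⟩ := (hJeb w).1 ⟨hwJ, by rwa [he.zero] at hwl⟩
    rwa [halfBox_re hn hζ] at hw
  obtain ⟨V, hVsub, hVo, hx₀V⟩ := mem_nhds_iff.1 (inter_mem (inter_mem
    (transport_leafBd hz hx₀ hy₀ hxy hE.range_mem) hlow) (hOd.mem_nhds hxOd))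
  have hVE : ∀ x ∈ V, x ∉ range E := fun x hx hxE => Set.disjoint_left.1 hdisj (hVsub hx).2 (hEr hxE)
  -- the height of the leaf of `x` in the chart at `y₀`
  have hA : ∀ x ∈ J, x ∈ V → ∃ v > 0, ∀ s, RegConn B x (E (halfBox m η s v)) ∧ B.lt x (E (halfBox m η s v)) := by
    intro x hxJ hxV
    obtain ⟨_, ⟨w, rfl⟩, h1, h2⟩ := (hVsub hxV).1.1 hxJ
    obtain ⟨s₀, v, hv, rfl⟩ := (hJE w).1 (mem_leafComp_of_rel hxJ h1)
    have h3 : ∀ s, RegConn B x (E (halfBox m η s v)) := fun s => h1.trans (hE.regConn hη _ _ hv)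
    have h4 : B.lt x (E (halfBox m η s₀ v)) := by
      rcases h2 with h2 | h2
      · exact absurd ⟨_, h2⟩ (hVE x hxV)
      · exact h2
    refine ⟨v, hv, fun s => ⟨h3 s, ?_⟩⟩
    refine lt_of_connected (C := E '' ((fun s => halfBox m η s v) '' univ))
      ((isPreconnected_halfBox_row hm hη hv.le isPreconnected_univ).image _ hE.emb.continuous.continuousOn)
      ?_ ?_ ⟨_, ⟨s₀, trivial, rfl⟩, rfl⟩ ⟨_, ⟨s, trivial, rfl⟩, rfl⟩ h4
    · rintro _ ⟨_, ⟨s, -, rfl⟩, rfl⟩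
      exact (h3 s).rel
    · rintro _ ⟨_, ⟨s, -, rfl⟩, rfl⟩
      rcases (h3 s).comparable with h5 | h5 | h5
      · exact Or.inl h5
      · exact absurd ⟨_, h5.symm⟩ (hVE x hxV)
      · exact Or.inr h5
  have huniq : ∀ x s v v', 0 ≤ v → 0 ≤ v' → RegConn B x (E (halfBox m η s v)) → RegConn B x (E (halfBox m η s v')) →
      v = v' := by
    intro x s v v' hv hv' h1 h2
    exact (halfBox_inj hm hη (hE.emb.injective (eq_of_comparable_of_minus (h1.symm.trans h2).comparable
      (hE.minus_vertical hη s hv hv')))).2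
  -- On the leaf of `x₀` no positive row exists, and the default value `0` is the correct one: the
  -- row is the axis.
  let v : P → ℝ := fun x => if hx : ∃ v > 0, ∀ s, RegConn B x (E (halfBox m η s v)) ∧ B.lt x (E (halfBox m η s v))
    then hx.choose else 0
  have hvJ : ∀ x ∈ J, x ∈ V → 0 < v x ∧ ∀ s, RegConn B x (E (halfBox m η s (v x))) ∧ B.lt x (E (halfBox m η s (v x))) := by
    intro x hxJ hxV
    have h1 := hA x hxJ hxV
    simp only [v, dif_pos h1]
    exact h1.choose_spec
  have hvl : ∀ x, B.plus x₀ x → v x = 0 := by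
    intro x hx
    refine dif_neg ?_
    rintro ⟨v, hv, h1⟩
    have h2 := B.plus.trans hx (h1 0).1.rel
    have h3 : E (halfBox m η 0 v) ∈ J := (hJE _).2 ⟨0, v, hv, rfl⟩
    exact connectedComponentIn_subset _ _ h3 h2
  have hcl : ∀ x ∈ closure J, x ∈ J ∨ B.plus x₀ x := fun x hx => B.plusFol.mem_or_rel_of_mem_closure hx
  have hv0 : ∀ x ∈ closure J ∩ V, 0 ≤ v x := by
    rintro x ⟨hx, hxV⟩
    rcases hcl x hx with h1 | h1
    · exact (hvJ x h1 hxV).1.le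
    · exact (hvl x h1).ge
  have hlty : ∀ x ∈ closure J, x ∈ V → B.plus x₀ x → ∀ y ∈ leafBd B.plus x₀ z, a ≤ k y → B.lt x y := by
    intro x hx hxV hxl y hy hay
    have h1 : k x < k y := ((hVsub hxV).1.2 hx hxl).trans_le hay
    rcases lt_trichotomy_leafBd hz ⟨hx, hxl⟩ hy with h2 | h2 | h2
    · exact h2
    · rw [h2] at h1
      exact absurd h1 (_root_.lt_irrefl _)
    · exact absurd h1 (hk.mono _ _ hy.2 h2).not_gt
  -- Nearby points are transported into a thin strip around the row of `x₁`, and any row reached by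
  -- a regular arc is the row `v x`. Inside the component the arc is regular; at the leaf of `x₀`
  -- one-sided transport is used.
  have hvc : ContinuousOn v (closure J ∩ V) := by
    rintro x₁ ⟨hx₁, hx₁V⟩
    have hW : ∀ (s v₁ ε : ℝ), 0 < ε → 0 ≤ v₁ → E '' {w | |(|(w ^ m).im| - v₁)| < ε} ∈ 𝓝 (E (halfBox m η s v₁)) := by
      intro s v₁ ε hε hv₁
      refine hE.emb.isOpenMap.image_mem_nhds ((isOpen_lt (by fun_prop) continuous_const).mem_nhds ?_)
      show |(|(halfBox m η s v₁ ^ m).im| - v₁)| < ε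
      rw [abs_halfBox_im hm hη s hv₁, sub_self, abs_zero]
      exact hε
    have hfin : ∀ x ∈ J, x ∈ V → ∀ v₁ ε, ∀ y ∈ E '' {w | |(|(w ^ m).im| - v₁)| < ε}, RegConn B x y → |v x - v₁| < ε := by
      rintro x hxJ hxV v₁ ε _ ⟨w, hw, rfl⟩ h1
      obtain ⟨s, v', hv', rfl⟩ := (hJE w).1 (mem_leafComp_of_rel hxJ h1)
      obtain ⟨h2, h3⟩ := hvJ x hxJ hxV
      rw [huniq x s _ _ h2.le hv'.le (h3 s).1 h1]
      have : |(|(halfBox m η s v' ^ m).im| - v₁)| < ε := hw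
      rwa [abs_halfBox_im hm hη s hv'.le] at this
    have hgoal : ∀ ε > 0, ∀ᶠ x in 𝓝[closure J ∩ V] x₁, |v x - v x₁| < ε := by
      intro ε hε
      rcases hcl x₁ hx₁ with h1 | h1
      · obtain ⟨h2, h3⟩ := hvJ x₁ h1 hx₁V
        have h4 := (h3 0).1.transport (hW 0 (v x₁) ε hε h2.le)
        have h5 : J ∈ 𝓝 x₁ := B.plusFol.isOpen_leafComp.mem_nhds h1
        filter_upwards [mem_nhdsWithin_of_mem_nhds h4, mem_nhdsWithin_of_mem_nhds h5, self_mem_nhdsWithin]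
          with x ⟨y', hy', h6⟩ hxJ hx
        exact hfin x hxJ hx.2 _ _ y' hy' h6
      · have h2 : B.lt x₁ y₀ := hlty x₁ hx₁ hx₁V h1 y₀ hy₀ hay.le
        have h3 : E '' {w | |(|(w ^ m).im| - 0)| < ε} ∈ 𝓝 y₀ := by
          have := hW 0 0 ε hε le_rfl
          rwa [halfBox_zero hm, hE.zero] at this
        have h4 := transport_leafBd hz ⟨hx₁, h1⟩ hy₀ h2 h3
        rw [hvl x₁ h1]
        filter_upwards [mem_nhdsWithin_of_mem_nhds h4, self_mem_nhdsWithin] with x hx hxV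
        rcases hcl x hxV.1 with h5 | h5
        · obtain ⟨y', hy', h6, -⟩ := hx h5
          exact hfin x h5 hxV.2 _ _ y' hy' h6
        · rw [hvl x h5]
          simpa using hε
    rw [ContinuousWithinAt, Metric.tendsto_nhds]
    intro ε hε
    filter_upwards [hgoal ε hε] with x hx
    rwa [Real.dist_eq]
  have hIa : ∀ t ∈ I, a ≤ t := fun t ht => (le_max_left _ _).trans ht.1.le
  have hbd : ∀ s, E (halfBox m η s 0) ∈ leafBd B.plus x₀ z := fun s => (hJEb _).2 ⟨s, rfl⟩
  refine ⟨V, hVo.mem_nhds hx₀V, I, hIy, fun x t => E (halfBox m η (u t) (v x)), ?_, ?_, ?_, ?_, ?_, ?_⟩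
  · refine hE.emb.continuous.comp_continuousOn ((continuousOn_halfBox hm hη).comp
      (f := fun p : P × ℝ => ((u p.2, v p.1) : ℝ × ℝ)) ?_ ?_)
    · exact (huc.comp continuousOn_snd fun p hp => hp.2).prodMk (hvc.comp continuousOn_fst fun p hp => hp.1)
    · exact fun p hp => hv0 _ hp.1
  · intro x hx hxV t ht
    rcases hcl x hx with h1 | h1
    · obtain ⟨-, h2⟩ := hvJ x h1 hxV
      exact (h2 _).1.mem_R (h2 _).2
    · simp only [hvl x h1]
      refine ⟨hlty x hx hxV h1 _ (hbd _) ((hIa t ht).trans (hfu t ht).ge), z, ?_, ?_, ?_⟩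
      · rw [← leafOf_eq h1]; exact hz
      · rw [← leafOf_eq h1]; exact hx
      · rw [← leafOf_eq h1]; exact (hbd _).1
  · intro x hx hxV t ht
    refine ⟨E (halfBox m η (u t) 0), hbd _, hlty x₀ hx₀.1 hx₀V (B.plus.refl x₀) _ (hbd _) ((hIa t ht).trans (hfu t ht).ge),
      hfu t ht, hE.minus_vertical hη _ (hv0 x ⟨hx, hxV⟩) le_rfl⟩
  · intro x hx hxV t ht h1
    simp only [hvl x h1]
    exact ⟨hbd _, hfu t ht⟩
  · intro x₁ hx₁ hx₁V t₁ ht₁ T hT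
    have h1 : ∀ᶠ w in 𝓝 (halfBox m η (u t₁) (v x₁)), f ((w ^ m).re) ∈ T ∩ I := by
      have hc : Continuous fun w : ℂ => f ((w ^ m).re) := hfc.comp (by fun_prop)
      refine hc.continuousAt.eventually_mem ?_
      rw [halfBox_re hm hη, hfu t₁ ht₁]
      exact inter_mem hT (Ioo_mem_nhds ht₁.1 ht₁.2)
    have h2 : ∀ᶠ y in 𝓝 (E (halfBox m η (u t₁) (v x₁))), ∃ w, y = E w ∧ f ((w ^ m).re) ∈ T ∩ I := by
      rw [← hE.emb.map_nhds_eq, eventually_map]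
      filter_upwards [h1] with w hw
      exact ⟨w, rfl, hw⟩
    rw [nhds_prod_eq]
    filter_upwards [h2.prod_inr (𝓝 x₁)] with p hp hp1 hpV hp2 hlt
    obtain ⟨x, y⟩ := p
    obtain ⟨w, hyw, hw⟩ := hp
    have hyw : y = E w := hyw
    subst hyw
    have hlt : B.lt x (E w) := hlt
    rcases hcl x hp1 with h3 | h3
    · have h4 : E w ∈ J := by
        rcases hcl _ hp2 with h4 | h4
        · exact h4
        · exact absurd (B.plus.trans h4 (B.plus.symm (B.lt_leaf _ _ hlt))) (connectedComponentIn_subset _ _ h3)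
      obtain ⟨s, v', hv', rfl⟩ := (hJE w).1 h4
      rw [halfBox_re hm hη] at hw
      refine ⟨f s, hw, ?_⟩
      obtain ⟨h5, h6⟩ := hvJ x h3 hpV
      show E (halfBox m η s v') = E (halfBox m η (u (f s)) (v x))
      rw [huf]
      exact eq_of_comparable_of_minus ((h6 s).1.comparable_of_lt (h6 s).2 hlt)
        (hE.minus_vertical hη s hv'.le h5.le)
    · obtain ⟨s, rfl⟩ := (hJEb w).1 ⟨hp2, B.plus.trans h3 (B.lt_leaf _ _ hlt)⟩
      rw [halfBox_re hm hη] at hw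
      refine ⟨f s, hw, ?_⟩
      show E (halfBox m η s 0) = E (halfBox m η (u (f s)) (v x))
      rw [huf, hvl x h3]
  · intro x hx hxV t ht y hxy' hs
    obtain ⟨-, h2⟩ := hvJ x hx hxV
    exact eq_of_sim_of_comparable hh hs ((h2 _).1.comparable_of_lt (h2 _).2 hxy')

end height

end OrientedBifoliatedPlane

namespace OrientedBifoliatedPlane

variable {P : Type*} [TopologicalSpace P] {B : OrientedBifoliatedPlane P}

section height

variable {G : Type*} [Group G] [MulAction G P] {h : P → ℝ} (hh : B.IsHeight G h)
include hh

/-! ### The leaves of the transverse foliation and the linking relation -/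

lemma linked_of_sim {x y y' : P} (hy : B.lt x y) (hy' : B.lt x y') (hs : B.sim h y y') : Linked B h y y' := by
  rcases exists_ord_of_not_comparable hy hy' with h1 | ⟨s, hs', hsy, hsy'⟩
  · rw [eq_of_sim_of_comparable hh hs h1]
    exact Relation.ReflTransGen.refl
  · rcases hs with rfl | ⟨-, -, h2⟩
    · exact Relation.ReflTransGen.refl
    · exact Linked.of_edge ⟨s, hs', hsy, hsy', h2⟩

lemma linked_of_setoidN {a b : B.N₂} (hab : B.setoidN h a b) : Linked B h a.1.2 b.1.2 := by
  obtain ⟨h1, h2⟩ := hab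
  exact linked_of_sim hh (x := a.1.1) a.2.1 (h1 ▸ b.2.1) h2

/-- Each generating step keeps the second coordinate on a leaf of `𝓕⁻`, and a change of
representative is an identification. All representatives are quantified, so that transitivity can
pass through an arbitrary one. -/
lemma linked_of_folF {p q : B.N h} (hpq : B.folF h p q) : ∀ a b : B.N₂, Quotient.mk (B.setoidN h) a = p →
    Quotient.mk (B.setoidN h) b = q → Linked B h a.1.2 b.1.2 := by
  have hpq' : Relation.EqvGen _ p q := hpq
  induction hpq' with
  | rel p q hr =>
    obtain ⟨a', b', ha', hb', hc⟩ := hr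
    intro a b ha hb
    have h1 := linked_of_setoidN hh (Quotient.exact (ha.trans ha'.symm))
    have h2 := linked_of_setoidN hh (Quotient.exact (hb'.trans hb.symm))
    have h3 : b' ∈ {c : B.N₂ | B.minus a'.1.2 c.1.2} := connectedComponentIn_subset _ _ hc
    exact h1.trans ((Linked.of_minus h3).trans h2)
  | refl p =>
    intro a b ha hb
    exact linked_of_setoidN hh (Quotient.exact (ha.trans hb.symm))
  | symm p q _ ih =>
    intro a b ha hb
    exact (ih (by assumption) b a hb ha).symm
  | trans p q r _ _ ih1 ih2 =>
    intro a b ha hb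
    obtain ⟨c, hc⟩ := Quotient.exists_rep q
    exact (ih1 (by assumption) a c ha hc).trans (ih2 (by assumption) c b hc hb)

end height

/-! ### Local product structure -/

/-- Local sections of `N` over all sectors at `x₀`. -/
structure LocalProduct (B : OrientedBifoliatedPlane P) (h : P → ℝ) (x₀ : P) (k : P → ℝ) (Z V : Set P) (I : Set ℝ)
    (σ : P → P → ℝ → P) : Prop where
  height : LeafHeight B h x₀ k
  finite : Z.Finite
  open_V : IsOpen V
  mem : x₀ ∈ V
  not_rel : ∀ z ∈ Z, ¬ B.plus x₀ z
  mem_bd : ∀ z ∈ Z, x₀ ∈ leafBd B.plus x₀ z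
  sec : ∀ z ∈ Z, LocalSection B h x₀ z k V I (σ z)
  cover : ∀ x ∈ V, ∃ z ∈ Z, x ∈ closure (leafComp B.plus x₀ z)
  cover_R : ∀ x ∈ V, ∀ y ∈ B.R x, ∃ z ∈ Z, x ∈ closure (leafComp B.plus x₀ z) ∧ y ∈ closure (leafComp B.plus x₀ z)
  conn : ∀ z ∈ Z, IsPreconnected (leafComp B.plus x₀ z ∩ V)

section height

variable {G : Type*} [Group G] [MulAction G P] {h : P → ℝ} (hh : B.IsHeight G h)
include hh

/-- `Z` has one point in each of the finitely many sectors at `x₀`. For each sector, `y₀` is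
replaced by its identified partner in the boundary of that component; this has the same height, so
all sections are labelled by one interval of heights. The common neighbourhood is the range of a
chart, which makes its intersection with each component a single sector. -/
theorem exists_localProduct {x₀ y₀ : P} (hxy : B.lt x₀ y₀) : ∃ k Z V σ, ∃ δ > 0, ∃ e,
    B.BiChart (B.ord x₀) e x₀ ∧ range e = V ∧
    LocalProduct B h x₀ k Z V (Ioo (k y₀ - δ) (k y₀ + δ)) σ := by
  obtain ⟨k, hk⟩ := exists_leafHeight hh x₀
  obtain ⟨e, he, -⟩ := B.exists_biChart x₀ univ_mem
  set n := B.ord x₀ with hn'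
  have hn := he.ne_zero
  set Z := (fun ζ => e (halfBox n ζ 0 1)) '' sectorDirs n with hZ
  have hsec1 : ∀ ζ, halfBox n ζ 0 1 ∈ sector n ζ := fun ζ => ⟨0, 1, one_pos, rfl⟩
  have hZf : Z.Finite := (finite_sectorDirs hn).image _
  have hZrel : ∀ z ∈ Z, ¬ B.plus x₀ z := by
    rintro _ ⟨ζ, hζ, rfl⟩
    exact he.nice.image_sector_subset hζ ⟨_, hsec1 ζ, rfl⟩
  have hZbd : ∀ z ∈ Z, x₀ ∈ leafBd B.plus x₀ z := by
    rintro _ ⟨ζ, hζ, rfl⟩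
    exact B.plusFol.mem_leafBd_sector he.nice hζ (hsec1 ζ)
  have hZall : ∀ z', x₀ ∈ closure (leafComp B.plus x₀ z') → ∃ z ∈ Z, leafComp B.plus x₀ z' = leafComp B.plus x₀ z := by
    intro z' hz'
    obtain ⟨ζ, hζ, h1, -⟩ := B.plusFol.exists_sector_leafComp (B.plus.refl x₀) he.nice (w₁ := 0)
      (by rw [he.zero]; exact hz')
    exact ⟨_, ⟨ζ, hζ, rfl⟩, connectedComponentIn_eq ((h1 _).2 (hsec1 ζ))⟩
  have hloc : ∀ z ∈ Z, ∃ V ∈ 𝓝 x₀, ∃ I ∈ 𝓝 (k y₀), ∃ σ, LocalSection B h x₀ z k V I σ := by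
    intro z hz
    obtain ⟨y, hy, hs⟩ := exists_sim_mem_leafBd hh (hZrel z hz) (hZbd z hz) hxy
    have hky := (hk.sim_iff _ _ (B.lt_leaf _ _ hxy) hy.2).1 hs
    have hlt : B.lt x₀ y := by
      have h1 := hk.mono _ _ (B.plus.refl x₀) hxy
      rcases lt_trichotomy_leafBd (hZrel z hz) (hZbd z hz) hy with h2 | h2 | h2
      · exact h2
      · rw [hky, ← h2] at h1
        exact absurd h1 (_root_.lt_irrefl _)
      · have h3 := hk.mono _ _ hy.2 h2
        rw [← hky] at h3
        exact absurd h1 h3.not_gt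
    rw [hky]
    exact exists_localSection hh (hZrel z hz) (hZbd z hz) hy hlt hk
  choose! V hV I hI σ hσ using hloc
  have hVi : (⋂ z ∈ Z, V z) ∈ 𝓝 x₀ := (biInter_mem hZf).2 hV
  have hIi : (⋂ z ∈ Z, I z) ∈ 𝓝 (k y₀) := (biInter_mem hZf).2 hI
  obtain ⟨δ, hδ, hball⟩ := Metric.mem_nhds_iff.1 hIi
  rw [Real.ball_eq_Ioo] at hball
  obtain ⟨e', he', hr⟩ := B.exists_biChart x₀ hVi
  have hZ'all : ∀ z', ∀ w, e' w ∈ closure (leafComp B.plus x₀ z') → ∃ z ∈ Z, leafComp B.plus x₀ z' = leafComp B.plus x₀ z := by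
    intro z' w hw
    obtain ⟨ζ, hζ, h1, h2⟩ := B.plusFol.exists_sector_leafComp (B.plus.refl x₀) he'.nice hw
    apply hZall
    have := (h2 0).2 ⟨0, halfBox_zero hn⟩
    rw [he'.zero] at this
    exact this.1
  refine ⟨k, Z, range e', σ, δ, hδ, e', he', rfl, ⟨hk, hZf, he'.emb.isOpen_range, ⟨0, he'.zero⟩, hZrel, hZbd, ?_, ?_, ?_, ?_⟩⟩
  · intro z hz
    exact (hσ z hz).mono (fun x hx => mem_iInter₂.1 (hr hx) z hz) (fun t ht => mem_iInter₂.1 (hball ht) z hz) isOpen_Ioo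
  · rintro _ ⟨w, rfl⟩
    obtain ⟨ζ, hζ, hw⟩ : ∃ ζ ∈ sectorDirs n, w ∈ closure (sector n ζ) := by
      by_cases hw0 : (w ^ n).im = 0
      · by_cases hww : w = 0
        · obtain ⟨ζ, hζ⟩ := exists_sectorDir n hn
          refine ⟨ζ, Or.inl hζ, ?_⟩
          have := halfBox_mem_closure_sector hn (ζ := ζ) (Or.inl hζ) 0
          rwa [halfBox_zero hn, ← hww] at this
        · obtain ⟨ζ, hζ, -, h1, -⟩ := exists_axis_halfBox hn hww hw0 (Or.inl rfl)
          refine ⟨ζ, hζ, ?_⟩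
          rw [← h1]
          exact halfBox_mem_closure_sector hn hζ _
      · obtain ⟨ζ, hζ, h1⟩ := exists_sector hn hw0
        exact ⟨ζ, hζ, subset_closure h1⟩
    have h2 : e' '' sector n ζ ⊆ leafComp B.plus x₀ (e' (halfBox n ζ 0 1)) :=
      (he'.nice.isPreconnected_image_sector hζ).subset_connectedComponentIn ⟨_, hsec1 ζ, rfl⟩ (he'.nice.image_sector_subset hζ)
    have h3 : e' w ∈ closure (leafComp B.plus x₀ (e' (halfBox n ζ 0 1))) :=
      closure_mono h2 (image_closure_subset_closure_image he'.emb.continuous ⟨w, hw, rfl⟩)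
    obtain ⟨z, hz, h4⟩ := hZ'all _ w h3
    exact ⟨z, hz, h4 ▸ h3⟩
  · rintro _ ⟨w, rfl⟩ y ⟨hlt, z', hz', hx', hy'⟩
    by_cases hw : B.plus x₀ (e' w)
    · rw [← leafOf_eq hw] at hx' hy'
      obtain ⟨z, hz, h4⟩ := hZ'all _ w hx'
      exact ⟨z, hz, h4 ▸ hx', h4 ▸ hy'⟩
    · have h1 : e' w ∈ leafComp B.plus x₀ (e' w) := mem_connectedComponentIn hw
      obtain ⟨z, hz, h4⟩ := hZ'all _ w (subset_closure h1)
      refine ⟨z, hz, h4 ▸ subset_closure h1, h4 ▸ subset_closure ?_⟩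
      obtain ⟨C, hC, hxC, hyC, hC'⟩ := exists_arc hlt
      refine hC.subset_connectedComponentIn hxC ?_ hyC
      intro c hc hc0
      apply hw
      refine B.plus.trans hc0 ?_
      rcases (hC' c hc).1 with rfl | h2
      · exact B.plus.refl _
      · exact B.plus.symm (B.lt_leaf _ _ h2)
  · intro z hz
    obtain ⟨ζ, hζ, h1, -⟩ := B.plusFol.exists_sector_leafComp (z := z) (B.plus.refl x₀) he'.nice (w₁ := 0)
      (by rw [he'.zero]; exact (hZbd z hz).1)
    have h2 : leafComp B.plus x₀ z ∩ range e' = e' '' sector n ζ := by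
      ext y
      constructor
      · rintro ⟨h3, w, rfl⟩
        exact ⟨w, (h1 w).1 h3, rfl⟩
      · rintro ⟨w, hw, rfl⟩
        exact ⟨(h1 w).2 hw, w, rfl⟩
    rw [h2]
    exact he'.nice.isPreconnected_image_sector hζ

variable {x₀ : P} {k : P → ℝ} {Z V : Set P} {I : Set ℝ} {σ : P → P → ℝ → P}
variable (L : LocalProduct B h x₀ k Z V I σ)

namespace LocalProduct

include L

/-- Points of the sections with linked values have the same height. -/
lemma eq_of_linked {x x' z z' : P} {t t' : ℝ} (hz : z ∈ Z) (hx : x ∈ closure (leafComp B.plus x₀ z)) (hxV : x ∈ V)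
    (ht : t ∈ I) (hz' : z' ∈ Z) (hx' : x' ∈ closure (leafComp B.plus x₀ z')) (hxV' : x' ∈ V) (ht' : t' ∈ I)
    (hl : Linked B h (σ z x t) (σ z' x' t')) : t = t' := by
  obtain ⟨y, -, hy, hyt, hm⟩ := (L.sec z hz).foot x hx hxV t ht
  obtain ⟨y', -, hy', hyt', hm'⟩ := (L.sec z' hz').foot x' hx' hxV' t' ht'
  have h1 : Linked B h y y' := (Linked.of_minus (B.minus.symm hm)).trans (hl.trans (Linked.of_minus hm'))
  rw [← hyt, ← hyt']
  exact (L.height.sim_iff _ _ (B.lt_leaf _ _ hy) (B.lt_leaf _ _ hy')).1 (sim_of_linked hh hy hy' h1)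

/-- Over a common boundary point of two sectors the feet of the two sections have equal height, so
they are identified. The section values are then linked points of one `R x`. This makes the sections
a well-defined map to `N`. -/
lemma sim_section {x z z' : P} {t : ℝ} (hxV : x ∈ V) (ht : t ∈ I) (hz : z ∈ Z) (hx : x ∈ closure (leafComp B.plus x₀ z))
    (hz' : z' ∈ Z) (hx' : x ∈ closure (leafComp B.plus x₀ z')) : B.sim h (σ z x t) (σ z' x t) := by
  obtain ⟨y, -, hy, hyt, hm⟩ := (L.sec z hz).foot x hx hxV t ht
  obtain ⟨y', -, hy', hyt', hm'⟩ := (L.sec z' hz').foot x hx' hxV t ht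
  have h1 := (L.height.sim_iff _ _ (B.lt_leaf _ _ hy) (B.lt_leaf _ _ hy')).2 (hyt.trans hyt'.symm)
  have h2 := linked_of_sim hh hy hy' h1
  exact sim_of_linked hh ((L.sec z hz).mem_R x hx hxV t ht).1 ((L.sec z' hz').mem_R x hx' hxV t ht).1
    ((Linked.of_minus hm).trans (h2.trans (Linked.of_minus (B.minus.symm hm'))))

lemma eq_section {x y z : P} {t : ℝ} (hxV : x ∈ V) (ht : t ∈ I) (hz : z ∈ Z) (hx : x ∈ closure (leafComp B.plus x₀ z))
    (hy : y ∈ closure (leafComp B.plus x₀ z)) (hlt : B.lt x y) (hs : B.sim h y (σ z x t)) : y = σ z x t := by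
  rcases B.plusFol.mem_or_rel_of_mem_closure hx with h1 | h1
  · exact (L.sec z hz).unique x h1 hxV t ht y hlt hs
  · have h2 := ((L.sec z hz).leaf x hx hxV t ht h1).1
    exact eq_of_sim_of_comparable hh hs (lt_trichotomy_leafBd (L.not_rel z hz)
      ⟨hy, B.plus.trans h1 (B.lt_leaf _ _ hlt)⟩ h2)

omit hh

/-- The point of `N` over `x` at height `t`. -/
lemma exists_point {x : P} {t : ℝ} (hx : x ∈ V) (ht : t ∈ I) : ∃ a : B.N₂, a.1.1 = x ∧
    ∃ z ∈ Z, x ∈ closure (leafComp B.plus x₀ z) ∧ a.1.2 = σ z x t := by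
  obtain ⟨z, hz, hxz⟩ := L.cover x hx
  exact ⟨⟨(x, σ z x t), (L.sec z hz).mem_R x hxz hx t ht⟩, rfl, z, hz, hxz, rfl⟩

end LocalProduct

end height

end OrientedBifoliatedPlane

namespace OrientedBifoliatedPlane

variable {P : Type*} [TopologicalSpace P] {B : OrientedBifoliatedPlane P}

open Classical in
/-- The map `V × I → N` given by the sections `σ`. -/
noncomputable def sectionMap (B : OrientedBifoliatedPlane P) {h : P → ℝ} (x₀ : P) (Z : Set P) (σ : P → P → ℝ → P)
    (p : B.N h) (x : P × ℝ) : B.N h :=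
  if H : ∃ a : B.N₂, a.1.1 = x.1 ∧ ∃ z ∈ Z, x.1 ∈ closure (leafComp B.plus x₀ z) ∧ a.1.2 = σ z x.1 x.2
    then Quotient.mk (B.setoidN h) H.choose else p

section height

variable {G : Type*} [Group G] [MulAction G P] {h : P → ℝ} (hh : B.IsHeight G h)
variable {x₀ : P} {k : P → ℝ} {Z V : Set P} {I : Set ℝ} {σ : P → P → ℝ → P}
variable (L : LocalProduct B h x₀ k Z V I σ) (p : B.N h)
include hh L

namespace LocalProduct

lemma sectionMap_eq {x : P × ℝ} (hx : x.1 ∈ V) (ht : x.2 ∈ I) {a : B.N₂} {z : P} (ha : a.1.1 = x.1) (hz : z ∈ Z)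
    (hxz : x.1 ∈ closure (leafComp B.plus x₀ z)) (ha' : a.1.2 = σ z x.1 x.2) :
    B.sectionMap x₀ Z σ p x = Quotient.mk (B.setoidN h) a := by
  have H : ∃ a : B.N₂, a.1.1 = x.1 ∧ ∃ z ∈ Z, x.1 ∈ closure (leafComp B.plus x₀ z) ∧ a.1.2 = σ z x.1 x.2 :=
    ⟨a, ha, z, hz, hxz, ha'⟩
  rw [sectionMap, dif_pos H]
  obtain ⟨h1, z', hz', h2, h3⟩ := H.choose_spec
  refine Quotient.sound ⟨h1.trans ha.symm, ?_⟩
  rw [h3, ha']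
  exact L.sim_section hh hx ht hz' h2 hz hxz

lemma exists_sectionMap_eq {x : P × ℝ} (hx : x.1 ∈ V) (ht : x.2 ∈ I) : ∃ a : B.N₂, a.1.1 = x.1 ∧
    (∃ z ∈ Z, x.1 ∈ closure (leafComp B.plus x₀ z) ∧ a.1.2 = σ z x.1 x.2) ∧
    B.sectionMap x₀ Z σ p x = Quotient.mk (B.setoidN h) a := by
  obtain ⟨a, ha, z, hz, hxz, ha'⟩ := L.exists_point hx ht
  exact ⟨a, ha, ⟨z, hz, hxz, ha'⟩, L.sectionMap_eq hh p hx ht ha hz hxz ha'⟩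

lemma proj_sectionMap {x : P × ℝ} (hx : x.1 ∈ V) (ht : x.2 ∈ I) : B.proj h (B.sectionMap x₀ Z σ p x) = x.1 := by
  obtain ⟨a, ha, -, h1⟩ := L.exists_sectionMap_eq hh p hx ht
  rw [h1]
  exact ha

lemma sectionMap_center {a : B.N₂} (ha : a.1.1 = x₀) (ht : k a.1.2 ∈ I) :
    B.sectionMap x₀ Z σ p (x₀, k a.1.2) = Quotient.mk (B.setoidN h) a := by
  obtain ⟨b, hb, ⟨z, hz, hxz, hb'⟩, h1⟩ := L.exists_sectionMap_eq hh p (x := (x₀, k a.1.2)) L.mem ht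
  rw [h1]
  refine Quotient.sound ⟨hb.trans ha.symm, ?_⟩
  obtain ⟨h2, h3⟩ := (L.sec z hz).leaf x₀ hxz L.mem _ ht (B.plus.refl _)
  rw [hb']
  refine (L.height.sim_iff _ _ h2.2 ?_).2 h3
  have := B.lt_leaf _ _ a.2.1
  rwa [ha] at this

lemma eq_of_folF_sectionMap {x x' : P × ℝ} (hx : x.1 ∈ V) (ht : x.2 ∈ I) (hx' : x'.1 ∈ V) (ht' : x'.2 ∈ I)
    (H : B.folF h (B.sectionMap x₀ Z σ p x) (B.sectionMap x₀ Z σ p x')) : x.2 = x'.2 := by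
  obtain ⟨a, -, ⟨z, hz, hxz, ha'⟩, h1⟩ := L.exists_sectionMap_eq hh p hx ht
  obtain ⟨b, -, ⟨z', hz', hxz', hb'⟩, h2⟩ := L.exists_sectionMap_eq hh p hx' ht'
  have h3 := linked_of_folF hh H a b h1.symm h2.symm
  rw [ha', hb'] at h3
  exact L.eq_of_linked hh hz hxz hx ht hz' hxz' hx' ht' h3

/-- The domain is a finite union of relatively closed pieces, one for each sector, and on each of
them the map is given by a continuous section. -/
lemma continuousOn_sectionMap : ContinuousOn (B.sectionMap x₀ Z σ p) (V ×ˢ I) := by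
  have hc : ∀ z ∈ Z, ContinuousOn (B.sectionMap x₀ Z σ p) ((closure (leafComp B.plus x₀ z) ∩ V) ×ˢ I) := by
    intro z hz
    have h1 := (L.sec z hz).cont
    rw [continuousOn_iff_continuous_domRestrict] at h1 ⊢
    have h2 : ∀ q : ((closure (leafComp B.plus x₀ z) ∩ V) ×ˢ I : Set (P × ℝ)), σ z q.1.1 q.1.2 ∈ B.R q.1.1 :=
      fun q => (L.sec z hz).mem_R _ q.2.1.1 q.2.1.2 _ q.2.2
    have h3 : Continuous fun q : ((closure (leafComp B.plus x₀ z) ∩ V) ×ˢ I : Set (P × ℝ)) =>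
        Quotient.mk (B.setoidN h) ⟨(q.1.1, σ z q.1.1 q.1.2), h2 q⟩ :=
      continuous_quotient_mk'.comp (Continuous.subtype_mk ((continuous_fst.comp continuous_subtype_val).prodMk h1) _)
    convert h3 using 2 with q
    exact L.sectionMap_eq hh p q.2.1.2 q.2.2 rfl hz q.2.1.1 rfl
  have hU : V ×ˢ I = ⋃ z ∈ Z, (closure (leafComp B.plus x₀ z) ∩ V) ×ˢ I := by
    ext x
    simp only [mem_iUnion, exists_prop, mem_prod, mem_inter_iff]
    constructor
    · rintro ⟨h1, h2⟩
      obtain ⟨z, hz, h3⟩ := L.cover _ h1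
      exact ⟨z, hz, ⟨h3, h1⟩, h2⟩
    · rintro ⟨z, hz, ⟨-, h1⟩, h2⟩
      exact ⟨h1, h2⟩
  intro x hx
  rw [ContinuousWithinAt, hU, nhdsWithin_biUnion L.finite]
  simp only [tendsto_iSup]
  intro z hz
  by_cases hxz : x.1 ∈ closure (leafComp B.plus x₀ z)
  · exact hc z hz x ⟨⟨hxz, hx.1⟩, hx.2⟩
  · have h1 : 𝓝[(closure (leafComp B.plus x₀ z) ∩ V) ×ˢ I] x = ⊥ := by
      rw [← notMem_closure_iff_nhdsWithin_eq_bot]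
      intro h2
      have h3 : IsClosed {q : P × ℝ | q.1 ∈ closure (leafComp B.plus x₀ z)} := isClosed_closure.preimage continuous_fst
      have h4 : x ∈ {q : P × ℝ | q.1 ∈ closure (leafComp B.plus x₀ z)} :=
        h3.closure_subset_iff.2 (fun q hq => hq.1.1) h2
      exact hxz h4
    rw [h1]
    exact tendsto_bot

/-- Openness is tested upstairs in `N₂`. A pair near `a` has both coordinates in the closure of one
of the finitely many components. If this closure contains both coordinates of `a`, then the pair is
a section value of nearby height; otherwise a neighbourhood of `a` excludes it. -/
lemma isOpen_image_sectionMap {O : Set (P × ℝ)} (hO : IsOpen O) (hOV : O ⊆ V ×ˢ I) :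
    IsOpen (B.sectionMap x₀ Z σ p '' O) := by
  rw [← isQuotientMap_quotient_mk'.isOpen_preimage, isOpen_iff_mem_nhds]
  rintro a ⟨⟨x, t⟩, hxt, ha⟩
  obtain ⟨hx, ht⟩ := hOV hxt
  obtain ⟨b, hb, ⟨z₀, hz₀, hxz₀, hb'⟩, h1⟩ := L.exists_sectionMap_eq hh p hx ht
  have h2 : B.setoidN h a b := Quotient.exact (ha.symm.trans h1)
  have hax : a.1.1 = x := h2.1.trans hb
  have has : B.sim h a.1.2 (σ z₀ x t) := hb' ▸ h2.2
  obtain ⟨V', hV', T, hT, hVT⟩ := mem_nhds_prod_iff.1 (hO.mem_nhds hxt)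
  have hcont : Continuous fun c : B.N₂ => c.1 := continuous_subtype_val
  have hcz : ∀ z ∈ Z, ∀ᶠ c : B.N₂ in 𝓝 a, c.1.1 ∈ V → c.1.1 ∈ closure (leafComp B.plus x₀ z) →
      c.1.2 ∈ closure (leafComp B.plus x₀ z) → ∃ t' ∈ T ∩ I, c.1.2 = σ z c.1.1 t' := by
    intro z hz
    by_cases haz : a.1.1 ∈ closure (leafComp B.plus x₀ z) ∧ a.1.2 ∈ closure (leafComp B.plus x₀ z)
    · have h3 : a.1.2 = σ z x t := L.eq_section hh hx ht hz (hax ▸ haz.1) haz.2 (hax ▸ a.2.1)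
        (B.sim_trans has (L.sim_section hh hx ht hz₀ hxz₀ hz (hax ▸ haz.1)))
      have h4 : a.1 = (x, σ z x t) := Prod.ext hax h3
      have h5 := (L.sec z hz).nhds x (hax ▸ haz.1) hx t ht T hT
      rw [← h4] at h5
      filter_upwards [hcont.continuousAt.eventually h5] with c hc h6 h7 h8
      exact hc h7 h6 h8 c.2.1
    · rw [not_and_or] at haz
      have hcl : IsClosed (closure (leafComp B.plus x₀ z)) := isClosed_closure
      rcases haz with h3 | h3
      · filter_upwards [(continuous_fst.comp hcont).continuousAt.eventually (hcl.isOpen_compl.mem_nhds h3)] with c hc _ h4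
        exact absurd h4 hc
      · filter_upwards [(continuous_snd.comp hcont).continuousAt.eventually (hcl.isOpen_compl.mem_nhds h3)] with c hc _ _ h4
        exact absurd h4 hc
  have hfst : Continuous fun c : B.N₂ => c.1.1 := continuous_fst.comp hcont
  filter_upwards [(eventually_all_finite L.finite).2 hcz,
    hfst.continuousAt.eventually_mem (hax ▸ inter_mem hV' (L.open_V.mem_nhds hx))] with c hc hcV
  obtain ⟨z, hz, h3, h4⟩ := L.cover_R _ hcV.2 _ c.2
  obtain ⟨t', ht', h5⟩ := hc z hz hcV.2 h3 h4
  exact ⟨(c.1.1, t'), hVT ⟨hcV.1, ht'.1⟩, L.sectionMap_eq hh p hcV.2 ht'.2 rfl hz h3 h5⟩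

/-- With `t` fixed, all values of a section lie on the leaf of `𝓕⁻` through one foot, and the closed
sector over which `x` varies is connected. -/
lemma folF_sectionMap_center {x : P} {t : ℝ} (hx : x ∈ V) (ht : t ∈ I) :
    B.folF h (B.sectionMap x₀ Z σ p (x, t)) (B.sectionMap x₀ Z σ p (x₀, t)) := by
  obtain ⟨z, hz, hxz⟩ := L.cover x hx
  have hR := fun (y : (closure (leafComp B.plus x₀ z) ∩ V : Set P)) => (L.sec z hz).mem_R _ y.2.1 y.2.2 t ht
  set f : (closure (leafComp B.plus x₀ z) ∩ V : Set P) → B.N₂ := fun y => ⟨(y.1, σ z y.1 t), hR y⟩ with hf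
  have hfc : Continuous f := by
    refine Continuous.subtype_mk (continuous_subtype_val.prodMk ?_) _
    exact (L.sec z hz).cont.comp_continuous (continuous_subtype_val.prodMk continuous_const) fun y => ⟨y.2, ht⟩
  have hT : IsPreconnected (closure (leafComp B.plus x₀ z) ∩ V) := by
    refine (L.conn z hz).subset_closure (inter_subset_inter_left _ subset_closure) ?_
    exact L.open_V.closure_inter
  have hpre : IsPreconnected (range f) := by
    have := isPreconnected_iff_preconnectedSpace.1 hT
    exact isPreconnected_range hfc
  set a := f ⟨x, hxz, hx⟩ with ha
  set b := f ⟨x₀, (L.mem_bd z hz).1, L.mem⟩ with hb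
  have hsub : range f ⊆ {c : B.N₂ | B.minus a.1.2 c.1.2} := by
    rintro _ ⟨y, rfl⟩
    obtain ⟨u, hu, hxu, hku, hmu⟩ := (L.sec z hz).foot x hxz hx t ht
    obtain ⟨v, hv, hxv, hkv, hmv⟩ := (L.sec z hz).foot y.1 y.2.1 y.2.2 t ht
    have huv : u = v := by
      rcases lt_trichotomy_leafBd (L.not_rel z hz) hu hv with h1 | h1 | h1
      · exact absurd (L.height.mono _ _ hu.2 h1) (by rw [hku, hkv]; exact _root_.lt_irrefl _)
      · exact h1
      · exact absurd (L.height.mono _ _ hv.2 h1) (by rw [hku, hkv]; exact _root_.lt_irrefl _)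
    subst huv
    exact B.minus.trans hmu (B.minus.symm hmv)
  refine Relation.EqvGen.rel _ _ ⟨a, b, ?_, ?_, ?_⟩
  · exact (L.sectionMap_eq hh p hx ht rfl hz hxz rfl).symm
  · exact (L.sectionMap_eq hh p (x := (x₀, t)) L.mem ht rfl hz (L.mem_bd z hz).1 rfl).symm
  · exact hpre.subset_connectedComponentIn ⟨_, rfl⟩ hsub ⟨_, rfl⟩

end LocalProduct

end height

section height

variable {G : Type*} [Group G] [MulAction G P] {h : P → ℝ} (hh : B.IsHeight G h)
include hh

/-- A product chart of `N` around a point. -/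
theorem exists_productChart (p : B.N h) : ∃ e, B.BiChart (B.ord (B.proj h p)) e (B.proj h p) ∧
    ∃ Θ : P × ℝ → B.N h, (∀ e' : ℂ → P, IsOpenEmbedding e' → range e' = range e →
      IsOpenEmbedding fun w : ℂ × ℝ => Θ (e' w.1, w.2)) ∧
    (∀ x ∈ range e, ∀ r, B.proj h (Θ (x, r)) = x) ∧ Θ (B.proj h p, 0) = p ∧
    (∀ x ∈ range e, ∀ x' ∈ range e, ∀ r r', B.folF h (Θ (x, r)) (Θ (x', r')) ↔ r = r') := by
  obtain ⟨a, rfl⟩ := Quotient.exists_rep p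
  set p := Quotient.mk (B.setoidN h) a
  obtain ⟨k, Z, V, σ, δ, hδ, e, he, hr, L⟩ := exists_localProduct hh a.2.1
  -- The interval of heights is stretched to the whole line, with the given point at `0`.
  set s : ℝ → ℝ := fun r => k a.1.2 + squeeze δ r with hs
  have hsI : ∀ r, s r ∈ Ioo (k a.1.2 - δ) (k a.1.2 + δ) := by
    intro r
    have := abs_lt.1 (abs_squeeze_lt hδ r)
    constructor <;> simp only [hs] <;> linarith
  have hsc : Continuous s := continuous_const.add (continuous_squeeze δ)
  have hsi : Function.Injective s := fun r r' hrr => squeeze_injective hδ (add_left_cancel hrr)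
  have hso : IsOpenEmbedding s := by
    have h1 : StrictMono s := fun r r' hrr => by
      have := squeeze_strictMono hδ hrr
      simp only [hs]
      linarith
    have h2 : range s = Ioo (k a.1.2 - δ) (k a.1.2 + δ) := by
      refine (range_subset_iff.2 hsI).antisymm fun t ht => ⟨unsqueeze δ (t - k a.1.2), ?_⟩
      have h3 : |t - k a.1.2| < δ := abs_lt.2 ⟨by linarith [ht.1], by linarith [ht.2]⟩
      simp only [hs]
      rw [squeeze_unsqueeze h3]
      ring
    have h3 : OrdConnected (range s) := h2 ▸ ordConnected_Ioo
    exact ⟨h1.isEmbedding_of_ordConnected h3, h2 ▸ isOpen_Ioo⟩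
  refine ⟨e, he, fun x => B.sectionMap a.1.1 Z σ p (x.1, s x.2), ?_, ?_, ?_, ?_⟩
  · intro e' he' hr'
    have hV : ∀ w, e' w ∈ V := fun w => hr ▸ hr' ▸ ⟨w, rfl⟩
    refine IsOpenEmbedding.of_continuous_injective_isOpenMap ?_ ?_ ?_
    · exact (L.continuousOn_sectionMap hh p).comp_continuous
        ((he'.continuous.comp continuous_fst).prodMk (hsc.comp continuous_snd)) fun w => ⟨hV _, hsI _⟩
    · intro w w' hww
      have hww : B.sectionMap a.1.1 Z σ p (e' w.1, s w.2) = B.sectionMap a.1.1 Z σ p (e' w'.1, s w'.2) := hww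
      have h1 := congrArg (B.proj h) hww
      rw [L.proj_sectionMap hh p (hV _) (hsI _), L.proj_sectionMap hh p (hV _) (hsI _)] at h1
      have h2 := L.eq_of_folF_sectionMap hh p (x := (e' w.1, s w.2)) (x' := (e' w'.1, s w'.2)) (hV _) (hsI _) (hV _) (hsI _)
        (by rw [hww])
      exact Prod.ext (he'.injective h1) (hsi h2)
    · intro O hO
      have h1 : (fun w : ℂ × ℝ => B.sectionMap a.1.1 Z σ p (e' w.1, s w.2)) '' O =
          B.sectionMap a.1.1 Z σ p '' (Prod.map e' s '' O) := by
        rw [image_image]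
        rfl
      rw [h1]
      refine L.isOpen_image_sectionMap hh p ((he'.prodMap hso).isOpenMap _ hO) ?_
      rintro _ ⟨w, -, rfl⟩
      exact ⟨hV _, hsI _⟩
  · intro x hx r
    exact L.proj_sectionMap hh p (x := (x, s r)) (hr ▸ hx) (hsI _)
  · have h1 : s 0 = k a.1.2 := by simp [hs, squeeze]
    show B.sectionMap a.1.1 Z σ p (a.1.1, s 0) = p
    rw [h1]
    exact L.sectionMap_center hh p rfl (h1 ▸ hsI 0)
  · intro x hx x' hx' r r'
    constructor
    · intro H
      exact hsi (L.eq_of_folF_sectionMap hh p (x := (x, s r)) (x' := (x', s r')) (hr ▸ hx) (hsI _) (hr ▸ hx') (hsI _) H)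
    · rintro rfl
      exact (B.folF h).trans (L.folF_sectionMap_center hh p (hr ▸ hx) (hsI _))
        ((B.folF h).symm (L.folF_sectionMap_center hh p (hr ▸ hx') (hsI _)))

end height

end OrientedBifoliatedPlane

/-! ### From product charts to transverse foliations -/

section transverse

variable {P X : Type*} [TopologicalSpace P] [TopologicalSpace X] {E : Setoid P} {F : Setoid X} {π : X → P} {n : ℕ}
  {e : ℂ → P} {Θ : ℂ × ℝ → X}

/-- A plaque projects to a connected subset of a leaf inside the chart, hence into one component of
a level set. Conversely, the product of such a component with the line is connected and lies over
one leaf. -/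
lemma mem_plaque_comap (he : FolChart E (fun w => (w ^ n).im) e) (hΘ : IsOpenEmbedding Θ)
    (hπ : ∀ w, π (Θ w) = e w.1) (w w' : ℂ × ℝ) : Θ w' ∈ plaque (E.comap π) (range Θ) (Θ w) ↔
      w'.1 ∈ connectedComponentIn {v : ℂ | (v ^ n).im = (w.1 ^ n).im} w.1 := by
  constructor
  · intro H
    set C := plaque (E.comap π) (range Θ) (Θ w) with hC
    have hsub : C ⊆ leafOf (E.comap π) (Θ w) ∩ range Θ := connectedComponentIn_subset _ _
    have hpre : IsPreconnected (Θ ⁻¹' C) := by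
      rw [← hΘ.isInducing.isPreconnected_image, image_preimage_eq_of_subset (fun y hy => (hsub hy).2)]
      exact isPreconnected_connectedComponentIn
    have hw : w ∈ Θ ⁻¹' C := mem_connectedComponentIn ⟨(E.comap π).refl _, w, rfl⟩
    have hE : ∀ v ∈ Θ ⁻¹' C, E (e w.1) (e v.1) := by
      intro v hv
      have h1 : E (π (Θ w)) (π (Θ v)) := (hsub hv).1
      rwa [hπ, hπ] at h1
    have hlev := he.level (Prod.fst '' (Θ ⁻¹' C)) (hpre.image _ continuous_fst.continuousOn) (by
      rintro _ ⟨v, hv, rfl⟩ _ ⟨v', hv', rfl⟩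
      exact E.trans (E.symm (hE v hv)) (hE v' hv'))
    refine (hpre.image _ continuous_fst.continuousOn).subset_connectedComponentIn ⟨w, hw, rfl⟩ ?_ ⟨w', H, rfl⟩
    intro v hv
    exact hlev v hv w.1 ⟨w, hw, rfl⟩
  · intro H
    set C := connectedComponentIn {v : ℂ | (v ^ n).im = (w.1 ^ n).im} w.1
    have hsub : C ⊆ {v : ℂ | (v ^ n).im = (w.1 ^ n).im} := connectedComponentIn_subset _ _
    have hw : w.1 ∈ C := mem_connectedComponentIn (by rfl)
    have hpre : IsPreconnected C := isPreconnected_connectedComponentIn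
    have hsame := he.same C hpre fun v hv v' hv' => (hsub hv).trans (hsub hv').symm
    refine ((hpre.prod isPreconnected_univ).image Θ hΘ.continuous.continuousOn).subset_connectedComponentIn
      ⟨w, ⟨hw, trivial⟩, rfl⟩ ?_ ⟨w', ⟨H, trivial⟩, rfl⟩
    rintro _ ⟨v, hv, rfl⟩
    refine ⟨?_, v, rfl⟩
    show E (π (Θ w)) (π (Θ v))
    rw [hπ, hπ]
    exact hsame _ hw _ hv.1

lemma mem_plaque_iff_snd_eq (hΘ : IsOpenEmbedding Θ) (hF : ∀ w w', F (Θ w) (Θ w') ↔ w.2 = w'.2) (w w' : ℂ × ℝ) :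
    Θ w' ∈ plaque F (range Θ) (Θ w) ↔ w'.2 = w.2 := by
  constructor
  · intro H
    exact ((hF _ _).1 (connectedComponentIn_subset _ _ H).1).symm
  · intro H
    have hpre : IsPreconnected ((univ : Set ℂ) ×ˢ {w.2}) := isPreconnected_univ.prod isPreconnected_singleton
    refine (hpre.image Θ hΘ.continuous.continuousOn).subset_connectedComponentIn ⟨w, ⟨trivial, rfl⟩, rfl⟩ ?_
      ⟨w', ⟨trivial, H⟩, rfl⟩
    rintro _ ⟨v, hv, rfl⟩
    exact ⟨(hF _ _).2 hv.2.symm, v, rfl⟩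

/-- A product chart is a chart of transverse foliations. -/
lemma exists_transverse_chart (hn : n ≠ 0) (he : FolChart E (fun w => (w ^ n).im) e) (hΘ : IsOpenEmbedding Θ)
    (hπ : ∀ w, π (Θ w) = e w.1) (hF : ∀ w w', F (Θ w) (Θ w') ↔ w.2 = w'.2) :
    ∃ (n : ℕ) (U : Set X) (φ : U ≃ₜ ℂ × ℝ) (hp : Θ 0 ∈ U), 1 ≤ n ∧ IsOpen U ∧
    φ ⟨Θ 0, hp⟩ = (0, 0) ∧
    (∀ y z : U, (z : X) ∈ plaque (E.comap π) U y ↔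
      (φ z).1 ∈ connectedComponentIn {w : ℂ | (w ^ n).im = ((φ y).1 ^ n).im} (φ y).1) ∧
    (∀ y z : U, (z : X) ∈ plaque F U y ↔ (φ z).2 = (φ y).2) := by
  set ψ := hΘ.isEmbedding.toHomeomorph
  have hψ : ∀ w, ψ.symm ⟨Θ w, w, rfl⟩ = w := fun w => ψ.symm_apply_apply w
  refine ⟨n, range Θ, ψ.symm, ⟨0, rfl⟩, by omega, hΘ.isOpen_range, hψ 0, ?_, ?_⟩
  · rintro ⟨_, w, rfl⟩ ⟨_, w', rfl⟩
    rw [hψ, hψ]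
    exact mem_plaque_comap he hΘ hπ w w'
  · rintro ⟨_, w, rfl⟩ ⟨_, w', rfl⟩
    rw [hψ, hψ]
    exact mem_plaque_iff_snd_eq hΘ hF w w'

end transverse

namespace OrientedBifoliatedPlane

variable {P : Type*} [TopologicalSpace P] {B : OrientedBifoliatedPlane P}
variable {G : Type*} [Group G] [MulAction G P] {h : P → ℝ}

section height

variable (hh : B.IsHeight G h)
include hh

theorem transverseFoliations_stable : TransverseFoliations (B.stable h) (B.folF h) := by
  intro p
  obtain ⟨e, he, Θ, hΘ, hπ, h0, hF⟩ := exists_productChart hh p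
  have h1 := exists_transverse_chart (E := B.plus) (F := B.folF h) (π := B.proj h) he.ne_zero he.plus (hΘ e he.emb rfl)
    (fun w => hπ _ ⟨_, rfl⟩ _) (fun w w' => hF _ ⟨_, rfl⟩ _ ⟨_, rfl⟩ _ _)
  simp only [Prod.fst_zero, Prod.snd_zero, he.zero, h0] at h1
  exact h1

theorem transverseFoliations_unstable : TransverseFoliations (B.unstable h) (B.folF h) := by
  intro p
  obtain ⟨e, he, Θ, hΘ, hπ, h0, hF⟩ := exists_productChart hh p
  obtain ⟨κ, hκ, hκ0⟩ := exists_rot _ he.ne_zero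
  have h1 := exists_transverse_chart (E := B.minus) (F := B.folF h) (π := B.proj h) he.ne_zero
    (folChart_rotate he.minus hκ hκ0)
    (hΘ _ (folChart_rotate he.minus hκ hκ0).emb ((Homeomorph.mulLeft₀ κ⁻¹ (inv_ne_zero hκ0)).surjective.range_comp e))
    (fun w => hπ _ ⟨_, rfl⟩ _) (fun w w' => hF _ ⟨_, rfl⟩ _ ⟨_, rfl⟩ _ _)
  simp only [Prod.fst_zero, Prod.snd_zero, mul_zero, he.zero, h0] at h1
  exact h1

end height

/-! ### Invariance -/

variable (hG : B.IsOrientedAction G) (hh : B.IsHeight G h)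

lemma proj_act (g : G) (p : B.N h) : B.proj h (act hG hh g p) = g • B.proj h p := by
  obtain ⟨a, rfl⟩ := Quotient.exists_rep p
  rfl

lemma stable_act (g : G) (p q : B.N h) (H : B.stable h p q) : B.stable h (act hG hh g p) (act hG hh g q) := by
  show B.plus _ _
  rw [proj_act, proj_act]
  exact hG.plus _ _ _ H

lemma unstable_act (g : G) (p q : B.N h) (H : B.unstable h p q) : B.unstable h (act hG hh g p) (act hG hh g q) := by
  show B.minus _ _
  rw [proj_act, proj_act]
  exact hG.minus _ _ _ H

lemma folF_act (g : G) (p q : B.N h) (H : B.folF h p q) : B.folF h (act hG hh g p) (act hG hh g q) := by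
  have H' : Relation.EqvGen _ p q := H
  induction H' with
  | rel p q hr =>
    obtain ⟨a, b, rfl, rfl, hc⟩ := hr
    set f : B.N₂ → B.N₂ := fun a => ⟨(g • a.1.1, g • a.1.2), smul_mem_R hG g a.2⟩ with hf
    have hfc : Continuous f := by
      have h1 : Continuous fun a : B.N₂ => a.1 := continuous_subtype_val
      exact Continuous.subtype_mk (((hG.cont g).comp (continuous_fst.comp h1)).prodMk
        ((hG.cont g).comp (continuous_snd.comp h1))) _
    refine Relation.EqvGen.rel _ _ ⟨f a, f b, rfl, rfl, ?_⟩
    refine (isPreconnected_connectedComponentIn.image f hfc.continuousOn).subset_connectedComponentIn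
      ⟨a, mem_connectedComponentIn (B.minus.refl a.1.2), rfl⟩ ?_ ⟨b, hc, rfl⟩
    rintro _ ⟨c, hc, rfl⟩
    have h1 : c ∈ {c : B.N₂ | B.minus a.1.2 c.1.2} := connectedComponentIn_subset _ _ hc
    exact hG.minus g _ _ h1
  | refl p => exact (B.folF h).refl _
  | symm p q _ ih => exact (B.folF h).symm (ih (by assumption))
  | trans p q r _ _ ih1 ih2 => exact (B.folF h).trans (ih1 (by assumption)) (ih2 (by assumption))

end OrientedBifoliatedPlane

/-! ### The projection of `N` to the plane and the orbit space -/

namespace OrientedBifoliatedPlane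

variable {P : Type*} [TopologicalSpace P] {B : OrientedBifoliatedPlane P}

lemma mem_R_of_leafBd {x z a y : P} (hz : ¬ B.plus x z) (ha : a ∈ leafBd B.plus x z) (hy : y ∈ leafBd B.plus x z)
    (hlt : B.lt a y) : y ∈ B.R a := by
  have h1 : leafOf B.plus x = leafOf B.plus a := leafOf_eq ha.2
  refine ⟨hlt, z, ?_, ?_, ?_⟩
  · rw [← h1]; exact hz
  · rw [← h1]; exact ha.1
  · rw [← h1]; exact hy.1

lemma exists_leafBd_of_mem_R {a y : P} (h : y ∈ B.R a) : ∃ z, ¬ B.plus a z ∧ a ∈ leafBd B.plus a z ∧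
    y ∈ leafBd B.plus a z := by
  obtain ⟨hlt, z, hz, h1, h2⟩ := h
  exact ⟨z, hz, ⟨h1, B.plus.refl a⟩, ⟨h2, B.lt_leaf _ _ hlt⟩⟩

section chart

variable {n : ℕ} {e : ℂ → P} {x : P} (he : B.BiChart n e x) {ζ : ℂ} (hζ : ζ ∈ sectorDirs n)
include he hζ

lemma BiChart.not_plus_sector : ¬ B.plus x (e (halfBox n ζ 0 1)) :=
  he.nice.image_sector_subset hζ ⟨_, ⟨0, 1, one_pos, rfl⟩, rfl⟩

lemma BiChart.axis_mem_leafBd (u : ℝ) : e (halfBox n ζ u 0) ∈ leafBd B.plus x (e (halfBox n ζ 0 1)) := by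
  have h2 : e '' sector n ζ ⊆ leafComp B.plus x (e (halfBox n ζ 0 1)) :=
    (he.nice.isPreconnected_image_sector hζ).subset_connectedComponentIn ⟨_, ⟨0, 1, one_pos, rfl⟩, rfl⟩
      (he.nice.image_sector_subset hζ)
  refine ⟨closure_mono h2 (image_closure_subset_closure_image he.emb.continuous
    ⟨_, halfBox_mem_closure_sector he.ne_zero hζ u, rfl⟩), he.nice.rel ?_⟩
  rw [halfBox_im he.ne_zero hζ, zero_mul]

lemma BiChart.row_mem_R {u u' v : ℝ} (hv : 0 ≤ v) (huu : u < u') :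
    e (halfBox n ζ u' v) ∈ B.R (e (halfBox n ζ u v)) := by
  have hlt := (he.lt_iff hζ hv).2 huu
  rcases hv.eq_or_lt with rfl | hv'
  · exact mem_R_of_leafBd (he.not_plus_sector hζ) (he.axis_mem_leafBd hζ u) (he.axis_mem_leafBd hζ u') hlt
  · exact (he.regConn hζ u u' hv').mem_R hlt

end chart

variable (B) in
lemma nonempty_R (x : P) : (B.R x).Nonempty := by
  obtain ⟨e, he, -⟩ := B.exists_biChart x univ_mem
  obtain ⟨ζ, hζ⟩ := exists_sectorDir _ he.ne_zero
  have h1 := he.row_mem_R (Or.inl hζ) le_rfl (zero_lt_one (α := ℝ))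
  rw [halfBox_zero he.ne_zero, he.zero] at h1
  exact ⟨_, h1⟩

variable (B) in
lemma proj_surjective (h : P → ℝ) : Function.Surjective (B.proj h) := by
  intro x
  obtain ⟨y, hy⟩ := B.nonempty_R x
  exact ⟨Quotient.mk (B.setoidN h) ⟨(x, y), hy⟩, rfl⟩

variable (B) in
lemma continuous_proj (h : P → ℝ) : Continuous (B.proj h) :=
  Continuous.quotient_lift (continuous_fst.comp continuous_subtype_val) _

section height

variable {G : Type*} [Group G] [MulAction G P] {h : P → ℝ} (hh : B.IsHeight G h)
include hh

/-- The slice of height `0` of a product chart is a local section of the projection through the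
given point. -/
theorem isOpenMap_proj : IsOpenMap (B.proj h) := by
  rw [isOpenMap_iff_nhds_le]
  intro p S hS
  obtain ⟨e, he, Θ, hΘ, hπ, h0, -⟩ := exists_productChart hh p
  have h1 : Continuous fun w : ℂ => Θ (e w, 0) :=
    (hΘ e he.emb rfl).continuous.comp (continuous_id.prodMk continuous_const)
  have h2 : B.proj h ⁻¹' S ∈ 𝓝 ((fun w : ℂ => Θ (e w, 0)) 0) := by
    simp only [he.zero, h0]
    exact hS
  rw [← he.zero, ← he.emb.map_nhds_eq, mem_map]
  filter_upwards [h1.continuousAt.preimage_mem_nhds h2] with w hw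
  have h3 : B.proj h (Θ (e w, 0)) ∈ S := hw
  rwa [hπ _ ⟨w, rfl⟩] at h3

/-- The orbit space is the plane. -/
lemma isOpenEmbedding_orbits : IsOpenEmbedding (Quotient.lift (B.proj h) (fun _ _ H => H) : B.Orbits h → P) := by
  refine IsOpenEmbedding.of_continuous_injective_isOpenMap ((B.continuous_proj h).quotient_lift _) ?_ ?_
  · intro a b
    obtain ⟨p, rfl⟩ := Quotient.exists_rep a
    obtain ⟨q, rfl⟩ := Quotient.exists_rep b
    exact fun H => Quotient.sound H
  · intro U hU
    have h1 : (Quotient.lift (B.proj h) (fun _ _ H => H) : B.Orbits h → P) '' U =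
        B.proj h '' (Quotient.mk (Setoid.ker (B.proj h)) ⁻¹' U) := by
      ext x
      constructor
      · rintro ⟨a, ha, rfl⟩
        obtain ⟨p, rfl⟩ := Quotient.exists_rep a
        exact ⟨p, ha, rfl⟩
      · rintro ⟨p, hp, rfl⟩
        exact ⟨_, hp, rfl⟩
    rw [h1]
    exact isOpenMap_proj hh _ (hU.preimage continuous_quotient_mk')

omit [Group G] [MulAction G P] hh in
lemma mem_flowline {p q : B.N h} : q ∈ B.flowline (Quotient.mk (Setoid.ker (B.proj h)) p) ↔
    B.proj h q = B.proj h p := Quotient.eq (r := Setoid.ker (B.proj h))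

/-- The orbit space is embedded in the plane as an open subset, and the plane is first countable.
Limits of flowlines are thus limits of points, and sequences detect closures. -/
theorem asymptotic_iff {p : B.N h} {l : Set (B.N h)} : B.Asymptotic (Quotient.mk (Setoid.ker (B.proj h)) p) l ↔
    B.proj h p ∈ closure (B.proj h '' l) ∧ B.proj h p ∉ B.proj h '' l := by
  have : FirstCountableTopology P := by
    obtain ⟨φ⟩ := B.plane
    exact φ.isInducing.firstCountableTopology
  refine and_congr ?_ ?_
  · rw [mem_closure_iff_seq_limit]
    constructor
    · rintro ⟨u, hu, hl⟩
      refine ⟨_, ?_, (isOpenEmbedding_orbits hh).continuous.continuousAt.tendsto.comp hu⟩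
      intro k
      obtain ⟨q, hq, hql⟩ := hl k
      have hq : Quotient.mk (Setoid.ker (B.proj h)) q = u k := hq
      refine ⟨q, hql, ?_⟩
      rw [Function.comp_apply, ← hq]
      rfl
    · rintro ⟨x, hx, hlim⟩
      choose q hq hqx using hx
      refine ⟨fun k => Quotient.mk _ (q k), ?_, fun k => ⟨q k, rfl, hq k⟩⟩
      rw [(isOpenEmbedding_orbits hh).tendsto_nhds_iff]
      have h1 : (Quotient.lift (B.proj h) (fun _ _ H => H) : B.Orbits h → P) ∘
          (fun k => Quotient.mk (Setoid.ker (B.proj h)) (q k)) = x := funext hqx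
      rw [h1]
      exact hlim
  · rw [← disjoint_iff_inter_eq_empty, Set.disjoint_left]
    constructor
    · rintro H ⟨q, hq, hqp⟩
      exact H (mem_flowline.2 hqp) hq
    · intro H q hq hql
      exact H ⟨q, hql, mem_flowline.1 hq⟩

/-- Flowlines are connected. -/
lemma isPreconnected_fiber (x : P) : IsPreconnected (B.proj h ⁻¹' {x}) := by
  obtain ⟨y₀, hy₀⟩ := B.nonempty_R x
  -- The part of the fibre that belongs to one component is the image of a half-line. The parts of
  -- two components share a point of `N`: the partner of `y₀` in the second boundary.
  have key : ∀ z, ¬ B.plus x z → x ∈ leafBd B.plus x z → ∀ (T : Set B.N₂), T = {a : B.N₂ | a.1.1 = x ∧ a.1.2 ∈ leafBd B.plus x z} →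
      IsPreconnected (Quotient.mk (B.setoidN h) '' T) := by
    rintro z hz hx T rfl
    obtain ⟨g, hg, hr⟩ := exists_line_leafBd hz
    obtain ⟨u, hu⟩ : x ∈ range g := hr ▸ hx
    have hgu : ∀ t : Ioi u, g t ∈ B.R x := by
      intro t
      refine mem_R_of_leafBd hz hx (hr ▸ ⟨_, rfl⟩) ?_
      rw [← hu]
      exact (hg.lt_iff _ _).2 t.2
    set f : Ioi u → B.N₂ := fun t => ⟨(x, g t), hgu t⟩
    have hf : Continuous f := Continuous.subtype_mk (continuous_const.prodMk (hg.cont.comp continuous_subtype_val)) _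
    have h1 : {a : B.N₂ | a.1.1 = x ∧ a.1.2 ∈ leafBd B.plus x z} = range f := by
      ext a
      constructor
      · rintro ⟨h1, h2⟩
        rw [← hr] at h2
        obtain ⟨t, ht⟩ := h2
        have h3 := a.2.1
        rw [h1, ← hu, ← ht] at h3
        exact ⟨⟨t, (hg.lt_iff _ _).1 h3⟩, Subtype.ext (Prod.ext h1.symm ht)⟩
      · rintro ⟨t, rfl⟩
        exact ⟨rfl, hr ▸ ⟨_, rfl⟩⟩
    rw [h1]
    have : PreconnectedSpace (Ioi u) := isPreconnected_iff_preconnectedSpace.1 isPreconnected_Ioi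
    exact (isPreconnected_range hf).image _ continuous_quotient_mk'.continuousOn
  obtain ⟨z₀, hz₀, hx₀, hyz₀⟩ := exists_leafBd_of_mem_R hy₀
  refine isPreconnected_of_forall (Quotient.mk (B.setoidN h) ⟨(x, y₀), hy₀⟩) ?_
  rintro q hq
  obtain ⟨⟨⟨x', y⟩, hy⟩, rfl⟩ := Quotient.exists_rep q
  obtain rfl : x' = x := hq
  obtain ⟨z, hz, hx, hyz⟩ := exists_leafBd_of_mem_R hy
  obtain ⟨y', hy', hs⟩ := exists_sim_mem_leafBd hh hz hx hy₀.1
  have hlt : B.lt x' y' := by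
    rcases lt_trichotomy_leafBd hz hx hy' with h1 | h1 | h1
    · exact h1
    · obtain ⟨k, hk⟩ := exists_leafHeight hh x'
      have h2 := (hk.sim_iff _ _ (B.lt_leaf _ _ hy₀.1) hy'.2).1 hs
      rw [← h1] at h2
      exact absurd h2 (hk.mono _ _ (B.plus.refl _) hy₀.1).ne'
    · obtain ⟨k, hk⟩ := exists_leafHeight hh x'
      have h2 := (hk.sim_iff _ _ (B.lt_leaf _ _ hy₀.1) hy'.2).1 hs
      have h3 := hk.mono _ _ hy'.2 h1
      have h4 := hk.mono _ _ (B.plus.refl _) hy₀.1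
      rw [← h2] at h3
      exact absurd h3 h4.not_gt
  have hyR := mem_R_of_leafBd hz hx hy' hlt
  refine ⟨Quotient.mk (B.setoidN h) '' {a : B.N₂ | a.1.1 = x' ∧ a.1.2 ∈ leafBd B.plus x' z₀} ∪
    Quotient.mk (B.setoidN h) '' {a : B.N₂ | a.1.1 = x' ∧ a.1.2 ∈ leafBd B.plus x' z}, ?_, ?_, ?_, ?_⟩
  · rintro _ (⟨a, ha, rfl⟩ | ⟨a, ha, rfl⟩)
    · exact ha.1
    · exact ha.1
  · exact Or.inl ⟨_, ⟨rfl, hyz₀⟩, rfl⟩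
  · exact Or.inr ⟨_, ⟨rfl, hyz⟩, rfl⟩
  · refine IsPreconnected.union (Quotient.mk (B.setoidN h) ⟨(x', y₀), hy₀⟩) ⟨_, ⟨rfl, hyz₀⟩, rfl⟩ ?_
      (key z₀ hz₀ hx₀ _ rfl) (key z hz hx _ rfl)
    refine ⟨⟨(x', y'), hyR⟩, ⟨rfl, hy'⟩, Quotient.sound ⟨rfl, ?_⟩⟩
    exact B.sim_symm hs

/-- The projection is an open surjection with connected fibres. -/
lemma isPreconnected_preimage_proj {C : Set P} (hC : IsPreconnected C) : IsPreconnected (B.proj h ⁻¹' C) := by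
  rintro U V hU hV hCUV ⟨a, haC, haU⟩ ⟨b, hbC, hbV⟩
  obtain ⟨x, hxC, ⟨u, hu, hux⟩, v, hv, hvx⟩ := hC (B.proj h '' U) (B.proj h '' V) (isOpenMap_proj hh _ hU)
    (isOpenMap_proj hh _ hV) (by
      intro x hx
      obtain ⟨q, rfl⟩ := B.proj_surjective h x
      exact (hCUV hx).imp (fun H => ⟨q, H, rfl⟩) fun H => ⟨q, H, rfl⟩) ⟨_, haC, a, haU, rfl⟩ ⟨_, hbC, b, hbV, rfl⟩
  have hsub : B.proj h ⁻¹' {x} ⊆ B.proj h ⁻¹' C := preimage_mono (singleton_subset_iff.2 hxC)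
  obtain ⟨q, hq, hq'⟩ := isPreconnected_fiber hh x U V hU hV (hsub.trans hCUV) ⟨u, hux, hu⟩ ⟨v, hvx, hv⟩
  exact ⟨q, hsub hq, hq'⟩

end height

end OrientedBifoliatedPlane

namespace OrientedBifoliatedPlane

variable {P : Type*} [TopologicalSpace P] {B : OrientedBifoliatedPlane P}

/-! ### Components on the negative side of a leaf of `𝓕⁻` -/

/-- The component of `z` in the complement of the leaf of `x` lies on the negative side of this leaf. -/
structure NegComp (B : OrientedBifoliatedPlane P) (x z : P) : Prop where
  not_rel : ¬ B.minus x z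
  neg : ∀ y ∈ leafBd B.minus x z, NegSide B (leafComp B.minus x z) y

/-- The points `(x', y)` of `N₂` with `x'` in a component of the complement of a leaf of `𝓕⁻`, and `y` in
its boundary. -/
def entry (B : OrientedBifoliatedPlane P) (x z : P) : Set B.N₂ :=
  {a | a.1.1 ∈ leafComp B.minus x z ∧ a.1.2 ∈ leafBd B.minus x z}

lemma subset_leafComp {E : Setoid P} {x z p : P} {C : Set P} (hC : IsPreconnected C) (hCE : ∀ c ∈ C, ¬ E x c)
    (hp : p ∈ C) (hpJ : p ∈ leafComp E x z) : C ⊆ leafComp E x z := by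
  have h1 : leafComp E x z = leafComp E x p := connectedComponentIn_eq hpJ
  rw [h1]
  exact hC.subset_connectedComponentIn hp hCE

/-- Along the oriented boundary line every point before `y` has `y` in its `R`. Moving `x` there
keeps the second coordinate fixed and therefore stays in one transverse leaf. -/
lemma folF_slide {h : P → ℝ} {x z y : P} (hz : ¬ B.plus x z) (hy : y ∈ leafBd B.plus x z) {a b : B.N₂}
    (ha : a.1.1 ∈ leafBd B.plus x z) (hb : b.1.1 ∈ leafBd B.plus x z) (hay : a.1.2 = y) (hby : b.1.2 = y) :
    B.folF h (Quotient.mk (B.setoidN h) a) (Quotient.mk (B.setoidN h) b) := by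
  obtain ⟨g, hg, hr⟩ := exists_line_leafBd hz
  obtain ⟨w, hw⟩ : y ∈ range g := hr ▸ hy
  have hR : ∀ t : Iio w, y ∈ B.R (g t) := by
    intro t
    refine mem_R_of_leafBd hz (hr ▸ ⟨_, rfl⟩) hy ?_
    rw [← hw]
    exact (hg.lt_iff _ _).2 t.2
  set f : Iio w → B.N₂ := fun t => ⟨(g t, y), hR t⟩ with hf
  have hfc : Continuous f := Continuous.subtype_mk ((hg.cont.comp continuous_subtype_val).prodMk continuous_const) _
  have : PreconnectedSpace (Iio w) := isPreconnected_iff_preconnectedSpace.1 isPreconnected_Iio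
  have key : ∀ c : B.N₂, c.1.1 ∈ leafBd B.plus x z → c.1.2 = y → c ∈ range f := by
    intro c hc hcy
    rw [← hr] at hc
    obtain ⟨t, ht⟩ := hc
    have h1 := c.2.1
    rw [hcy, ← ht, ← hw] at h1
    exact ⟨⟨t, (hg.lt_iff _ _).1 h1⟩, Subtype.ext (Prod.ext ht hcy.symm)⟩
  refine Relation.EqvGen.rel _ _ ⟨a, b, rfl, rfl, ?_⟩
  refine (isPreconnected_range hfc).subset_connectedComponentIn (key a ha hay) ?_ (key b hb hby)
  rintro _ ⟨t, rfl⟩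
  show B.minus a.1.2 y
  rw [hay]

section chart

variable {n : ℕ} {e : ℂ → P} {x y z : P} (he : B.BiChart n e y)
include he

/-- Over the connected quadrant `u < 0`, `v ≥ 0`, each point is paired with the foot of its row in
the column `0`, and all these feet are on one leaf of `𝓕⁻`. -/
lemma BiChart.folF_quadrant {h : P → ℝ} {ζ : ℂ} (hζ : ζ ∈ sectorDirs n) {a b : B.N₂} {u v u' v' : ℝ} (hu : u < 0) (hv : 0 ≤ v)
    (hu' : u' < 0) (hv' : 0 ≤ v') (ha : a.1 = (e (halfBox n ζ u v), e (halfBox n ζ 0 v)))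
    (hb : b.1 = (e (halfBox n ζ u' v'), e (halfBox n ζ 0 v'))) :
    B.folF h (Quotient.mk (B.setoidN h) a) (Quotient.mk (B.setoidN h) b) := by
  have hn := he.ne_zero
  have hR : ∀ p : (Iio (0 : ℝ) ×ˢ Ici (0 : ℝ) : Set (ℝ × ℝ)), e (halfBox n ζ 0 p.1.2) ∈ B.R (e (halfBox n ζ p.1.1 p.1.2)) :=
    fun p => he.row_mem_R hζ p.2.2 p.2.1
  set f : (Iio (0 : ℝ) ×ˢ Ici (0 : ℝ) : Set (ℝ × ℝ)) → B.N₂ := fun p => ⟨(_, _), hR p⟩ with hf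
  have hfc : Continuous f := by
    refine Continuous.subtype_mk (Continuous.prodMk ?_ ?_) _
    · exact he.emb.continuous.comp ((continuousOn_halfBox hn hζ).comp_continuous continuous_subtype_val fun p => p.2.2)
    · exact he.emb.continuous.comp ((continuousOn_halfBox hn hζ).comp_continuous
        (f := fun p : (Iio (0 : ℝ) ×ˢ Ici (0 : ℝ) : Set (ℝ × ℝ)) => ((0, p.1.2) : ℝ × ℝ))
        (continuous_const.prodMk (continuous_snd.comp continuous_subtype_val)) fun p => p.2.2)
  have : PreconnectedSpace (Iio (0 : ℝ) ×ˢ Ici (0 : ℝ) : Set (ℝ × ℝ)) :=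
    isPreconnected_iff_preconnectedSpace.1 (isPreconnected_Iio.prod isPreconnected_Ici)
  refine Relation.EqvGen.rel _ _ ⟨a, b, rfl, rfl, ?_⟩
  refine (isPreconnected_range hfc).subset_connectedComponentIn ⟨⟨(u, v), hu, hv⟩, Subtype.ext ha.symm⟩ ?_
    ⟨⟨(u', v'), hu', hv'⟩, Subtype.ext hb.symm⟩
  rintro _ ⟨⟨⟨s, t⟩, hs, ht⟩, rfl⟩
  show B.minus a.1.2 (e (halfBox n ζ 0 t))
  rw [ha]
  exact he.minus_vertical hζ 0 hv ht

variable (hxy : B.minus x y)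
include hxy

lemma BiChart.not_minus {w : ℂ} (hw : (w ^ n).re ≠ 0) : ¬ B.minus x (e w) := fun H =>
  hw (he.axis_minus _ (B.minus.trans (B.minus.symm hxy) H))

lemma BiChart.quadrant_subset {ζ : ℂ} (hζ : ζ ∈ sectorDirs n) {u v u' v' : ℝ} (hu : u < 0) (hv : 0 ≤ v)
    (hJ : e (halfBox n ζ u v) ∈ leafComp B.minus x z) (hu' : u' < 0) (hv' : 0 ≤ v') :
    e (halfBox n ζ u' v') ∈ leafComp B.minus x z := by
  have hn := he.ne_zero
  have h1 : IsPreconnected ((fun p : ℝ × ℝ => e (halfBox n ζ p.1 p.2)) '' (Iio 0 ×ˢ Ici 0)) :=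
    (isPreconnected_Iio.prod isPreconnected_Ici).image _ (he.emb.continuous.comp_continuousOn
      ((continuousOn_halfBox hn hζ).mono fun p hp => hp.2))
  refine subset_leafComp h1 ?_ ⟨(u, v), ⟨hu, hv⟩, rfl⟩ hJ ⟨(u', v'), ⟨hu', hv'⟩, rfl⟩
  rintro _ ⟨p, hp, rfl⟩
  refine he.not_minus hxy ?_
  rw [halfBox_re hn hζ]
  exact hp.1.ne

/-- A component of the complement of the leaf of `𝓕⁻` through `y` contains at most one half-leaf at `y` of `𝓕⁺`. -/
lemma BiChart.axis_unique {w w' : ℂ} (hw : (w ^ n).im = 0) (hw' : (w' ^ n).im = 0) (hww : (w ^ n).re = (w' ^ n).re)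
    (hwJ : e w ∈ leafComp B.minus x z) (hwJ' : e w' ∈ leafComp B.minus x z) : w = w' := by
  obtain rfl := he.ord_eq
  have hn := he.ne_zero
  obtain ⟨κ, hκ, hκ0⟩ := exists_rot _ hn
  have hcan : ∀ w, κ⁻¹ * (κ * w) = w := fun w => by field_simp
  obtain ⟨ζ, hζ, h1, -⟩ := B.minusFol.exists_sector_leafComp (z := z) hxy (he.nice_minus hκ hκ0) (w₁ := κ * w)
    (by rw [hcan]; exact subset_closure hwJ)
  have key : ∀ w, (w ^ B.ord y).im = 0 → e w ∈ leafComp B.minus x z → κ * w = halfBox (B.ord y) ζ 0 |(w ^ B.ord y).re| := by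
    intro w hw hwJ
    obtain ⟨u, v, hv, huv⟩ := (h1 (κ * w)).1 (by rw [hcan]; exact hwJ)
    have h2 : (κ * w) ^ B.ord y = Complex.I * w ^ B.ord y := by rw [mul_pow, hκ]
    have h3 := halfBox_re hn hζ u v
    have h4 := abs_halfBox_im hn hζ u hv.le
    rw [huv, h2] at h3 h4
    simp [hw] at h3 h4
    rw [← huv, ← h3, h4]
  have h2 := key w hw hwJ
  rw [hww, ← key w' hw' hwJ'] at h2
  exact mul_left_cancel₀ hκ0 h2

end chart

/-- The half-leaf of `𝓕⁺` at `y` that points into a negative component is a negative one. Any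
quadrant next to it lies in the component, because it misses the leaf of `𝓕⁻`. -/
lemma exists_neg_quadrant {x y z : P} {n : ℕ} {e : ℂ → P} (hJ : NegComp B x z) (he : B.BiChart n e y)
    (hy : y ∈ leafBd B.minus x z) :
    ∃ ζ ∈ sectorDirs n, ∀ u < 0, ∀ v ≥ 0, e (halfBox n ζ u v) ∈ leafComp B.minus x z := by
  have hn := he.ne_zero
  obtain ⟨ω, hω, -, h2⟩ := exists_minus_sector he hy.2 (w₁ := 0) (z := z) (by rw [he.zero]; exact hy.1)
  have hneg : (ω ^ n).re = -1 := by
    rcases hω with h3 | h3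
    · exfalso
      refine (not_posSide_and_negSide hy).1 ?_ (hJ.neg y hy)
      refine (frequently_ray he ω h2).mono ?_
      rintro _ ⟨hzJ, t, ht, rfl⟩
      refine ⟨hzJ, (he.lt_center (im_smul_rayDir (Or.inl h3) t)).1.2 ?_⟩
      simp only [Complex.real_smul, mul_pow, h3, mul_one]
      rw [← Complex.ofReal_pow, Complex.ofReal_re]
      positivity
    · simp [h3]
  have hω0 : ω ≠ 0 := by
    rintro rfl
    simp [hn] at hneg
  have him : (ω ^ n).im = 0 := by simpa using im_smul_rayDir hω 1
  obtain ⟨ζ, hζ, -, h3, -⟩ := exists_axis_halfBox hn hω0 him (Or.inl rfl)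
  refine ⟨ζ, hζ, fun u hu v hv => ?_⟩
  refine he.quadrant_subset hy.2 hζ (u := -1) (v := 0) (by norm_num) le_rfl ?_ hu hv
  rw [← hneg, h3]
  simpa using h2 1 one_pos

lemma exists_entry_near {x y z : P} (hJ : NegComp B x z) (hy : y ∈ leafBd B.minus x z) {O : Set P} (hO : O ∈ 𝓝 y) :
    ∃ x' ∈ O, x' ∈ leafComp B.minus x z ∧ y ∈ B.R x' := by
  obtain ⟨e, he, hr⟩ := B.exists_biChart y hO
  obtain ⟨ζ, hζ, h1⟩ := exists_neg_quadrant hJ he hy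
  have h2 := he.row_mem_R hζ le_rfl (neg_one_lt_zero (R := ℝ))
  rw [halfBox_zero he.ne_zero, he.zero] at h2
  exact ⟨_, hr ⟨_, rfl⟩, h1 _ neg_one_lt_zero _ le_rfl, h2⟩

/-- The first coordinate can be slid along its leaf towards `y`. It stays in the component, since
otherwise the leaf of `𝓕⁻` would meet an oriented arc twice, and it enters the chart on a negative
half-axis. The component contains only one such half-axis, so all entry points at `y` are joined to
the same reference point. -/
lemma folF_entry_center {h : P → ℝ} {x y z : P} {n : ℕ} {e : ℂ → P} (he : B.BiChart n e y)
    (hy : y ∈ leafBd B.minus x z) {ζ : ℂ} (hζ : ζ ∈ sectorDirs n) {u : ℝ} (hu : u < 0)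
    (hζJ : ∀ u < 0, e (halfBox n ζ u 0) ∈ leafComp B.minus x z) {a b : B.N₂}
    (ha : a.1.1 ∈ leafComp B.minus x z) (hay : a.1.2 = y) (hb : b.1 = (e (halfBox n ζ u 0), y)) :
    B.folF h (Quotient.mk (B.setoidN h) a) (Quotient.mk (B.setoidN h) b) := by
  have hn := he.ne_zero
  obtain ⟨z', hz', hx', hyz'⟩ := exists_leafBd_of_mem_R a.2
  rw [hay] at hyz'
  obtain ⟨g, hg, hr⟩ := exists_line_leafBd hz'
  obtain ⟨t₁, ht₁⟩ : a.1.1 ∈ range g := hr ▸ hx'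
  obtain ⟨t₂, ht₂⟩ : y ∈ range g := hr ▸ hyz'
  have htt : t₁ < t₂ := by
    have h1 := a.2.1
    rw [hay, ← ht₁, ← ht₂] at h1
    exact (hg.lt_iff _ _).1 h1
  have h1 : ∀ᶠ t in 𝓝[<] t₂, g t ∈ range e := by
    refine mem_nhdsWithin_of_mem_nhds (hg.cont.continuousAt.eventually_mem ?_)
    rw [ht₂]
    exact he.range_mem
  obtain ⟨t, ⟨w, hw⟩, ht⟩ := (h1.and (Ioo_mem_nhdsLT htt)).exists
  have htJ : g t ∈ leafComp B.minus x z := by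
    refine subset_leafComp (isPreconnected_Icc.image g hg.cont.continuousOn) ?_ ⟨t₁, left_mem_Icc.2 ht.1.le, rfl⟩
      (by rw [ht₁]; exact ha) ⟨t, right_mem_Icc.2 ht.1.le, rfl⟩
    rintro _ ⟨s, hs, rfl⟩ hms
    have h2 : B.lt (g s) y := by
      rw [← ht₂]
      exact (hg.lt_iff _ _).2 (hs.2.trans_lt ht.2)
    exact not_minus_of_lt h2 (B.minus.trans (B.minus.symm hms) hy.2)
  have hlt : B.lt (g t) y := by
    rw [← ht₂]
    exact (hg.lt_iff _ _).2 ht.2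
  have him : (w ^ n).im = 0 := he.axis_plus _ (by rw [hw]; exact B.plus.symm (B.lt_leaf _ _ hlt))
  have hre : (w ^ n).re < 0 := (he.lt_center him).2.1 (by rw [hw]; exact hlt)
  have hwe : w = halfBox n ζ (w ^ n).re 0 := by
    refine he.axis_unique hy.2 (z := z) him (by rw [halfBox_im hn hζ, zero_mul]) (halfBox_re hn hζ _ _).symm ?_ (hζJ _ hre)
    rw [hw]
    exact htJ
  have hgt : g t ∈ leafBd B.plus a.1.1 z' := hr ▸ ⟨_, rfl⟩
  have h2 : y ∈ B.R (g t) := mem_R_of_leafBd hz' hgt hyz' hlt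
  refine (B.folF h).trans (folF_slide (b := ⟨(g t, y), h2⟩) hz' hyz' hx' hgt hay rfl) ?_
  refine he.folF_quadrant hζ hre le_rfl hu le_rfl ?_ ?_
  · rw [← hwe, hw, halfBox_zero hn, he.zero]
  · rw [hb, halfBox_zero hn, he.zero]

/-- All points over a negative component that lie on its boundary leaf are in one leaf of the transverse foliation. -/
theorem folF_entry {h : P → ℝ} {x z : P} (hJ : NegComp B x z) {a b : B.N₂} (ha : a ∈ B.entry x z) (hb : b ∈ B.entry x z) :
    B.folF h (Quotient.mk (B.setoidN h) a) (Quotient.mk (B.setoidN h) b) := by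
  refine (B.minusFol.isPreconnected_leafBd hJ.not_rel).induction₂
    (fun y y' => ∀ a ∈ B.entry x z, ∀ b ∈ B.entry x z, a.1.2 = y → b.1.2 = y' →
      B.folF h (Quotient.mk (B.setoidN h) a) (Quotient.mk (B.setoidN h) b)) ?_ ?_ ?_ ha.2 hb.2 a ha b hb rfl rfl
  · intro y hy
    obtain ⟨e, he, -⟩ := B.exists_biChart y univ_mem
    set n := B.ord y
    have hn := he.ne_zero
    obtain ⟨ζ, hζ, hζJ⟩ := exists_neg_quadrant hJ he hy
    have h1 := he.row_mem_R hζ le_rfl (neg_one_lt_zero (R := ℝ))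
    rw [halfBox_zero hn, he.zero] at h1
    filter_upwards [mem_nhdsWithin_of_mem_nhds he.range_mem, self_mem_nhdsWithin]
    rintro _ ⟨w, rfl⟩ hw a ha b hb hay hbw
    by_cases hw0 : w = 0
    · rw [hw0, he.zero] at hbw
      refine (B.folF h).trans (folF_entry_center (b := ⟨(_, y), h1⟩) he hy hζ neg_one_lt_zero
        (fun u hu => hζJ u hu 0 le_rfl) ha.1 hay rfl) ((B.folF h).symm ?_)
      exact folF_entry_center (b := ⟨(_, y), h1⟩) he hy hζ neg_one_lt_zero
        (fun u hu => hζJ u hu 0 le_rfl) hb.1 hbw rfl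
    have hre : (w ^ n).re = 0 := he.axis_minus _ (B.minus.trans (B.minus.symm hy.2) hw.2)
    have him : (w ^ n).im ≠ 0 := by
      intro him
      exact hw0 (pow_eq_zero_iff hn |>.1 (Complex.ext hre him))
    obtain ⟨η, hη, u, v, hv, huv⟩ := exists_sector hn him
    have hu : u = 0 := by
      rw [← halfBox_re hn hη u v, huv, hre]
    subst hu
    have hopen : e '' sector n η ∈ 𝓝 (e w) := by
      have : IsOpen (sector n η) := isOpen_sector hn hη
      exact he.emb.isOpenMap.image_mem_nhds (this.mem_nhds ⟨0, v, hv, huv⟩)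
    -- A point of the component just before `e w` selects a quadrant at `y` that lies in the
    -- component and has both `y` and `e w` on its edge. The entry points at `y` and at `e w` are
    -- connected through this quadrant.
    obtain ⟨_, ⟨hqJ, hqlt⟩, ⟨_, ⟨s, t, ht, rfl⟩, rfl⟩⟩ := ((hJ.neg _ hw).and_eventually hopen).exists
    have hs : s < 0 := by
      by_contra hs
      rcases (not_lt.1 hs).eq_or_lt with rfl | hs
      · exact not_minus_of_lt hqlt (huv ▸ he.minus_vertical hη 0 ht.le hv.le)
      · have h2 := (he.lt_iff hη hv.le).2 hs
        rw [huv] at h2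
        exact not_minus_of_lt (lt_trans hqlt h2) (he.minus_vertical hη s ht.le hv.le)
    have hηJ : ∀ u < 0, ∀ v ≥ 0, e (halfBox n η u v) ∈ leafComp B.minus x z := fun u hu v hv =>
      he.quadrant_subset hy.2 hη hs ht.le hqJ hu hv
    have h2 := he.row_mem_R hη le_rfl (neg_one_lt_zero (R := ℝ))
    rw [halfBox_zero hn, he.zero] at h2
    have h3 := he.row_mem_R hη hv.le (neg_one_lt_zero (R := ℝ))
    rw [huv] at h3
    refine (B.folF h).trans (folF_entry_center (b := ⟨(_, y), h2⟩) he hy hη neg_one_lt_zero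
      (fun u hu => hηJ u hu 0 le_rfl) ha.1 hay rfl) ?_
    refine (B.folF h).trans (b := Quotient.mk (B.setoidN h) ⟨(_, e w), h3⟩) ?_ ?_
    · refine he.folF_quadrant hη (u := -1) (v := 0) (u' := -1) (v' := v) neg_one_lt_zero le_rfl neg_one_lt_zero hv.le ?_ ?_
      · rw [halfBox_zero hn, he.zero]
      · rw [huv]
    · obtain ⟨e', he', -⟩ := B.exists_biChart (e w) univ_mem
      obtain ⟨ζ', hζ', hζJ'⟩ := exists_neg_quadrant hJ he' hw
      have h4 := he'.row_mem_R hζ' le_rfl (neg_one_lt_zero (R := ℝ))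
      rw [halfBox_zero he'.ne_zero, he'.zero] at h4
      refine (B.folF h).trans (folF_entry_center (b := ⟨(_, e w), h4⟩) he' hw hζ' neg_one_lt_zero
        (fun u hu => hζJ' u hu 0 le_rfl) (hηJ _ neg_one_lt_zero _ hv.le) rfl rfl) ((B.folF h).symm ?_)
      exact folF_entry_center (b := ⟨(_, e w), h4⟩) he' hw hζ' neg_one_lt_zero
        (fun u hu => hζJ' u hu 0 le_rfl) hb.1 hbw rfl
  · intro y₁ y₂ y₃ _ h2 _ H1 H2 a ha b hb hay hby
    -- Transitivity requires some entry point at the intermediate boundary point.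
    obtain ⟨x', -, hx', hR⟩ := exists_entry_near hJ h2 univ_mem
    exact (B.folF h).trans (H1 a ha ⟨(x', y₂), hR⟩ ⟨hx', h2⟩ hay rfl) (H2 _ ⟨hx', h2⟩ b hb rfl hby)
  · intro y₁ y₂ _ _ H a ha b hb hay hby
    exact (B.folF h).symm (H b hb a ha hby hay)

end OrientedBifoliatedPlane

/-! ### The transverse leaf attached to a negative component -/

namespace OrientedBifoliatedPlane

variable {P : Type*} [TopologicalSpace P] {B : OrientedBifoliatedPlane P}

/-- The leaf of the transverse foliation that enters a leaf of `𝓕⁻` from a negative component. -/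
def entryLeaf (B : OrientedBifoliatedPlane P) (h : P → ℝ) (x z : P) : Set (B.N h) :=
  {q | ∃ a ∈ B.entry x z, B.folF h q (Quotient.mk (B.setoidN h) a)}

lemma entryLeaf_eq {h : P → ℝ} {x z : P} (hJ : NegComp B x z) {a : B.N₂} (ha : a ∈ B.entry x z) :
    B.entryLeaf h x z = {q | B.folF h q (Quotient.mk (B.setoidN h) a)} := by
  ext q
  exact ⟨fun ⟨b, hb, h1⟩ => (B.folF h).trans h1 (folF_entry hJ hb ha), fun h1 => ⟨a, ha, h1⟩⟩

lemma NegComp.nonempty_entry {x z : P} (hJ : NegComp B x z) : (B.entry x z).Nonempty := by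
  obtain ⟨y, hy⟩ := B.minusFol.leafBd_nonempty hJ.not_rel
  obtain ⟨x', -, h1, h2⟩ := exists_entry_near hJ hy univ_mem
  exact ⟨⟨(x', y), h2⟩, h1, hy⟩

lemma entryLeaf_mem_classes {h : P → ℝ} {x z : P} (hJ : NegComp B x z) : B.entryLeaf h x z ∈ (B.folF h).classes := by
  obtain ⟨a, ha⟩ := hJ.nonempty_entry
  exact ⟨_, entryLeaf_eq hJ ha⟩

/-- Each generating step joins two points by a connected subset of the leaf, and such sets can be
concatenated. -/
lemma isPreconnected_of_mem_classes {h : P → ℝ} {l : Set (B.N h)} (hl : l ∈ (B.folF h).classes) : IsPreconnected l := by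
  obtain ⟨p, rfl⟩ := hl
  have key : ∀ q r, Relation.EqvGen (fun p q => ∃ a b : B.N₂, Quotient.mk (B.setoidN h) a = p ∧
      Quotient.mk (B.setoidN h) b = q ∧ b ∈ connectedComponentIn {c : B.N₂ | B.minus a.1.2 c.1.2} a) q r →
      ∃ C : Set (B.N h), IsPreconnected C ∧ q ∈ C ∧ r ∈ C ∧ ∀ c ∈ C, B.folF h c q := by
    intro q r H
    induction H with
    | rel q r hr =>
      obtain ⟨a, b, rfl, rfl, hc⟩ := hr
      refine ⟨_, isPreconnected_connectedComponentIn.image _ continuous_quotient_mk'.continuousOn,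
        ⟨a, mem_connectedComponentIn (B.minus.refl a.1.2), rfl⟩, ⟨b, hc, rfl⟩, ?_⟩
      rintro _ ⟨c, hc', rfl⟩
      exact (B.folF h).symm (Relation.EqvGen.rel _ _ ⟨a, c, rfl, rfl, hc'⟩)
    | refl q =>
      refine ⟨{q}, isPreconnected_singleton, rfl, rfl, ?_⟩
      rintro _ rfl
      exact (B.folF h).refl _
    | symm q r H ih =>
      obtain ⟨C, hC, h1, h2, h3⟩ := ih
      exact ⟨C, hC, h2, h1, fun c hc => (B.folF h).trans (h3 c hc) H⟩
    | trans q r s H1 H2 ih1 ih2 =>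
      obtain ⟨C, hC, h1, h2, h3⟩ := ih1
      obtain ⟨D, hD, k1, k2, k3⟩ := ih2
      refine ⟨C ∪ D, hC.union r h2 k1 hD, Or.inl h1, Or.inr k2, ?_⟩
      rintro c (hc | hc)
      · exact h3 c hc
      · exact (B.folF h).trans (k3 c hc) ((B.folF h).symm H1)
  refine isPreconnected_of_forall p ?_
  intro q hq
  obtain ⟨C, hC, h1, h2, h3⟩ := key p q ((B.folF h).symm hq)
  exact ⟨C, h3, h1, h2, hC⟩

lemma mem_closure_proj_entryLeaf {h : P → ℝ} {x z y : P} (hJ : NegComp B x z) (hy : y ∈ leafBd B.minus x z) :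
    y ∈ closure (B.proj h '' B.entryLeaf h x z) := by
  rw [mem_closure_iff_nhds]
  intro O hO
  obtain ⟨x', hx', h1, h2⟩ := exists_entry_near hJ hy hO
  exact ⟨x', hx', Quotient.mk (B.setoidN h) ⟨(x', y), h2⟩, ⟨_, ⟨h1, hy⟩, (B.folF h).refl _⟩, rfl⟩

/-- Each negative half-leaf of `𝓕⁺` at `x` points into a component that is negative at `x`, and the
side is the same at all other boundary points. -/
lemma negComp_of_ray {x : P} {n : ℕ} {e : ℂ → P} (he : B.BiChart n e x) {ω : ℂ} (hω : ω ^ n = -1) :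
    NegComp B x (e ω) ∧ x ∈ leafBd B.minus x (e ω) := by
  have hn := he.ne_zero
  have hre : ∀ t : ℝ, ((t • ω) ^ n).re = -(t ^ n) := by
    intro t
    simp only [Complex.real_smul, mul_pow, hω, mul_neg, mul_one, Complex.neg_re]
    rw [← Complex.ofReal_pow, Complex.ofReal_re]
  have hnr : ¬ B.minus x (e ω) := he.not_minus (B.minus.refl x) (by simp [hω])
  have hJ : ∀ t : ℝ, 0 < t → e (t • ω) ∈ leafComp B.minus x (e ω) := by
    intro t ht
    have h1 : IsPreconnected ((fun t : ℝ => e (t • ω)) '' Ioi 0) :=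
      isPreconnected_Ioi.image _ (he.emb.continuous.comp (continuous_id.smul continuous_const)).continuousOn
    refine h1.subset_connectedComponentIn ⟨1, mem_Ioi.2 one_pos, by simp⟩ ?_ ⟨t, ht, rfl⟩
    rintro _ ⟨t, ht, rfl⟩
    have ht : 0 < t := ht
    refine he.not_minus (B.minus.refl x) ?_
    rw [hre]
    have : 0 < t ^ n := by positivity
    linarith
  have hfr := frequently_ray he ω hJ
  have hx : x ∈ leafBd B.minus x (e ω) :=
    ⟨mem_closure_iff_frequently.2 (hfr.mono fun _ hz => hz.1), B.minus.refl x⟩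
  have hneg : NegSide B (leafComp B.minus x (e ω)) x := by
    refine hfr.mono ?_
    rintro _ ⟨h1, t, ht, rfl⟩
    refine ⟨h1, (he.lt_center (im_smul_rayDir (Or.inr hω) t)).2.2 ?_⟩
    rw [hre]
    have : 0 < t ^ n := by positivity
    linarith
  refine ⟨⟨hnr, fun y hy => ?_⟩, hx⟩
  by_contra H
  exact (not_posSide_and_negSide hx).1 ((posSide_iff hnr hy hx).1 ((not_posSide_and_negSide hy).2 H)) hneg

lemma exists_pow_eq_neg_one {n : ℕ} (hn : n ≠ 0) : ∃ ω : ℂ, ω ^ n = -1 := by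
  obtain ⟨ζ, hζ⟩ := exists_sectorDir n hn
  exact ⟨ζ ^ 2, by rw [← pow_mul, mul_comm, pow_mul, hζ, Complex.I_sq]⟩

variable (B) in
lemma exists_negComp (x : P) : ∃ z, NegComp B x z ∧ x ∈ leafBd B.minus x z := by
  obtain ⟨e, he, -⟩ := B.exists_biChart x univ_mem
  obtain ⟨ω, hω⟩ := exists_pow_eq_neg_one he.ne_zero
  exact ⟨_, negComp_of_ray he hω⟩

/-- A component of the complement of a regular leaf of `𝓕⁻` is bounded by the whole leaf. -/
lemma leafBd_eq_leafOf {x z : P} (hx : ∀ y, B.minus x y → B.ord y = 1) (hz : ¬ B.minus x z) :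
    leafBd B.minus x z = leafOf B.minus x := by
  refine inter_subset_right.antisymm fun y hy => ?_
  obtain ⟨y₀, hy₀⟩ := B.minusFol.leafBd_nonempty hz
  exact B.minusFol.mem_leafBd_of_connected (isPreconnected_leaf_minus x) subset_rfl hx hy₀.2 hy hy₀

section height

variable {G : Type*} [Group G] [MulAction G P] {h : P → ℝ} (hh : B.IsHeight G h)
include hh

/-- If `(b, b')` were in the entry leaf with `b` on the boundary leaf of `𝓕⁻`, then `b'` would be
linked to a point of that leaf, hence to `b`. But `b'` is on the positive side of `b`. -/
lemma not_minus_of_mem_entryLeaf {x z : P} {q : B.N h} (hq : q ∈ B.entryLeaf h x z) : ¬ B.minus x (B.proj h q) := by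
  obtain ⟨a, ha, hqa⟩ := hq
  obtain ⟨b, rfl⟩ := Quotient.exists_rep q
  intro H
  have h1 := linked_of_folF hh hqa b a rfl rfl
  have h2 : B.minus a.1.2 b.1.1 := B.minus.trans (B.minus.symm ha.2.2) H
  exact not_linked_of_lt hh b.2.1 (h1.trans (Linked.of_minus h2)).symm

lemma asymptotic_entryLeaf {x z : P} (hJ : NegComp B x z) {p : B.N h} (hp : B.proj h p ∈ leafBd B.minus x z) :
    B.Asymptotic (Quotient.mk (Setoid.ker (B.proj h)) p) (B.entryLeaf h x z) := by
  rw [asymptotic_iff hh]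
  refine ⟨mem_closure_proj_entryLeaf hJ hp, ?_⟩
  rintro ⟨q, hq, hqp⟩
  exact not_minus_of_mem_entryLeaf hh hq (hqp ▸ hp.2)

theorem nowhereRegulating : B.NowhereRegulating h := by
  intro ρ
  obtain ⟨p, rfl⟩ := Quotient.exists_rep ρ
  obtain ⟨z, hJ, hp⟩ := B.exists_negComp (B.proj h p)
  exact ⟨_, entryLeaf_mem_classes hJ, asymptotic_entryLeaf hh hJ hp⟩

omit [Group G] [MulAction G P] hh in
lemma proj_mem_of_flowline_subset {p : B.N h} {S : Set (B.N h)}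
    (H : B.flowline (Quotient.mk (Setoid.ker (B.proj h)) p) ⊆ S) : p ∈ S := H rfl

omit [Group G] [MulAction G P] hh in
/-- The leaf of the unstable foliation over the leaf of `𝓕⁻` through `x`. -/
lemma exists_eq_preimage {lu : Set (B.N h)} (hlu : lu ∈ (B.unstable h).classes) :
    ∃ x, lu = B.proj h ⁻¹' leafOf B.minus x := by
  obtain ⟨p, rfl⟩ := hlu
  refine ⟨B.proj h p, ?_⟩
  ext q
  exact ⟨fun H => B.minus.symm H, fun H => B.minus.symm H⟩

lemma connectedComponentIn_preimage {x : P} {p : B.N h} (hp : ¬ B.minus x (B.proj h p)) :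
    connectedComponentIn (B.proj h ⁻¹' leafOf B.minus x)ᶜ p = B.proj h ⁻¹' leafComp B.minus x (B.proj h p) := by
  apply Subset.antisymm
  · intro q hq
    refine (isPreconnected_connectedComponentIn.image _ (B.continuous_proj h).continuousOn).subset_connectedComponentIn
      ⟨p, mem_connectedComponentIn hp, rfl⟩ ?_ ⟨q, hq, rfl⟩
    rintro _ ⟨r, hr, rfl⟩
    have h1 : r ∈ (B.proj h ⁻¹' leafOf B.minus x)ᶜ := connectedComponentIn_subset _ _ hr
    exact h1
  · refine (isPreconnected_preimage_proj hh isPreconnected_connectedComponentIn).subset_connectedComponentIn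
      (mem_connectedComponentIn hp) ?_
    intro q hq
    have h1 : B.proj h q ∈ (leafOf B.minus x)ᶜ := connectedComponentIn_subset _ _ hq
    exact h1

lemma closure_preimage_proj (J : Set P) : closure (B.proj h ⁻¹' J) = B.proj h ⁻¹' closure J :=
  ((isOpenMap_proj hh).preimage_closure_eq_closure_preimage (B.continuous_proj h) J).symm

/-- If the leaf of `𝓕⁻` is regular, it is the whole boundary of the component. If it is singular,
the entry leaf is connected and disjoint from the unstable leaf, so it lies over the component, and
the flowlines in question are those over the boundary of this component. -/
theorem asymptoticToLeaf_entryLeaf {x z : P} (hJ : NegComp B x z) :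
    B.AsymptoticToLeaf (B.entryLeaf h x z) (B.proj h ⁻¹' leafOf B.minus x) := by
  have hdis : ∀ q ∈ B.entryLeaf h x z, ¬ B.minus x (B.proj h q) := fun q hq => not_minus_of_mem_entryLeaf hh hq
  refine ⟨fun hs ρ hρ => ?_, fun hs => ⟨?_, ?_⟩⟩
  · obtain ⟨p, rfl⟩ := Quotient.exists_rep ρ
    refine asymptotic_entryLeaf hh hJ ?_
    rw [leafBd_eq_leafOf ?_ hJ.not_rel]
    · exact proj_mem_of_flowline_subset hρ
    · intro y hy
      obtain ⟨q, rfl⟩ := B.proj_surjective h y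
      have h1 := B.ord_pos (B.proj h q)
      by_contra h2
      exact hs ⟨q, hy, by omega⟩
  · rw [← disjoint_iff_inter_eq_empty, Set.disjoint_left]
    exact fun q hq hq' => hdis q hq hq'
  · obtain ⟨a, ha⟩ := hJ.nonempty_entry
    set p := Quotient.mk (B.setoidN h) a with hp
    have hpl : p ∈ B.entryLeaf h x z := ⟨a, ha, (B.folF h).refl _⟩
    refine ⟨p, hdis p hpl, ?_, ?_⟩
    · exact (isPreconnected_of_mem_classes (entryLeaf_mem_classes hJ)).subset_connectedComponentIn hpl hdis
    · intro ρ hρ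
      obtain ⟨q, rfl⟩ := Quotient.exists_rep ρ
      have h1 := proj_mem_of_flowline_subset hρ
      rw [connectedComponentIn_preimage hh (hdis p hpl), closure_preimage_proj hh] at h1
      have h2 : leafComp B.minus x z = leafComp B.minus x (B.proj h p) := connectedComponentIn_eq ha.1
      exact asymptotic_entryLeaf hh hJ ⟨h2 ▸ h1.2, h1.1⟩

/-! ### Uniqueness of the asymptotic leaves -/

lemma entryLeaf_subset {x z : P} (hJ : NegComp B x z) : B.proj h '' B.entryLeaf h x z ⊆ leafComp B.minus x z := by
  obtain ⟨a, ha⟩ := hJ.nonempty_entry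
  refine subset_leafComp ((isPreconnected_of_mem_classes (entryLeaf_mem_classes hJ)).image _
    (B.continuous_proj h).continuousOn) ?_ ⟨_, ⟨a, ha, (B.folF h).refl _⟩, rfl⟩ ha.1
  rintro _ ⟨q, hq, rfl⟩
  exact not_minus_of_mem_entryLeaf hh hq

/-- An entry leaf lies over its component, so equal entry leaves have equal components, and a
component contains only one negative half-axis at `s`. -/
lemma entryLeaf_injOn {s : P} {e : ℂ → P} (he : B.BiChart (B.ord s) e s) :
    InjOn (fun ω => B.entryLeaf h s (e ω)) {ω | ω ^ B.ord s = -1} := by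
  intro ω hω ω' hω' H
  have hω : ω ^ B.ord s = -1 := hω
  have hω' : ω' ^ B.ord s = -1 := hω'
  have H : B.entryLeaf h s (e ω) = B.entryLeaf h s (e ω') := H
  obtain ⟨hJ, -⟩ := negComp_of_ray he hω
  obtain ⟨hJ', -⟩ := negComp_of_ray he hω'
  obtain ⟨a, ha⟩ := hJ.nonempty_entry
  have h1 : B.proj h (Quotient.mk (B.setoidN h) a) ∈ leafComp B.minus s (e ω) := ha.1
  have h2 : B.proj h (Quotient.mk (B.setoidN h) a) ∈ leafComp B.minus s (e ω') :=
    entryLeaf_subset hh hJ' ⟨_, H ▸ ⟨a, ha, (B.folF h).refl _⟩, rfl⟩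
  have h3 : leafComp B.minus s (e ω) = leafComp B.minus s (e ω') :=
    (connectedComponentIn_eq h1).trans (connectedComponentIn_eq h2).symm
  have h4 : e ω ∈ leafComp B.minus s (e ω) := mem_connectedComponentIn hJ.not_rel
  have h5 : e ω' ∈ leafComp B.minus s (e ω) := h3 ▸ mem_connectedComponentIn hJ'.not_rel
  exact he.axis_unique (B.minus.refl s) (by simp [hω]) (by simp [hω']) (by rw [hω, hω']) h4 h5

end height

end OrientedBifoliatedPlane

lemma PlaneFol.singular_mem_leafBd {P : Type*} [TopologicalSpace P] {E : Setoid P} {ord : P → ℕ} (F : PlaneFol E ord)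
    {s x z : P} (hs : 2 ≤ ord s) (hxs : E x s) (hz : ¬ E x z) : s ∈ leafBd E x z := by
  obtain ⟨m, γ, hγ⟩ := F.exists_leafParam x
  obtain ⟨c, rfl⟩ := hγ.exists_eq hxs
  by_cases hc : (c : ℂ) = 0
  · have h1 : c = ⟨0, zero_mem_prong hγ.ne_zero⟩ := Subtype.ext hc
    rw [h1]
    exact F.center_mem_leafBd hγ hz
  · have := F.ord_of_ne hγ hc
    omega

namespace OrientedBifoliatedPlane

variable {P : Type*} [TopologicalSpace P] {B : OrientedBifoliatedPlane P}

lemma exists_halfBox_eq {n : ℕ} (hn : n ≠ 0) (w : ℂ) : ∃ ζ ∈ sectorDirs n, ∃ u v, 0 ≤ v ∧ w = halfBox n ζ u v := by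
  by_cases hw0 : w = 0
  · obtain ⟨ζ, hζ⟩ := exists_sectorDir n hn
    exact ⟨ζ, Or.inl hζ, 0, 0, le_rfl, hw0.trans (halfBox_zero hn).symm⟩
  by_cases him : (w ^ n).im = 0
  · obtain ⟨ζ, hζ, -, h1, -⟩ := exists_axis_halfBox hn hw0 him (Or.inl rfl)
    exact ⟨ζ, hζ, _, 0, le_rfl, h1.symm⟩
  · obtain ⟨ζ, hζ, u, v, hv, h1⟩ := exists_sector hn him
    exact ⟨ζ, hζ, u, v, hv.le, h1.symm⟩

section chart

variable {n : ℕ} {e : ℂ → P} {s : P} (he : B.BiChart n e s) (hs : 2 ≤ B.ord s) {ζ : ℂ} (hζ : ζ ∈ sectorDirs n) {u v : ℝ}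
  (hv : 0 ≤ v)
include he hs hζ hv

lemma BiChart.foot_mem_leafBd {x z : P} (hx : e (halfBox n ζ u v) ∈ leafBd B.plus x z) (hz : ¬ B.plus x z) :
    e (halfBox n ζ 0 v) ∈ leafBd B.plus x z := by
  rcases hv.eq_or_lt with rfl | hv'
  · rw [halfBox_zero he.ne_zero, he.zero]
    refine B.plusFol.singular_mem_leafBd hs (B.plus.trans hx.2 (B.plus.symm (he.nice.rel ?_))) hz
    rw [halfBox_im he.ne_zero hζ, zero_mul]
  · exact (he.regConn hζ u 0 hv').mem_leafBd hx

lemma BiChart.row_mem_leafBd {x z : P} (hx : e (halfBox n ζ u v) ∈ leafBd B.plus x z) (hu : u < 0) {t : ℝ} (ht : t < 0) :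
    e (halfBox n ζ t v) ∈ leafBd B.plus x z := by
  rcases hv.eq_or_lt with rfl | hv'
  · have hn := he.ne_zero
    have hrel : ∀ t, B.plus s (e (halfBox n ζ t 0)) := fun t => he.nice.rel (by rw [halfBox_im hn hζ, zero_mul])
    have h1 : IsPreconnected (e '' ((fun t => halfBox n ζ t 0) '' Iio 0)) :=
      (isPreconnected_halfBox_row hn hζ le_rfl isPreconnected_Iio).image _ he.emb.continuous.continuousOn
    refine B.plusFol.mem_leafBd_of_connected h1 ?_ ?_ ⟨_, ⟨u, hu, rfl⟩, rfl⟩ ⟨_, ⟨t, ht, rfl⟩, rfl⟩ hx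
    · rintro _ ⟨_, ⟨t, -, rfl⟩, rfl⟩
      exact B.plus.trans hx.2 (B.plus.trans (B.plus.symm (hrel u)) (hrel t))
    · rintro _ ⟨_, ⟨t, ht, rfl⟩, rfl⟩
      refine ord_eq_one hs (hrel t) ?_
      rw [← he.zero]
      intro H
      exact halfBox_ne_zero hn hζ (Or.inl (ne_of_lt ht)) (he.emb.injective H)
  · exact (he.regConn hζ u t hv').mem_leafBd hx

/-- A point between a point and its foot is in the same row of the chart. -/
lemma BiChart.exists_row_eq {y z : P} (hu : u < 0) (hz : ¬ B.plus (e (halfBox n ζ u v)) z)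
    (hx : e (halfBox n ζ u v) ∈ leafBd B.plus (e (halfBox n ζ u v)) z) (hy : y ∈ leafBd B.plus (e (halfBox n ζ u v)) z)
    (hxy : B.lt (e (halfBox n ζ u v)) y) (hyf : B.lt y (e (halfBox n ζ 0 v))) :
    ∃ t, u < t ∧ t < 0 ∧ y = e (halfBox n ζ t v) := by
  have hn := he.ne_zero
  have hmem : ∀ t ≤ 0, e (halfBox n ζ t v) ∈ leafBd B.plus (e (halfBox n ζ u v)) z := by
    intro t ht
    rcases ht.eq_or_lt with rfl | ht
    · exact he.foot_mem_leafBd hs hζ hv hx hz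
    · exact he.row_mem_leafBd hs hζ hv hx hu ht
  by_cases H : ∃ t ≤ 0, y = e (halfBox n ζ t v)
  · obtain ⟨t, -, rfl⟩ := H
    exact ⟨t, (he.lt_iff hζ hv).1 hxy, (he.lt_iff hζ hv).1 hyf, rfl⟩
  exfalso
  refine lt_asymm hxy (lt_of_connected (C := e '' ((fun t => halfBox n ζ t v) '' Iic 0))
    ((isPreconnected_halfBox_row hn hζ hv isPreconnected_Iic).image _ he.emb.continuous.continuousOn) ?_ ?_
    ⟨_, ⟨0, mem_Iic.2 le_rfl, rfl⟩, rfl⟩ ⟨_, ⟨u, hu.le, rfl⟩, rfl⟩ hyf)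
  · rintro _ ⟨_, ⟨t, ht, rfl⟩, rfl⟩
    exact B.plus.trans (B.plus.symm hy.2) (hmem t ht).2
  · rintro _ ⟨_, ⟨t, ht, rfl⟩, rfl⟩
    rcases lt_trichotomy_leafBd hz hy (hmem t ht) with h1 | h1 | h1
    · exact Or.inl h1
    · exact absurd ⟨t, ht, h1⟩ H
    · exact Or.inr h1

end chart

section height

variable {G : Type*} [Group G] [MulAction G P] {h : P → ℝ} (hh : B.IsHeight G h)
include hh

omit [Group G] [MulAction G P] hh in
/-- Points of a leaf of the transverse foliation, not meeting the unstable leaf over a singularity, that are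
close to this singularity. -/
lemma le_foot {n : ℕ} {e : ℂ → P} {s : P} (he : B.BiChart n e s) (hs : 2 ≤ B.ord s) {l : Set (B.N h)}
    (hl : l ∈ (B.folF h).classes) (hdis : ∀ q ∈ l, ¬ B.minus s (B.proj h q)) {ζ : ℂ} (hζ : ζ ∈ sectorDirs n) {u v : ℝ}
    (hv : 0 ≤ v) (hu : u ≠ 0) {a : B.N₂} (ha : Quotient.mk (B.setoidN h) a ∈ l) (hax : a.1.1 = e (halfBox n ζ u v)) :
    u < 0 ∧ (a.1.2 = e (halfBox n ζ 0 v) ∨ ∃ t, u < t ∧ t < 0 ∧ a.1.2 = e (halfBox n ζ t v)) := by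
  obtain ⟨⟨x, y⟩, hy⟩ := a
  obtain rfl : x = e (halfBox n ζ u v) := hax
  obtain ⟨z, hz, hxz, hyz⟩ := exists_leafBd_of_mem_R hy
  have hf := he.foot_mem_leafBd hs hζ hv hxz hz
  -- If `y` were beyond the foot, the first coordinate could be slid to the foot with `y` fixed. The
  -- foot is on the leaf of `𝓕⁻` through `s`, which `l` avoids.
  have hnot : ¬ B.lt (e (halfBox n ζ 0 v)) y := by
    intro hlt
    have h1 := mem_R_of_leafBd hz hf hyz hlt
    have h2 := folF_slide (h := h) (a := ⟨(_, y), hy⟩) (b := ⟨(_, y), h1⟩) hz hyz hxz hf rfl rfl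
    have h3 : Quotient.mk (B.setoidN h) ⟨(_, y), h1⟩ ∈ l := by
      obtain ⟨p, rfl⟩ := hl
      exact (B.folF h).trans ((B.folF h).symm h2) ha
    refine hdis _ h3 ?_
    have h4 := he.minus_vertical hζ 0 (v := 0) (v' := v) le_rfl hv
    rwa [halfBox_zero he.ne_zero, he.zero] at h4
  have hu' : u < 0 := by
    by_contra h1
    exact hnot (lt_trans ((he.lt_iff hζ hv).2 (lt_of_le_of_ne (not_lt.1 h1) hu.symm)) hy.1)
  refine ⟨hu', ?_⟩
  rcases lt_trichotomy_leafBd hz hyz hf with h1 | h1 | h1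
  · exact Or.inr (he.exists_row_eq hs hζ hv hu' hz hxz hyz hy.1 h1)
  · exact Or.inl h1
  · exact absurd h1 hnot

/-- Asymptoticity to the singular flowline gives points `(x, y)` of `l` with `x` arbitrarily close
to `s` in one component. By `le_foot`, the component is negative and `y` is the foot of the row of
`x` or strictly before it. A foot identifies `l` as the entry leaf. Two suitable points of the other
kind would link different points of one half-leaf at `s`. -/
theorem exists_eq_entryLeaf {s : P} {e : ℂ → P} (he : B.BiChart (B.ord s) e s) (hs : 2 ≤ B.ord s) {l : Set (B.N h)}
    (hl : l ∈ (B.folF h).classes) (hasy : B.AsymptoticToLeaf l (B.proj h ⁻¹' leafOf B.minus s)) :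
    ∃ ω, ω ^ B.ord s = -1 ∧ l = B.entryLeaf h s (e ω) := by
  have hn := he.ne_zero
  obtain ⟨ps, hps⟩ := B.proj_surjective h s
  have hsl : ps ∈ B.proj h ⁻¹' leafOf B.minus s := by
    show B.minus s (B.proj h ps)
    rw [hps]
  obtain ⟨hdis', p, hp, hlp, hflow⟩ := hasy.2 ⟨ps, hsl, by rwa [hps]⟩
  have hdis : ∀ q ∈ l, ¬ B.minus s (B.proj h q) := fun q hq H =>
    (Set.disjoint_left.1 (disjoint_iff_inter_eq_empty.2 hdis') hq) H
  have hp : ¬ B.minus s (B.proj h p) := hp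
  rw [connectedComponentIn_preimage hh hp] at hlp hflow
  set J := leafComp B.minus s (B.proj h p) with hJdef
  have hsJ : s ∈ leafBd B.minus s (B.proj h p) := B.minusFol.singular_mem_leafBd hs (B.minus.refl s) hp
  have hclo : s ∈ closure (B.proj h '' l) := by
    have h1 := hflow (Quotient.mk _ ps) (by
      intro q hq
      have h2 : B.proj h q = s := (mem_flowline.1 hq).trans hps
      refine ⟨?_, ?_⟩
      · show B.minus s (B.proj h q)
        rw [h2]
      · rw [closure_preimage_proj hh]
        show B.proj h q ∈ closure J
        rw [h2]
        exact hsJ.1)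
    rw [asymptotic_iff hh, hps] at h1
    exact h1.1
  obtain ⟨ω, hω, h1, h2⟩ := exists_minus_sector he (B.minus.refl s) (w₁ := 0) (z := B.proj h p)
    (by rw [he.zero]; exact hsJ.1)
  -- points of `l` near the singularity
  have hnear : ∀ O ∈ 𝓝 (0 : ℂ), ∃ ζ ∈ sectorDirs (B.ord s), ∃ u v, 0 ≤ v ∧ u < 0 ∧ halfBox (B.ord s) ζ u v ∈ O ∧
      e (halfBox (B.ord s) ζ u v) ∈ J ∧ ∃ a : B.N₂, Quotient.mk (B.setoidN h) a ∈ l ∧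
      a.1.1 = e (halfBox (B.ord s) ζ u v) ∧
      (a.1.2 = e (halfBox (B.ord s) ζ 0 v) ∨ ∃ t, u < t ∧ t < 0 ∧ a.1.2 = e (halfBox (B.ord s) ζ t v)) := by
    intro O hO
    have h3 : e '' O ∈ 𝓝 s := he.zero ▸ he.emb.isOpenMap.image_mem_nhds hO
    obtain ⟨_, ⟨w, hw, rfl⟩, q, hql, hqw⟩ := mem_closure_iff_nhds.1 hclo _ h3
    obtain ⟨a, rfl⟩ := Quotient.exists_rep q
    have hax : a.1.1 = e w := hqw
    have hwJ : e w ∈ J := hqw ▸ hlp hql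
    obtain ⟨ζ, hζ, u, v, hv, rfl⟩ := exists_halfBox_eq hn w
    have hu : u ≠ 0 := by
      intro hu
      have h4 := h1 _ hwJ
      rw [halfBox_re hn hζ, hu, zero_mul] at h4
      exact _root_.lt_irrefl _ h4
    obtain ⟨h5, h6⟩ := le_foot he hs hl hdis hζ hv hu hql hax
    exact ⟨ζ, hζ, u, v, hv, h5, hw, hwJ, a, hql, hax, h6⟩
  obtain ⟨ζ, hζ, u, v, hv, hu, -, hxJ, a, hal, hax, hay⟩ := hnear univ univ_mem
  have hω1 : ω ^ B.ord s = -1 := by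
    rcases hω with h3 | h3
    · have h4 := h1 _ hxJ
      rw [halfBox_re hn hζ, h3, Complex.one_re, mul_one] at h4
      exact absurd h4 hu.not_gt
    · exact h3
  have hωJ : e ω ∈ J := by simpa using h2 1 one_pos
  have hJω : J = leafComp B.minus s (e ω) := connectedComponentIn_eq hωJ
  obtain ⟨hneg, -⟩ := negComp_of_ray he hω1
  -- The foot is a limit of points of its row in `J`, and it is on the leaf of `𝓕⁻` through `s`. So
  -- the pair is an entry point.
  have hmain : ∀ ζ ∈ sectorDirs (B.ord s), ∀ u < 0, ∀ v ≥ 0, e (halfBox (B.ord s) ζ u v) ∈ J → ∀ a : B.N₂,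
      Quotient.mk (B.setoidN h) a ∈ l → a.1.1 = e (halfBox (B.ord s) ζ u v) → a.1.2 = e (halfBox (B.ord s) ζ 0 v) →
      l = B.entryLeaf h s (e ω) := by
    intro ζ hζ u hu v hv hxJ a hal hax hay
    have haE : a ∈ B.entry s (e ω) := by
      refine ⟨hJω ▸ hax ▸ hxJ, ?_, ?_⟩
      · rw [← hJω, hay]
        have hc : ContinuousWithinAt (fun t => e (halfBox (B.ord s) ζ t v)) (Iio 0) 0 := by
          have h3 : ContinuousOn (fun t => e (halfBox (B.ord s) ζ t v)) univ :=
            he.emb.continuous.comp_continuousOn ((continuousOn_halfBox hn hζ).comp (f := fun t : ℝ => ((t, v) : ℝ × ℝ))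
              (continuous_id.prodMk continuous_const).continuousOn fun t _ => hv)
          exact (h3 0 trivial).mono (subset_univ _)
        refine hc.mem_closure (by rw [closure_Iio]; exact mem_Iic.2 le_rfl) ?_
        intro t ht
        exact he.quadrant_subset (B.minus.refl s) hζ hu hv hxJ ht hv
      · rw [hay]
        have h4 := he.minus_vertical hζ 0 (v := 0) (v' := v) le_rfl hv
        rwa [halfBox_zero hn, he.zero] at h4
    rw [entryLeaf_eq hneg haE]
    obtain ⟨p', rfl⟩ := hl
    ext q
    exact ⟨fun H => (B.folF h).trans H ((B.folF h).symm hal), fun H => (B.folF h).trans H hal⟩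
  refine ⟨ω, hω1, ?_⟩
  rcases hay with hay | ⟨t, hut, ht, hay⟩
  · exact hmain ζ hζ u hu v hv hxJ a hal hax hay
  -- The next point of `l` is chosen so close to `s` that its first coordinate is already beyond
  -- column `t`. If its second coordinate is in a column `t'`, then `t < u' < t'`.
  have hO : {w : ℂ | t < (w ^ B.ord s).re} ∈ 𝓝 (0 : ℂ) := by
    refine (isOpen_lt continuous_const (by fun_prop)).mem_nhds ?_
    show t < ((0 : ℂ) ^ B.ord s).re
    simpa [hn] using ht
  obtain ⟨η, hη, u', v', hv', hu', htu', hxJ', b, hbl, hbx, hby⟩ := hnear _ hO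
  have htu' : t < (halfBox (B.ord s) η u' v' ^ B.ord s).re := htu'
  rw [halfBox_re hn hη] at htu'
  rcases hby with hby | ⟨t', hut', ht', hby⟩
  · exact hmain η hη u' hu' v' hv' hxJ' b hbl hbx hby
  exfalso
  have hlink : Linked B h a.1.2 b.1.2 := by
    refine linked_of_folF hh ?_ a b rfl rfl
    obtain ⟨p', rfl⟩ := hl
    exact (B.folF h).trans hal ((B.folF h).symm hbl)
  -- The sectors `ζ` and `η` may differ. But `J` contains only one half-axis with negative
  -- coordinate, so the columns `t` and `t'` can be followed down to points of the same half-leaf.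
  have hax' : halfBox (B.ord s) η t' 0 = halfBox (B.ord s) ζ t' 0 := by
    refine he.axis_unique (B.minus.refl s) (z := B.proj h p) ?_ ?_ ?_ (he.quadrant_subset (B.minus.refl s) hη hu' hv' hxJ' ht' le_rfl)
      (he.quadrant_subset (B.minus.refl s) hζ hu hv hxJ ht' le_rfl)
    · rw [halfBox_im hn hη, zero_mul]
    · rw [halfBox_im hn hζ, zero_mul]
    · rw [halfBox_re hn hη, halfBox_re hn hζ]
  rw [hay, hby] at hlink
  have h3 : Linked B h (e (halfBox (B.ord s) ζ t 0)) (e (halfBox (B.ord s) η t' 0)) :=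
    (Linked.of_minus (he.minus_vertical hζ t le_rfl hv)).trans (hlink.trans (Linked.of_minus (he.minus_vertical hη t' hv' le_rfl)))
  rw [hax'] at h3
  exact not_linked_of_lt hh ((he.lt_iff hζ le_rfl).2 (htu'.trans hut')) h3

/-- The centre of a `2 n`-prong has order `n`, and the asymptotic leaves correspond bijectively to
the `n` solutions of `ω ^ n = -1`, the directions of the negative half-leaves of `𝓕⁺` at the centre.
-/
theorem ncard_asymptotic {lu : Set (B.N h)} (hlu : lu ∈ (B.unstable h).classes) {n : ℕ} (hn : 2 ≤ n)
    (hpr : IsProng n (B.proj h '' lu)) : {l | l ∈ (B.folF h).classes ∧ B.AsymptoticToLeaf l lu}.ncard = n := by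
  obtain ⟨x, rfl⟩ := exists_eq_preimage hlu
  rw [image_preimage_eq _ (B.proj_surjective h)] at hpr
  obtain ⟨γ, hγ, hr⟩ := hpr
  have hγ' : LeafParam B.minus n γ x := ⟨by omega, hγ, hr⟩
  set s := γ ⟨0, zero_mem_prong hγ'.ne_zero⟩ with hs
  have hord : B.ord s = n := B.minusFol.ord_center hγ'
  rw [leafOf_eq (hγ'.rel _), ← hs, ← hord]
  rw [← hord] at hn
  obtain ⟨e, he, -⟩ := B.exists_biChart s univ_mem
  have h1 : {l | l ∈ (B.folF h).classes ∧ B.AsymptoticToLeaf l (B.proj h ⁻¹' leafOf B.minus s)} =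
      (fun ω => B.entryLeaf h s (e ω)) '' {ω | ω ^ B.ord s = -1} := by
    ext l
    constructor
    · rintro ⟨hl, hasy⟩
      obtain ⟨ω, hω, rfl⟩ := exists_eq_entryLeaf hh he hn hl hasy
      exact ⟨ω, hω, rfl⟩
    · rintro ⟨ω, hω, rfl⟩
      obtain ⟨hJ, -⟩ := negComp_of_ray he hω
      exact ⟨entryLeaf_mem_classes hJ, asymptoticToLeaf_entryLeaf hh hJ⟩
  rw [h1, (entryLeaf_injOn hh he).ncard_image]
  exact ncard_setOf_pow_eq he.ne_zero (neg_ne_zero.2 one_ne_zero)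

end height

end OrientedBifoliatedPlane

theorem proposition5 {P : Type*} [TopologicalSpace P] (B : OrientedBifoliatedPlane P)
    {G : Type*} [Group G] [MulAction G P]
    (hG : B.IsOrientedAction G) (hflow : B.IsFlowable G)
    (h : P → ℝ) (hh : B.IsHeight G h) :
    B.NowhereRegulating h ∧
    TransverseInQuotient (OrientedBifoliatedPlane.act hG hh) (B.stable h) (B.folF h) ∧
    TransverseInQuotient (OrientedBifoliatedPlane.act hG hh) (B.unstable h) (B.folF h) ∧
    (∀ lu ∈ (B.unstable h).classes, ∃ l ∈ (B.folF h).classes, B.AsymptoticToLeaf l lu) ∧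
    (∀ lu ∈ (B.unstable h).classes, ∀ n : ℕ, 2 ≤ n → IsProng n (B.proj h '' lu) →
      {l | l ∈ (B.folF h).classes ∧ B.AsymptoticToLeaf l lu}.ncard = n) := by
  refine ⟨OrientedBifoliatedPlane.nowhereRegulating hh,
    ⟨OrientedBifoliatedPlane.stable_act hG hh, OrientedBifoliatedPlane.folF_act hG hh,
      OrientedBifoliatedPlane.transverseFoliations_stable hh⟩,
    ⟨OrientedBifoliatedPlane.unstable_act hG hh, OrientedBifoliatedPlane.folF_act hG hh,
      OrientedBifoliatedPlane.transverseFoliations_unstable hh⟩, ?_,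
    fun lu hlu n hn hpr => OrientedBifoliatedPlane.ncard_asymptotic hh hlu hn hpr⟩
  intro lu hlu
  obtain ⟨x, rfl⟩ := OrientedBifoliatedPlane.exists_eq_preimage hlu
  obtain ⟨z, hJ, -⟩ := B.exists_negComp x
  exact ⟨_, OrientedBifoliatedPlane.entryLeaf_mem_classes hJ, OrientedBifoliatedPlane.asymptoticToLeaf_entryLeaf hh hJ⟩
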